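/- Let $\Omega\subset\mathbb R^2$ be a bounded polygonal domain, that is, a nonempty bounded connected open set which is the interior of its closure and whose boundary is a finite union of segments, and let $Q_1,\dots,Q_N$ be its vertices (the boundary points near which $\partial\Omega$ does not coincide with a straight line). Let $r_i(x)=|x-Q_i|$. For $\mathbf b=(b_1,\dots,b_N)\in\mathbb R^N$ and an integer $l\ge 0$ let $\mathcal K^{l}_{\mathbf b}(\Omega)$ be the space of functions $v$ on $\Omega$ whose weak derivatives satisfy $\prod_i r_i^{|\nu|-b_i}\,\partial^\nu v\in L^2(\Omega)$ for all $|\nu|\le l$, with the norm $$\|v\|_{\mathcal K^{l}_{\mathbf b}(\Omega)}=\Big(\sum_{|\nu|\le l}\int_\Omega\Big|\prod_i r_i^{|\nu|-b_i}\,\partial^\nu v\Big|^2dx\Big)^{1/2}.$$ Let $k\ge 1$ and $m\ge 1$ be integers, let $\mathbf a=(a_1,\dots,a_N)$ and $\theta$ be real with $0<a_i\le\theta\le\min\{k,m\}$ for all $i$, and put $\kappa_{Q_i}=2^{-\theta/a_i}$ and $\mathbf a+1=(a_1+1,\dots,a_N+1)$. Let $\mathcal T_0$ be a (finite, conforming)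 triangulation of $\overline\Omega$ in which every triangle has at most one of the $Q_i$ as a vertex. For $n\ge 0$, the mesh $\mathcal T_{n+1}$ is obtained from $\mathcal T_n$ by placing on each edge $AB$ a new node $D$, namely the midpoint if neither $A$ nor $B$ is one of the $Q_i$, and the point with $|AD|=\kappa_{Q_i}|AB|$ if $A=Q_i$, and by dividing each triangle into four by connecting the three new nodes on its edges. Let $V_n^k$ be the space of continuous functions on $\overline\Omega$ that are polynomials of degree at most $k$ on each triangle of $\mathcal T_n$, and let $h=2^{-n}$. Then there is a constant $C>0$, which may depend on $\Omega$, $\mathcal T_0$, $\mathbf a$, $\theta$, $k$ and $m$ but not on $n$ or $v$, such that the following holds. Every $v\in\mathcal K^{m+1}_{\mathbf a+1}(\Omega)$ has a representative that is continuous on $\overline\Omega$, and for every $n\ge 0$ its nodal interpolant $v_I\in V_n^k$ (the function of $V_n^k$ that agrees with this representative at the Lagrange nodes of degree $k$ of all triangles of $\mathcal T_n$) exists, and $v-v_I\in H^1(\Omega)$ with $$\|v-v_I\|_{H^1(\Omega)}\le C\,h^{\theta}\,\|v\|_{\mathcal K^{m+1}_{\mathbf a+1}(\Omega)}.$$ 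-/

import Mathlib

open MeasureTheory Set
open scoped ContDiff

noncomputable section

namespace GradedFEM

/-- The Euclidean plane. -/
abbrev Plane : Type := EuclideanSpace ℝ (Fin 2)

/-! ### Polygonal domains and their vertices -/

/-- A bounded polygonal domain: a nonempty, bounded, connected open set, equal to the interior of
its closure (no cracks, no punctures), whose boundary is a finite union of segments. -/
structure IsPolygonalDomain (Ω : Set Plane) : Prop where
  isOpen : IsOpen Ω
  isConnected : IsConnected Ω
  isBounded : Bornology.IsBounded Ω
  regular : interior (closure Ω) = Ω
  polygonal : ∃ S : Finset (Plane × Plane), frontier Ω = ⋃ s ∈ S, segment ℝ s.1 s.2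

/-- The vertices (corners) of a polygonal domain: the boundary points near which the boundary does
not coincide with a straight line. -/
def domainVertices (Ω : Set Plane) : Set Plane :=
  {q | q ∈ frontier Ω ∧ ¬ ∃ ε > 0, ∃ u : Plane, u ≠ 0 ∧
    frontier Ω ∩ Metric.ball q ε = range (fun t : ℝ => q + t • u) ∩ Metric.ball q ε}

/-! ### Weak derivatives and (weighted) Sobolev spaces -/

/-- The classical partial derivative `∂ψ/∂xᵢ`. -/
def partialDeriv (i : Fin 2) (ψ : Plane → ℝ) : Plane → ℝ :=
  fun x => fderiv ℝ ψ x (EuclideanSpace.single i 1)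

/-- The classical derivative `∂^ν ψ = ∂_x^{ν₁} ∂_y^{ν₂} ψ`. -/
def multiDeriv (ν : ℕ × ℕ) (ψ : Plane → ℝ) : Plane → ℝ :=
  (partialDeriv 0)^[ν.1] ((partialDeriv 1)^[ν.2] ψ)

/-- `g` is a weak derivative `∂^ν v` on the open set `Ω`. -/
structure IsWeakDeriv (Ω : Set Plane) (ν : ℕ × ℕ) (v g : Plane → ℝ) : Prop where
  locallyIntegrable : LocallyIntegrableOn v Ω
  locallyIntegrable_deriv : LocallyIntegrableOn g Ω
  integral_eq : ∀ φ : Plane → ℝ, ContDiff ℝ ∞ φ → HasCompactSupport φ → tsupport φ ⊆ Ω →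
    ∫ x in Ω, v x * multiDeriv ν φ x = (-1 : ℝ) ^ (ν.1 + ν.2) * ∫ x in Ω, g x * φ x

open Classical in
/-- The weak derivative `∂^ν v` on `Ω` (determined almost everywhere on `Ω`); zero if there is
none. -/
def weakDeriv (Ω : Set Plane) (ν : ℕ × ℕ) (v : Plane → ℝ) : Plane → ℝ :=
  if h : ∃ g, IsWeakDeriv Ω ν v g then Classical.choose h else 0

/-- The multi-indices `ν` with `|ν| ≤ m`. -/
def multiIndices (m : ℕ) : Finset (ℕ × ℕ) :=
  (Finset.range (m + 1) ×ˢ Finset.range (m + 1)).filter (fun ν => ν.1 + ν.2 ≤ m)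

/-- `w |ν| · ∂^ν v ∈ L²(Ω)` for all `|ν| ≤ m`, where `w j` is the weight for derivatives of
order `j`. -/
def MemWeighted (w : ℕ → Plane → ℝ) (m : ℕ) (Ω : Set Plane) (v : Plane → ℝ) : Prop :=
  ∀ ν ∈ multiIndices m, (∃ g, IsWeakDeriv Ω ν v g) ∧
    MemLp (fun x => w (ν.1 + ν.2) x * weakDeriv Ω ν v x) 2 (volume.restrict Ω)

/-- `(∑_{|ν| ≤ m} ∫_Ω |w |ν| · ∂^ν v|²)^{1/2}`. -/
def weightedNorm (w : ℕ → Plane → ℝ) (m : ℕ) (Ω : Set Plane) (v : Plane → ℝ) : ℝ :=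
  Real.sqrt (∑ ν ∈ multiIndices m, ∫ x in Ω, |w (ν.1 + ν.2) x * weakDeriv Ω ν v x| ^ 2)

/-- The Sobolev space `H^m(Ω)`. -/
def MemH (m : ℕ) (Ω : Set Plane) (v : Plane → ℝ) : Prop :=
  MemWeighted (fun _ _ => 1) m Ω v

/-- The norm of `H^m(Ω)`. -/
def normH (m : ℕ) (Ω : Set Plane) (v : Plane → ℝ) : ℝ :=
  weightedNorm (fun _ _ => 1) m Ω v

/-- The weight `ρ^{j - b} = ∏ᵢ rᵢ^{j - bᵢ}`, with `rᵢ` the distance to `Qᵢ`. -/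
def rhoPow {N : ℕ} (Q : Fin N → Plane) (b : Fin N → ℝ) (j : ℕ) (x : Plane) : ℝ :=
  ∏ i, dist x (Q i) ^ ((j : ℝ) - b i)

/-- The weighted Sobolev (Kondratiev) space `K^m_b(Ω)`. -/
def MemK {N : ℕ} (Q : Fin N → Plane) (b : Fin N → ℝ) (m : ℕ) (Ω : Set Plane)
    (v : Plane → ℝ) : Prop :=
  MemWeighted (rhoPow Q b) m Ω v

/-- The norm of `K^m_b(Ω)`. -/
def normK {N : ℕ} (Q : Fin N → Plane) (b : Fin N → ℝ) (m : ℕ) (Ω : Set Plane)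
    (v : Plane → ℝ) : ℝ :=
  weightedNorm (rhoPow Q b) m Ω v

/-! ### Triangulations and graded refinement -/

/-- `T` is a (conforming) triangulation of the region `S`. A triangle is given by the set of its
three vertices. -/
structure IsTriangulation (T : Set (Finset Plane)) (S : Set Plane) : Prop where
  finite : T.Finite
  card_eq : ∀ t ∈ T, t.card = 3
  affineIndependent : ∀ t ∈ T, AffineIndependent ℝ ((↑) : t → Plane)
  conforming : ∀ s ∈ T, ∀ t ∈ T,
    convexHull ℝ (s : Set Plane) ∩ convexHull ℝ (t : Set Plane)
      = convexHull ℝ ((s : Set Plane) ∩ (t : Set Plane))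
  cover : ⋃ t ∈ T, convexHull ℝ (t : Set Plane) = S

open Classical in
/-- The new node on the edge `AB`: at relative distance `κᵢ` from an endpoint equal to `Qᵢ`, and the
midpoint if neither endpoint is one of the `Qᵢ`. (If `A = B` it is `A`.) -/
def newNode {N : ℕ} (Q : Fin N → Plane) (κ : Fin N → ℝ) (A B : Plane) : Plane :=
  if hA : ∃ i, Q i = A then A + κ hA.choose • (B - A)
  else if hB : ∃ i, Q i = B then B + κ hB.choose • (A - B)
  else midpoint ℝ A B

open Classical in
/-- The four triangles into which `t` is divided: for each vertex `A` of `t`, the triangle of `A`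
and the new nodes on the two edges at `A`; and the triangle of the three new nodes. -/
def children {N : ℕ} (Q : Fin N → Plane) (κ : Fin N → ℝ) (t : Finset Plane) :
    Set (Finset Plane) :=
  {s | (∃ A ∈ t, s = t.image (newNode Q κ A)) ∨
    s = t.offDiag.image (fun e => newNode Q κ e.1 e.2)}

/-- The graded meshes `T_0, T_1, T_2, …`, each obtained from the previous one by a graded
refinement. -/
def gradedMesh {N : ℕ} (Q : Fin N → Plane) (κ : Fin N → ℝ) (T₀ : Set (Finset Plane)) :
    ℕ → Set (Finset Plane)
  | 0 => T₀
  | n + 1 => ⋃ t ∈ gradedMesh Q κ T₀ n, children Q κ t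

/-! ### Lagrange finite elements -/

/-- Membership in the Lagrange finite element space of degree `k` on the mesh `T` of `closure Ω`:
continuous functions whose restriction to each triangle is a polynomial of degree at most `k`. -/
def MemFE (Ω : Set Plane) (T : Set (Finset Plane)) (k : ℕ) (w : Plane → ℝ) : Prop :=
  ContinuousOn w (closure Ω) ∧
    ∀ t ∈ T, ∃ p : MvPolynomial (Fin 2) ℝ, p.totalDegree ≤ k ∧
      ∀ x ∈ convexHull ℝ (t : Set Plane), w x = MvPolynomial.eval (fun i => x i) p

/-- The Lagrange nodes of degree `k` of a triangle: the points whose barycentric coordinates are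
nonnegative integer multiples of `1/k`. -/
def lagrangeNodes (k : ℕ) (t : Finset Plane) : Set Plane :=
  {x | ∃ α : Plane → ℕ, ∑ A ∈ t, α A = k ∧ x = ∑ A ∈ t, ((α A : ℝ) / k) • A}

/-- `vI` is the nodal interpolant of degree `k` on the mesh `T` of the function `v`, which is
continuous on `closure Ω`. -/
def IsNodalInterpolant (Ω : Set Plane) (T : Set (Finset Plane)) (k : ℕ) (v vI : Plane → ℝ) :
    Prop :=
  MemFE Ω T k vI ∧ ∀ t ∈ T, ∀ x ∈ lagrangeNodes k t, vI x = v x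

/-- `vc` is a representative of `v` on `Ω` that is continuous up to the boundary. -/
def IsContinuousRep (Ω : Set Plane) (v vc : Plane → ℝ) : Prop :=
  ContinuousOn vc (closure Ω) ∧ vc =ᵐ[volume.restrict Ω] v

end GradedFEM

end

open MeasureTheory Set
open scoped ContDiff

noncomputable section

namespace GradedFEM

open scoped ENNReal NNReal
open Filter Topology

/-! ### Calculus of partial derivatives -/

/-! Put `p = min k m`: polynomials of degree `p` are available and `v` has weighted derivatives of
order `p + 1`. The grading satisfies `κ_i^(n a_i) = h^θ` (`GradedSetup.grading_pow_rpow`). From this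
follows a dichotomy that refinement preserves with one constant `K` for all `n`
(`GradedSetup.exists_invariant`): a triangle of `T_n` is either the image of an initial triangle
with vertex `Q_i` under the homothety of ratio `κ_i^n` about `Q_i`, or it is shape regular, avoids
every `Q_i`, and its size `d` satisfies `d^p ≤ K h^θ ∏ r_i^(p - a_i)` at each of its points.

On a triangle of the second kind the classical estimate bounds the `H¹` error by `d^p` times the
seminorm of order `p + 1`, and the grading inequality trades `d^p` for `h^θ` times exactly the
weight of that seminorm (`GradedSetup.exists_errSq_le_graded`). The squares add up because the
interiors are disjoint.

On a corner triangle `v` need not be in `H²`, so `v` and `v_I` are estimated separately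
(`GradedSetup.exists_errSq_le_corner_aux`). Cutting a triangle at `Q_i` into strips at geometrically
decreasing distance from `Q_i` and using a scaled bound of the supremum by the `H²` norm on each of
them gives `|v| ≤ C r_i^(a_i) ‖v‖_K` (`exists_corner_sup`). Hence `v` and its nodal values are of
size `h^θ ‖v‖_K` on the triangle of ratio `κ_i^n`. An inverse estimate then bounds `v_I` and its
gradient, and the weight `r_i^(-a_i)` of first derivatives bounds the gradient of `v`. The number of
corner triangles does not grow with `n`, so the full norm may be spent on each.

The local analysis rests on integrating along segments of a convex set: this gives `poincare`, by
iteration `bramble_hilbert_smooth`, and the supremum bound `sup_le_of_smooth`.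
`exists_smooth_approx` transfers them to weak derivatives; on a convex set a slight contraction
before mollifying makes any extension unnecessary. With the stability of the Lagrange nodes
(`isStableNodes_triangle`) they combine into `interpolation_error`.

The continuous representative is built from essential limits at each point of the closure
(`exists_continuousOn_of_essCauchyAt`). Away from the vertices the domain is locally convex and `v`
is locally in `H²`; at `Q_i` the strip estimate shows that the limit is `0`. On the side of the
meshes, refinement keeps conformity because a new node depends only on its edge
(`IsTriMesh.refine`), and a vertex of the domain can meet a triangle only at a vertex of that
triangle (`IsTriMesh.mem_of_mem_convexHull`). Finally `v_I` is locally Lipschitz, so its almost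
everywhere gradient is its weak gradient. -/

theorem fderiv_apply_eq_partialDeriv (f : Plane → ℝ) (x h : Plane) :
    fderiv ℝ f x h = h 0 * partialDeriv 0 f x + h 1 * partialDeriv 1 f x := by
  have hh : h = h 0 • EuclideanSpace.single (0 : Fin 2) (1 : ℝ)
      + h 1 • EuclideanSpace.single (1 : Fin 2) (1 : ℝ) := by
    ext i; fin_cases i <;> simp
  conv_lhs => rw [hh]
  simp [partialDeriv]

theorem _root_.ContDiff.partialDeriv {f : Plane → ℝ} (hf : ContDiff ℝ ∞ f) (i : Fin 2) :
    ContDiff ℝ ∞ (partialDeriv i f) := by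
  unfold GradedFEM.partialDeriv
  exact (hf.fderiv_right (m := ∞) (by simp)).clm_apply contDiff_const

theorem partialDeriv_comm {f : Plane → ℝ} (hf : ContDiff ℝ ∞ f) (i j : Fin 2) :
    partialDeriv i (partialDeriv j f) = partialDeriv j (partialDeriv i f) := by
  funext x
  have h1 : Differentiable ℝ (fderiv ℝ f) :=
    (hf.fderiv_right (m := ∞) (by simp)).differentiable (by simp)
  have key : ∀ i j : Fin 2, GradedFEM.partialDeriv i (GradedFEM.partialDeriv j f) x
      = fderiv ℝ (fderiv ℝ f) x (EuclideanSpace.single i 1) (EuclideanSpace.single j 1) := by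
    intro i j
    unfold GradedFEM.partialDeriv
    rw [fderiv_clm_apply h1.differentiableAt (by fun_prop)]
    simp
  rw [key, key]
  exact second_derivative_symmetric (f := f) (fun y => (hf.differentiable (by simp) y).hasFDerivAt)
    (h1 x).hasFDerivAt _ _

theorem _root_.ContDiff.iterate_partialDeriv {f : Plane → ℝ} (hf : ContDiff ℝ ∞ f) (i : Fin 2) (n : ℕ) :
    ContDiff ℝ ∞ ((GradedFEM.partialDeriv i)^[n] f) := by
  induction n generalizing f with
  | zero => exact hf
  | succ n ih => exact ih (hf.partialDeriv i)

theorem _root_.ContDiff.multiDeriv {f : Plane → ℝ} (hf : ContDiff ℝ ∞ f) (ν : ℕ × ℕ) :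
    ContDiff ℝ ∞ (multiDeriv ν f) :=
  (hf.iterate_partialDeriv 1 _).iterate_partialDeriv 0 _

theorem partialDeriv_zero_multiDeriv (f : Plane → ℝ) (ν : ℕ × ℕ) :
    partialDeriv 0 (multiDeriv ν f) = multiDeriv (ν.1 + 1, ν.2) f := by
  unfold multiDeriv
  rw [Function.iterate_succ_apply']

theorem partialDeriv_one_multiDeriv {f : Plane → ℝ} (hf : ContDiff ℝ ∞ f) (ν : ℕ × ℕ) :
    partialDeriv 1 (multiDeriv ν f) = multiDeriv (ν.1, ν.2 + 1) f := by
  unfold multiDeriv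
  simp only [Function.iterate_succ_apply']
  generalize hg : (partialDeriv 1)^[ν.2] f = g
  have hg' : ContDiff ℝ ∞ g := hg ▸ hf.iterate_partialDeriv 1 _
  clear hg
  induction ν.1 generalizing g with
  | zero => rfl
  | succ n ih =>
    rw [Function.iterate_succ_apply, Function.iterate_succ_apply, ih _ (hg'.partialDeriv 0),
      partialDeriv_comm hg' 1 0]

/-- Reduces a formula for all `multiDeriv ν f` to the effect of a single partial derivative.
Smoothness is needed because the second-variable derivatives are applied innermost, so raising `ν.2`
from outside uses commutation. -/
theorem multiDeriv_induction {P : (ℕ × ℕ) → (Plane → ℝ) → Prop} {f : Plane → ℝ}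
    (hf : ContDiff ℝ ∞ f) (h0 : P (0, 0) f)
    (hs : ∀ (ν : ℕ × ℕ) (i : Fin 2), P ν (multiDeriv ν f) →
      P (ν + if i = 0 then (1, 0) else (0, 1)) (partialDeriv i (multiDeriv ν f))) (ν : ℕ × ℕ) :
    P ν (multiDeriv ν f) := by
  obtain ⟨a, b⟩ := ν
  induction b with
  | zero =>
    induction a with
    | zero => exact h0
    | succ a ih =>
      have := hs (a, 0) 0 ih
      rw [partialDeriv_zero_multiDeriv] at this
      simpa using this
  | succ b ih =>
    have := hs (a, b) 1 ih
    rw [partialDeriv_one_multiDeriv hf] at this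
    simpa using this

theorem partialDeriv_add {f g : Plane → ℝ} (hf : Differentiable ℝ f) (hg : Differentiable ℝ g)
    (i : Fin 2) : partialDeriv i (fun x => f x + g x)
      = fun x => partialDeriv i f x + partialDeriv i g x := by
  funext x
  simp only [partialDeriv]
  rw [fderiv_fun_add hf.differentiableAt hg.differentiableAt]; simp

theorem partialDeriv_sub {f g : Plane → ℝ} (hf : Differentiable ℝ f) (hg : Differentiable ℝ g)
    (i : Fin 2) : partialDeriv i (fun x => f x - g x)
      = fun x => partialDeriv i f x - partialDeriv i g x := by
  funext x
  simp only [partialDeriv]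
  rw [fderiv_fun_sub hf.differentiableAt hg.differentiableAt]; simp

theorem partialDeriv_mul {f g : Plane → ℝ} {x : Plane} (hf : DifferentiableAt ℝ f x)
    (hg : DifferentiableAt ℝ g x) (i : Fin 2) : partialDeriv i (fun x => f x * g x) x
      = f x * partialDeriv i g x + partialDeriv i f x * g x := by
  simp only [partialDeriv]
  rw [fderiv_fun_mul hf hg]; simp [mul_comm]

theorem multiDeriv_sub {f g : Plane → ℝ} (hf : ContDiff ℝ ∞ f) (hg : ContDiff ℝ ∞ g)
    (ν : ℕ × ℕ) : multiDeriv ν (fun x => f x - g x)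
      = fun x => multiDeriv ν f x - multiDeriv ν g x := by
  refine multiDeriv_induction (f := fun x => f x - g x)
    (P := fun ν h => h = fun x => multiDeriv ν f x - multiDeriv ν g x) (hf.sub hg) rfl ?_ ν
  intro ν i h
  rw [h, partialDeriv_sub ((hf.multiDeriv ν).differentiable (by simp))
    ((hg.multiDeriv ν).differentiable (by simp))]
  obtain ⟨a, b⟩ := ν
  fin_cases i
  · simp [partialDeriv_zero_multiDeriv]
  · simp [partialDeriv_one_multiDeriv hf, partialDeriv_one_multiDeriv hg]

theorem tsupport_partialDeriv_subset (f : Plane → ℝ) (i : Fin 2) :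
    tsupport (partialDeriv i f) ⊆ tsupport f :=
  closure_minimal (fun x hx => by
    by_contra h
    apply hx
    have : fderiv ℝ f x = 0 := by
      have := support_fderiv_subset ℝ (f := f)
      by_contra h'
      exact h (this h')
    simp [partialDeriv, this]) (isClosed_tsupport f)

theorem tsupport_iterate_partialDeriv_subset (f : Plane → ℝ) (i : Fin 2) (n : ℕ) :
    tsupport ((partialDeriv i)^[n] f) ⊆ tsupport f := by
  induction n generalizing f with
  | zero => exact subset_rfl
  | succ n ih => exact (ih _).trans (tsupport_partialDeriv_subset f i)

theorem tsupport_multiDeriv_subset (f : Plane → ℝ) (ν : ℕ × ℕ) :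
    tsupport (multiDeriv ν f) ⊆ tsupport f :=
  (tsupport_iterate_partialDeriv_subset _ _ _).trans (tsupport_iterate_partialDeriv_subset _ _ _)

/-! ### Polynomial functions -/

/-- The function on the plane defined by a polynomial. -/
def polyFun (P : MvPolynomial (Fin 2) ℝ) (x : Plane) : ℝ := MvPolynomial.eval (fun i => x i) P

@[simp] theorem polyFun_add (P R : MvPolynomial (Fin 2) ℝ) (x : Plane) :
    polyFun (P + R) x = polyFun P x + polyFun R x := by simp [polyFun]

@[simp] theorem polyFun_sub (P R : MvPolynomial (Fin 2) ℝ) (x : Plane) :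
    polyFun (P - R) x = polyFun P x - polyFun R x := by simp [polyFun]

@[simp] theorem polyFun_mul (P R : MvPolynomial (Fin 2) ℝ) (x : Plane) :
    polyFun (P * R) x = polyFun P x * polyFun R x := by simp [polyFun]

@[simp] theorem polyFun_C (c : ℝ) (x : Plane) : polyFun (MvPolynomial.C c) x = c := by
  simp [polyFun]

@[simp] theorem polyFun_X (i : Fin 2) (x : Plane) : polyFun (MvPolynomial.X i) x = x i := by
  simp [polyFun]

theorem contDiff_polyFun (P : MvPolynomial (Fin 2) ℝ) : ContDiff ℝ ∞ (polyFun P) := by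
  induction P using MvPolynomial.induction_on with
  | C a => exact (funext fun x => by simp : polyFun (MvPolynomial.C a) = fun _ => a) ▸ contDiff_const
  | add p q hp hq => exact (funext fun x => by simp : polyFun (p + q) = fun x => polyFun p x + polyFun q x) ▸
      (hp.add hq)
  | mul_X p i hp =>
    have h : ContDiff ℝ ∞ fun x : Plane => x i := by fun_prop
    exact (funext fun x => by simp : polyFun (p * MvPolynomial.X i) = fun x => polyFun p x * x i) ▸
      (hp.mul h)

theorem partialDeriv_polyFun (P : MvPolynomial (Fin 2) ℝ) (i : Fin 2) :
    partialDeriv i (polyFun P) = polyFun (MvPolynomial.pderiv i P) := by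
  induction P using MvPolynomial.induction_on with
  | C a =>
    have : polyFun (MvPolynomial.C a) = fun _ => a := by funext x; simp
    funext x
    simp only [this, partialDeriv, MvPolynomial.pderiv_C]
    simp [polyFun]
  | add p q hp hq =>
    have : polyFun (p + q) = fun x => polyFun p x + polyFun q x := by funext x; simp
    rw [this, partialDeriv_add ((contDiff_polyFun p).differentiable (by simp))
      ((contDiff_polyFun q).differentiable (by simp)), hp, hq]
    funext x; simp
  | mul_X p j hp =>
    have : polyFun (p * MvPolynomial.X j) = fun x => polyFun p x * x j := by funext x; simp
    funext x
    have hd : HasFDerivAt (fun x : Plane => x j) (EuclideanSpace.proj j : Plane →L[ℝ] ℝ) x :=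
      (EuclideanSpace.proj j : Plane →L[ℝ] ℝ).hasFDerivAt
    have h2 : partialDeriv i (fun x : Plane => x j) x = polyFun (MvPolynomial.pderiv i (MvPolynomial.X j)) x := by
      simp only [partialDeriv, hd.fderiv]
      by_cases hij : j = i
      · subst hij; simp [polyFun]
      · rw [MvPolynomial.pderiv_X_of_ne hij]; simp [polyFun, hij]
    rw [this, partialDeriv_mul ((contDiff_polyFun p).differentiable (by simp)).differentiableAt
      hd.differentiableAt, hp, h2, Derivation.leibniz]
    simp [polyFun]; ring

/-- The iterated formal derivative of a polynomial. -/
def polyDeriv (ν : ℕ × ℕ) (P : MvPolynomial (Fin 2) ℝ) : MvPolynomial (Fin 2) ℝ :=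
  (MvPolynomial.pderiv 0)^[ν.1] ((MvPolynomial.pderiv 1)^[ν.2] P)

theorem multiDeriv_polyFun (P : MvPolynomial (Fin 2) ℝ) (ν : ℕ × ℕ) :
    multiDeriv ν (polyFun P) = polyFun (polyDeriv ν P) := by
  have h : ∀ (i : Fin 2) (n : ℕ) (P : MvPolynomial (Fin 2) ℝ),
      (partialDeriv i)^[n] (polyFun P) = polyFun ((MvPolynomial.pderiv i)^[n] P) := by
    intro i n
    induction n with
    | zero => intro P; rfl
    | succ n ih => intro P; rw [Function.iterate_succ_apply, Function.iterate_succ_apply,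
        partialDeriv_polyFun, ih]
  unfold multiDeriv polyDeriv
  rw [h, h]

/-- Each coefficient of the `n`-fold derivative is a multiple of the coefficient of `P` whose `i`-th
exponent is larger by `n`, so the vanishing threshold drops by `n`. -/
theorem coeff_iterate_pderiv_eq_zero {P : MvPolynomial (Fin 2) ℝ} (i : Fin 2) (n : ℕ) {k : ℕ}
    (h : ∀ s : Fin 2 →₀ ℕ, k < s 0 + s 1 → P.coeff s = 0) (s : Fin 2 →₀ ℕ)
    (hs : k < s 0 + s 1 + n) : ((MvPolynomial.pderiv i)^[n] P).coeff s = 0 := by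
  induction n generalizing s with
  | zero => exact h s hs
  | succ n ih =>
    rw [Function.iterate_succ_apply', MvPolynomial.coeff_pderiv, ih, zero_mul]
    fin_cases i <;> simp <;> omega

theorem coeff_eq_zero_of_totalDegree_lt' {P : MvPolynomial (Fin 2) ℝ} {k : ℕ}
    (hP : P.totalDegree ≤ k) (s : Fin 2 →₀ ℕ) (hs : k < s 0 + s 1) : P.coeff s = 0 := by
  apply MvPolynomial.coeff_eq_zero_of_totalDegree_lt
  rw [← Finsupp.degree_apply, Finsupp.degree_eq_sum, Fin.sum_univ_two]; omega

theorem polyDeriv_eq_zero {P : MvPolynomial (Fin 2) ℝ} {k : ℕ} (hP : P.totalDegree ≤ k)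
    {ν : ℕ × ℕ} (hν : k < ν.1 + ν.2) : polyDeriv ν P = 0 := by
  ext s
  unfold polyDeriv
  rw [MvPolynomial.coeff_zero]
  -- The threshold `k - ν.2` left by the inner derivatives is a truncated subtraction; when `k <
  -- ν.2` the inner derivative is already zero.
  by_cases hk : k < ν.2
  · have : (MvPolynomial.pderiv 1)^[ν.2] P = 0 := by
      ext s
      exact coeff_iterate_pderiv_eq_zero 1 ν.2 (coeff_eq_zero_of_totalDegree_lt' hP) s (by omega)
    rw [this, Function.iterate_fixed (map_zero _), MvPolynomial.coeff_zero]
  · refine coeff_iterate_pderiv_eq_zero (k := k - ν.2) 0 ν.1 (fun s hs => ?_) s (by omega)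
    exact coeff_iterate_pderiv_eq_zero 1 ν.2 (coeff_eq_zero_of_totalDegree_lt' hP) s (by omega)

/-! ### Squared `L²` norms -/

/-- The square of the `L²` norm on `U`. -/
def lsq (U : Set Plane) (f : Plane → ℝ) : ℝ≥0∞ := ∫⁻ x in U, ‖f x‖ₑ ^ 2

/-- The sum of the squared `L²` norms of the members of order `j` of a family indexed by
multi-indices. -/
def fsq (U : Set Plane) (j : ℕ) (g : ℕ × ℕ → Plane → ℝ) : ℝ≥0∞ :=
  ∑ ν ∈ Finset.HasAntidiagonal.antidiagonal j, lsq U (g ν)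

theorem lsq_le_fsq (U : Set Plane) (g : ℕ × ℕ → Plane → ℝ) (ν : ℕ × ℕ) :
    lsq U (g ν) ≤ fsq U (ν.1 + ν.2) g :=
  Finset.single_le_sum (f := fun ν => lsq U (g ν)) (fun _ _ => zero_le) (by simp)

theorem lintegral_sq_le {α : Type*} [MeasurableSpace α] (μ : Measure α) {f : α → ℝ≥0∞}
    (hf : AEMeasurable f μ) : (∫⁻ x, f x ∂μ) ^ 2 ≤ μ univ * ∫⁻ x, f x ^ 2 ∂μ := by
  have h := ENNReal.lintegral_mul_le_Lp_mul_Lq μ Real.HolderConjugate.two_two hf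
    (aemeasurable_const (b := (1 : ℝ≥0∞)))
  simp only [Pi.mul_apply, mul_one, ENNReal.one_rpow, lintegral_const, one_mul] at h
  have h2 := pow_le_pow_left' h 2
  rw [mul_pow, ← ENNReal.rpow_natCast, ← ENNReal.rpow_natCast, ← ENNReal.rpow_natCast,
    ← ENNReal.rpow_mul, ← ENNReal.rpow_mul] at h2
  norm_num at h2
  rw [mul_comm]
  convert h2 using 2

theorem enorm_integral_sq_le {α : Type*} [MeasurableSpace α] (μ : Measure α) {f : α → ℝ}
    (hf : AEMeasurable f μ) : ‖∫ x, f x ∂μ‖ₑ ^ 2 ≤ μ univ * ∫⁻ x, ‖f x‖ₑ ^ 2 ∂μ :=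
  (pow_le_pow_left' (enorm_integral_le_lintegral_enorm f) 2).trans (lintegral_sq_le μ hf.enorm)

theorem enorm_sq_eq_ofReal (a : ℝ) : ‖a‖ₑ ^ 2 = ENNReal.ofReal (a ^ 2) := by
  rw [Real.enorm_eq_ofReal_abs, ← ENNReal.ofReal_pow (abs_nonneg _), sq_abs]

theorem enorm_add_sq_le (a b : ℝ) : ‖a + b‖ₑ ^ 2 ≤ 2 * (‖a‖ₑ ^ 2 + ‖b‖ₑ ^ 2) := by
  simp only [enorm_sq_eq_ofReal]
  rw [← ENNReal.ofReal_add (sq_nonneg _) (sq_nonneg _),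
    ← ENNReal.ofReal_ofNat, ← ENNReal.ofReal_mul (by norm_num)]
  exact ENNReal.ofReal_le_ofReal (by nlinarith [sq_nonneg (a - b)])

theorem enorm_add_three_sq_le (a b c : ℝ) :
    ‖a + b + c‖ₑ ^ 2 ≤ 3 * (‖a‖ₑ ^ 2 + ‖b‖ₑ ^ 2 + ‖c‖ₑ ^ 2) := by
  simp only [enorm_sq_eq_ofReal]
  rw [← ENNReal.ofReal_add (sq_nonneg _) (sq_nonneg _),
    ← ENNReal.ofReal_add (add_nonneg (sq_nonneg _) (sq_nonneg _)) (sq_nonneg _),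
    ← ENNReal.ofReal_ofNat, ← ENNReal.ofReal_mul (by norm_num)]
  exact ENNReal.ofReal_le_ofReal
    (by nlinarith [sq_nonneg (a - b), sq_nonneg (a - c), sq_nonneg (b - c)])

/-! ### Integrals along segments -/

theorem map_smul_add_volume {t : ℝ} (ht : 0 < t) (c : Plane) :
    Measure.map (fun y : Plane => t • y + c) volume
      = ENNReal.ofReal ((t ^ 2)⁻¹) • (volume : Measure Plane) := by
  have h1 : (fun y : Plane => t • y + c) = (fun y => y + c) ∘ (fun y => t • y) := rfl
  rw [h1, ← Measure.map_map (by fun_prop) (by fun_prop), Measure.map_addHaar_smul _ ht.ne',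
    Measure.map_smul, map_add_right_eq_self]
  simp [abs_of_pos ht]

/-- The contraction `y ↦ x + t (y - x)` maps the convex set `U` into itself and has Jacobian `t²`.
-/
theorem lintegral_comp_segment_le {U : Set Plane} (hU : Convex ℝ U) (hUo : IsOpen U)
    {G : Plane → ℝ≥0∞} (hG : Measurable G) {t : ℝ} (ht : 0 < t) (ht1 : t ≤ 1) {x : Plane}
    (hx : x ∈ U) :
    ∫⁻ y in U, G (x + t • (y - x)) ≤ ENNReal.ofReal ((t ^ 2)⁻¹) * ∫⁻ y in U, G y := by
  calc ∫⁻ y in U, G (x + t • (y - x))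
      = ∫⁻ y in U, U.indicator G (t • y + (1 - t) • x) := by
        refine setLIntegral_congr_fun hUo.measurableSet fun y hy => ?_
        have e : x + t • (y - x) = t • y + (1 - t) • x := by module
        have : t • y + (1 - t) • x ∈ U := hU hy hx ht.le (by linarith) (by ring)
        simp only [e, indicator_of_mem this]
    _ ≤ ∫⁻ y, U.indicator G (t • y + (1 - t) • x) := setLIntegral_le_lintegral _ _
    _ = ∫⁻ y, U.indicator G y ∂(Measure.map (fun y : Plane => t • y + (1 - t) • x) volume) := by
        rw [lintegral_map (hG.indicator hUo.measurableSet) (by fun_prop)]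
    _ = _ := by
        rw [map_smul_add_volume ht, lintegral_smul_measure, lintegral_indicator hUo.measurableSet]
        rfl

theorem measurable_segment_comp {G : Plane → ℝ≥0∞} (hG : Measurable G) :
    Measurable fun q : (Plane × Plane) × ℝ => G (q.1.1 + q.2 • (q.1.2 - q.1.1)) :=
  hG.comp (by fun_prop)

/-- The factor `t⁻²` from the change of variables is not integrable at `0`. For `t ≥ 1/2` it is at
most `4`; for `t < 1/2` the roles of `x` and `y` are exchanged, which replaces `t` by `1 - t`. -/
theorem lintegral_segments_le {U : Set Plane} (hU : Convex ℝ U) (hUo : IsOpen U)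
    {G : Plane → ℝ≥0∞} (hG : Measurable G) :
    ∫⁻ x in U, ∫⁻ y in U, ∫⁻ t in Ioc (0 : ℝ) 1, G (x + t • (y - x))
      ≤ 4 * volume U * ∫⁻ y in U, G y := by
  have hm := measurable_segment_comp hG
  have key : ∀ t ∈ Ioc (0 : ℝ) 1, ∫⁻ x in U, ∫⁻ y in U, G (x + t • (y - x))
      ≤ 4 * volume U * ∫⁻ y in U, G y := by
    intro t ht
    have main : ∀ s : ℝ, 1 / 2 ≤ s → s ≤ 1 → ∫⁻ x in U, ∫⁻ y in U, G (x + s • (y - x))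
        ≤ 4 * volume U * ∫⁻ y in U, G y := by
      intro s hs hs1
      calc ∫⁻ x in U, ∫⁻ y in U, G (x + s • (y - x))
          ≤ ∫⁻ x in U, 4 * ∫⁻ y in U, G y := by
            refine setLIntegral_mono' hUo.measurableSet fun x hx => ?_
            refine (lintegral_comp_segment_le hU hUo hG (by linarith) hs1 hx).trans ?_
            gcongr
            rw [← ENNReal.ofReal_ofNat]
            apply ENNReal.ofReal_le_ofReal
            rw [inv_le_comm₀ (by positivity) (by norm_num)]
            norm_num
            nlinarith
        _ = _ := by simp; ring
    by_cases h : 1 / 2 ≤ t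
    · exact main t h ht.2
    · rw [lintegral_lintegral_swap]
      · have := main (1 - t) (by linarith) (by linarith [ht.1])
        convert this using 6
        module
      · exact (hm.comp (measurable_id.prodMk measurable_const)).aemeasurable
  calc ∫⁻ x in U, ∫⁻ y in U, ∫⁻ t in Ioc (0 : ℝ) 1, G (x + t • (y - x))
      = ∫⁻ x in U, ∫⁻ t in Ioc (0 : ℝ) 1, ∫⁻ y in U, G (x + t • (y - x)) := by
        refine lintegral_congr fun x => ?_
        rw [lintegral_lintegral_swap]
        exact (hm.comp (f := fun q : Plane × ℝ => ((x, q.1), q.2)) (by fun_prop)).aemeasurable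
    _ = ∫⁻ t in Ioc (0 : ℝ) 1, ∫⁻ x in U, ∫⁻ y in U, G (x + t • (y - x)) := by
        rw [lintegral_lintegral_swap]
        refine Measurable.aemeasurable ?_
        exact Measurable.lintegral_prod_right
          (f := fun (p : Plane × ℝ) (y : Plane) => G (p.1 + p.2 • (y - p.1)))
          (hm.comp (f := fun q : (Plane × ℝ) × Plane => ((q.1.1, q.2), q.1.2)) (by fun_prop))
    _ ≤ ∫⁻ t in Ioc (0 : ℝ) 1, 4 * volume U * ∫⁻ y in U, G y :=
        setLIntegral_mono' measurableSet_Ioc key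
    _ = _ := by simp

theorem hasDerivAt_comp_line {f : Plane → ℝ} (hf : ContDiff ℝ ∞ f) (x h : Plane) (t : ℝ) :
    HasDerivAt (fun t : ℝ => f (x + t • h))
      (h 0 * partialDeriv 0 f (x + t • h) + h 1 * partialDeriv 1 f (x + t • h)) t := by
  have h1 : HasDerivAt (fun t : ℝ => x + t • h) h t := by
    simpa using ((hasDerivAt_id t).smul_const h).const_add x
  have := ((hf.differentiable (by simp)) (x + t • h)).hasFDerivAt.comp_hasDerivAt t h1
  rwa [fderiv_apply_eq_partialDeriv] at this

theorem norm_sq_plane (h : Plane) : ‖h‖ ^ 2 = h 0 ^ 2 + h 1 ^ 2 := by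
  simp [EuclideanSpace.norm_sq_eq, Fin.sum_univ_two]

theorem enorm_sub_sq_le {w : Plane → ℝ} (hw : ContDiff ℝ ∞ w) (x y : Plane) {d : ℝ≥0}
    (hd : dist x y ≤ d) :
    ‖w x - w y‖ₑ ^ 2 ≤ ∫⁻ t in Ioc (0 : ℝ) 1, (d : ℝ≥0∞) ^ 2 *
      (‖partialDeriv 0 w (x + t • (y - x))‖ₑ ^ 2 + ‖partialDeriv 1 w (x + t • (y - x))‖ₑ ^ 2) := by
  set h := y - x
  have hc : ∀ i, Continuous (partialDeriv i w) := fun i => (hw.partialDeriv i).continuous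
  have hcont : Continuous fun t : ℝ =>
      h 0 * partialDeriv 0 w (x + t • h) + h 1 * partialDeriv 1 w (x + t • h) := by
    have := hc 0; have := hc 1; fun_prop
  have hint : ∫ t in Ioc (0 : ℝ) 1,
      (h 0 * partialDeriv 0 w (x + t • h) + h 1 * partialDeriv 1 w (x + t • h)) = w y - w x := by
    rw [← intervalIntegral.integral_of_le zero_le_one,
      intervalIntegral.integral_eq_sub_of_hasDerivAt (fun t _ => hasDerivAt_comp_line hw x h t)
        (hcont.intervalIntegrable _ _)]
    simp [h]
  rw [← enorm_neg, neg_sub, ← hint]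
  refine (enorm_integral_sq_le _ hcont.measurable.aemeasurable).trans ?_
  simp only [Measure.restrict_apply MeasurableSet.univ, univ_inter, Real.volume_Ioc, sub_zero,
    ENNReal.ofReal_one, one_mul]
  refine lintegral_mono fun t => ?_
  have hh : ‖h‖ ^ 2 ≤ (d : ℝ) ^ 2 := by
    gcongr; rwa [← dist_eq_norm, dist_comm]
  rw [norm_sq_plane] at hh
  generalize partialDeriv 0 w (x + t • h) = a
  generalize partialDeriv 1 w (x + t • h) = b
  have : ((d : ℝ≥0∞)) ^ 2 = ENNReal.ofReal ((d : ℝ) ^ 2) := by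
    rw [ENNReal.ofReal_pow d.coe_nonneg, ENNReal.ofReal_coe_nnreal]
  simp only [this, enorm_sq_eq_ofReal]
  rw [← ENNReal.ofReal_add (sq_nonneg _) (sq_nonneg _), ← ENNReal.ofReal_mul (sq_nonneg _)]
  apply ENNReal.ofReal_le_ofReal
  nlinarith [sq_nonneg (h 0 * b - h 1 * a), mul_le_mul_of_nonneg_right hh
    (add_nonneg (sq_nonneg a) (sq_nonneg b))]

/-- Taylor's formula for `w x` expanded about `y`, with the segment parametrised from `x`. The
remainder is then `∫ t g₂(t) dt`, so squaring produces a factor `t²`, which later cancels the `t⁻²`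
of `lintegral_comp_segment_le`. -/
theorem enorm_sq_le_taylor {w : Plane → ℝ} (hw : ContDiff ℝ ∞ w) (x y : Plane) {d : ℝ≥0}
    (hd : dist x y ≤ d) :
    ‖w x‖ₑ ^ 2 ≤ 3 * (‖w y‖ₑ ^ 2
      + (d : ℝ≥0∞) ^ 2 * (‖partialDeriv 0 w y‖ₑ ^ 2 + ‖partialDeriv 1 w y‖ₑ ^ 2)
      + ∫⁻ t in Ioc (0 : ℝ) 1, ENNReal.ofReal (t ^ 2) * (2 * (d : ℝ≥0∞) ^ 4 *
        (‖multiDeriv (2, 0) w (x + t • (y - x))‖ₑ ^ 2 + ‖multiDeriv (1, 1) w (x + t • (y - x))‖ₑ ^ 2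
          + ‖multiDeriv (0, 2) w (x + t • (y - x))‖ₑ ^ 2))) := by
  set h := y - x with h_def
  have hh : ‖h‖ ^ 2 ≤ (d : ℝ) ^ 2 := by
    gcongr; rwa [← dist_eq_norm, dist_comm]
  rw [norm_sq_plane] at hh
  have hde : ((d : ℝ≥0∞)) ^ 2 = ENNReal.ofReal ((d : ℝ) ^ 2) := by
    rw [ENNReal.ofReal_pow d.coe_nonneg, ENNReal.ofReal_coe_nnreal]
  have hde4 : 2 * ((d : ℝ≥0∞)) ^ 4 = ENNReal.ofReal (2 * (d : ℝ) ^ 4) := by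
    rw [ENNReal.ofReal_mul (by norm_num), ENNReal.ofReal_pow d.coe_nonneg,
      ENNReal.ofReal_coe_nnreal, ENNReal.ofReal_ofNat]
  set g1 : ℝ → ℝ := fun t =>
    h 0 * partialDeriv 0 w (x + t • h) + h 1 * partialDeriv 1 w (x + t • h) with hg1
  set g2 : ℝ → ℝ := fun t => h 0 ^ 2 * multiDeriv (2, 0) w (x + t • h)
    + 2 * h 0 * h 1 * multiDeriv (1, 1) w (x + t • h) + h 1 ^ 2 * multiDeriv (0, 2) w (x + t • h)
    with hg2
  have hc2 : ∀ ν, Continuous (multiDeriv ν w) := fun ν => (hw.multiDeriv ν).continuous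
  have hg2c : Continuous g2 := by
    have := hc2 (2, 0); have := hc2 (1, 1); have := hc2 (0, 2); fun_prop
  have hd1 : ∀ t, HasDerivAt g1 (g2 t) t := by
    intro t
    have e0 := hasDerivAt_comp_line (hw.partialDeriv 0) x h t
    have e1 := hasDerivAt_comp_line (hw.partialDeriv 1) x h t
    have := (e0.const_mul (h 0)).add (e1.const_mul (h 1))
    refine this.congr_deriv ?_
    rw [partialDeriv_comm hw 1 0]
    simp only [hg2, multiDeriv, Function.iterate_succ_apply, Function.iterate_zero, id]
    ring
  have hint : ∫ t in Ioc (0 : ℝ) 1, t * g2 t = g1 1 - w y + w x := by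
    rw [← intervalIntegral.integral_of_le zero_le_one,
      intervalIntegral.integral_eq_sub_of_hasDerivAt (f := fun t => t * g1 t - w (x + t • h))
        (fun t _ => (((hasDerivAt_id t).mul (hd1 t)).sub
          (hasDerivAt_comp_line hw x h t)).congr_deriv (by simp [hg1]))
        ((by fun_prop : Continuous fun t => t * g2 t).intervalIntegrable _ _)]
    simp [h_def]
  have e : w x = w y + (- g1 1) + ∫ t in Ioc (0 : ℝ) 1, t * g2 t := by rw [hint]; ring
  rw [e]
  refine (enorm_add_three_sq_le _ _ _).trans ?_
  gcongr
  · rw [enorm_neg]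
    have hy : x + (1 : ℝ) • h = y := by simp [h_def]
    simp only [hg1, hy]
    generalize partialDeriv 0 w y = a
    generalize partialDeriv 1 w y = b
    simp only [hde, enorm_sq_eq_ofReal]
    rw [← ENNReal.ofReal_add (sq_nonneg _) (sq_nonneg _), ← ENNReal.ofReal_mul (sq_nonneg _)]
    apply ENNReal.ofReal_le_ofReal
    nlinarith [sq_nonneg (h 0 * b - h 1 * a), mul_le_mul_of_nonneg_right hh
      (add_nonneg (sq_nonneg a) (sq_nonneg b))]
  · refine (enorm_integral_sq_le _ (by fun_prop : Continuous fun t => t * g2 t).measurable.aemeasurable).trans ?_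
    simp only [Measure.restrict_apply MeasurableSet.univ, univ_inter, Real.volume_Ioc, sub_zero,
      ENNReal.ofReal_one, one_mul]
    refine lintegral_mono fun t => ?_
    simp only [hg2]
    generalize multiDeriv (2, 0) w (x + t • h) = a
    generalize multiDeriv (1, 1) w (x + t • h) = b
    generalize multiDeriv (0, 2) w (x + t • h) = c
    simp only [hde4, enorm_sq_eq_ofReal]
    rw [← ENNReal.ofReal_add (sq_nonneg _) (sq_nonneg _),
      ← ENNReal.ofReal_add (by positivity) (sq_nonneg _),
      ← ENNReal.ofReal_mul (by positivity),
      ← ENNReal.ofReal_mul (by positivity)]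
    apply ENNReal.ofReal_le_ofReal
    rw [mul_pow]
    refine mul_le_mul_of_nonneg_left ?_ (sq_nonneg _)
    have h4 : (h 0 ^ 2 + h 1 ^ 2) ^ 2 ≤ (d : ℝ) ^ 4 := by
      calc _ ≤ ((d : ℝ) ^ 2) ^ 2 := by gcongr
        _ = _ := by ring
    have : (h 0 ^ 2 * a + 2 * h 0 * h 1 * b + h 1 ^ 2 * c) ^ 2
        ≤ (h 0 ^ 2 + h 1 ^ 2) ^ 2 * (2 * (a ^ 2 + b ^ 2 + c ^ 2)) := by
      set p := h 0 ^ 2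
      set q := h 1 ^ 2
      have hr : (2 * h 0 * h 1) ^ 2 = 4 * (p * q) := by simp only [p, q]; ring
      set r := 2 * h 0 * h 1
      have hpq : 0 ≤ p * q := by positivity
      -- Cauchy–Schwarz with weights `1, 2, 1`: since `r² = 4pq`, the first factor becomes the
      -- perfect square `(p + q)² = ‖h‖⁴`.
      have cs : (p * a + r * b + q * c) ^ 2 ≤ (p ^ 2 + r ^ 2 / 2 + q ^ 2) * (a ^ 2 + 2 * b ^ 2 + c ^ 2) := by
        nlinarith [sq_nonneg (p * c - q * a), sq_nonneg (2 * p * b - r * a),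
          sq_nonneg (2 * q * b - r * c)]
      refine cs.trans ?_
      have : p ^ 2 + r ^ 2 / 2 + q ^ 2 = (p + q) ^ 2 := by rw [hr]; ring
      rw [this]
      gcongr
      nlinarith [sq_nonneg a, sq_nonneg c]
    calc _ ≤ _ := this
      _ ≤ (d : ℝ) ^ 4 * (2 * (a ^ 2 + b ^ 2 + c ^ 2)) := by gcongr
      _ = _ := by ring

/-! ### Inequalities for smooth functions on convex sets -/

theorem fsq_one (U : Set Plane) (g : ℕ × ℕ → Plane → ℝ) :
    fsq U 1 g = lsq U (g (0, 1)) + lsq U (g (1, 0)) := by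
  simp [fsq, Finset.Nat.antidiagonal_succ]

theorem fsq_two (U : Set Plane) (g : ℕ × ℕ → Plane → ℝ) :
    fsq U 2 g = lsq U (g (0, 2)) + (lsq U (g (1, 1)) + lsq U (g (2, 0))) := by
  simp [fsq, Finset.Nat.antidiagonal_succ]

theorem fsq_zero (U : Set Plane) (g : ℕ × ℕ → Plane → ℝ) : fsq U 0 g = lsq U (g (0, 0)) := by
  simp [fsq]

theorem lsq_add_le (U : Set Plane) {f g : Plane → ℝ}
    (hf : AEStronglyMeasurable f (volume.restrict U)) :
    lsq U (fun x => f x + g x) ≤ 2 * (lsq U f + lsq U g) := by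
  unfold lsq
  rw [← lintegral_add_left' (hf.enorm.pow_const 2), ← lintegral_const_mul' _ _ (by simp)]
  exact lintegral_mono fun x => enorm_add_sq_le _ _

theorem lsq_neg (U : Set Plane) (f : Plane → ℝ) : lsq U (fun x => - f x) = lsq U f := by
  simp [lsq]

theorem lsq_sub_comm (U : Set Plane) (f g : Plane → ℝ) :
    lsq U (fun x => f x - g x) = lsq U (fun x => g x - f x) := by
  rw [← lsq_neg]; simp

theorem lsq_congr {U : Set Plane} {f g : Plane → ℝ} (h : f =ᵐ[volume.restrict U] g) :
    lsq U f = lsq U g :=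
  lintegral_congr_ae (h.mono fun x hx => by simp only [hx])

theorem lsq_mono_set {U V : Set Plane} (h : U ⊆ V) (f : Plane → ℝ) : lsq U f ≤ lsq V f :=
  lintegral_mono_set h

theorem fsq_mono_set {U V : Set Plane} (h : U ⊆ V) (j : ℕ) (g : ℕ × ℕ → Plane → ℝ) :
    fsq U j g ≤ fsq V j g :=
  Finset.sum_le_sum fun _ _ => lsq_mono_set h _

theorem _root_.Continuous.integrableOn_of_isBounded {U : Set Plane} (hU : Bornology.IsBounded U)
    {f : Plane → ℝ} (hf : Continuous f) : IntegrableOn f U :=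
  (hf.continuousOn.integrableOn_compact hU.isCompact_closure).mono_set subset_closure

/-- `w x` minus the mean is the mean over `y` of `w x - w y`, which is an integral of the gradient
along a segment; `lintegral_segments_le` sums these. Convexity makes the constant depend on the
diameter only and not on the shape. -/
theorem poincare {U : Set Plane} (hU : Convex ℝ U) (hUo : IsOpen U)
    (hUb : Bornology.IsBounded U) (hUn : U.Nonempty) {d : ℝ≥0}
    (hd : ∀ x ∈ U, ∀ y ∈ U, dist x y ≤ d) {w : Plane → ℝ} (hw : ContDiff ℝ ∞ w) :
    lsq U (fun x => w x - ⨍ y in U, w y) ≤ 4 * (d : ℝ≥0∞) ^ 2 *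
      (lsq U (partialDeriv 0 w) + lsq U (partialDeriv 1 w)) := by
  have hv0 : volume U ≠ 0 := (hUo.measure_pos _ hUn).ne'
  have hvt : volume U ≠ ⊤ := hUb.measure_lt_top.ne
  have hwi : IntegrableOn w U := hw.continuous.integrableOn_of_isBounded hUb
  have h1 : ∀ x, volume U * ‖w x - ⨍ y in U, w y‖ₑ ^ 2 ≤ ∫⁻ y in U, ‖w x - w y‖ₑ ^ 2 := by
    intro x
    have e : w x - ⨍ y in U, w y = (volume.real U)⁻¹ * ∫ y in U, (w x - w y) := by
      have hci : IntegrableOn (fun _ : Plane => w x) U := integrableOn_const hvt (by simp)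
      rw [integral_sub hci hwi, setAverage_eq]
      simp only [integral_const, smul_eq_mul, measureReal_restrict_apply_univ]
      have : volume.real U ≠ 0 := by
        simp [measureReal_def, ENNReal.toReal_eq_zero_iff, hv0, hvt]
      field_simp
    have hm : ‖(volume.real U)⁻¹‖ₑ = (volume U)⁻¹ := by
      rw [Real.enorm_eq_ofReal (by positivity), measureReal_def, ENNReal.ofReal_inv_of_pos
        (ENNReal.toReal_pos hv0 hvt), ENNReal.ofReal_toReal hvt]
    rw [e, enorm_mul, hm, mul_pow]
    have := enorm_integral_sq_le (volume.restrict U) (f := fun y => w x - w y)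
      (by have := hw.continuous.measurable; fun_prop)
    rw [Measure.restrict_apply_univ] at this
    calc volume U * ((volume U)⁻¹ ^ 2 * ‖∫ y in U, (w x - w y)‖ₑ ^ 2)
        ≤ volume U * ((volume U)⁻¹ ^ 2 * (volume U * ∫⁻ y in U, ‖w x - w y‖ₑ ^ 2)) := by gcongr
      _ = (volume U * (volume U)⁻¹) * (volume U * (volume U)⁻¹) *
          ∫⁻ y in U, ‖w x - w y‖ₑ ^ 2 := by ring
      _ = _ := by rw [ENNReal.mul_inv_cancel hv0 hvt]; simp
  have hG : Measurable fun z => ‖partialDeriv 0 w z‖ₑ ^ 2 + ‖partialDeriv 1 w z‖ₑ ^ 2 := by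
    have := (hw.partialDeriv 0).continuous.measurable
    have := (hw.partialDeriv 1).continuous.measurable
    fun_prop
  have h2 : volume U * lsq U (fun x => w x - ⨍ y in U, w y)
      ≤ volume U * (4 * (d : ℝ≥0∞) ^ 2 *
        (lsq U (partialDeriv 0 w) + lsq U (partialDeriv 1 w))) := by
    unfold lsq
    rw [← lintegral_const_mul' _ _ hvt]
    calc _ ≤ ∫⁻ x in U, ∫⁻ y in U, ∫⁻ t in Ioc (0 : ℝ) 1, (d : ℝ≥0∞) ^ 2 *
          (‖partialDeriv 0 w (x + t • (y - x))‖ₑ ^ 2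
            + ‖partialDeriv 1 w (x + t • (y - x))‖ₑ ^ 2) := by
          refine setLIntegral_mono' hUo.measurableSet fun x hx => (h1 x).trans ?_
          exact setLIntegral_mono' hUo.measurableSet fun y hy =>
            enorm_sub_sq_le hw x y (hd x hx y hy)
      _ ≤ 4 * volume U * ∫⁻ z in U, (d : ℝ≥0∞) ^ 2 *
          (‖partialDeriv 0 w z‖ₑ ^ 2 + ‖partialDeriv 1 w z‖ₑ ^ 2) :=
          lintegral_segments_le hU hUo (G := fun z => (d : ℝ≥0∞) ^ 2 *
            (‖partialDeriv 0 w z‖ₑ ^ 2 + ‖partialDeriv 1 w z‖ₑ ^ 2)) (hG.const_mul _)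
      _ = _ := by
          rw [lintegral_const_mul _ hG, lintegral_add_left (by
            have := (hw.partialDeriv 0).continuous.measurable
            fun_prop)]
          ring
  rwa [ENNReal.mul_le_mul_iff_right hv0 hvt] at h2

/-- Integrate the Taylor bound over `y ∈ U`: the `t²` in the remainder cancels the Jacobian. This is
the embedding of `H²` into bounded functions with explicit scaling, the shape of `U` entering only
through `volume U`. -/
theorem sup_le_of_smooth {U : Set Plane} (hU : Convex ℝ U) (hUo : IsOpen U) {d : ℝ≥0}
    (hd : ∀ x ∈ U, ∀ y ∈ U, dist x y ≤ d) {w : Plane → ℝ} (hw : ContDiff ℝ ∞ w) {x : Plane}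
    (hx : x ∈ U) :
    volume U * ‖w x‖ₑ ^ 2 ≤ 6 * (fsq U 0 (fun ν => multiDeriv ν w)
      + (d : ℝ≥0∞) ^ 2 * fsq U 1 (fun ν => multiDeriv ν w)
      + (d : ℝ≥0∞) ^ 4 * fsq U 2 (fun ν => multiDeriv ν w)) := by
  set G : Plane → ℝ≥0∞ := fun z => ‖multiDeriv (2, 0) w z‖ₑ ^ 2
    + ‖multiDeriv (1, 1) w z‖ₑ ^ 2 + ‖multiDeriv (0, 2) w z‖ₑ ^ 2 with hG_def
  have hm : ∀ ν, Measurable (multiDeriv ν w) := fun ν => (hw.multiDeriv ν).continuous.measurable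
  have hm0 := hw.continuous.measurable
  have hp0 : Measurable (partialDeriv 0 w) := (hw.partialDeriv 0).continuous.measurable
  have hp1 : Measurable (partialDeriv 1 w) := (hw.partialDeriv 1).continuous.measurable
  have hG : Measurable G := by
    have := hm (2, 0); have := hm (1, 1); have := hm (0, 2)
    fun_prop
  have hGi : ∫⁻ z in U, G z = fsq U 2 (fun ν => multiDeriv ν w) := by
    have := hm (2, 0); have := hm (1, 1); have := hm (0, 2)
    rw [fsq_two, hG_def, lintegral_add_left (by fun_prop), lintegral_add_left (by fun_prop)]
    simp only [lsq]; ring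
  have hmt := (measurable_segment_comp hG)
  have e1 : fsq U 1 (fun ν => multiDeriv ν w)
      = ∫⁻ z in U, (‖partialDeriv 0 w z‖ₑ ^ 2 + ‖partialDeriv 1 w z‖ₑ ^ 2) := by
    rw [fsq_one, lintegral_add_left (by fun_prop), add_comm]
    simp [lsq, multiDeriv]
  calc volume U * ‖w x‖ₑ ^ 2 = ∫⁻ _ in U, ‖w x‖ₑ ^ 2 := by simp [mul_comm]
    _ ≤ ∫⁻ y in U, 3 * (‖w y‖ₑ ^ 2
      + (d : ℝ≥0∞) ^ 2 * (‖partialDeriv 0 w y‖ₑ ^ 2 + ‖partialDeriv 1 w y‖ₑ ^ 2)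
      + ∫⁻ t in Ioc (0 : ℝ) 1, ENNReal.ofReal (t ^ 2) * (2 * (d : ℝ≥0∞) ^ 4 *
        G (x + t • (y - x)))) :=
        setLIntegral_mono' hUo.measurableSet fun y hy => enorm_sq_le_taylor hw x y (hd x hx y hy)
    _ = 3 * ((∫⁻ y in U, ‖w y‖ₑ ^ 2)
      + (d : ℝ≥0∞) ^ 2 * (∫⁻ y in U, (‖partialDeriv 0 w y‖ₑ ^ 2 + ‖partialDeriv 1 w y‖ₑ ^ 2))
      + ∫⁻ y in U, ∫⁻ t in Ioc (0 : ℝ) 1, ENNReal.ofReal (t ^ 2) * (2 * (d : ℝ≥0∞) ^ 4 *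
        G (x + t • (y - x)))) := by
        rw [lintegral_const_mul' _ _ (by simp), lintegral_add_left (by fun_prop),
          lintegral_add_left (by fun_prop), lintegral_const_mul _ (by fun_prop)]
    _ ≤ 3 * (fsq U 0 (fun ν => multiDeriv ν w)
      + (d : ℝ≥0∞) ^ 2 * fsq U 1 (fun ν => multiDeriv ν w)
      + 2 * (d : ℝ≥0∞) ^ 4 * fsq U 2 (fun ν => multiDeriv ν w)) := by
        rw [e1, fsq_zero]
        gcongr
        · rfl
        rw [lintegral_lintegral_swap ((((by fun_prop : Measurable fun q : Plane × ℝ =>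
          ENNReal.ofReal (q.2 ^ 2)).mul ((hmt.comp (f := fun q : Plane × ℝ => ((x, q.1), q.2))
            (by fun_prop)).const_mul _))).aemeasurable)]
        calc _ ≤ ∫⁻ t in Ioc (0 : ℝ) 1, 2 * (d : ℝ≥0∞) ^ 4 *
              fsq U 2 (fun ν => multiDeriv ν w) := by
              refine setLIntegral_mono' measurableSet_Ioc fun t ht => ?_
              rw [lintegral_const_mul' _ _ ENNReal.ofReal_ne_top,
                lintegral_const_mul' _ _ (ENNReal.mul_ne_top (by simp) (by simp))]
              have := lintegral_comp_segment_le hU hUo hG ht.1 ht.2 hx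
              calc _ ≤ ENNReal.ofReal (t ^ 2) * (2 * (d : ℝ≥0∞) ^ 4 *
                    (ENNReal.ofReal ((t ^ 2)⁻¹) * ∫⁻ y in U, G y)) := by gcongr
                _ = (ENNReal.ofReal (t ^ 2) * ENNReal.ofReal ((t ^ 2)⁻¹)) *
                    (2 * (d : ℝ≥0∞) ^ 4 * ∫⁻ y in U, G y) := by ring
                _ = _ := by
                  rw [← ENNReal.ofReal_mul (by positivity), mul_inv_cancel₀
                    (by have := ht.1; positivity), hGi]
                  simp
          _ = _ := by simp
    _ ≤ 3 * (2 * fsq U 0 (fun ν => multiDeriv ν w)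
      + 2 * ((d : ℝ≥0∞) ^ 2 * fsq U 1 (fun ν => multiDeriv ν w))
      + 2 * (d : ℝ≥0∞) ^ 4 * fsq U 2 (fun ν => multiDeriv ν w)) := by
        have h2 : ∀ a : ℝ≥0∞, a ≤ 2 * a := fun a => le_mul_of_one_le_left zero_le (by norm_num)
        exact mul_le_mul_right (add_le_add_left (add_le_add (h2 _) (h2 _)) _) _
    _ = _ := by ring

/-! ### The Bramble–Hilbert lemma -/

theorem iterate_pderiv_monomial (i : Fin 2) (n : ℕ) (s : Fin 2 →₀ ℕ) (c : ℝ) :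
    (MvPolynomial.pderiv i)^[n] (MvPolynomial.monomial s c)
      = MvPolynomial.monomial (s - Finsupp.single i n) (c * (s i).descFactorial n) := by
  induction n with
  | zero => simp
  | succ n ih =>
    rw [Function.iterate_succ_apply', ih, MvPolynomial.pderiv_monomial, Nat.descFactorial_succ]
    have h1 : s - Finsupp.single i n - Finsupp.single i 1 = s - Finsupp.single i (n + 1) := by
      rw [tsub_tsub, ← Finsupp.single_add]
    rw [h1]
    congr 1
    simp; ring

/-- The polynomial is `∑ c_μ x^μ / μ!`. Two distinct multi-indices of the same order satisfy `μ_i <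
ν_i` for some `i`, so the cross terms are differentiated away. -/
theorem exists_polyDeriv_eq (n : ℕ) (c : ℕ × ℕ → ℝ) :
    ∃ P : MvPolynomial (Fin 2) ℝ, P.totalDegree ≤ n ∧
      ∀ ν ∈ Finset.HasAntidiagonal.antidiagonal n, polyDeriv ν P = MvPolynomial.C (c ν) := by
  let e : ℕ × ℕ → (Fin 2 →₀ ℕ) := fun μ => Finsupp.single 0 μ.1 + Finsupp.single 1 μ.2
  have e0 : ∀ μ, e μ 0 = μ.1 := fun μ => by simp [e]
  have e1 : ∀ μ, e μ 1 = μ.2 := fun μ => by simp [e]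
  refine ⟨∑ μ ∈ Finset.HasAntidiagonal.antidiagonal n,
    MvPolynomial.monomial (e μ) (c μ / (μ.1.factorial * μ.2.factorial)), ?_, ?_⟩
  · refine MvPolynomial.totalDegree_finsetSum_le fun μ hμ => ?_
    refine (MvPolynomial.totalDegree_monomial_le _ _).trans ?_
    rw [Finset.HasAntidiagonal.mem_antidiagonal] at hμ
    rw [Finsupp.sum_fintype _ _ (by simp), Fin.sum_univ_two, e0, e1]
    exact hμ.le
  · intro ν hν
    have hlin : ∀ (s : Finset (ℕ × ℕ)) (F : ℕ × ℕ → MvPolynomial (Fin 2) ℝ),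
        polyDeriv ν (∑ μ ∈ s, F μ) = ∑ μ ∈ s, polyDeriv ν (F μ) := by
      intro s F
      unfold polyDeriv
      have h : ∀ (i : Fin 2) (n : ℕ) (P : MvPolynomial (Fin 2) ℝ),
        (MvPolynomial.pderiv i)^[n] P
          = (((MvPolynomial.pderiv i : Derivation ℝ (MvPolynomial (Fin 2) ℝ) (MvPolynomial (Fin 2) ℝ)) :
            MvPolynomial (Fin 2) ℝ →ₗ[ℝ] MvPolynomial (Fin 2) ℝ) ^ n) P := by
        intro i n P; rw [Module.End.pow_apply]; rfl
      simp only [h, map_sum]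
    rw [hlin, Finset.sum_eq_single ν]
    · unfold polyDeriv
      rw [iterate_pderiv_monomial, iterate_pderiv_monomial]
      have : e ν - Finsupp.single 1 ν.2 - Finsupp.single 0 ν.1 = 0 := by
        ext j; fin_cases j <;> simp [e]
      rw [this, e1, Nat.descFactorial_self]
      simp only [e, Finsupp.coe_tsub, Finsupp.coe_add, Pi.sub_apply, Pi.add_apply]
      simp only [Finsupp.single_eq_same, Fin.isValue, ne_eq, not_false_eq_true,
        Finsupp.single_eq_of_ne, zero_ne_one, add_zero, tsub_zero, Nat.descFactorial_self]
      rw [← MvPolynomial.C_apply]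
      congr 1
      field_simp
    · intro μ hμ hne
      rw [Finset.HasAntidiagonal.mem_antidiagonal] at hμ hν
      unfold polyDeriv
      rw [iterate_pderiv_monomial, iterate_pderiv_monomial]
      have : μ.1 < ν.1 ∨ μ.2 < ν.2 := by
        by_contra! h
        exact hne (Prod.ext (by omega) (by omega))
      rcases this with h | h
      · simp [e0, e1, h]
      · simp [e0, e1, h]
    · intro h; exact absurd hν h

/-- Induction on `n`: subtract a polynomial `T` whose derivatives of top order are the means of
those of `f`, so that `poincare` gains a factor `d²` there, and apply the induction hypothesis to `f
- T`. For `n = 0` the truncated `n - 1` is harmless, the polynomial being `0`. -/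
theorem bramble_hilbert_smooth (n : ℕ) : ∃ C : ℝ≥0, ∀ (U : Set Plane), Convex ℝ U → IsOpen U →
    Bornology.IsBounded U → U.Nonempty → ∀ d : ℝ≥0, (∀ x ∈ U, ∀ y ∈ U, dist x y ≤ d) →
    ∀ f : Plane → ℝ, ContDiff ℝ ∞ f → ∃ P : MvPolynomial (Fin 2) ℝ, P.totalDegree ≤ n - 1 ∧
      ∀ j ≤ n, fsq U j (fun ν => multiDeriv ν (fun x => f x - polyFun P x))
        ≤ C * (d : ℝ≥0∞) ^ (2 * (n - j)) * fsq U n (fun ν => multiDeriv ν f) := by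
  induction n with
  | zero =>
    refine ⟨1, fun U _ _ _ _ d _ f _ => ⟨0, by simp, fun j hj => ?_⟩⟩
    obtain rfl : j = 0 := by omega
    simp [polyFun]
  | succ n ih =>
    obtain ⟨C, hC⟩ := ih
    -- `8 = 4 · 2`: the Poincaré constant, and two first derivatives each bounded by the whole sum
    -- of order `n + 1`. There are `n + 1` multi-indices of order `n`, and the summand `1` covers `j
    -- = n + 1`.
    refine ⟨C * (8 * (n + 1)) + 1, fun U hU hUo hUb hUn d hd f hf => ?_⟩
    obtain ⟨T, hTd, hT⟩ := exists_polyDeriv_eq n (fun ν => ⨍ y in U, multiDeriv ν f y)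
    have hTs := contDiff_polyFun T
    obtain ⟨R, hRd, hR⟩ := hC U hU hUo hUb hUn d hd (fun x => f x - polyFun T x) (hf.sub hTs)
    have hRs := contDiff_polyFun R
    have hdeg : (T + R).totalDegree ≤ n :=
      (MvPolynomial.totalDegree_add _ _).trans (by omega)
    refine ⟨T + R, by simpa using hdeg, fun j hj => ?_⟩
    have hfun : (fun x => f x - polyFun (T + R) x)
        = fun x => (f x - polyFun T x) - polyFun R x := by
      funext x; simp; ring
    rcases Nat.lt_or_ge n j with h | h
    · obtain rfl : j = n + 1 := by omega
      have : fsq U (n + 1) (fun ν => multiDeriv ν fun x => f x - polyFun (T + R) x)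
          = fsq U (n + 1) (fun ν => multiDeriv ν f) := by
        refine Finset.sum_congr rfl fun ν hν => ?_
        rw [Finset.HasAntidiagonal.mem_antidiagonal] at hν
        simp only
        rw [multiDeriv_sub hf (contDiff_polyFun _), multiDeriv_polyFun,
          polyDeriv_eq_zero hdeg (by omega)]
        simp [polyFun]
      rw [this]
      simp only [tsub_self, mul_zero, pow_zero, mul_one]
      refine le_mul_of_one_le_left zero_le ?_
      push_cast
      exact le_add_self
    · have hstep : fsq U n (fun ν => multiDeriv ν (fun x => f x - polyFun T x))
          ≤ (8 * (n + 1)) * (d : ℝ≥0∞) ^ 2 * fsq U (n + 1) (fun ν => multiDeriv ν f) := by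
        unfold fsq
        calc _ ≤ ∑ ν ∈ Finset.HasAntidiagonal.antidiagonal n,
              8 * (d : ℝ≥0∞) ^ 2 * fsq U (n + 1) (fun ν => multiDeriv ν f) := by
              refine Finset.sum_le_sum fun ν hν => ?_
              simp only [multiDeriv_sub hf hTs, multiDeriv_polyFun, hT ν hν, polyFun_C]
              refine (poincare hU hUo hUb hUn hd (hf.multiDeriv ν)).trans ?_
              rw [partialDeriv_zero_multiDeriv, partialDeriv_one_multiDeriv hf]
              rw [Finset.HasAntidiagonal.mem_antidiagonal] at hν
              have h0 := lsq_le_fsq U (fun ν => multiDeriv ν f) (ν.1 + 1, ν.2)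
              have h1 := lsq_le_fsq U (fun ν => multiDeriv ν f) (ν.1, ν.2 + 1)
              rw [show (ν.1 + 1, ν.2).1 + (ν.1 + 1, ν.2).2 = n + 1 by simp; omega] at h0
              rw [show (ν.1, ν.2 + 1).1 + (ν.1, ν.2 + 1).2 = n + 1 by simp; omega] at h1
              calc _ ≤ 4 * (d : ℝ≥0∞) ^ 2 * (fsq U (n + 1) (fun ν => multiDeriv ν f)
                    + fsq U (n + 1) (fun ν => multiDeriv ν f)) := by gcongr
                _ = _ := by ring
          _ = _ := by
              rw [Finset.sum_const, Finset.Nat.card_antidiagonal, nsmul_eq_mul]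
              push_cast
              simp only [fsq]
              ring
      rw [hfun]
      calc _ ≤ C * (d : ℝ≥0∞) ^ (2 * (n - j))
            * fsq U n (fun ν => multiDeriv ν (fun x => f x - polyFun T x)) := hR j h
        _ ≤ C * (d : ℝ≥0∞) ^ (2 * (n - j)) * ((8 * (n + 1)) * (d : ℝ≥0∞) ^ 2
            * fsq U (n + 1) (fun ν => multiDeriv ν f)) := by gcongr
        _ = (C * (8 * (n + 1))) * (d : ℝ≥0∞) ^ (2 * (n + 1 - j))
            * fsq U (n + 1) (fun ν => multiDeriv ν f) := by
            rw [show 2 * (n + 1 - j) = 2 * (n - j) + 2 by omega, pow_add]; ring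
        _ ≤ _ := by
            gcongr
            push_cast
            exact le_self_add

/-! ### Density of smooth functions -/

theorem lintegral_mul_sq_le {α : Type*} [MeasurableSpace α] (μ : Measure α) {w f : α → ℝ≥0∞}
    (hw : AEMeasurable w μ) (hf : AEMeasurable f μ) :
    (∫⁻ x, w x * f x ∂μ) ^ 2 ≤ (∫⁻ x, w x ∂μ) * ∫⁻ x, w x * f x ^ 2 ∂μ := by
  have hf' : AEMeasurable f (μ.withDensity w) := hf.mono' (withDensity_absolutelyContinuous μ w)
  have := lintegral_sq_le (μ.withDensity w) hf'
  rwa [lintegral_withDensity_eq_lintegral_mul₀ hw hf,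
    lintegral_withDensity_eq_lintegral_mul₀ hw (hf.pow_const 2),
    withDensity_apply _ MeasurableSet.univ, setLIntegral_univ] at this

theorem lsq_eq_eLpNorm_sq (U : Set Plane) (f : Plane → ℝ) :
    lsq U f = eLpNorm f 2 (volume.restrict U) ^ 2 := by
  have := eLpNorm_nnreal_pow_eq_lintegral (p := 2) (f := f) (μ := volume.restrict U) (by norm_num)
  simp only [NNReal.coe_ofNat, ENNReal.rpow_ofNat, ENNReal.coe_ofNat] at this
  exact this.symm

theorem memLp_two_iff_lsq {U : Set Plane} {f : Plane → ℝ}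
    (hf : AEStronglyMeasurable f (volume.restrict U)) :
    MemLp f 2 (volume.restrict U) ↔ lsq U f ≠ ⊤ := by
  rw [lsq_eq_eLpNorm_sq, MemLp, lt_top_iff_ne_top]
  simp [hf]

/-- Convolution of functions on the plane. -/
def conv (ψ g : Plane → ℝ) : Plane → ℝ :=
  convolution ψ g (ContinuousLinearMap.lsmul ℝ ℝ) volume

theorem conv_apply (ψ g : Plane → ℝ) (x : Plane) : conv ψ g x = ∫ t, ψ (x - t) * g t := by
  unfold conv
  rw [convolution_lsmul_swap]; rfl

theorem contDiff_conv {ψ g : Plane → ℝ} (hψ : ContDiff ℝ ∞ ψ) (hc : HasCompactSupport ψ)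
    (hg : LocallyIntegrable g) : ContDiff ℝ ∞ (conv ψ g) :=
  hc.contDiff_convolution_left _ hψ hg

theorem conv_sub {ψ g h : Plane → ℝ} (hψ : ContDiff ℝ ∞ ψ) (hc : HasCompactSupport ψ)
    (hg : LocallyIntegrable g) (hh : LocallyIntegrable h) (x : Plane) :
    conv ψ (fun y => g y - h y) x = conv ψ g x - conv ψ h x := by
  have i1 := (hc.convolutionExists_left (ContinuousLinearMap.lsmul ℝ ℝ) hψ.continuous hg
    x).integrable_swap
  have i2 := (hc.convolutionExists_left (ContinuousLinearMap.lsmul ℝ ℝ) hψ.continuous hh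
    x).integrable_swap
  simp only [ContinuousLinearMap.lsmul_apply, smul_eq_mul] at i1 i2
  simp only [conv_apply]
  rw [← integral_sub i1 i2]
  simp only [mul_sub]

theorem partialDeriv_conv {ψ g : Plane → ℝ} (hψ : ContDiff ℝ ∞ ψ) (hc : HasCompactSupport ψ)
    (hg : LocallyIntegrable g) (i : Fin 2) :
    partialDeriv i (conv ψ g) = conv (partialDeriv i ψ) g := by
  funext x
  have h := hc.hasFDerivAt_convolution_left (ContinuousLinearMap.lsmul ℝ ℝ)
    (hψ.of_le (by norm_cast)) hg x
  have hex := ((hc.fderiv ℝ).convolutionExists_left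
    ((ContinuousLinearMap.lsmul ℝ ℝ : ℝ →L[ℝ] ℝ →L[ℝ] ℝ).precompL Plane)
    (hψ.continuous_fderiv (by simp)) hg x).integrable
  unfold conv
  rw [partialDeriv, h.fderiv, convolution_def, ContinuousLinearMap.integral_apply hex]
  rfl

theorem multiDeriv_conv {ψ g : Plane → ℝ} (hψ : ContDiff ℝ ∞ ψ) (hc : HasCompactSupport ψ)
    (hg : LocallyIntegrable g) (ν : ℕ × ℕ) :
    multiDeriv ν (conv ψ g) = conv (multiDeriv ν ψ) g := by
  refine multiDeriv_induction (P := fun ν h => h = conv (multiDeriv ν ψ) g)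
    (contDiff_conv hψ hc hg) rfl ?_ ν
  intro ν i h
  rw [h, partialDeriv_conv (hψ.multiDeriv ν)
    (hc.of_isClosed_subset (isClosed_tsupport _) (tsupport_multiDeriv_subset ψ ν)) hg]
  obtain ⟨a, b⟩ := ν
  fin_cases i
  · simp [partialDeriv_zero_multiDeriv]
  · simp [partialDeriv_one_multiDeriv hψ]

theorem partialDeriv_comp_affine {F : Plane → ℝ} (hF : ContDiff ℝ ∞ F) (s : ℝ) (c : Plane)
    (i : Fin 2) : partialDeriv i (fun x => F (c + s • x))
      = fun x => s * partialDeriv i F (c + s • x) := by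
  funext x
  have h1 : HasFDerivAt (fun x : Plane => c + s • x) (s • ContinuousLinearMap.id ℝ Plane) x :=
    ((hasFDerivAt_id x).const_smul s).const_add c
  have := ((hF.differentiable (by simp)) (c + s • x)).hasFDerivAt.comp x h1
  simp only [partialDeriv]
  rw [HasFDerivAt.fderiv (f := fun x => F (c + s • x)) this]
  simp

theorem multiDeriv_comp_affine {F : Plane → ℝ} (hF : ContDiff ℝ ∞ F) (s : ℝ) (c : Plane)
    (ν : ℕ × ℕ) : multiDeriv ν (fun x => F (c + s • x))
      = fun x => s ^ (ν.1 + ν.2) * multiDeriv ν F (c + s • x) := by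
  refine multiDeriv_induction (f := fun x => F (c + s • x))
    (P := fun ν h => h = fun x => s ^ (ν.1 + ν.2) * multiDeriv ν F (c + s • x))
    (hF.comp (by fun_prop)) (by simp [multiDeriv]) ?_ ν
  intro ν i h
  have hs := hF.multiDeriv ν
  have e : partialDeriv i (fun x => s ^ (ν.1 + ν.2) * multiDeriv ν F (c + s • x))
      = fun x => s ^ (ν.1 + ν.2) * (s * partialDeriv i (multiDeriv ν F) (c + s • x)) := by
    have e' := partialDeriv_comp_affine hs s c i
    funext x
    rw [← congrFun e' x]
    simp only [partialDeriv]
    have hd : DifferentiableAt ℝ (fun x : Plane => multiDeriv ν F (c + s • x)) x :=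
      (hs.comp (by fun_prop : ContDiff ℝ ∞ fun x : Plane => c + s • x)).differentiable (by simp) x
    rw [fderiv_const_mul hd]
    simp
  rw [h, e]
  obtain ⟨a, b⟩ := ν
  funext x
  fin_cases i
  · simp [partialDeriv_zero_multiDeriv]; ring
  · simp [partialDeriv_one_multiDeriv hF]; ring

/-- The rescaled and reflected kernel `ε⁻² η(-w/ε)`. -/
def scaledKernel (η : Plane → ℝ) (ε : ℝ) (w : Plane) : ℝ := (ε ^ 2)⁻¹ * η (-ε⁻¹ • w)

/-! ### Mollification after a contraction -/

section Kernel

variable {η : Plane → ℝ} {ε : ℝ}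

theorem contDiff_scaledKernel (hη : ContDiff ℝ ∞ η) : ContDiff ℝ ∞ (scaledKernel η ε) :=
  contDiff_const.mul (hη.comp (by fun_prop))

theorem hasCompactSupport_scaledKernel (hε : 0 < ε) (hc : HasCompactSupport η) :
    HasCompactSupport (scaledKernel η ε) :=
  (hc.comp_smul (c := -ε⁻¹) (by simp [hε.ne'])).mul_left

theorem lintegral_scaledKernel_comp (hε : 0 < ε) (hη : Measurable η) {s : ℝ} (hs : 0 < s)
    (z : Plane) : ∫⁻ x, ‖scaledKernel η ε (s • x + z)‖ₑ
      = ENNReal.ofReal ((s ^ 2)⁻¹) * ∫⁻ x, ‖η x‖ₑ := by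
  have hm : Measurable fun x => ‖scaledKernel η ε x‖ₑ := by unfold scaledKernel; fun_prop
  rw [← lintegral_map (f := fun x => ‖scaledKernel η ε x‖ₑ) hm (by fun_prop : Measurable fun x : Plane => s • x + z),
    map_smul_add_volume hs, lintegral_smul_measure]
  congr 1
  have h2 : ∫⁻ x, ‖scaledKernel η ε x‖ₑ
      = ENNReal.ofReal ((ε ^ 2)⁻¹) * ∫⁻ x, ‖η (-ε⁻¹ • x)‖ₑ := by
    rw [← lintegral_const_mul _ (by fun_prop)]
    refine lintegral_congr fun x => ?_
    rw [scaledKernel, enorm_mul, Real.enorm_eq_ofReal (by positivity)]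
  have h3 : ∫⁻ x, ‖η (-ε⁻¹ • x)‖ₑ = ∫⁻ x, ‖η (ε⁻¹ • x + 0)‖ₑ := by
    rw [← lintegral_neg_eq_self]
    simp
  rw [h2, h3, ← lintegral_map (f := fun x => ‖η x‖ₑ) (by fun_prop)
    (by fun_prop : Measurable fun x : Plane => ε⁻¹ • x + 0),
    map_smul_add_volume (by positivity), lintegral_smul_measure, smul_eq_mul, ← mul_assoc,
    ← ENNReal.ofReal_mul (by positivity)]
  rw [show (ε ^ 2)⁻¹ * (ε⁻¹ ^ 2)⁻¹ = 1 by field_simp]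
  simp

/-- Young's inequality: the kernel has `L¹` norm one, so Cauchy–Schwarz with respect to it and an
exchange of integrals suffice. The dilation by `s ≥ 1/2` costs `s⁻² ≤ 4`. -/
theorem lsq_conv_comp_le (hε : 0 < ε) (hη : ContDiff ℝ ∞ η)
    (h1 : ∫⁻ x, ‖η x‖ₑ = 1) {s : ℝ} (hs : 1 / 2 ≤ s) {g : Plane → ℝ}
    (hg : AEStronglyMeasurable g) :
    lsq univ (fun x => conv (scaledKernel η ε) g (s • x)) ≤ 4 * lsq univ g := by
  have hm : Measurable (scaledKernel η ε) := (contDiff_scaledKernel hη).continuous.measurable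
  have hs0 : 0 < s := by linarith
  unfold lsq
  simp only [setLIntegral_univ]
  have b1 : ∀ x, ‖conv (scaledKernel η ε) g (s • x)‖ₑ ^ 2
      ≤ ∫⁻ t, ‖scaledKernel η ε (s • x - t)‖ₑ * ‖g t‖ₑ ^ 2 := by
    intro x
    rw [conv_apply]
    calc _ ≤ (∫⁻ t, ‖scaledKernel η ε (s • x - t)‖ₑ * ‖g t‖ₑ) ^ 2 := by
          gcongr
          refine (enorm_integral_le_lintegral_enorm _).trans_eq ?_
          simp only [enorm_mul]
      _ ≤ (∫⁻ t, ‖scaledKernel η ε (s • x - t)‖ₑ)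
          * ∫⁻ t, ‖scaledKernel η ε (s • x - t)‖ₑ * ‖g t‖ₑ ^ 2 :=
          lintegral_mul_sq_le _ (by fun_prop) hg.enorm
      _ = _ := by
          have := lintegral_scaledKernel_comp hε hη.continuous.measurable one_pos (s • x)
          have e : ∫⁻ t, ‖scaledKernel η ε (s • x - t)‖ₑ
              = ∫⁻ t, ‖scaledKernel η ε ((1 : ℝ) • t + s • x)‖ₑ := by
            rw [← lintegral_neg_eq_self]
            refine lintegral_congr fun t => ?_
            congr 2; module
          rw [e, this, h1]; simp
  calc _ ≤ ∫⁻ x : Plane, ∫⁻ t, ‖scaledKernel η ε (s • x - t)‖ₑ * ‖g t‖ₑ ^ 2 := lintegral_mono b1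
    _ = ∫⁻ t, ∫⁻ x : Plane, ‖scaledKernel η ε (s • x - t)‖ₑ * ‖g t‖ₑ ^ 2 := by
        rw [lintegral_lintegral_swap]
        have a1 : Measurable fun p : Plane × Plane => ‖scaledKernel η ε (s • p.1 - p.2)‖ₑ := by
          fun_prop
        exact a1.aemeasurable.mul ((hg.comp_snd (μ := volume)).enorm.pow_const 2)
    _ = ∫⁻ t, ENNReal.ofReal ((s ^ 2)⁻¹) * ‖g t‖ₑ ^ 2 := by
        refine lintegral_congr fun t => ?_
        rw [lintegral_mul_const _ (by fun_prop)]
        have := lintegral_scaledKernel_comp hε hη.continuous.measurable hs0 (-t)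
        simp only [← sub_eq_add_neg] at this
        rw [this, h1, mul_one]
    _ = ENNReal.ofReal ((s ^ 2)⁻¹) * ∫⁻ t, ‖g t‖ₑ ^ 2 := by
        rw [lintegral_const_mul'' _ (hg.enorm.pow_const 2)]
    _ ≤ _ := by
        gcongr
        rw [← ENNReal.ofReal_ofNat]
        apply ENNReal.ofReal_le_ofReal
        rw [inv_le_comm₀ (by positivity) (by norm_num)]
        nlinarith

theorem integral_scaledKernel (hε : 0 < ε) (h1 : ∫ x, η x = 1) :
    ∫ x, scaledKernel η ε x = 1 := by
  unfold scaledKernel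
  rw [integral_const_mul, Measure.integral_comp_smul, h1]
  simp
  field_simp

/-- The reflection in the kernel puts the support of `t ↦ scaledKernel η ε ((1 - ε) x - t)` inside
`(1 - ε) x + ε tsupport η`, which lies in `U` by convexity. It is therefore an admissible test
function for every `x ∈ U`, up to the boundary. The sign `(-1)^|ν|` from differentiating in `t`
cancels the one in the definition of weak derivatives. -/
theorem conv_multiDeriv_eq (hε : 0 < ε) (hε1 : ε < 1) (hη : ContDiff ℝ ∞ η)
    (hc : HasCompactSupport η) {U : Set Plane} (hU : Convex ℝ U) (hUo : IsOpen U)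
    (hηU : tsupport η ⊆ U) {ν : ℕ × ℕ} {v g : Plane → ℝ} (hv : IsWeakDeriv U ν v g) {x : Plane}
    (hx : x ∈ U) :
    conv (multiDeriv ν (scaledKernel η ε)) (U.indicator v) ((1 - ε) • x)
      = conv (scaledKernel η ε) (U.indicator g) ((1 - ε) • x) := by
  have hk := contDiff_scaledKernel (ε := ε) hη
  set x' := (1 - ε) • x with hx'
  set φ : Plane → ℝ := fun t => scaledKernel η ε (x' + (-1 : ℝ) • t) with hφ
  have hφs : ContDiff ℝ ∞ φ := hk.comp (by fun_prop)
  have hsub : tsupport φ ⊆ (fun t : Plane => ε⁻¹ • (t - x')) ⁻¹' tsupport η := by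
    refine closure_minimal (fun t ht => ?_) ((isClosed_tsupport η).preimage (by fun_prop))
    refine subset_tsupport η ?_
    rw [Function.mem_support] at ht ⊢
    intro h0
    apply ht
    simp only [hφ, scaledKernel]
    rw [show -ε⁻¹ • (x' + (-1 : ℝ) • t) = ε⁻¹ • (t - x') by module, h0, mul_zero]
  have hφU : tsupport φ ⊆ U := by
    intro t ht
    have h := hηU (hsub ht)
    have e : t = (1 - ε) • x + ε • (ε⁻¹ • (t - x')) := by
      rw [smul_smul, mul_inv_cancel₀ hε.ne', hx']; module
    rw [e]
    exact hU hx h (by linarith) hε.le (by ring)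
  have hφc : HasCompactSupport φ := by
    have hh : IsCompact ((fun t : Plane => ε⁻¹ • (t - x')) ⁻¹' tsupport η) := by
      have hcl : Topology.IsClosedEmbedding (fun t : Plane => ε⁻¹ • (t - x')) :=
        ((Homeomorph.subRight x').trans
          (Homeomorph.smulOfNeZero ε⁻¹ (inv_ne_zero hε.ne'))).isClosedEmbedding
      exact hcl.isCompact_preimage hc.isCompact
    exact hh.of_isClosed_subset (isClosed_tsupport φ) hsub
  have h := hv.integral_eq φ hφs hφc hφU
  rw [hφ, multiDeriv_comp_affine hk] at h
  rw [conv_apply, conv_apply]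
  have e1 : ∀ u : Plane → ℝ, ∀ k : Plane → ℝ, ∫ t, k (x' - t) * U.indicator u t
      = ∫ t in U, u t * k (x' + (-1 : ℝ) • t) := by
    intro u k
    rw [← integral_indicator hUo.measurableSet]
    congr 1
    funext t
    by_cases ht : t ∈ U
    · simp only [indicator_of_mem ht]
      rw [show x' + (-1 : ℝ) • t = x' - t by module]; ring
    · simp [ht]
  rw [e1, e1]
  have h2 : ∫ t in U, v t * ((-1 : ℝ) ^ (ν.1 + ν.2) *
      multiDeriv ν (scaledKernel η ε) (x' + (-1 : ℝ) • t))
      = (-1 : ℝ) ^ (ν.1 + ν.2) *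
        ∫ t in U, v t * multiDeriv ν (scaledKernel η ε) (x' + (-1 : ℝ) • t) := by
    rw [← integral_const_mul]
    congr 1; funext t; ring
  rw [h2] at h
  exact mul_left_cancel₀ (by positivity : ((-1 : ℝ) ^ (ν.1 + ν.2)) ≠ 0) h

end Kernel

theorem lsq_const_mul (U : Set Plane) (c : ℝ) (f : Plane → ℝ) :
    lsq U (fun x => c * f x) = ‖c‖ₑ ^ 2 * lsq U f := by
  unfold lsq
  rw [← lintegral_const_mul' _ _ (by simp)]
  simp only [enorm_mul, mul_pow]

/-! ### Convergence of the contracted mollifications in `L²` -/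

theorem tendsto_lsq_conv_of_continuous {η : Plane → ℝ}
    (hc : HasCompactSupport η) (h0 : ∀ x, 0 ≤ η x) (h1 : ∫ x, η x = 1) {U : Set Plane}
    (hUb : Bornology.IsBounded U) {h : Plane → ℝ} (hh : Continuous h)
    (hhc : HasCompactSupport h) :
    Tendsto (fun ε : ℝ => lsq U (fun x => conv (scaledKernel η ε) h ((1 - ε) • x) - h x))
      (𝓝[>] 0) (𝓝 0) := by
  obtain ⟨R, hR0, hR⟩ : ∃ R > 0, ∀ x, η x ≠ 0 → ‖x‖ < R := by
    obtain ⟨R, hR⟩ := hc.isCompact.isBounded.subset_ball 0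
    refine ⟨max R 1, by positivity, fun x hx => ?_⟩
    have := hR (subset_tsupport η hx)
    rw [mem_ball_zero_iff] at this
    exact this.trans_le (le_max_left _ _)
  obtain ⟨D, hD0, hD⟩ : ∃ D > 0, ∀ x ∈ U, ‖x‖ < D := by
    obtain ⟨R, hR⟩ := hUb.subset_ball 0
    refine ⟨max R 1, by positivity, fun x hx => ?_⟩
    have := hR hx
    rw [mem_ball_zero_iff] at this
    exact this.trans_le (le_max_left _ _)
  have huc := hhc.uniformContinuous_of_continuous hh
  rw [Metric.uniformContinuous_iff] at huc
  have hvt : volume U ≠ ⊤ := hUb.measure_lt_top.ne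
  rw [ENNReal.tendsto_nhds_zero]
  intro e he
  obtain ⟨δ, hδ, hδe⟩ : ∃ δ : ℝ≥0, 0 < δ ∧ (δ : ℝ≥0∞) ^ 2 * volume U ≤ e := by
    have ht : Tendsto (fun δ : ℝ≥0 => (δ : ℝ≥0∞) ^ 2 * volume U) (𝓝[>] 0) (𝓝 0) := by
      have : Tendsto (fun δ : ℝ≥0 => (δ : ℝ≥0∞) ^ 2 * volume U) (𝓝 0)
          (𝓝 (((0 : ℝ≥0) : ℝ≥0∞) ^ 2 * volume U)) :=
        ENNReal.Tendsto.mul_const (((ENNReal.continuous_pow 2).comp ENNReal.continuous_coe).tendsto 0) (Or.inr hvt)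
      simp only [ENNReal.coe_zero, ne_eq, OfNat.ofNat_ne_zero, not_false_eq_true, zero_pow,
        zero_mul] at this
      exact this.mono_left nhdsWithin_le_nhds
    obtain ⟨δ, h1, h2⟩ := ((ht.eventually (ge_mem_nhds he)).and self_mem_nhdsWithin).exists
    exact ⟨δ, h2, h1⟩
  obtain ⟨τ, hτ, hτh⟩ := huc δ (by exact_mod_cast hδ)
  -- The value of the convolution at `(1 - ε) x` involves points within `ε R` of `(1 - ε) x`, which
  -- itself is within `ε D` of `x`.
  have hev : ∀ᶠ ε in 𝓝[>] (0 : ℝ), ε < τ / (R + D) :=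
    (Iio_mem_nhds (by positivity) |> mem_nhdsWithin_of_mem_nhds)
  filter_upwards [hev, self_mem_nhdsWithin] with ε hε1 hε
  have hε0 : 0 < ε := hε
  rw [lt_div_iff₀ (by positivity)] at hε1
  calc _ ≤ ∫⁻ x in U, (δ : ℝ≥0∞) ^ 2 := by
        refine lintegral_mono_ae ?_
        refine ae_restrict_of_ae_restrict_of_subset (t := {x | ‖x‖ < D}) (fun x hx => hD x hx) ?_
        refine (ae_restrict_mem (measurableSet_lt (by fun_prop) (by fun_prop))).mono fun x hx => ?_
        gcongr
        have := dist_convolution_le (μ := volume) (f := scaledKernel η ε) (g := h)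
          (x₀ := (1 - ε) • x) (R := ε * R) (ε := δ) (z₀ := h x) δ.coe_nonneg ?_ ?_
          (integral_scaledKernel hε0 h1) hh.aestronglyMeasurable ?_
        · rw [Real.dist_eq] at this
          rw [Real.enorm_eq_ofReal_abs]
          exact (ENNReal.ofReal_le_ofReal this).trans (by simp)
        · intro w hw
          rw [Function.mem_support, scaledKernel] at hw
          have := hR _ (right_ne_zero_of_mul hw)
          rw [norm_smul, norm_neg, norm_inv, Real.norm_of_nonneg hε0.le,
            inv_mul_lt_iff₀ hε0] at this
          simpa using this
        · intro x
          exact mul_nonneg (by positivity) (h0 _)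
        · intro z hz
          refine (hτh ?_).le
          rw [Metric.mem_ball] at hz
          have hx' : dist ((1 - ε) • x) x ≤ ε * D := by
            rw [dist_eq_norm, show (1 - ε) • x - x = (-ε) • x by module, norm_smul, norm_neg,
              Real.norm_of_nonneg hε0.le]
            exact mul_le_mul_of_nonneg_left (le_of_lt hx) hε0.le
          calc dist z x ≤ dist z ((1 - ε) • x) + dist ((1 - ε) • x) x := dist_triangle _ _ _
            _ < ε * R + ε * D := by linarith
            _ < τ := by linarith
    _ = (δ : ℝ≥0∞) ^ 2 * volume U := by simp
    _ ≤ e := hδe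

/-- Approximate `g` in `L²` by a continuous, compactly supported `h`. By `lsq_conv_comp_le` the
operators are bounded uniformly in `ε`, so convergence for `h` passes to `g`. -/
theorem tendsto_lsq_conv {η : Plane → ℝ} (hη : ContDiff ℝ ∞ η)
    (hc : HasCompactSupport η) (h0 : ∀ x, 0 ≤ η x) (h1 : ∫ x, η x = 1) {U : Set Plane}
    (hUb : Bornology.IsBounded U) {g : Plane → ℝ} (hg : MemLp g 2) :
    Tendsto (fun ε : ℝ => lsq U (fun x => conv (scaledKernel η ε) g ((1 - ε) • x) - g x))
      (𝓝[>] 0) (𝓝 0) := by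
  have h1' : ∫⁻ x, ‖η x‖ₑ = 1 := by
    have := ofReal_integral_eq_lintegral_ofReal (integrable_of_integral_eq_one h1)
      (ae_of_all _ h0)
    rw [h1, ENNReal.ofReal_one] at this
    rw [this]
    exact lintegral_congr fun x => Real.enorm_eq_ofReal (h0 x)
  rw [ENNReal.tendsto_nhds_zero]
  intro e he
  obtain ⟨δ, hδ, hδe⟩ : ∃ δ : ℝ≥0∞, δ ≠ 0 ∧ 3 * (4 * δ ^ 2 + δ ^ 2 + δ ^ 2) ≤ e := by
    have ht : Tendsto (fun δ : ℝ≥0 => 3 * (4 * (δ : ℝ≥0∞) ^ 2 + δ ^ 2 + δ ^ 2)) (𝓝[>] 0) (𝓝 0) := by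
      have : ∀ δ : ℝ≥0, 3 * (4 * (δ : ℝ≥0∞) ^ 2 + δ ^ 2 + δ ^ 2)
        = ((3 * (4 * δ ^ 2 + δ ^ 2 + δ ^ 2) : ℝ≥0) : ℝ≥0∞) := by intro δ; push_cast; rfl
      simp only [this]
      rw [← ENNReal.coe_zero, ENNReal.tendsto_coe]
      have : Tendsto (fun δ : ℝ≥0 => 3 * (4 * δ ^ 2 + δ ^ 2 + δ ^ 2)) (𝓝 0)
        (𝓝 (3 * (4 * 0 ^ 2 + 0 ^ 2 + 0 ^ 2))) := Continuous.tendsto (by fun_prop) 0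
      have h3 : Tendsto (fun δ : ℝ≥0 => 3 * (4 * δ ^ 2 + δ ^ 2 + δ ^ 2)) (𝓝 0) (𝓝 0) := by
        simpa using this
      exact h3.mono_left nhdsWithin_le_nhds
    obtain ⟨δ, h1, h2⟩ := ((ht.eventually (ge_mem_nhds he)).and self_mem_nhdsWithin).exists
    exact ⟨δ, by simpa using (ne_of_gt h2), h1⟩
  obtain ⟨h, hhc, hgh, hh, hhm⟩ := hg.exists_hasCompactSupport_eLpNorm_sub_le (by simp) hδ
  have hgl : LocallyIntegrable g := hg.locallyIntegrable (by norm_num)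
  have hhl : LocallyIntegrable h := hh.locallyIntegrable
  have hgh' : lsq univ (fun x => g x - h x) ≤ δ ^ 2 := by
    rw [lsq_eq_eLpNorm_sq, Measure.restrict_univ]
    gcongr
    exact hgh
  have hconv := tendsto_lsq_conv_of_continuous hc h0 h1 hUb hh hhc
  rw [ENNReal.tendsto_nhds_zero] at hconv
  have hev : ∀ᶠ ε in 𝓝[>] (0 : ℝ), ε < 1 / 2 :=
    (Iio_mem_nhds (by positivity) |> mem_nhdsWithin_of_mem_nhds)
  filter_upwards [hconv (δ ^ 2) (by positivity), hev, self_mem_nhdsWithin] with ε hε1 hε2 hε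
  have hε0 : 0 < ε := hε
  have hk := contDiff_scaledKernel (ε := ε) hη
  have hkc := hasCompactSupport_scaledKernel hε0 hc
  have hsplit : ∀ x, conv (scaledKernel η ε) g ((1 - ε) • x) - g x
      = conv (scaledKernel η ε) (fun y => g y - h y) ((1 - ε) • x)
        + (conv (scaledKernel η ε) h ((1 - ε) • x) - h x) + (h x - g x) := by
    intro x
    rw [conv_sub hk hkc hgl hhl]; ring
  have m1 : Measurable fun x => ‖conv (scaledKernel η ε) (fun y => g y - h y) ((1 - ε) • x)‖ₑ ^ 2 := by
    have := (contDiff_conv hk hkc (hgl.sub hhl)).continuous.measurable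
    exact ((this.comp (by fun_prop : Measurable fun x : Plane => (1 - ε) • x)).enorm).pow_const 2
  have m2 : Measurable fun x => ‖conv (scaledKernel η ε) h ((1 - ε) • x) - h x‖ₑ ^ 2 := by
    have := (contDiff_conv hk hkc hhl).continuous.measurable
    exact (((this.comp (by fun_prop : Measurable fun x : Plane => (1 - ε) • x)).sub
      hh.measurable).enorm).pow_const 2
  calc _ = ∫⁻ x in U, ‖conv (scaledKernel η ε) (fun y => g y - h y) ((1 - ε) • x)
        + (conv (scaledKernel η ε) h ((1 - ε) • x) - h x) + (h x - g x)‖ₑ ^ 2 := by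
        unfold lsq; simp only [hsplit]
    _ ≤ ∫⁻ x in U, 3 * (‖conv (scaledKernel η ε) (fun y => g y - h y) ((1 - ε) • x)‖ₑ ^ 2
        + ‖conv (scaledKernel η ε) h ((1 - ε) • x) - h x‖ₑ ^ 2 + ‖h x - g x‖ₑ ^ 2) :=
        lintegral_mono fun x => enorm_add_three_sq_le _ _ _
    _ = 3 * (lsq U (fun x => conv (scaledKernel η ε) (fun y => g y - h y) ((1 - ε) • x))
        + lsq U (fun x => conv (scaledKernel η ε) h ((1 - ε) • x) - h x)
        + lsq U (fun x => h x - g x)) := by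
        rw [lintegral_const_mul' _ _ (by simp), lintegral_add_left (by exact m1.add m2),
          lintegral_add_left (by exact m1)]
        rfl
    _ ≤ 3 * (4 * δ ^ 2 + δ ^ 2 + δ ^ 2) := by
        gcongr
        · calc _ ≤ _ := lsq_mono_set (subset_univ U) _
            _ ≤ 4 * lsq univ (fun x => g x - h x) := lsq_conv_comp_le hε0 hη h1' (by linarith)
                (hg.1.sub hh.aestronglyMeasurable)
            _ ≤ _ := by gcongr
        · rw [lsq_sub_comm]
          exact (lsq_mono_set (subset_univ U) _).trans hgh'
    _ ≤ e := hδe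

theorem IsWeakDeriv.aestronglyMeasurable_deriv {U : Set Plane} {ν : ℕ × ℕ}
    {v g : Plane → ℝ} (h : IsWeakDeriv U ν v g) :
    AEStronglyMeasurable g (volume.restrict U) :=
  h.locallyIntegrable_deriv.aestronglyMeasurable

/-- The approximant is the mollified zero extension of `v` evaluated at `(1 - ε) x`. By
`conv_multiDeriv_eq` its derivatives on `U` are `(1 - ε)^|ν|` times the same construction applied to
`g ν`, so a single `ε` serves the finitely many `ν`. -/
theorem exists_smooth_approx {U : Set Plane} (hU : Convex ℝ U) (hUo : IsOpen U)
    (hUb : Bornology.IsBounded U) (hUn : U.Nonempty) (M : ℕ) {v : Plane → ℝ}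
    {g : ℕ × ℕ → Plane → ℝ} (hw : ∀ ν, ν.1 + ν.2 ≤ M → IsWeakDeriv U ν v (g ν))
    (hfin : ∀ ν, ν.1 + ν.2 ≤ M → lsq U (g ν) ≠ ⊤) {e : ℝ≥0∞} (he : e ≠ 0)
    (hv : lsq U v ≠ ⊤) :
    ∃ f : Plane → ℝ, ContDiff ℝ ∞ f ∧
      ∀ ν, ν.1 + ν.2 ≤ M → lsq U (fun x => multiDeriv ν f x - g ν x) ≤ e := by
  obtain ⟨c, hc⟩ := hUn
  obtain ⟨r, hr, hrU⟩ := Metric.isOpen_iff.1 hUo c hc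
  let b : ContDiffBump c := ⟨r / 4, r / 2, by positivity, by linarith⟩
  set η := b.normed volume with hηdef
  -- The bump sits at a point of `U`, not at the origin: `conv_multiDeriv_eq` needs its support
  -- inside `U`.
  have hη : ContDiff ℝ ∞ η := b.contDiff_normed
  have hηc : HasCompactSupport η := b.hasCompactSupport_normed
  have hη0 : ∀ x, 0 ≤ η x := fun x => b.nonneg_normed x
  have hη1 : ∫ x, η x = 1 := b.integral_normed
  have hηU : tsupport η ⊆ U := by
    rw [hηdef, b.tsupport_normed_eq]
    exact (Metric.closedBall_subset_ball (by change r / 2 < r; linarith)).trans hrU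
  have hmem : ∀ {u : Plane → ℝ}, AEStronglyMeasurable u (volume.restrict U) → lsq U u ≠ ⊤ →
      MemLp (U.indicator u) 2 := fun hu hl =>
    (memLp_indicator_iff_restrict hUo.measurableSet).2 ((memLp_two_iff_lsq hu).2 hl)
  have hvm := hmem (hw (0, 0) (Nat.zero_le _)).locallyIntegrable.aestronglyMeasurable hv
  have hvl : LocallyIntegrable (U.indicator v) := hvm.locallyIntegrable (by norm_num)
  have hfs : (multiIndices M : Set (ℕ × ℕ)).Finite := Finset.finite_toSet _
  have key : ∀ ν ∈ multiIndices M, ∀ᶠ ε in 𝓝[>] (0 : ℝ), 0 < ε ∧ ε < 1 →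
      lsq U (fun x => multiDeriv ν (fun x => conv (scaledKernel η ε) (U.indicator v)
        (0 + (1 - ε) • x)) x - g ν x) ≤ e := by
    intro ν hν
    have hνM : ν.1 + ν.2 ≤ M := (Finset.mem_filter.1 hν).2
    have hgm := hmem (hw ν hνM).aestronglyMeasurable_deriv (hfin ν hνM)
    have hgl : LocallyIntegrable (U.indicator (g ν)) := hgm.locallyIntegrable (by norm_num)
    have t1 := tendsto_lsq_conv hη hηc hη0 hη1 hUb hgm
    have t2 : Tendsto (fun ε : ℝ => 2 * (lsq U (fun x => conv (scaledKernel η ε) (U.indicator (g ν))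
        ((1 - ε) • x) - U.indicator (g ν) x) + ‖(1 - ε) ^ (ν.1 + ν.2) - 1‖ₑ ^ 2 * lsq U (g ν)))
        (𝓝[>] 0) (𝓝 0) := by
      have h2 : Tendsto (fun ε : ℝ => ‖(1 - ε) ^ (ν.1 + ν.2) - 1‖ₑ ^ 2 * lsq U (g ν)) (𝓝[>] 0)
          (𝓝 0) := by
        have : Tendsto (fun ε : ℝ => ‖(1 - ε) ^ (ν.1 + ν.2) - 1‖ₑ ^ 2 * lsq U (g ν)) (𝓝 0)
            (𝓝 (‖((1 : ℝ) - 0) ^ (ν.1 + ν.2) - 1‖ₑ ^ 2 * lsq U (g ν))) :=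
          ENNReal.Tendsto.mul_const (Continuous.tendsto (by fun_prop) 0) (Or.inr (hfin ν hνM))
        simp only [sub_zero, one_pow, sub_self, enorm_zero, ne_eq, OfNat.ofNat_ne_zero,
          not_false_eq_true, zero_pow, zero_mul] at this
        exact this.mono_left nhdsWithin_le_nhds
      have := ENNReal.Tendsto.const_mul (a := 2) (t1.add h2) (Or.inr (by simp))
      simpa using this
    rw [ENNReal.tendsto_nhds_zero] at t2
    filter_upwards [t2 e (pos_iff_ne_zero.2 he)] with ε hε ⟨hε0, hε1⟩
    refine le_trans ?_ hε
    have hk := contDiff_scaledKernel (ε := ε) hη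
    have hkc := hasCompactSupport_scaledKernel hε0 hηc
    have hcs := contDiff_conv hk hkc hvl
    have hcg := contDiff_conv hk hkc hgl
    set s := (1 - ε) ^ (ν.1 + ν.2) with hs
    have hs1 : ‖s‖ₑ ≤ 1 := by
      rw [Real.enorm_eq_ofReal (by rw [hs]; exact pow_nonneg (by linarith) _), ← ENNReal.ofReal_one]
      exact ENNReal.ofReal_le_ofReal (pow_le_one₀ (by linarith) (by linarith))
    have hcongr : (fun x => multiDeriv ν (fun x => conv (scaledKernel η ε) (U.indicator v)
        (0 + (1 - ε) • x)) x - g ν x) =ᵐ[volume.restrict U]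
        fun x => s * (conv (scaledKernel η ε) (U.indicator (g ν)) ((1 - ε) • x)
          - U.indicator (g ν) x) + (s - 1) * g ν x := by
      refine (ae_restrict_mem hUo.measurableSet).mono fun x hx => ?_
      simp only
      rw [multiDeriv_comp_affine hcs, multiDeriv_conv hk hkc hvl]
      simp only [zero_add]
      rw [conv_multiDeriv_eq hε0 hε1 hη hηc hU hUo hηU (hw ν hνM) hx, indicator_of_mem hx]
      ring
    rw [lsq_congr hcongr]
    refine (lsq_add_le U ?_).trans ?_
    · refine AEStronglyMeasurable.const_mul ?_ _
      refine AEStronglyMeasurable.sub ?_ hgm.1.restrict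
      exact (hcg.continuous.comp (by fun_prop : Continuous fun x : Plane => (1 - ε) • x)).aestronglyMeasurable
    · rw [lsq_const_mul, lsq_const_mul]
      gcongr
      exact mul_le_of_le_one_left zero_le (pow_le_one₀ zero_le hs1)
  have hall := (Filter.eventually_all_finset (multiIndices M)).2 key
  have hev : ∀ᶠ ε in 𝓝[>] (0 : ℝ), ε < 1 :=
    (Iio_mem_nhds (by positivity) |> mem_nhdsWithin_of_mem_nhds)
  obtain ⟨ε, hε, hε1, hε0⟩ := (hall.and (hev.and self_mem_nhdsWithin)).exists
  refine ⟨fun x => conv (scaledKernel η ε) (U.indicator v) (0 + (1 - ε) • x), ?_, ?_⟩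
  · have hk := contDiff_scaledKernel (ε := ε) hη
    have hkc := hasCompactSupport_scaledKernel hε0 hηc
    exact (contDiff_conv hk hkc hvl).comp (by fun_prop)
  · intro ν hν
    refine hε ν ?_ ⟨hε0, hε1⟩
    simp only [multiIndices, Finset.mem_filter, Finset.mem_product, Finset.mem_range]
    omega

/-! ### Weak derivatives -/

theorem IsWeakDeriv.mono {Ω U : Set Plane} {ν : ℕ × ℕ} {v g : Plane → ℝ}
    (h : IsWeakDeriv Ω ν v g) (hΩ : IsOpen Ω) (hU : U ⊆ Ω) : IsWeakDeriv U ν v g where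
  locallyIntegrable := h.locallyIntegrable.mono_set hU
  locallyIntegrable_deriv := h.locallyIntegrable_deriv.mono_set hU
  integral_eq φ h1 h2 h3 := by
    have key : ∀ (u k : Plane → ℝ), tsupport k ⊆ U →
        ∫ x in U, u x * k x = ∫ x in Ω, u x * k x := by
      intro u k hk
      symm
      refine setIntegral_eq_of_subset_of_forall_sdiff_eq_zero hΩ.measurableSet hU
        fun x hx => ?_
      rw [image_eq_zero_of_notMem_tsupport fun h => hx.2 (hk h), mul_zero]
    rw [key v _ ((tsupport_multiDeriv_subset φ ν).trans h3), key g _ h3]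
    exact h.integral_eq φ h1 h2 (h3.trans hU)

theorem integrable_mul_of_locallyIntegrableOn {U : Set Plane} {u φ : Plane → ℝ}
    (hu : LocallyIntegrableOn u U) (hφ : Continuous φ)
    (hc : HasCompactSupport φ) (hs : tsupport φ ⊆ U) : IntegrableOn (fun x => u x * φ x) U := by
  have h1 : IntegrableOn u (tsupport φ) := hu.integrableOn_compact_subset hs hc
  have h2 : IntegrableOn (fun x => u x * φ x) (tsupport φ) :=
    h1.mul_continuousOn hφ.continuousOn hc
  have h3 : Integrable (fun x => u x * φ x) :=
    (integrableOn_iff_integrable_of_support_subset (by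
      intro x hx
      exact subset_tsupport φ (right_ne_zero_of_mul hx))).1 h2
  exact h3.integrableOn

theorem IsWeakDeriv.ae_eq {U : Set Plane} (hU : IsOpen U) {ν : ℕ × ℕ} {v g g' : Plane → ℝ}
    (h : IsWeakDeriv U ν v g) (h' : IsWeakDeriv U ν v g') : g =ᵐ[volume.restrict U] g' := by
  have := hU.ae_eq_zero_of_integral_contDiff_smul_eq_zero
    (h.locallyIntegrable_deriv.sub h'.locallyIntegrable_deriv) (μ := volume) ?_
  · rw [Filter.EventuallyEq, ae_restrict_iff' hU.measurableSet]
    filter_upwards [this] with x hx hxU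
    exact sub_eq_zero.1 (hx hxU)
  · intro φ h1 h2 h3
    have e := (h.integral_eq φ h1 h2 h3).symm.trans (h'.integral_eq φ h1 h2 h3)
    have e' := mul_left_cancel₀ (by positivity : ((-1 : ℝ) ^ (ν.1 + ν.2)) ≠ 0) e
    have i1 := integrable_mul_of_locallyIntegrableOn h.locallyIntegrable_deriv
      h1.continuous h2 h3
    have i2 := integrable_mul_of_locallyIntegrableOn h'.locallyIntegrable_deriv
      h1.continuous h2 h3
    rw [← setIntegral_eq_integral_of_forall_compl_eq_zero (s := U)]
    · calc _ = ∫ x in U, (g x * φ x - g' x * φ x) := by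
            congr 1; funext x; simp; ring
        _ = 0 := by rw [integral_sub i1 i2, e', sub_self]
    · intro x hx
      rw [image_eq_zero_of_notMem_tsupport fun h => hx (h3 h), zero_smul]

theorem isWeakDeriv_zero {U : Set Plane} {v : Plane → ℝ} (h : LocallyIntegrableOn v U) :
    IsWeakDeriv U (0, 0) v v :=
  ⟨h, h, fun φ _ _ _ => by simp [multiDeriv]⟩

/-- The family `g` consists of square integrable weak derivatives of `v` up to order `M`. -/
structure IsSobolevJet (U : Set Plane) (M : ℕ) (v : Plane → ℝ) (g : ℕ × ℕ → Plane → ℝ) :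
    Prop where
  weak : ∀ ν, ν.1 + ν.2 ≤ M → IsWeakDeriv U ν v (g ν)
  fin : ∀ ν, ν.1 + ν.2 ≤ M → lsq U (g ν) ≠ ⊤

theorem IsSobolevJet.mono_order {U : Set Plane} {M L : ℕ} {v : Plane → ℝ}
    {g : ℕ × ℕ → Plane → ℝ} (h : IsSobolevJet U M v g) (hL : L ≤ M) : IsSobolevJet U L v g :=
  ⟨fun ν hν => h.weak ν (hν.trans hL), fun ν hν => h.fin ν (hν.trans hL)⟩

theorem IsSobolevJet.ae_eq {U : Set Plane} {M : ℕ} {v : Plane → ℝ} {g : ℕ × ℕ → Plane → ℝ}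
    (h : IsSobolevJet U M v g) (hU : IsOpen U) : g (0, 0) =ᵐ[volume.restrict U] v :=
  (h.weak (0, 0) (Nat.zero_le _)).ae_eq hU
    (isWeakDeriv_zero (h.weak (0, 0) (Nat.zero_le _)).locallyIntegrable)

theorem IsSobolevJet.exists_approx {U : Set Plane} {M : ℕ} {v : Plane → ℝ}
    {g : ℕ × ℕ → Plane → ℝ} (h : IsSobolevJet U M v g) (hU : Convex ℝ U) (hUo : IsOpen U)
    (hUb : Bornology.IsBounded U) (hUn : U.Nonempty) {e : ℝ≥0∞} (he : e ≠ 0) :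
    ∃ f : Plane → ℝ, ContDiff ℝ ∞ f ∧
      ∀ ν, ν.1 + ν.2 ≤ M → lsq U (fun x => multiDeriv ν f x - g ν x) ≤ e :=
  exists_smooth_approx hU hUo hUb hUn M h.weak h.fin he
    (by rw [← lsq_congr (h.ae_eq hUo)]; exact h.fin _ (Nat.zero_le _))

theorem fsq_le_of_sub {U : Set Plane} {j : ℕ} {F g : ℕ × ℕ → Plane → ℝ} {e : ℝ≥0∞}
    (hg : ∀ ν, ν.1 + ν.2 = j → AEStronglyMeasurable (g ν) (volume.restrict U))
    (h : ∀ ν, ν.1 + ν.2 = j → lsq U (fun x => F ν x - g ν x) ≤ e) :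
    fsq U j F ≤ 2 * (fsq U j g + (j + 1) * e) := by
  calc fsq U j F ≤ ∑ ν ∈ Finset.HasAntidiagonal.antidiagonal j, 2 * (lsq U (g ν) + e) := by
        refine Finset.sum_le_sum fun ν hν => ?_
        rw [Finset.HasAntidiagonal.mem_antidiagonal] at hν
        have : lsq U (F ν) = lsq U (fun x => g ν x + (F ν x - g ν x)) := by simp
        rw [this]
        refine (lsq_add_le U (hg ν hν)).trans ?_
        gcongr
        exact h ν hν
    _ = _ := by
        rw [← Finset.mul_sum, Finset.sum_add_distrib, Finset.sum_const,
          Finset.Nat.card_antidiagonal, nsmul_eq_mul]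
        simp [fsq]

/-- Apply `sup_le_of_smooth` to `F n - f`, where `F n` are smooth approximants of `v`. A subsequence
converges almost everywhere and the right-hand sides converge; splitting the squares doubles `6` to
`12`. -/
theorem IsSobolevJet.ae_sub_le {U : Set Plane} {v : Plane → ℝ}
    {g : ℕ × ℕ → Plane → ℝ} (h : IsSobolevJet U 2 v g) (hU : Convex ℝ U) (hUo : IsOpen U)
    (hUb : Bornology.IsBounded U) (hUn : U.Nonempty) {d : ℝ≥0}
    (hd : ∀ x ∈ U, ∀ y ∈ U, dist x y ≤ d) {f : Plane → ℝ} (hf : ContDiff ℝ ∞ f) :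
    ∀ᵐ x ∂volume.restrict U, volume U * ‖v x - f x‖ₑ ^ 2 ≤
      12 * (fsq U 0 (fun ν x => g ν x - multiDeriv ν f x)
        + (d : ℝ≥0∞) ^ 2 * fsq U 1 (fun ν x => g ν x - multiDeriv ν f x)
        + (d : ℝ≥0∞) ^ 4 * fsq U 2 (fun ν x => g ν x - multiDeriv ν f x)) := by
  have hen : ∀ n : ℕ, ((n : ℝ≥0∞) + 1)⁻¹ ≠ 0 := fun n => by simp
  choose F hFs hF using fun n : ℕ => h.exists_approx hU hUo hUb hUn (hen n)
  have hvt : volume U ≠ ⊤ := hUb.measure_lt_top.ne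
  set e : ℕ → ℝ≥0∞ := fun n => ((n : ℝ≥0∞) + 1)⁻¹ with he
  have he0 : Tendsto e atTop (𝓝 0) := by
    have := (tendsto_add_atTop_iff_nat 1).2 ENNReal.tendsto_inv_nat_nhds_zero
    simpa [he] using this
  have hm0 : AEStronglyMeasurable v (volume.restrict U) :=
    (h.weak (0, 0) (Nat.zero_le _)).locallyIntegrable.aestronglyMeasurable
  have hin : TendstoInMeasure (volume.restrict U) F atTop v := by
    refine tendstoInMeasure_of_tendsto_eLpNorm (p := 2) (by norm_num)
      (fun n => (hFs n).continuous.aestronglyMeasurable) hm0 ?_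
    have hsq : Tendsto (fun n => eLpNorm (F n - v) 2 (volume.restrict U) ^ 2) atTop (𝓝 0) := by
      refine tendsto_of_tendsto_of_tendsto_of_le_of_le tendsto_const_nhds he0
        (fun _ => zero_le) fun n => ?_
      have := hF n (0, 0) (Nat.zero_le _)
      rw [lsq_eq_eLpNorm_sq] at this
      refine le_trans (le_of_eq ?_) this
      congr 1
      refine eLpNorm_congr_ae ?_
      filter_upwards [h.ae_eq hUo] with x hx
      simp [multiDeriv, hx]
    have := ((ENNReal.continuous_rpow_const (y := 1 / 2)).tendsto 0).comp hsq
    simp only [one_div, ENNReal.zero_rpow_of_pos (by norm_num : (0 : ℝ) < 2⁻¹)] at this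
    refine this.congr fun n => ?_
    simp only [Function.comp]
    rw [← ENNReal.rpow_natCast, ← ENNReal.rpow_mul]
    norm_num
  obtain ⟨ns, hns, hae⟩ := hin.exists_seq_tendsto_ae
  filter_upwards [hae, ae_restrict_mem hUo.measurableSet] with x hx hxU
  set G : ℕ × ℕ → Plane → ℝ := fun ν x => g ν x - multiDeriv ν f x with hG
  have hb : ∀ n, volume U * ‖F n x - f x‖ₑ ^ 2 ≤ 6 * (2 * (fsq U 0 G + ((0 : ℕ) + 1) * e n)
      + (d : ℝ≥0∞) ^ 2 * (2 * (fsq U 1 G + ((1 : ℕ) + 1) * e n))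
      + (d : ℝ≥0∞) ^ 4 * (2 * (fsq U 2 G + ((2 : ℕ) + 1) * e n))) := by
    intro n
    refine (sup_le_of_smooth hU hUo hd ((hFs n).sub hf) hxU).trans ?_
    have : ∀ j ≤ 2, fsq U j (fun ν => multiDeriv ν fun x => F n x - f x)
        ≤ 2 * (fsq U j G + (j + 1) * e n) := by
      intro j hj
      refine fsq_le_of_sub (fun ν hν => ?_) fun ν hν => ?_
      · exact (h.weak ν (by omega)).aestronglyMeasurable_deriv.sub
          (hf.multiDeriv ν).continuous.aestronglyMeasurable
      · refine le_trans (le_of_eq ?_) (hF n ν (by omega))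
        rw [multiDeriv_sub (hFs n) hf]
        congr 1; funext x; simp [hG]
    gcongr
    · exact this 0 (by norm_num)
    · exact this 1 (by norm_num)
    · exact this 2 (by norm_num)
  have hlim1 : Tendsto (fun n => volume U * ‖F (ns n) x - f x‖ₑ ^ 2) atTop
      (𝓝 (volume U * ‖v x - f x‖ₑ ^ 2)) := by
    refine ENNReal.Tendsto.const_mul ?_ (Or.inr hvt)
    exact (ENNReal.continuous_pow 2).continuousAt.tendsto.comp
      ((hx.sub_const (f x)).enorm)
  have hlim2 : Tendsto (fun n => 6 * (2 * (fsq U 0 G + ((0 : ℕ) + 1) * e (ns n))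
      + (d : ℝ≥0∞) ^ 2 * (2 * (fsq U 1 G + ((1 : ℕ) + 1) * e (ns n)))
      + (d : ℝ≥0∞) ^ 4 * (2 * (fsq U 2 G + ((2 : ℕ) + 1) * e (ns n))))) atTop
      (𝓝 (6 * (2 * (fsq U 0 G + ((0 : ℕ) + 1) * 0)
      + (d : ℝ≥0∞) ^ 2 * (2 * (fsq U 1 G + ((1 : ℕ) + 1) * 0))
      + (d : ℝ≥0∞) ^ 4 * (2 * (fsq U 2 G + ((2 : ℕ) + 1) * 0))))) := by
    have hcomp := he0.comp hns.tendsto_atTop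
    have hj : ∀ (j : ℕ) (a : ℝ≥0), Tendsto (fun n => (a : ℝ≥0∞) * (2 * (fsq U j G + ((j : ℕ) + 1) * e (ns n))))
        atTop (𝓝 (a * (2 * (fsq U j G + ((j : ℕ) + 1) * 0)))) := fun j a =>
      ENNReal.Tendsto.const_mul (ENNReal.Tendsto.const_mul (tendsto_const_nhds.add
        (ENNReal.Tendsto.const_mul hcomp (Or.inr (by norm_cast; simp)))) (Or.inr (by simp)))
          (Or.inr (by simp))
    refine ENNReal.Tendsto.const_mul ?_ (Or.inr (by simp))
    have h0 := hj 0 1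
    have h1 := hj 1 (d ^ 2)
    have h2 := hj 2 (d ^ 4)
    push_cast at h0 h1 h2 ⊢
    simp only [one_mul] at h0
    exact (h0.add h1).add h2
  refine (le_of_tendsto_of_tendsto' hlim1 hlim2 fun n => hb (ns n)).trans (le_of_eq ?_)
  ring

/-- Closeness of the derivatives up to order two forces closeness almost everywhere, by
`IsSobolevJet.ae_sub_le`. The approximation then also controls nodal values, including nodes on the
boundary. -/
theorem IsSobolevJet.exists_approx_unif {U : Set Plane} {M : ℕ} {v : Plane → ℝ}
    {g : ℕ × ℕ → Plane → ℝ} (h : IsSobolevJet U M v g) (hM : 2 ≤ M) (hU : Convex ℝ U)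
    (hUo : IsOpen U) (hUb : Bornology.IsBounded U) (hUn : U.Nonempty) {e : ℝ≥0∞} (he : e ≠ 0) :
    ∃ f : Plane → ℝ, ContDiff ℝ ∞ f ∧
      (∀ ν, ν.1 + ν.2 ≤ M → lsq U (fun x => multiDeriv ν f x - g ν x) ≤ e) ∧
      ∀ᵐ x ∂volume.restrict U, ‖v x - f x‖ₑ ^ 2 ≤ e := by
  have hv0 : volume U ≠ 0 := (hUo.measure_pos _ hUn).ne'
  have hvt : volume U ≠ ⊤ := hUb.measure_lt_top.ne
  obtain ⟨D, hD⟩ := hUb.exists_norm_le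
  set d : ℝ≥0 := 2 * D.toNNReal with hd_def
  have hd : ∀ x ∈ U, ∀ y ∈ U, dist x y ≤ d := by
    intro x hx y hy
    rw [dist_eq_norm]
    refine (norm_sub_le _ _).trans ?_
    have h1 := (hD x hx).trans (Real.le_coe_toNNReal D)
    have h2 := (hD y hy).trans (Real.le_coe_toNNReal D)
    rw [hd_def, NNReal.coe_mul, NNReal.coe_ofNat]
    linarith
  set K : ℝ≥0∞ := 12 * (1 + (d : ℝ≥0∞) ^ 2 * 2 + (d : ℝ≥0∞) ^ 4 * 3) with hK
  have hKt : K ≠ ⊤ := by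
    have : K = ((12 * (1 + d ^ 2 * 2 + d ^ 4 * 3) : ℝ≥0) : ℝ≥0∞) := by rw [hK]; push_cast; rfl
    rw [this]; exact ENNReal.coe_ne_top
  have hK0 : K ≠ 0 := by simp [hK]
  -- Chosen so that `K * e' ≤ volume U * e`, where `K` collects the constants of `ae_sub_le`
  -- together with the `j + 1` multi-indices of order `j`.
  set e' := min e (volume U * e / K) with he'
  have he'0 : e' ≠ 0 := by
    rw [he']
    refine (lt_min (pos_iff_ne_zero.2 he) (ENNReal.div_pos (mul_ne_zero hv0 he) hKt)).ne'
  obtain ⟨f, hf, hfe⟩ := h.exists_approx hU hUo hUb hUn he'0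
  refine ⟨f, hf, fun ν hν => (hfe ν hν).trans (min_le_left _ _), ?_⟩
  filter_upwards [(h.mono_order hM).ae_sub_le hU hUo hUb hUn hd hf] with x hx
  have hj : ∀ j ≤ 2, fsq U j (fun ν x => g ν x - multiDeriv ν f x) ≤ (j + 1) * e' := by
    intro j hj
    refine (Finset.sum_le_card_nsmul _ _ e' fun ν hν => ?_).trans (by simp)
    rw [Finset.HasAntidiagonal.mem_antidiagonal] at hν
    rw [lsq_sub_comm]
    exact hfe ν (by omega)
  have hx2 : volume U * ‖v x - f x‖ₑ ^ 2 ≤ volume U * e := by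
    calc _ ≤ _ := hx
      _ ≤ 12 * (((0 : ℕ) + 1) * e' + (d : ℝ≥0∞) ^ 2 * (((1 : ℕ) + 1) * e')
          + (d : ℝ≥0∞) ^ 4 * (((2 : ℕ) + 1) * e')) := by
          gcongr
          · exact hj 0 (by norm_num)
          · exact hj 1 (by norm_num)
          · exact hj 2 (by norm_num)
      _ = K * e' := by rw [hK]; push_cast; ring
      _ ≤ K * (volume U * e / K) := by gcongr; exact min_le_right _ _
      _ = _ := ENNReal.mul_div_cancel hK0 hKt
  rwa [ENNReal.mul_le_mul_iff_right hv0 hvt] at hx2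

/-! ### Interpolation error on a convex set -/

theorem enorm_sq_le_of_ae {U : Set Plane} (hUo : IsOpen U) {w : Plane → ℝ}
    (hw : ContinuousOn w (closure U)) {B : ℝ≥0∞}
    (h : ∀ᵐ x ∂volume.restrict U, ‖w x‖ₑ ^ 2 ≤ B) : ∀ x ∈ closure U, ‖w x‖ₑ ^ 2 ≤ B := by
  have hU : ∀ x ∈ U, ‖w x‖ₑ ^ 2 ≤ B := by
    intro x hx
    by_contra! hlt
    have hc : ContinuousAt (fun y => ‖w y‖ₑ ^ 2) x :=
      ((ENNReal.continuous_pow 2).continuousAt).comp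
        (((hw.mono subset_closure).continuousAt (hUo.mem_nhds hx)).enorm)
    have hn : {y | B < ‖w y‖ₑ ^ 2} ∩ U ∈ 𝓝 x :=
      Filter.inter_mem (hc.eventually (lt_mem_nhds hlt)) (hUo.mem_nhds hx)
    have hpos := Measure.measure_pos_of_mem_nhds volume hn
    rw [ae_restrict_iff' hUo.measurableSet] at h
    refine hpos.ne' (measure_mono_null (fun y hy => ?_) h)
    simp only [mem_compl_iff, mem_ofPred_eq, not_forall]
    exact ⟨hy.2, not_le.2 hy.1⟩
  intro x hx
  have hc : ContinuousWithinAt (fun y => ‖w y‖ₑ ^ 2) U x :=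
    ((ENNReal.continuous_pow 2).continuousAt).comp_continuousWithinAt
      (((hw x hx).mono subset_closure).enorm)
  have : (𝓝[U] x).NeBot := mem_closure_iff_nhdsWithin_neBot.1 hx
  exact le_of_tendsto hc (eventually_nhdsWithin_of_forall hU)

/-- `S` bounds a polynomial of degree at most `k` on `U`, and `d` times its first derivatives, in
terms of its values on `X` (all quantities squared). -/
def IsStableNodes (U X : Set Plane) (k : ℕ) (d S : ℝ≥0) : Prop :=
  ∀ R : MvPolynomial (Fin 2) ℝ, R.totalDegree ≤ k → ∀ B : ℝ≥0∞, B ≠ ⊤ →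
    (∀ x ∈ X, ‖polyFun R x‖ₑ ^ 2 ≤ B) → ∀ x ∈ U, ‖polyFun R x‖ₑ ^ 2 ≤ S * B ∧
      ∀ i, (d : ℝ≥0∞) ^ 2 * ‖partialDeriv i (polyFun R) x‖ₑ ^ 2 ≤ S * B

theorem le_of_forall_le_add_const_mul {a b K : ℝ≥0∞} (hK : K ≠ ⊤)
    (h : ∀ e : ℝ≥0∞, e ≠ 0 → a ≤ b + K * e) : a ≤ b := by
  have ht : Tendsto (fun e : ℝ≥0∞ => b + K * e) (𝓝[>] 0) (𝓝 (b + K * 0)) :=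
    tendsto_const_nhds.add (ENNReal.Tendsto.const_mul (tendsto_id.mono_left nhdsWithin_le_nhds)
      (Or.inr hK))
  rw [mul_zero, add_zero] at ht
  have : (𝓝[>] (0 : ℝ≥0∞)).NeBot := by
    exact nhdsGT_neBot_of_exists_gt ⟨1, zero_lt_one⟩
  exact ge_of_tendsto ht (eventually_nhdsWithin_of_forall fun e he => h e (ne_of_gt he))

theorem lsq_add_three_le (U : Set Plane) {f g h : Plane → ℝ}
    (hf : AEStronglyMeasurable f (volume.restrict U))
    (hg : AEStronglyMeasurable g (volume.restrict U)) :
    lsq U (fun x => f x + g x + h x) ≤ 3 * (lsq U f + lsq U g + lsq U h) := by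
  unfold lsq
  refine (lintegral_mono fun x => enorm_add_three_sq_le _ _ _).trans_eq ?_
  rw [lintegral_const_mul' _ _ (by simp), lintegral_add_left'
    (by exact (hf.enorm.pow_const 2).add (hg.enorm.pow_const 2)),
    lintegral_add_left' (by exact hf.enorm.pow_const 2)]

/-- The error splits as `(v - f) + (f - R) + (R - P)`, with `f` a smooth approximant of `v` and `R`
its Bramble–Hilbert polynomial. The last term is a polynomial of degree at most `k`, because `n - 1
≤ k`, so node stability bounds it by its values on `X`; there `P = vc`, and those values are
controlled by the supremum bounds for `vc - f` and `f - R`. Finally the accuracy `e` of `f` tends to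
zero. -/
theorem interpolation_error (n : ℕ) (hn : 2 ≤ n) : ∃ C : ℝ≥0, ∀ (U : Set Plane), Convex ℝ U →
    IsOpen U → Bornology.IsBounded U → U.Nonempty → ∀ d : ℝ≥0,
    (∀ x ∈ U, ∀ y ∈ U, dist x y ≤ d) → ∀ (X : Set Plane) (S : ℝ≥0) (k : ℕ), X ⊆ closure U →
    n - 1 ≤ k → IsStableNodes U X k d S → ∀ (v vc : Plane → ℝ) (g : ℕ × ℕ → Plane → ℝ),
    IsSobolevJet U n v g → ContinuousOn vc (closure U) → vc =ᵐ[volume.restrict U] v →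
    ∀ P : MvPolynomial (Fin 2) ℝ, P.totalDegree ≤ k → (∀ x ∈ X, polyFun P x = vc x) →
    lsq U (fun x => g (0, 0) x - polyFun P x) ≤ C * (1 + S) * (d : ℝ≥0∞) ^ (2 * n) * fsq U n g ∧
    (d : ℝ≥0∞) ^ 2 * lsq U (fun x => g (1, 0) x - partialDeriv 0 (polyFun P) x)
      ≤ C * (1 + S) * (d : ℝ≥0∞) ^ (2 * n) * fsq U n g ∧
    (d : ℝ≥0∞) ^ 2 * lsq U (fun x => g (0, 1) x - partialDeriv 1 (polyFun P) x)
      ≤ C * (1 + S) * (d : ℝ≥0∞) ^ (2 * n) * fsq U n g := by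
  obtain ⟨C, hC⟩ := bramble_hilbert_smooth n
  -- `6 = 3 · 2` comes from the term `f - R`, and `216 = 3 · 2 · 18 · 2` from `R - P`, where `18 = 6
  -- · 3` is the supremum bound applied to the orders `0, 1, 2`.
  refine ⟨6 * C + 216 * C, fun U hU hUo hUb hUn d hd X S k hX hnk hS v vc g hj hvc hvv P hP hPX => ?_⟩
  have hv0 : volume U ≠ 0 := (hUo.measure_pos _ hUn).ne'
  have hvt : volume U ≠ ⊤ := hUb.measure_lt_top.ne
  have hft : fsq U n g ≠ ⊤ := by
    refine ENNReal.sum_ne_top.2 fun ν hν => hj.fin ν ?_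
    rw [Finset.HasAntidiagonal.mem_antidiagonal] at hν
    omega
  -- the approximation argument
  have key : ∀ e : ℝ≥0∞, e ≠ 0 → e ≠ ⊤ → ∃ R : MvPolynomial (Fin 2) ℝ, ∃ f : Plane → ℝ,
      ContDiff ℝ ∞ f ∧
      (∀ ν, ν.1 + ν.2 ≤ n → lsq U (fun x => g ν x - multiDeriv ν f x) ≤ e) ∧
      (∀ j ≤ n, fsq U j (fun ν => multiDeriv ν (fun x => f x - polyFun R x))
        ≤ C * (d : ℝ≥0∞) ^ (2 * (n - j)) * (2 * (fsq U n g + (n + 1) * e))) ∧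
      (∀ x ∈ U, volume U * ‖polyFun (R - P) x‖ₑ ^ 2 ≤ S * (2 * (volume U * e
          + 18 * C * (d : ℝ≥0∞) ^ (2 * n) * (2 * (fsq U n g + (n + 1) * e))))) ∧
      (∀ x ∈ U, ∀ i, volume U * ((d : ℝ≥0∞) ^ 2 * ‖partialDeriv i (polyFun (R - P)) x‖ₑ ^ 2) ≤
        S * (2 * (volume U * e
          + 18 * C * (d : ℝ≥0∞) ^ (2 * n) * (2 * (fsq U n g + (n + 1) * e))))) := by
    intro e he het
    obtain ⟨f, hf, hfe, hfu⟩ := hj.exists_approx_unif hn hU hUo hUb hUn he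
    obtain ⟨R, hRd, hR⟩ := hC U hU hUo hUb hUn d hd f hf
    have hF : fsq U n (fun ν => multiDeriv ν f) ≤ 2 * (fsq U n g + (n + 1) * e) :=
      fsq_le_of_sub (fun ν hν => (hj.weak ν hν.le).aestronglyMeasurable_deriv)
        (fun ν hν => hfe ν hν.le)
    have hR' : ∀ j ≤ n, fsq U j (fun ν => multiDeriv ν (fun x => f x - polyFun R x))
        ≤ C * (d : ℝ≥0∞) ^ (2 * (n - j)) * (2 * (fsq U n g + (n + 1) * e)) := fun j hj =>
      (hR j hj).trans (by gcongr)
    set F := 2 * (fsq U n g + (n + 1) * e) with hF_def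
    have hFt : F ≠ ⊤ := by
      rw [hF_def]
      exact ENNReal.mul_ne_top (by simp) (ENNReal.add_ne_top.2 ⟨hft,
        ENNReal.mul_ne_top (by norm_cast; simp) het⟩)
    have hs := hf.sub (contDiff_polyFun R)
    have hsup : ∀ x ∈ U, volume U * ‖f x - polyFun R x‖ₑ ^ 2
        ≤ 18 * C * (d : ℝ≥0∞) ^ (2 * n) * F := by
      intro x hx
      refine (sup_le_of_smooth hU hUo hd hs hx).trans ?_
      calc _ ≤ 6 * (C * (d : ℝ≥0∞) ^ (2 * (n - 0)) * F
            + (d : ℝ≥0∞) ^ 2 * (C * (d : ℝ≥0∞) ^ (2 * (n - 1)) * F)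
            + (d : ℝ≥0∞) ^ 4 * (C * (d : ℝ≥0∞) ^ (2 * (n - 2)) * F)) := by
            gcongr
            · exact hR' 0 (by omega)
            · exact hR' 1 (by omega)
            · exact hR' 2 hn
        _ = _ := by
            have e1 : (d : ℝ≥0∞) ^ (2 * n) = (d : ℝ≥0∞) ^ 2 * (d : ℝ≥0∞) ^ (2 * (n - 1)) := by
              rw [← pow_add]; congr 1; omega
            have e2 : (d : ℝ≥0∞) ^ (2 * n) = (d : ℝ≥0∞) ^ 4 * (d : ℝ≥0∞) ^ (2 * (n - 2)) := by
              rw [← pow_add]; congr 1; omega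
            calc _ = 6 * C * (((d : ℝ≥0∞) ^ (2 * n)) + (d : ℝ≥0∞) ^ 2 * (d : ℝ≥0∞) ^ (2 * (n - 1))
                  + (d : ℝ≥0∞) ^ 4 * (d : ℝ≥0∞) ^ (2 * (n - 2))) * F := by
                  rw [Nat.sub_zero]; ring
              _ = _ := by rw [← e1, ← e2]; ring
    set B : ℝ≥0∞ := 2 * (e + 18 * C * (d : ℝ≥0∞) ^ (2 * n) * F / volume U) with hB
    have hBt : B ≠ ⊤ := by
      refine ENNReal.mul_ne_top (by simp) (ENNReal.add_ne_top.2 ⟨het, ?_⟩)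
      refine ENNReal.div_ne_top (ENNReal.mul_ne_top ?_ hFt) hv0
      exact ENNReal.mul_ne_top (ENNReal.mul_ne_top (by simp) (by simp)) (by simp)
    have hvB : volume U * (S * B) = S * (2 * (volume U * e
        + 18 * C * (d : ℝ≥0∞) ^ (2 * n) * F)) := by
      rw [hB]
      calc _ = S * (2 * (volume U * e + volume U * (18 * C * (d : ℝ≥0∞) ^ (2 * n) * F / volume U))) := by
            ring
        _ = _ := by rw [ENNReal.mul_div_cancel hv0 hvt]
    have hnode : ∀ x ∈ X, ‖polyFun (R - P) x‖ₑ ^ 2 ≤ B := by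
      intro x hx
      have a1 : ‖vc x - f x‖ₑ ^ 2 ≤ e := by
        refine enorm_sq_le_of_ae hUo (w := fun x => vc x - f x)
          (hvc.sub hf.continuous.continuousOn) ?_ x (hX hx)
        filter_upwards [hfu, hvv] with y hy1 hy2
        rwa [hy2]
      have a2 : ‖f x - polyFun R x‖ₑ ^ 2 ≤ 18 * C * (d : ℝ≥0∞) ^ (2 * n) * F / volume U := by
        refine enorm_sq_le_of_ae hUo (w := fun x => f x - polyFun R x)
          hs.continuous.continuousOn ?_ x (hX hx)
        filter_upwards [ae_restrict_mem hUo.measurableSet] with y hy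
        rw [ENNReal.le_div_iff_mul_le (Or.inl hv0) (Or.inl hvt), mul_comm]
        exact hsup y hy
      have : polyFun (R - P) x = -((vc x - f x) + (f x - polyFun R x)) := by
        rw [polyFun_sub, hPX x hx]; ring
      rw [this, enorm_neg]
      refine (enorm_add_sq_le _ _).trans ?_
      rw [hB]
      gcongr
    have hst := hS (R - P) ((MvPolynomial.totalDegree_sub _ _).trans (max_le (hRd.trans hnk) hP))
      B hBt hnode
    refine ⟨R, f, hf, fun ν hν => by rw [lsq_sub_comm]; exact hfe ν hν, hR', fun x hx => ?_,
      fun x hx i => ?_⟩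
    · rw [← hvB]
      gcongr
      exact (hst x hx).1
    · rw [← hvB]
      exact mul_le_mul_right ((hst x hx).2 i) _
  -- The total coefficient of `e`; only its finiteness matters. The summand `1` makes it nonzero,
  -- which settles the case `e = ⊤`.
  set K : ℝ≥0∞ := 3 * ((d : ℝ≥0∞) ^ 2 + 1 + C * (d : ℝ≥0∞) ^ (2 * n) * 2 * (n + 1)
    + S * (2 * (volume U + 18 * C * (d : ℝ≥0∞) ^ (2 * n) * (2 * (n + 1))))) with hK
  have hnt : ((n : ℝ≥0∞) + 1) ≠ ⊤ := by norm_cast; simp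
  have hCd : ∀ c : ℝ≥0∞, c ≠ ⊤ → c * (d : ℝ≥0∞) ^ (2 * n) ≠ ⊤ := fun c hc =>
    ENNReal.mul_ne_top hc (by simp)
  have hKt : K ≠ ⊤ := by
    rw [hK]
    refine ENNReal.mul_ne_top (by simp) (ENNReal.add_ne_top.2 ⟨ENNReal.add_ne_top.2
      ⟨by simp, ?_⟩, ENNReal.mul_ne_top (by simp) (ENNReal.mul_ne_top (by simp)
        (ENNReal.add_ne_top.2 ⟨hvt, ?_⟩))⟩)
    · exact ENNReal.mul_ne_top (ENNReal.mul_ne_top (hCd _ (by simp)) (by simp)) hnt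
    · exact ENNReal.mul_ne_top (hCd _ (ENNReal.mul_ne_top (by simp) (by simp)))
        (ENNReal.mul_ne_top (by simp) hnt)
  have hCC : ((6 * C + 216 * C : ℝ≥0) : ℝ≥0∞) = 6 * C + 216 * C := by push_cast; rfl
  have final : ∀ (c : ℝ≥0∞) (e a b r : ℝ≥0∞), c ≤ (d : ℝ≥0∞) ^ 2 + 1 → a ≤ c * e →
      b ≤ C * (d : ℝ≥0∞) ^ (2 * n) * (2 * (fsq U n g + (n + 1) * e)) →
      r ≤ S * (2 * (volume U * e
          + 18 * C * (d : ℝ≥0∞) ^ (2 * n) * (2 * (fsq U n g + (n + 1) * e)))) →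
      3 * (a + b + r) ≤ (6 * C + 216 * C : ℝ≥0) * (1 + S) * (d : ℝ≥0∞) ^ (2 * n) * fsq U n g
        + K * e := by
    intro c e a b r hc ha hb hr
    calc 3 * (a + b + r) ≤ 3 * (((d : ℝ≥0∞) ^ 2 + 1) * e
          + C * (d : ℝ≥0∞) ^ (2 * n) * (2 * (fsq U n g + (n + 1) * e))
          + S * (2 * (volume U * e
          + 18 * C * (d : ℝ≥0∞) ^ (2 * n) * (2 * (fsq U n g + (n + 1) * e))))) := by
          have ha' : a ≤ ((d : ℝ≥0∞) ^ 2 + 1) * e := ha.trans (by gcongr)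
          gcongr
      _ = (6 * C + 108 * 2 * C * S) * (d : ℝ≥0∞) ^ (2 * n) * fsq U n g + K * e := by
          rw [hK]; ring
      _ ≤ (6 * C + 216 * C) * (1 + S) * (d : ℝ≥0∞) ^ (2 * n) * fsq U n g + K * e := by
          gcongr
          calc (6 * C + 108 * 2 * C * S : ℝ≥0∞) ≤ 6 * C + 216 * C * S + (6 * C * S + 216 * C) := by
                refine le_trans (le_of_eq ?_) le_self_add; ring
            _ = _ := by ring
      _ = _ := by rw [hCC]
  have hconst : ∀ {w : Plane → ℝ} {c A : ℝ≥0∞}, c ≠ ⊤ →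
      (∀ x ∈ U, volume U * (c * ‖w x‖ₑ ^ 2) ≤ A) → c * lsq U w ≤ A := by
    intro w c A hc h
    have : volume U * (c * lsq U w) ≤ volume U * A := by
      unfold lsq
      rw [← lintegral_const_mul' _ _ hc, ← lintegral_const_mul' _ _ hvt]
      calc _ ≤ ∫⁻ x in U, A := setLIntegral_mono' hUo.measurableSet h
        _ = _ := by simp [mul_comm]
    rwa [ENNReal.mul_le_mul_iff_right hv0 hvt] at this
  have hmg : ∀ ν, ν.1 + ν.2 ≤ n → ∀ {f}, ContDiff ℝ ∞ f →
      AEStronglyMeasurable (fun x => g ν x - multiDeriv ν f x) (volume.restrict U) :=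
    fun ν hν f hf => (hj.weak ν hν).aestronglyMeasurable_deriv.sub
      (hf.multiDeriv ν).continuous.aestronglyMeasurable
  have deriv_part : ∀ ν : ℕ × ℕ, ν.1 + ν.2 = 1 → ∀ i : Fin 2,
      (∀ f, multiDeriv ν f = partialDeriv i f) →
      (d : ℝ≥0∞) ^ 2 * lsq U (fun x => g ν x - partialDeriv i (polyFun P) x)
      ≤ (6 * C + 216 * C : ℝ≥0) * (1 + S) * (d : ℝ≥0∞) ^ (2 * n) * fsq U n g := by
    intro ν hν i hνi
    refine le_of_forall_le_add_const_mul hKt fun e he => ?_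
    rcases eq_or_ne e ⊤ with rfl | het
    · have : K ≠ 0 := by rw [hK]; simp
      rw [ENNReal.mul_top this]; simp
    obtain ⟨R, f, hf, h1, h2, h3, h4⟩ := key e he het
    have hs := hf.sub (contDiff_polyFun R)
    have hsplit : (fun x => g ν x - partialDeriv i (polyFun P) x)
        = fun x => (g ν x - multiDeriv ν f x) + multiDeriv ν (fun x => f x - polyFun R x) x
          + partialDeriv i (polyFun (R - P)) x := by
      funext x
      have e1 : partialDeriv i (polyFun (R - P)) x
          = partialDeriv i (polyFun R) x - partialDeriv i (polyFun P) x := by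
        have := partialDeriv_sub ((contDiff_polyFun R).differentiable (by simp))
          ((contDiff_polyFun P).differentiable (by simp)) i
        rw [← congrFun this x]
        congr 1; funext y; simp
      rw [multiDeriv_sub hf (contDiff_polyFun R), e1, hνi (polyFun R)]
      ring
    rw [hsplit]
    calc _ ≤ (d : ℝ≥0∞) ^ 2 * (3 * (lsq U (fun x => g ν x - multiDeriv ν f x)
          + lsq U (multiDeriv ν (fun x => f x - polyFun R x))
          + lsq U (partialDeriv i (polyFun (R - P))))) := by
          gcongr
          exact lsq_add_three_le U (hmg ν (by omega) hf)
            (hs.multiDeriv ν).continuous.aestronglyMeasurable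
      _ = 3 * ((d : ℝ≥0∞) ^ 2 * lsq U (fun x => g ν x - multiDeriv ν f x)
          + (d : ℝ≥0∞) ^ 2 * lsq U (multiDeriv ν (fun x => f x - polyFun R x))
          + (d : ℝ≥0∞) ^ 2 * lsq U (partialDeriv i (polyFun (R - P)))) := by ring
      _ ≤ _ := by
          refine final ((d : ℝ≥0∞) ^ 2) e _ _ _ le_self_add ?_ ?_ ?_
          · gcongr
            exact h1 ν (by omega)
          · have e1 : (d : ℝ≥0∞) ^ (2 * n) = (d : ℝ≥0∞) ^ 2 * (d : ℝ≥0∞) ^ (2 * (n - 1)) := by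
              rw [← pow_add]; congr 1; omega
            have := (lsq_le_fsq U (fun ν => multiDeriv ν (fun x => f x - polyFun R x)) ν)
            rw [hν] at this
            calc _ ≤ (d : ℝ≥0∞) ^ 2 * (C * (d : ℝ≥0∞) ^ (2 * (n - 1)) *
                  (2 * (fsq U n g + (n + 1) * e))) := by
                  gcongr
                  exact this.trans (h2 1 (by omega))
              _ = _ := by rw [e1]; ring
          · exact hconst (by simp) fun x hx => h4 x hx i
  refine ⟨?_, deriv_part (1, 0) rfl 0 (fun _ => rfl), deriv_part (0, 1) rfl 1 (fun _ => rfl)⟩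
  refine le_of_forall_le_add_const_mul hKt fun e he => ?_
  rcases eq_or_ne e ⊤ with rfl | het
  · have : K ≠ 0 := by rw [hK]; simp
    rw [ENNReal.mul_top this]; simp
  obtain ⟨R, f, hf, h1, h2, h3, h4⟩ := key e he het
  have hs := hf.sub (contDiff_polyFun R)
  have hsplit : (fun x => g (0, 0) x - polyFun P x)
      = fun x => (g (0, 0) x - multiDeriv (0, 0) f x) + (f x - polyFun R x)
        + polyFun (R - P) x := by
    funext x; simp [multiDeriv]
  rw [hsplit]
  refine (lsq_add_three_le U (hmg (0, 0) (Nat.zero_le _) hf)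
    hs.continuous.aestronglyMeasurable).trans ?_
  refine final 1 e _ _ _ le_add_self (by rw [one_mul]; exact h1 _ (Nat.zero_le _)) ?_ ?_
  · have := h2 0 (by omega)
    rw [fsq_zero] at this
    simpa [multiDeriv] using this
  · have := hconst (w := polyFun (R - P)) (c := 1) (by simp) (fun x hx => by
      rw [one_mul]; exact h3 x hx)
    rwa [one_mul] at this

/-! ### Essential limits -/

/-- The values of `v` on `U` have arbitrarily small essential oscillation near `x`. -/
def EssCauchyAt (U : Set Plane) (v : Plane → ℝ) (x : Plane) : Prop :=
  ∀ ε > 0, ∃ c : ℝ, ∃ δ > 0, ∀ᵐ y ∂volume.restrict U, dist y x < δ → |v y - c| ≤ ε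

theorem IsSobolevJet.essCauchyAt {U : Set Plane} {v : Plane → ℝ}
    {g : ℕ × ℕ → Plane → ℝ} (h : IsSobolevJet U 2 v g) (hU : Convex ℝ U)
    (hUo : IsOpen U) (hUb : Bornology.IsBounded U) (hUn : U.Nonempty) (x : Plane) :
    EssCauchyAt U v x := by
  intro ε hε
  obtain ⟨f, hf, -, hfe⟩ := h.exists_approx_unif le_rfl hU hUo hUb hUn
    (e := ENNReal.ofReal ((ε / 2) ^ 2)) (by simp; positivity)
  obtain ⟨δ, hδ, hfδ⟩ := Metric.continuous_iff.1 hf.continuous x (ε / 2) (by positivity)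
  refine ⟨f x, δ, hδ, ?_⟩
  filter_upwards [hfe] with y hy hyx
  have h1 : |v y - f y| ≤ ε / 2 := by
    rw [enorm_sq_eq_ofReal, ENNReal.ofReal_le_ofReal_iff (by positivity)] at hy
    exact abs_le_of_sq_le_sq hy (by positivity)
  have h2 := hfδ y hyx
  rw [Real.dist_eq] at h2
  calc |v y - f x| = |(v y - f y) + (f y - f x)| := by ring_nf
    _ ≤ _ := abs_add_le _ _
    _ ≤ ε := by linarith

/-- The representative takes at each point the essential limit of `v`. A neighbourhood of a point of
`closure U` meets `U` in positive measure, so essential bounds at nearby points can be compared at a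
common point; this gives existence of limits and continuity. Equality almost everywhere is local,
since near `x ∈ U` both functions are close to the limit at `x`. -/
theorem exists_continuousOn_of_essCauchyAt {U E : Set Plane} (hU : IsOpen U) (hUE : U ⊆ E)
    (hE : E ⊆ closure U) {v : Plane → ℝ} (h : ∀ x ∈ E, EssCauchyAt U v x) :
    ∃ w : Plane → ℝ, ContinuousOn w E ∧ w =ᵐ[volume.restrict U] v := by
  -- two essential bounds near points of `E` are compatible
  have common : ∀ {x y : Plane} {c c' r r' ε ε' : ℝ}, 0 < r' → y ∈ closure U → dist y x < r →
      (∀ᵐ z ∂volume.restrict U, dist z x < r → |v z - c| ≤ ε) →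
      (∀ᵐ z ∂volume.restrict U, dist z y < r' → |v z - c'| ≤ ε') → |c' - c| ≤ ε + ε' := by
    intro x y c c' r r' ε ε' hr' hy hyx h1 h2
    set ρ := min r' (r - dist y x) with hρ
    have hρ0 : 0 < ρ := lt_min hr' (by linarith)
    have hpos : volume (Metric.ball y ρ ∩ U) ≠ 0 := by
      obtain ⟨z, hz1, hz2⟩ := mem_closure_iff.1 hy (Metric.ball y ρ) Metric.isOpen_ball
        (Metric.mem_ball_self hρ0)
      exact ((Metric.isOpen_ball.inter hU).measure_pos volume ⟨z, hz1, hz2⟩).ne'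
    by_contra hcon
    apply hpos
    rw [ae_restrict_iff' hU.measurableSet] at h1 h2
    have h12 := h1.and h2
    refine measure_mono_null (fun z hz => ?_) h12
    simp only [mem_compl_iff, mem_ofPred_eq]
    rintro ⟨k1, k2⟩
    have hz1 : dist z y < ρ := hz.1
    have a1 := k1 hz.2 (by
      calc dist z x ≤ dist z y + dist y x := dist_triangle _ _ _
        _ < r := by linarith [hz1.trans_le (min_le_right r' (r - dist y x))])
    have a2 := k2 hz.2 (hz1.trans_le (min_le_left _ _))
    apply hcon
    calc |c' - c| = |(v z - c) - (v z - c')| := by ring_nf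
      _ ≤ |v z - c| + |v z - c'| := abs_sub _ _
      _ ≤ _ := add_le_add a1 a2
  have lim : ∀ x ∈ E, ∃ c : ℝ, ∀ ε > 0, ∃ δ > 0, ∀ᵐ y ∂volume.restrict U,
      dist y x < δ → |v y - c| ≤ ε := by
    intro x hx
    choose! c δ hδ hc using h x hx
    have hpos : ∀ n : ℕ, (0 : ℝ) < 1 / ((n : ℝ) + 1) := fun n => by positivity
    have hcs : CauchySeq fun n : ℕ => c (1 / ((n : ℝ) + 1)) := by
      refine Metric.cauchySeq_iff'.2 fun ε hε => ?_
      obtain ⟨N, hN⟩ := exists_nat_one_div_lt (show (0 : ℝ) < ε / 2 by positivity)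
      refine ⟨N, fun n hn => ?_⟩
      have hle : 1 / ((n : ℝ) + 1) ≤ 1 / ((N : ℝ) + 1) := by gcongr
      have := common (hδ _ (hpos n)) (hE hx) (by simpa using hδ _ (hpos N))
        (hc _ (hpos N)) (hc _ (hpos n))
      rw [Real.dist_eq]
      linarith
    obtain ⟨l, hl⟩ := cauchySeq_tendsto_of_complete hcs
    refine ⟨l, fun ε hε => ?_⟩
    have hev := (hl.eventually (Metric.ball_mem_nhds l (show (0 : ℝ) < ε / 2 by positivity))).and
      (tendsto_one_div_add_atTop_nhds_zero_nat.eventually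
        (gt_mem_nhds (show (0 : ℝ) < ε / 2 by positivity)))
    obtain ⟨n, hn1, hn2⟩ := hev.exists
    refine ⟨δ (1 / ((n : ℝ) + 1)), hδ _ (hpos n), ?_⟩
    filter_upwards [hc _ (hpos n)] with y hy hyx
    have := hy hyx
    rw [Real.dist_eq] at hn1
    calc |v y - l| = |(v y - c (1 / ((n : ℝ) + 1))) + (c (1 / ((n : ℝ) + 1)) - l)| := by ring_nf
      _ ≤ _ := abs_add_le _ _
      _ ≤ ε := by linarith
  choose! w hw using lim
  have hcont : ContinuousOn w E := by
    intro x hx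
    rw [Metric.continuousWithinAt_iff]
    intro ε hε
    obtain ⟨δ, hδ, h1⟩ := hw x hx (ε / 3) (by positivity)
    refine ⟨δ, hδ, fun y hy hyx => ?_⟩
    obtain ⟨δ', hδ', h2⟩ := hw y hy (ε / 3) (by positivity)
    have := common hδ' (hE hy) hyx h1 h2
    rw [Real.dist_eq]
    linarith
  refine ⟨w, hcont, ?_⟩
  have hn : ∀ n : ℕ, ∀ᵐ x ∂volume.restrict U, |w x - v x| ≤ 1 / ((n : ℝ) + 1) := by
    intro n
    have hpos : (0 : ℝ) < 1 / ((n : ℝ) + 1) := by positivity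
    rw [ae_restrict_iff' hU.measurableSet]
    refine measure_null_of_locally_null _ fun x hx => ?_
    have hxU : x ∈ U := by
      by_contra hxU
      exact hx fun h' => absurd h' hxU
    obtain ⟨δ, hδ, h1⟩ := hw x (hUE hxU) (1 / ((n : ℝ) + 1) / 2) (by positivity)
    obtain ⟨δ', hδ', h2⟩ := Metric.continuousWithinAt_iff.1 (hcont x (hUE hxU))
      (1 / ((n : ℝ) + 1) / 2) (by positivity)
    rw [ae_restrict_iff' hU.measurableSet] at h1
    refine ⟨_, inter_mem_nhdsWithin _ (Metric.ball_mem_nhds x (lt_min hδ hδ')), ?_⟩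
    refine measure_mono_null (fun y hy => ?_) h1
    simp only [mem_compl_iff, mem_ofPred_eq] at hy ⊢
    intro hcon
    apply hy.1
    intro hyU
    have hyd : dist y x < min δ δ' := hy.2
    have a1 := hcon hyU (hyd.trans_le (min_le_left _ _))
    have a2 := h2 (hUE hyU) (hyd.trans_le (min_le_right _ _))
    rw [Real.dist_eq] at a2
    calc |w y - v y| = |(w y - w x) - (v y - w x)| := by ring_nf
      _ ≤ |w y - w x| + |v y - w x| := abs_sub _ _
      _ ≤ _ := by linarith
  filter_upwards [ae_all_iff.2 hn] with x hx
  have : |w x - v x| ≤ 0 :=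
    ge_of_tendsto' tendsto_one_div_add_atTop_nhds_zero_nat hx
  exact sub_eq_zero.1 (abs_eq_zero.1 (le_antisymm this (abs_nonneg _)))

/-! ### Polynomials of bounded degree in the plane -/

/-- The exponent vector of `X₀^{μ₁} X₁^{μ₂}`. -/
def expVec (μ : ℕ × ℕ) : Fin 2 →₀ ℕ := Finsupp.single 0 μ.1 + Finsupp.single 1 μ.2

@[simp] theorem expVec_zero (μ : ℕ × ℕ) : expVec μ 0 = μ.1 := by simp [expVec]

@[simp] theorem expVec_one (μ : ℕ × ℕ) : expVec μ 1 = μ.2 := by simp [expVec]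

theorem mem_multiIndices {k : ℕ} {μ : ℕ × ℕ} : μ ∈ multiIndices k ↔ μ.1 + μ.2 ≤ k := by
  simp only [multiIndices, Finset.mem_filter, Finset.mem_product, Finset.mem_range]
  omega

theorem eval_eq_sum_multiIndices {P : MvPolynomial (Fin 2) ℝ} {k : ℕ} (hP : P.totalDegree ≤ k)
    (y : Fin 2 → ℝ) : MvPolynomial.eval y P
      = ∑ μ ∈ multiIndices k, P.coeff (expVec μ) * (y 0 ^ μ.1 * y 1 ^ μ.2) := by
  have hinj : Function.Injective expVec := fun μ ν h => by
    have h0 := DFunLike.congr_fun h 0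
    have h1 := DFunLike.congr_fun h 1
    simp only [expVec_zero, expVec_one] at h0 h1
    exact Prod.ext h0 h1
  have e : ∑ μ ∈ multiIndices k, P.coeff (expVec μ) * (y 0 ^ μ.1 * y 1 ^ μ.2)
      = ∑ d ∈ (multiIndices k).image expVec, P.coeff d * ∏ i, y i ^ d i := by
    rw [Finset.sum_image hinj.injOn]
    exact Finset.sum_congr rfl fun μ _ => by rw [Fin.prod_univ_two, expVec_zero, expVec_one]
  rw [MvPolynomial.eval_eq', e]
  refine Finset.sum_subset (fun d hd => ?_) fun d _ hd => ?_
  · rw [Finset.mem_image]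
    refine ⟨(d 0, d 1), ?_, ?_⟩
    · rw [mem_multiIndices]
      by_contra! h
      exact (MvPolynomial.mem_support_iff.1 hd) (coeff_eq_zero_of_totalDegree_lt' hP d h)
    · ext i; fin_cases i <;> simp
  · rw [MvPolynomial.notMem_support_iff.1 hd, zero_mul]

theorem totalDegree_bind₁_le {f : Fin 2 → MvPolynomial (Fin 2) ℝ}
    (hf : ∀ i, (f i).totalDegree ≤ 1) {P : MvPolynomial (Fin 2) ℝ} {k : ℕ}
    (hP : P.totalDegree ≤ k) : (MvPolynomial.bind₁ f P).totalDegree ≤ k := by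
  rw [MvPolynomial.bind₁, MvPolynomial.aeval_def, MvPolynomial.eval₂_eq']
  refine MvPolynomial.totalDegree_finsetSum_le fun d hd => ?_
  refine (MvPolynomial.totalDegree_mul _ _).trans ?_
  have h1 : (algebraMap ℝ (MvPolynomial (Fin 2) ℝ) (P.coeff d)).totalDegree = 0 :=
    MvPolynomial.totalDegree_C _
  rw [h1, zero_add, Fin.prod_univ_two]
  refine (MvPolynomial.totalDegree_mul _ _).trans ?_
  have h2 : ∀ i, (f i ^ d i).totalDegree ≤ d i := fun i =>
    (MvPolynomial.totalDegree_pow _ _).trans (by have := hf i; nlinarith)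
  have h3 : d 0 + d 1 ≤ k := by
    by_contra! h
    exact (MvPolynomial.mem_support_iff.1 hd) (coeff_eq_zero_of_totalDegree_lt' hP d h)
  have := h2 0; have := h2 1
  omega

/-- The affine polynomial `a + b X₀ + c X₁`. -/
def affPoly (a b c : ℝ) : MvPolynomial (Fin 2) ℝ :=
  MvPolynomial.C a + MvPolynomial.C b * MvPolynomial.X 0 + MvPolynomial.C c * MvPolynomial.X 1

theorem totalDegree_affPoly_le (a b c : ℝ) : (affPoly a b c).totalDegree ≤ 1 := by
  unfold affPoly
  refine (MvPolynomial.totalDegree_add _ _).trans (max_le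
    ((MvPolynomial.totalDegree_add _ _).trans (max_le (by simp) ?_)) ?_)
  all_goals
    refine (MvPolynomial.totalDegree_mul _ _).trans ?_
    simp

@[simp] theorem eval_affPoly (a b c : ℝ) (y : Fin 2 → ℝ) :
    MvPolynomial.eval y (affPoly a b c) = a + b * y 0 + c * y 1 := by
  simp [affPoly]

/-- Evaluation at the lattice points `(i/k, j/k)` of the polynomial with given coefficients. -/
def latticeEval (k : ℕ) : (multiIndices k → ℝ) →ₗ[ℝ] (multiIndices k → ℝ) where
  toFun c α := ∑ μ : multiIndices k, c μ * (((α.1.1 : ℝ) / k) ^ μ.1.1 * ((α.1.2 : ℝ) / k) ^ μ.1.2)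
  map_add' c c' := by
    funext α; simp only [Pi.add_apply, add_mul, Finset.sum_add_distrib]
  map_smul' r c := by
    funext α; simp only [Pi.smul_apply, smul_eq_mul, Finset.mul_sum, mul_assoc, RingHom.id_apply]

theorem latticeEval_coeff {k : ℕ} {P : MvPolynomial (Fin 2) ℝ} (hP : P.totalDegree ≤ k)
    (α : multiIndices k) : latticeEval k (fun μ => P.coeff (expVec μ.1)) α
      = MvPolynomial.eval ![(α.1.1 : ℝ) / k, (α.1.2 : ℝ) / k] P := by
  rw [eval_eq_sum_multiIndices hP]
  simp only [latticeEval, LinearMap.coe_mk, AddHom.coe_mk, Matrix.cons_val_zero,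
    Matrix.cons_val_one]
  exact Finset.sum_coe_sort (multiIndices k) (fun μ => P.coeff (expVec μ) *
    (((α.1.1 : ℝ) / k) ^ μ.1 * ((α.1.2 : ℝ) / k) ^ μ.2))

/-- A product of `k` affine forms, one for each lattice line strictly between `α = (a, b)` and one
of the three sides. Any other lattice point has a smaller first, second or third coordinate than
`α`, and hence lies on one of these lines. -/
theorem exists_lagrange_basis {k : ℕ} (hk : 1 ≤ k) (α : multiIndices k) :
    ∃ P : MvPolynomial (Fin 2) ℝ, P.totalDegree ≤ k ∧ ∀ β : multiIndices k,
      MvPolynomial.eval ![(β.1.1 : ℝ) / k, (β.1.2 : ℝ) / k] P = if β = α then 1 else 0 := by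
  have hk0 : (k : ℝ) ≠ 0 := by positivity
  obtain ⟨⟨a, b⟩, hα⟩ := α
  rw [mem_multiIndices] at hα
  simp only at hα
  set R : MvPolynomial (Fin 2) ℝ := (∏ j ∈ Finset.range a, affPoly (-j) k 0)
    * (∏ j ∈ Finset.range b, affPoly (-j) 0 k)
    * (∏ j ∈ Finset.range (k - a - b), affPoly (k - j) (-k) (-k)) with hR
  have hRd : R.totalDegree ≤ k := by
    have hp : ∀ (n : ℕ) (f : ℕ → MvPolynomial (Fin 2) ℝ), (∀ j, (f j).totalDegree ≤ 1) →
        (∏ j ∈ Finset.range n, f j).totalDegree ≤ n := fun n f hf =>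
      (MvPolynomial.totalDegree_finsetProd _ _).trans
        ((Finset.sum_le_sum fun j _ => hf j).trans (by simp))
    refine (MvPolynomial.totalDegree_mul _ _).trans ((add_le_add
      ((MvPolynomial.totalDegree_mul _ _).trans (add_le_add
        (hp a _ fun j => totalDegree_affPoly_le _ _ _)
        (hp b _ fun j => totalDegree_affPoly_le _ _ _)))
      (hp _ _ fun j => totalDegree_affPoly_le _ _ _)).trans ?_)
    omega
  have hRe : ∀ a' b' : ℕ, MvPolynomial.eval ![(a' : ℝ) / k, (b' : ℝ) / k] R
      = (∏ j ∈ Finset.range a, ((a' : ℝ) - j)) * (∏ j ∈ Finset.range b, ((b' : ℝ) - j))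
        * ∏ j ∈ Finset.range (k - a - b), ((k : ℝ) - a' - b' - j) := by
    intro a' b'
    rw [hR, map_mul, map_mul, map_prod, map_prod, map_prod]
    simp only [eval_affPoly, Matrix.cons_val_zero, Matrix.cons_val_one]
    congr 1
    · congr 1
      · refine Finset.prod_congr rfl fun j _ => ?_
        field_simp; ring
      · refine Finset.prod_congr rfl fun j _ => ?_
        field_simp; ring
    · refine Finset.prod_congr rfl fun j _ => ?_
      field_simp; ring
  have hne : MvPolynomial.eval ![(a : ℝ) / k, (b : ℝ) / k] R ≠ 0 := by
    rw [hRe]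
    refine mul_ne_zero (mul_ne_zero ?_ ?_) ?_ <;> refine Finset.prod_ne_zero_iff.2 fun j hj => ?_
    · rw [Finset.mem_range] at hj
      rw [sub_ne_zero]; exact_mod_cast hj.ne'
    · rw [Finset.mem_range] at hj
      rw [sub_ne_zero]; exact_mod_cast hj.ne'
    · rw [Finset.mem_range] at hj
      have h1 : a + b + j < k := by omega
      have h2 : (a : ℝ) + b + j < k := by exact_mod_cast h1
      intro h; linarith
  refine ⟨MvPolynomial.C (MvPolynomial.eval ![(a : ℝ) / k, (b : ℝ) / k] R)⁻¹ * R, ?_, ?_⟩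
  · refine (MvPolynomial.totalDegree_mul _ _).trans ?_
    rw [MvPolynomial.totalDegree_C, zero_add]; exact hRd
  · rintro ⟨⟨a', b'⟩, hβ⟩
    rw [mem_multiIndices] at hβ
    simp only at hβ
    rw [map_mul, MvPolynomial.eval_C]
    change _ * MvPolynomial.eval ![(a' : ℝ) / k, (b' : ℝ) / k] R = _
    split_ifs with h
    · simp only [Subtype.mk.injEq, Prod.mk.injEq] at h
      rw [h.1, h.2, inv_mul_cancel₀ hne]
    · simp only [Subtype.mk.injEq, Prod.mk.injEq, not_and] at h
      refine mul_eq_zero_of_right _ ?_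
      rw [hRe]
      rcases lt_or_ge a' a with h1 | h1
      · rw [Finset.prod_eq_zero (Finset.mem_range.2 h1) (by simp)]; simp
      rcases lt_or_ge b' b with h2 | h2
      · rw [Finset.prod_eq_zero (s := Finset.range b) (Finset.mem_range.2 h2) (by simp)]; simp
      have h3 : k - a' - b' < k - a - b := by
        by_contra hcon
        have : a' = a := by omega
        exact h this (by omega)
      rw [Finset.prod_eq_zero (s := Finset.range (k - a - b)) (Finset.mem_range.2 h3)]
      · simp
      · rw [Nat.cast_sub (by omega), Nat.cast_sub (by omega)]; ring

theorem latticeEval_surjective {k : ℕ} (hk : 1 ≤ k) :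
    Function.Surjective (latticeEval k) := by
  choose L hL hLe using exists_lagrange_basis hk
  intro y
  refine ⟨∑ α, y α • fun μ : multiIndices k => (L α).coeff (expVec μ.1), ?_⟩
  rw [map_sum]
  funext β
  simp only [map_smul, Finset.sum_apply, Pi.smul_apply, latticeEval_coeff (hL _), hLe, smul_eq_mul]
  simp

/-- There are as many coefficients as lattice points, so surjectivity gives bijectivity, and the
inverse is bounded in finite dimension. `M` depends on `k` only. -/
theorem exists_coeff_bound {k : ℕ} (hk : 1 ≤ k) : ∃ M : ℝ, 0 ≤ M ∧ ∀ (c : multiIndices k → ℝ)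
    (b : ℝ), 0 ≤ b → (∀ α, |latticeEval k c α| ≤ b) → ∀ μ, |c μ| ≤ M * b := by
  have hb : Function.Bijective (latticeEval k) :=
    ⟨LinearMap.injective_iff_surjective.2 (latticeEval_surjective hk), latticeEval_surjective hk⟩
  set E := LinearEquiv.ofBijective (latticeEval k) hb
  set G := LinearMap.toContinuousLinearMap E.symm.toLinearMap
  refine ⟨‖G‖, norm_nonneg _, fun c b hb0 h μ => ?_⟩
  have e : c = G (latticeEval k c) := by
    change c = E.symm (E c)
    simp
  calc |c μ| ≤ ‖c‖ := norm_le_pi_norm c μ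
    _ = ‖G (latticeEval k c)‖ := by rw [← e]
    _ ≤ ‖G‖ * ‖latticeEval k c‖ := G.le_opNorm _
    _ ≤ ‖G‖ * b := by
        gcongr
        exact (pi_norm_le_iff_of_nonneg hb0).2 h

/-- A polynomial of degree at most `k` with given values at the lattice points. -/
theorem exists_poly_lattice {k : ℕ} (hk : 1 ≤ k) (y : ℕ × ℕ → ℝ) :
    ∃ P : MvPolynomial (Fin 2) ℝ, P.totalDegree ≤ k ∧ ∀ β ∈ multiIndices k,
      MvPolynomial.eval ![(β.1 : ℝ) / k, (β.2 : ℝ) / k] P = y β := by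
  choose L hL hLe using exists_lagrange_basis hk
  refine ⟨∑ α : multiIndices k, MvPolynomial.C (y α.1) * L α, ?_, fun β hβ => ?_⟩
  · refine MvPolynomial.totalDegree_finsetSum_le fun α _ => ?_
    refine (MvPolynomial.totalDegree_mul _ _).trans ?_
    rw [MvPolynomial.totalDegree_C, zero_add]; exact hL α
  · rw [map_sum]
    have : ∀ α : multiIndices k, MvPolynomial.eval ![(β.1 : ℝ) / k, (β.2 : ℝ) / k]
        (MvPolynomial.C (y α.1) * L α) = if (⟨β, hβ⟩ : multiIndices k) = α then y β else 0 := by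
      intro α
      rw [map_mul, MvPolynomial.eval_C, hLe α ⟨β, hβ⟩]
      split_ifs with h
      · rw [← h, mul_one]
      · rw [mul_zero]
    simp only [this]
    simp

/-! ### Triangles -/

/-- Twice the signed area of the triangle `ABC`. -/
def tdet (A B C : Plane) : ℝ := (B 0 - A 0) * (C 1 - A 1) - (B 1 - A 1) * (C 0 - A 0)

/-- The barycentric coordinate of `x` with respect to `A` in the triangle `ABC`. -/
def bary (A B C x : Plane) : ℝ := tdet x B C / tdet A B C

theorem tdet_rotate (A B C : Plane) : tdet B C A = tdet A B C := by unfold tdet; ring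

theorem tdet_swap (A B C : Plane) : tdet A C B = - tdet A B C := by unfold tdet; ring

theorem bary_sum {A B C : Plane} (h : tdet A B C ≠ 0) (x : Plane) :
    bary A B C x + bary B C A x + bary C A B x = 1 := by
  unfold bary
  rw [tdet_rotate A B C, ← tdet_rotate C A B, ← add_div, ← add_div, div_eq_one_iff_eq h]
  unfold tdet; ring

theorem bary_combo {A B C : Plane} (h : tdet A B C ≠ 0) (x : Plane) :
    x = bary A B C x • A + bary B C A x • B + bary C A B x • C := by
  have e : tdet C A B = tdet A B C := by rw [← tdet_rotate C A B]
  unfold bary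
  rw [tdet_rotate A B C, e]
  ext i
  simp only [PiLp.add_apply, PiLp.smul_apply, smul_eq_mul]
  field_simp
  fin_cases i <;> simp only [tdet] <;> simp <;> ring

theorem tdet_combo (A B C : Plane) {a b c : ℝ} (h : a + b + c = 1) :
    tdet (a • A + b • B + c • C) B C = a * tdet A B C := by
  obtain rfl : a = 1 - b - c := by linarith
  simp only [tdet, PiLp.add_apply, PiLp.smul_apply, smul_eq_mul]; ring

theorem bary_of_combo {A B C : Plane} (hd : tdet A B C ≠ 0) {a b c : ℝ} (h : a + b + c = 1) :
    bary A B C (a • A + b • B + c • C) = a := by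
  rw [bary, tdet_combo A B C h, mul_div_assoc, div_self hd, mul_one]

theorem bary_of_combo' {A B C : Plane} (hd : tdet A B C ≠ 0) {a b c : ℝ} (h : a + b + c = 1) :
    bary B C A (a • A + b • B + c • C) = b := by
  rw [show a • A + b • B + c • C = b • B + c • C + a • A by abel]
  exact bary_of_combo (by rwa [tdet_rotate]) (by linarith)

theorem bary_of_combo'' {A B C : Plane} (hd : tdet A B C ≠ 0) {a b c : ℝ} (h : a + b + c = 1) :
    bary C A B (a • A + b • B + c • C) = c := by
  rw [show a • A + b • B + c • C = c • C + a • A + b • B by abel]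
  exact bary_of_combo (by rwa [← tdet_rotate C A B]) (by linarith)

theorem bary_affine (A B C : Plane) {x y : Plane} {s t : ℝ} (h : s + t = 1) :
    bary A B C (s • x + t • y) = s * bary A B C x + t * bary A B C y := by
  obtain rfl : s = 1 - t := by linarith
  unfold bary
  rw [← mul_div_assoc, ← mul_div_assoc, ← add_div]
  congr 1
  simp only [tdet, PiLp.add_apply, PiLp.smul_apply, smul_eq_mul]; ring

theorem continuous_bary (A B C : Plane) : Continuous (bary A B C) := by
  unfold bary tdet
  fun_prop

theorem bary_self {A B C : Plane} (h : tdet A B C ≠ 0) : bary A B C A = 1 := by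
  rw [bary, div_self h]

theorem bary_second (A B C : Plane) : bary A B C B = 0 := by
  rw [bary, show tdet B B C = 0 by unfold tdet; ring, zero_div]

theorem bary_third (A B C : Plane) : bary A B C C = 0 := by
  rw [bary, show tdet C B C = 0 by unfold tdet; ring, zero_div]

theorem convexHull_triple {A B C : Plane} (h : tdet A B C ≠ 0) :
    convexHull ℝ ({A, B, C} : Set Plane)
      = {x | 0 ≤ bary A B C x ∧ 0 ≤ bary B C A x ∧ 0 ≤ bary C A B x} := by
  have hB : tdet B C A ≠ 0 := by rwa [tdet_rotate]
  have hC : tdet C A B ≠ 0 := by rwa [← tdet_rotate C A B]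
  apply Subset.antisymm
  · refine convexHull_min ?_ ?_
    · rintro x (rfl | rfl | rfl)
      · simp [bary_self h, bary_second, bary_third]
      · simp [bary_self hB, bary_second, bary_third]
      · simp [bary_self hC, bary_second, bary_third]
    · intro x hx y hy s t hs ht hst
      simp only [mem_ofPred_eq, bary_affine _ _ _ hst] at hx hy ⊢
      obtain ⟨h1, h2, h3⟩ := hx
      obtain ⟨k1, k2, k3⟩ := hy
      exact ⟨by positivity, by positivity, by positivity⟩
  · rintro x ⟨h1, h2, h3⟩
    have hc := convex_convexHull ℝ ({A, B, C} : Set Plane)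
    have := hc.sum_mem (t := Finset.univ) (w := ![bary A B C x, bary B C A x, bary C A B x])
      (z := ![A, B, C]) (by intro i _; fin_cases i <;> simpa) (by
        simp [Fin.sum_univ_three, bary_sum h]) (by
        intro i _
        apply subset_convexHull
        fin_cases i <;> simp)
    rw [bary_combo h x]
    simpa [Fin.sum_univ_three] using this

/-- The open triangle `ABC`. -/
def openTri (A B C : Plane) : Set Plane :=
  {x | 0 < bary A B C x ∧ 0 < bary B C A x ∧ 0 < bary C A B x}

theorem isOpen_openTri (A B C : Plane) : IsOpen (openTri A B C) :=
  (isOpen_lt continuous_const (continuous_bary _ _ _)).inter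
    ((isOpen_lt continuous_const (continuous_bary _ _ _)).inter
      (isOpen_lt continuous_const (continuous_bary _ _ _)))

theorem convex_openTri (A B C : Plane) : Convex ℝ (openTri A B C) := by
  have h : ∀ A B C : Plane, Convex ℝ {x | 0 < bary A B C x} := by
    intro A B C x hx y hy s t hs ht hst
    simp only [mem_ofPred_eq, bary_affine _ _ _ hst] at hx hy ⊢
    rcases hs.eq_or_lt with rfl | hs'
    · simpa [show t = 1 by linarith] using hy
    · positivity
  exact (h A B C).inter ((h B C A).inter (h C A B))

theorem openTri_subset {A B C : Plane} (h : tdet A B C ≠ 0) :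
    openTri A B C ⊆ convexHull ℝ ({A, B, C} : Set Plane) := by
  rw [convexHull_triple h]
  exact fun x hx => ⟨hx.1.le, hx.2.1.le, hx.2.2.le⟩

theorem openTri_nonempty {A B C : Plane} (h : tdet A B C ≠ 0) : (openTri A B C).Nonempty := by
  refine ⟨(1 / 3 : ℝ) • A + (1 / 3 : ℝ) • B + (1 / 3 : ℝ) • C, ?_, ?_, ?_⟩
  · rw [bary_of_combo h (by norm_num)]; norm_num
  · rw [bary_of_combo' h (by norm_num)]; norm_num
  · rw [bary_of_combo'' h (by norm_num)]; norm_num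

theorem isCompact_convexHull_triple (A B C : Plane) :
    IsCompact (convexHull ℝ ({A, B, C} : Set Plane)) :=
  (Set.toFinite ({A, B, C} : Set Plane)).isCompact_convexHull ℝ

theorem closure_openTri {A B C : Plane} (h : tdet A B C ≠ 0) :
    closure (openTri A B C) = convexHull ℝ ({A, B, C} : Set Plane) := by
  refine Subset.antisymm (closure_minimal (openTri_subset h)
    (isCompact_convexHull_triple A B C).isClosed) fun x hx => ?_
  obtain ⟨c, hc⟩ := openTri_nonempty h
  rw [convexHull_triple h] at hx
  have ht : Tendsto (fun t : ℝ => (1 - t) • x + t • c) (𝓝[>] 0) (𝓝 x) := by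
    have : Tendsto (fun t : ℝ => (1 - t) • x + t • c) (𝓝 0) (𝓝 ((1 - 0 : ℝ) • x + (0 : ℝ) • c)) :=
      Continuous.tendsto (by fun_prop) 0
    simp only [sub_zero, one_smul, zero_smul, add_zero] at this
    exact this.mono_left nhdsWithin_le_nhds
  refine mem_closure_of_tendsto ht ?_
  have hev : ∀ᶠ ε in 𝓝[>] (0 : ℝ), ε < 1 :=
    (Iio_mem_nhds (by positivity) |> mem_nhdsWithin_of_mem_nhds)
  filter_upwards [hev, self_mem_nhdsWithin] with t ht1 ht0
  have ht0' : 0 < t := ht0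
  have key : ∀ p q : ℝ, 0 ≤ p → 0 < q → 0 < (1 - t) * p + t * q := fun p q hp hq =>
    add_pos_of_nonneg_of_pos (mul_nonneg (by linarith) hp) (mul_pos ht0' hq)
  refine ⟨?_, ?_, ?_⟩ <;> rw [bary_affine _ _ _ (by ring)]
  · exact key _ _ hx.1 hc.1
  · exact key _ _ hx.2.1 hc.2.1
  · exact key _ _ hx.2.2 hc.2.2

theorem isBounded_openTri {A B C : Plane} (h : tdet A B C ≠ 0) :
    Bornology.IsBounded (openTri A B C) :=
  (isCompact_convexHull_triple A B C).isBounded.subset (openTri_subset h)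

theorem convexHull_ae_eq_openTri {A B C : Plane} (h : tdet A B C ≠ 0) :
    (convexHull ℝ ({A, B, C} : Set Plane) : Set Plane) =ᵐ[volume] openTri A B C := by
  rw [← closure_openTri h]
  refine (ae_le_set.2 ?_).antisymm subset_closure.eventuallyLE
  have := (convex_openTri A B C).addHaar_frontier volume
  rwa [frontier, (isOpen_openTri A B C).interior_eq] at this

theorem dist_le_of_mem_convexHull {A B C : Plane} {d : ℝ} (hAB : dist A B ≤ d)
    (hBC : dist B C ≤ d) (hCA : dist C A ≤ d) {x y : Plane}
    (hx : x ∈ convexHull ℝ ({A, B, C} : Set Plane)) (hy : y ∈ convexHull ℝ ({A, B, C} : Set Plane)) :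
    dist x y ≤ d := by
  have hd : 0 ≤ d := dist_nonneg.trans hAB
  obtain ⟨p, hp, q, hq, hpq⟩ := convexHull_exists_dist_ge2 hx hy
  refine hpq.trans ?_
  rcases hp with rfl | rfl | rfl <;> rcases hq with rfl | rfl | rfl <;>
    first | assumption | (rw [dist_comm]; assumption) | simpa using hd

/-! ### Lagrange interpolation on a triangle -/

theorem tdet_ne_zero_distinct {A B C : Plane} (h : tdet A B C ≠ 0) : A ≠ B ∧ A ≠ C ∧ B ≠ C := by
  refine ⟨?_, ?_, ?_⟩ <;> rintro rfl <;> exact h (by unfold tdet; ring)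

theorem mem_lagrangeNodes_triple [DecidableEq Plane] {k : ℕ} (hk : 1 ≤ k) {A B C : Plane}
    (h : tdet A B C ≠ 0)
    {x : Plane} : x ∈ lagrangeNodes k {A, B, C} ↔ ∃ μ ∈ multiIndices k,
      x = (((k : ℝ) - μ.1 - μ.2) / k) • A + ((μ.1 : ℝ) / k) • B + ((μ.2 : ℝ) / k) • C := by
  obtain ⟨hAB, hAC, hBC⟩ := tdet_ne_zero_distinct h
  have hk0 : (k : ℝ) ≠ 0 := by positivity
  have hsum : ∀ {M : Type} [AddCommMonoid M] (f : Plane → M),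
      ∑ P ∈ ({A, B, C} : Finset Plane), f P = f A + f B + f C := by
    intro M _ f
    rw [Finset.sum_insert (by simp [hAB, hAC]), Finset.sum_insert (by simp [hBC]),
      Finset.sum_singleton, add_assoc]
  constructor
  · rintro ⟨α, hα, rfl⟩
    rw [hsum] at hα
    refine ⟨(α B, α C), mem_multiIndices.2 (by simp only; omega), ?_⟩
    rw [hsum, ← hα]
    push_cast
    congr 3
    ring
  · rintro ⟨⟨i, j⟩, hμ, rfl⟩
    rw [mem_multiIndices] at hμ
    simp only at hμ
    refine ⟨fun P => if P = A then k - i - j else if P = B then i else j, ?_, ?_⟩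
    · rw [hsum]
      simp [hAB.symm, hAC.symm, hBC.symm]; omega
    · rw [hsum]
      simp only [if_true, if_neg hAB.symm, if_neg hAC.symm, if_neg hBC.symm]
      rw [Nat.cast_sub (by omega), Nat.cast_sub (by omega)]

/-- The affine polynomial representing a barycentric coordinate. -/
def baryPoly (A B C : Plane) : MvPolynomial (Fin 2) ℝ :=
  affPoly ((B 0 * C 1 - B 1 * C 0) / tdet A B C) ((B 1 - C 1) / tdet A B C)
    ((C 0 - B 0) / tdet A B C)

theorem eval_baryPoly (A B C x : Plane) :
    MvPolynomial.eval (fun i => x i) (baryPoly A B C) = bary A B C x := by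
  rw [baryPoly, eval_affPoly, bary]
  have : tdet x B C = (B 0 * C 1 - B 1 * C 0) + (B 1 - C 1) * x 0 + (C 0 - B 0) * x 1 := by
    unfold tdet; ring
  rw [this]; ring

theorem exists_interpolating_poly [DecidableEq Plane] {k : ℕ} (hk : 1 ≤ k) {A B C : Plane}
    (h : tdet A B C ≠ 0)
    (f : Plane → ℝ) : ∃ P : MvPolynomial (Fin 2) ℝ, P.totalDegree ≤ k ∧
      ∀ x ∈ lagrangeNodes k {A, B, C}, polyFun P x = f x := by
  have hk0 : (k : ℝ) ≠ 0 := by positivity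
  obtain ⟨q, hq, hqe⟩ := exists_poly_lattice hk (fun μ => f ((((k : ℝ) - μ.1 - μ.2) / k) • A
    + ((μ.1 : ℝ) / k) • B + ((μ.2 : ℝ) / k) • C))
  refine ⟨MvPolynomial.bind₁ ![baryPoly B C A, baryPoly C A B] q,
    totalDegree_bind₁_le (by intro i; fin_cases i <;> exact totalDegree_affPoly_le _ _ _) hq, ?_⟩
  intro x hx
  obtain ⟨μ, hμ, rfl⟩ := (mem_lagrangeNodes_triple hk h).1 hx
  rw [← hqe μ hμ]
  set x := (((k : ℝ) - μ.1 - μ.2) / k) • A + ((μ.1 : ℝ) / k) • B + ((μ.2 : ℝ) / k) • C with hx'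
  have hs : ((k : ℝ) - μ.1 - μ.2) / k + (μ.1 : ℝ) / k + (μ.2 : ℝ) / k = 1 := by field_simp; ring
  unfold polyFun
  rw [MvPolynomial.eval, MvPolynomial.eval₂Hom_bind₁]
  change MvPolynomial.eval _ q = _
  congr 2
  funext i
  fin_cases i
  · change MvPolynomial.eval _ (baryPoly B C A) = _
    rw [eval_baryPoly, hx', bary_of_combo' h hs]; rfl
  · change MvPolynomial.eval _ (baryPoly C A B) = _
    rw [eval_baryPoly, hx', bary_of_combo'' h hs]; rfl

/-- Passage to the reference triangle: in the coordinates `bary B C A` and `bary C A B` the Lagrange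
nodes become the fixed lattice points, so that `exists_coeff_bound` applies uniformly in the
triangle. -/
theorem exists_polyFun_eq_sum_bary {k : ℕ} {A B C : Plane} (h : tdet A B C ≠ 0)
    {R : MvPolynomial (Fin 2) ℝ} (hR : R.totalDegree ≤ k) :
    ∃ q : MvPolynomial (Fin 2) ℝ, q.totalDegree ≤ k ∧
      ∀ x, polyFun R x = MvPolynomial.eval ![bary B C A x, bary C A B x] q := by
  refine ⟨MvPolynomial.bind₁ ![affPoly (A 0) (B 0 - A 0) (C 0 - A 0),
    affPoly (A 1) (B 1 - A 1) (C 1 - A 1)] R,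
    totalDegree_bind₁_le (by intro i; fin_cases i <;> exact totalDegree_affPoly_le _ _ _) hR,
    fun x => ?_⟩
  rw [MvPolynomial.eval, MvPolynomial.eval₂Hom_bind₁]
  change _ = MvPolynomial.eval _ R
  unfold polyFun
  congr 2
  have hc := bary_combo h x
  have hs := bary_sum h x
  have hc' : ∀ i, x i = bary A B C x * A i + bary B C A x * B i + bary C A B x * C i := by
    intro i
    conv_lhs => rw [hc]
    simp
  funext i
  fin_cases i
  · change _ = MvPolynomial.eval _ (affPoly _ _ _)
    rw [eval_affPoly]
    simp only [Matrix.cons_val_zero, Matrix.cons_val_one]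
    have := hc' 0
    rw [show bary A B C x = 1 - bary B C A x - bary C A B x by linarith] at this
    change x 0 = _
    rw [this]; ring
  · change _ = MvPolynomial.eval _ (affPoly _ _ _)
    rw [eval_affPoly]
    simp only [Matrix.cons_val_zero, Matrix.cons_val_one]
    have := hc' 1
    rw [show bary A B C x = 1 - bary B C A x - bary C A B x by linarith] at this
    change x 1 = _
    rw [this]; ring

theorem abs_coord_sub_le_dist (x y : Plane) (i : Fin 2) : |x i - y i| ≤ dist x y := by
  rw [EuclideanSpace.dist_eq]
  refine Real.abs_le_sqrt ?_
  have := Finset.single_le_sum (f := fun j => dist (x j) (y j) ^ 2) (fun j _ => sq_nonneg _)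
    (Finset.mem_univ i)
  simpa [Real.dist_eq, sq_abs] using this

/-- The linear part of a barycentric coordinate. -/
theorem bary_add_smul (A B C x h : Plane) (t : ℝ) : bary A B C (x + t • h)
    = bary A B C x + t * ((h 0 * (B 1 - C 1) + h 1 * (C 0 - B 0)) / tdet A B C) := by
  unfold bary
  rw [← mul_div_assoc, ← add_div]
  congr 1
  simp only [tdet, PiLp.add_apply, PiLp.smul_apply, smul_eq_mul]; ring

/-- A barycentric coordinate has slope at most the opposite edge length over twice the area, hence
at most `d / |tdet A B C|`; this is where shape regularity enters. -/
theorem exists_abs_bary_slope_le {A B C : Plane} {d σ : ℝ} (h : tdet A B C ≠ 0)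
    (hBC : dist B C ≤ d) (hσ : d ^ 2 ≤ σ * |tdet A B C|) (i : Fin 2) :
    ∃ l : ℝ, d * |l| ≤ σ ∧ ∀ (x : Plane) (t : ℝ),
      bary A B C (x + t • EuclideanSpace.single i (1 : ℝ)) = bary A B C x + t * l := by
  refine ⟨_, ?_, fun x t => bary_add_smul A B C x _ t⟩
  have hT : 0 < |tdet A B C| := abs_pos.2 h
  have hd : 0 ≤ d := dist_nonneg.trans hBC
  rw [abs_div, ← mul_div_assoc, div_le_iff₀ hT]
  refine le_trans ?_ hσ
  rw [sq]
  refine mul_le_mul_of_nonneg_left ?_ hd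
  fin_cases i
  · simpa using (abs_coord_sub_le_dist B C 1).trans hBC
  · simpa [abs_sub_comm] using (abs_coord_sub_le_dist B C 0).trans hBC

/-- In barycentric coordinates the coefficients are bounded by the nodal values, and on the triangle
the monomials are bounded by one. Differentiation brings down an exponent at most `k` and a slope at
most `σ / d`; the two coordinates account for the `2 k σ` in `K`. -/
theorem isStableNodes_triangle {k : ℕ} (hk : 1 ≤ k) (σ : ℝ≥0) : ∃ S : ℝ≥0,
    ∀ [DecidableEq Plane] {A B C : Plane} {d : ℝ≥0}, tdet A B C ≠ 0 → dist A B ≤ d →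
      dist B C ≤ d → dist C A ≤ d → (d : ℝ) ^ 2 ≤ σ * |tdet A B C| →
      IsStableNodes (convexHull ℝ {A, B, C}) (lagrangeNodes k {A, B, C}) k d S := by
  obtain ⟨M, hM, hMb⟩ := exists_coeff_bound hk
  set I : ℝ := ((multiIndices k).card : ℝ)
  set K : ℝ := I * (M * (1 + 2 * k * σ)) with hK
  have hI : 0 ≤ I := Nat.cast_nonneg _
  have hK0 : 0 ≤ K := by positivity
  refine ⟨(K ^ 2).toNNReal, fun {_ A B C d} hT hAB hBC hCA hσ R hR T hTtop hnode x hx => ?_⟩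
  obtain ⟨q, hq, hRq⟩ := exists_polyFun_eq_sum_bary hT hR
  have hk0 : (k : ℝ) ≠ 0 := by positivity
  set b := Real.sqrt T.toReal with hb
  have hb0 : 0 ≤ b := Real.sqrt_nonneg _
  have hcoef : ∀ μ ∈ multiIndices k, |q.coeff (expVec μ)| ≤ M * b := by
    intro μ hμ
    refine hMb (fun μ => q.coeff (expVec μ.1)) b hb0 (fun α => ?_) ⟨μ, hμ⟩
    have hs : ((k : ℝ) - α.1.1 - α.1.2) / k + (α.1.1 : ℝ) / k + (α.1.2 : ℝ) / k = 1 := by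
      field_simp; ring
    have := hnode _ ((mem_lagrangeNodes_triple hk hT).2 ⟨α.1, α.2, rfl⟩)
    rw [latticeEval_coeff hq]
    rw [hRq, bary_of_combo' hT hs, bary_of_combo'' hT hs, enorm_sq_eq_ofReal,
      ENNReal.ofReal_le_iff_le_toReal hTtop] at this
    exact Real.abs_le_sqrt this
  have hfin : ∀ y e : ℝ, 0 ≤ e → e * |y| ≤ K * b →
      ENNReal.ofReal e ^ 2 * ‖y‖ₑ ^ 2 ≤ ENNReal.ofReal (K ^ 2) * T := by
    intro y e he hy
    rw [← ENNReal.ofReal_toReal hTtop, enorm_sq_eq_ofReal, ← ENNReal.ofReal_pow he,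
      ← ENNReal.ofReal_mul (by positivity), ← ENNReal.ofReal_mul (by positivity)]
    refine ENNReal.ofReal_le_ofReal ?_
    have h2 := pow_le_pow_left₀ (by positivity) hy 2
    rw [mul_pow, mul_pow, sq_abs, hb, Real.sq_sqrt ENNReal.toReal_nonneg] at h2
    exact h2
  rw [convexHull_triple hT] at hx
  obtain ⟨hx1, hx2, hx3⟩ := hx
  have hsum := bary_sum hT x
  have hTB : tdet B C A ≠ 0 := by rwa [tdet_rotate]
  have hTC : tdet C A B ≠ 0 := by rwa [← tdet_rotate C A B]
  set u := bary B C A x with hu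
  set w := bary C A B x with hw
  have hu1 : u ≤ 1 := by linarith
  have hw1 : w ≤ 1 := by linarith
  have hpw : ∀ (i j : ℕ), 0 ≤ u ^ i * w ^ j ∧ u ^ i * w ^ j ≤ 1 := fun i j =>
    ⟨by positivity, mul_le_one₀ (pow_le_one₀ hx2 hu1) (by positivity) (pow_le_one₀ hx3 hw1)⟩
  have hval : ∀ y, polyFun R y = ∑ μ ∈ multiIndices k,
      q.coeff (expVec μ) * (bary B C A y ^ μ.1 * bary C A B y ^ μ.2) := fun y => by
    rw [hRq, eval_eq_sum_multiIndices hq]; rfl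
  constructor
  · have h1 : |polyFun R x| ≤ K * b := by
      rw [hval]
      calc _ ≤ ∑ μ ∈ multiIndices k, |q.coeff (expVec μ) * (u ^ μ.1 * w ^ μ.2)| :=
            Finset.abs_sum_le_sum_abs _ _
        _ ≤ ∑ μ ∈ multiIndices k, M * b := by
            refine Finset.sum_le_sum fun μ hμ => ?_
            rw [abs_mul, abs_of_nonneg (hpw _ _).1]
            calc _ ≤ M * b * 1 := mul_le_mul (hcoef μ hμ) (hpw _ _).2 (hpw _ _).1 (by positivity)
              _ = M * b := mul_one _
        _ = I * (M * 1) * b := by rw [Finset.sum_const, nsmul_eq_mul]; ring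
        _ ≤ K * b := by
            rw [hK]
            gcongr
            have : 0 ≤ 2 * k * (σ : ℝ) := by positivity
            linarith
    simpa [ENNReal.ofReal] using hfin _ 1 zero_le_one (by simpa using h1)
  · intro i
    obtain ⟨l, hl, hlx⟩ := exists_abs_bary_slope_le (σ := σ) hTB hCA (by rwa [tdet_rotate]) i
    obtain ⟨l', hl', hlx'⟩ := exists_abs_bary_slope_le (σ := σ) hTC hAB
      (by rwa [← tdet_rotate C A B]) i
    have hder := hasDerivAt_comp_line (contDiff_polyFun R) x (EuclideanSpace.single i 1) 0
    have hder' : HasDerivAt (fun t : ℝ => polyFun R (x + t • EuclideanSpace.single i 1))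
        (∑ μ ∈ multiIndices k, q.coeff (expVec μ) *
          (μ.1 * u ^ (μ.1 - 1) * l * w ^ μ.2 + u ^ μ.1 * (μ.2 * w ^ (μ.2 - 1) * l'))) 0 := by
      simp only [hval, hlx, hlx']
      refine HasDerivAt.fun_sum fun μ _ => HasDerivAt.const_mul _ ?_
      have aff : ∀ a r : ℝ, HasDerivAt (fun t : ℝ => a + t * r) r 0 := fun a r => by
        simpa using ((hasDerivAt_id (0 : ℝ)).mul_const r).const_add a
      have := ((aff u l).fun_pow μ.1).fun_mul ((aff w l').fun_pow μ.2)
      simpa using this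
    have heq : partialDeriv i (polyFun R) x = ∑ μ ∈ multiIndices k, q.coeff (expVec μ) *
          (μ.1 * u ^ (μ.1 - 1) * l * w ^ μ.2 + u ^ μ.1 * (μ.2 * w ^ (μ.2 - 1) * l')) := by
      rw [← hder.unique hder']
      fin_cases i <;> simp
    have h2 : (d : ℝ) * |partialDeriv i (polyFun R) x| ≤ K * b := by
      rw [heq]
      calc (d : ℝ) * _ ≤ d * ∑ μ ∈ multiIndices k, |q.coeff (expVec μ) *
              (μ.1 * u ^ (μ.1 - 1) * l * w ^ μ.2 + u ^ μ.1 * (μ.2 * w ^ (μ.2 - 1) * l'))| :=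
            mul_le_mul_of_nonneg_left (Finset.abs_sum_le_sum_abs _ _) d.2
        _ = ∑ μ ∈ multiIndices k, |q.coeff (expVec μ)| *
              (d * |μ.1 * u ^ (μ.1 - 1) * l * w ^ μ.2 + u ^ μ.1 * (μ.2 * w ^ (μ.2 - 1) * l')|) := by
            rw [Finset.mul_sum]
            refine Finset.sum_congr rfl fun μ _ => ?_
            rw [abs_mul]; ring
        _ ≤ ∑ μ ∈ multiIndices k, M * b * (2 * k * σ) := by
            refine Finset.sum_le_sum fun μ hμ => mul_le_mul (hcoef μ hμ) ?_ (by positivity)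
              (by positivity)
            rw [mem_multiIndices] at hμ
            have hμ1 : (μ.1 : ℝ) ≤ k := by exact_mod_cast (by omega : μ.1 ≤ k)
            have hμ2 : (μ.2 : ℝ) ≤ k := by exact_mod_cast (by omega : μ.2 ≤ k)
            have t1 : |μ.1 * u ^ (μ.1 - 1) * l * w ^ μ.2 + u ^ μ.1 * (μ.2 * w ^ (μ.2 - 1) * l')|
                ≤ k * |l| + k * |l'| := by
              refine (abs_add_le _ _).trans (add_le_add ?_ ?_)
              · rw [show (μ.1 : ℝ) * u ^ (μ.1 - 1) * l * w ^ μ.2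
                  = (μ.1 * (u ^ (μ.1 - 1) * w ^ μ.2)) * l by ring, abs_mul]
                refine mul_le_mul_of_nonneg_right ?_ (abs_nonneg _)
                rw [abs_of_nonneg (mul_nonneg (Nat.cast_nonneg _) (hpw _ _).1)]
                exact (mul_le_of_le_one_right (Nat.cast_nonneg _) (hpw _ _).2).trans hμ1
              · rw [show u ^ μ.1 * ((μ.2 : ℝ) * w ^ (μ.2 - 1) * l')
                  = (μ.2 * (u ^ μ.1 * w ^ (μ.2 - 1))) * l' by ring, abs_mul]
                refine mul_le_mul_of_nonneg_right ?_ (abs_nonneg _)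
                rw [abs_of_nonneg (mul_nonneg (Nat.cast_nonneg _) (hpw _ _).1)]
                exact (mul_le_of_le_one_right (Nat.cast_nonneg _) (hpw _ _).2).trans hμ2
            calc _ ≤ (d : ℝ) * (k * |l| + k * |l'|) := mul_le_mul_of_nonneg_left t1 d.2
              _ = k * (d * |l|) + k * (d * |l'|) := by ring
              _ ≤ k * σ + k * σ := by gcongr
              _ = 2 * k * σ := by ring
        _ = I * (M * (2 * k * σ)) * b := by rw [Finset.sum_const, nsmul_eq_mul]; ring
        _ ≤ K * b := by
            rw [hK]
            gcongr
            linarith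
    simpa [ENNReal.ofReal] using hfin _ d d.2 h2

open scoped Classical

/-! ### Conforming meshes and their refinement -/

/-- The point `(1 - p) A + p B`. -/
def node (p : ℝ) (A B : Plane) : Plane := (1 - p) • A + p • B

@[simp] theorem node_apply (p : ℝ) (A B : Plane) (i : Fin 2) :
    node p A B i = (1 - p) * A i + p * B i := by simp [node]

theorem node_symm (p : ℝ) (A B : Plane) : node (1 - p) B A = node p A B := by
  unfold node; rw [sub_sub_cancel, add_comm]

theorem node_mem_convexHull {p : ℝ} (hp : p ∈ Ioo (0 : ℝ) 1) {A B : Plane} {s : Set Plane}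
    (hA : A ∈ convexHull ℝ s) (hB : B ∈ convexHull ℝ s) : node p A B ∈ convexHull ℝ s :=
  convex_convexHull ℝ s hA hB (by linarith [hp.2]) hp.1.le (by ring)

theorem bary_node (A B C : Plane) (p : ℝ) (x y : Plane) :
    bary A B C (node p x y) = (1 - p) * bary A B C x + p * bary A B C y :=
  bary_affine A B C (by ring)

theorem tdet_corner (A B C : Plane) (p r : ℝ) :
    tdet A (node p A B) (node r C A) = p * (1 - r) * tdet A B C := by
  simp only [tdet, node_apply]; ring

theorem tdet_center (A B C : Plane) (p q r : ℝ) :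
    tdet (node p A B) (node q B C) (node r C A)
      = ((1 - p) * (1 - q) * (1 - r) + p * q * r) * tdet A B C := by
  simp only [tdet, node_apply]; ring

theorem tdet_center' (A B C : Plane) (p q r : ℝ) :
    tdet (node q B C) (node p A B) (node r C A)
      = - (((1 - p) * (1 - q) * (1 - r) + p * q * r) * tdet A B C) := by
  simp only [tdet, node_apply]; ring

theorem center_coeff_pos {p q r : ℝ} (hp : p ∈ Ioo (0 : ℝ) 1) (hq : q ∈ Ioo (0 : ℝ) 1)
    (hr : r ∈ Ioo (0 : ℝ) 1) : 0 < (1 - p) * (1 - q) * (1 - r) + p * q * r := by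
  have := hp.1; have := hq.1; have := hr.1
  have h1 : 0 < 1 - p := by linarith [hp.2]
  have h2 : 0 < 1 - q := by linarith [hq.2]
  have h3 : 0 < 1 - r := by linarith [hr.2]
  positivity

/-- The face of a convex hull cut out by a supporting affine function: a convex combination of
nonnegative numbers with positive weights vanishes only if all of them do. -/
theorem mem_convexHull_face {s : Set Plane} {f : Plane → ℝ}
    (hf : ∀ (x y : Plane) (a b : ℝ), a + b = 1 → f (a • x + b • y) = a * f x + b * f y)
    (hs : ∀ y ∈ s, 0 ≤ f y) {x : Plane} (hx : x ∈ convexHull ℝ s) :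
    0 ≤ f x ∧ (f x ≤ 0 → x ∈ convexHull ℝ {y ∈ s | f y = 0}) := by
  have key : convexHull ℝ s ⊆ {x | 0 ≤ f x ∧ (f x ≤ 0 → x ∈ convexHull ℝ {y ∈ s | f y = 0})} := by
    refine convexHull_min (fun y hy => ⟨hs y hy, fun h =>
      subset_convexHull ℝ _ ⟨hy, le_antisymm h (hs y hy)⟩⟩) ?_
    rintro y ⟨hy0, hy⟩ z ⟨hz0, hz⟩ a b ha hb hab
    have e := hf y z a b hab
    have h1 := mul_nonneg ha hy0
    have h2 := mul_nonneg hb hz0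
    refine ⟨by rw [e]; exact add_nonneg h1 h2, fun h => ?_⟩
    rw [e] at h
    rcases ha.eq_or_lt with rfl | ha'
    · obtain rfl : b = 1 := by linarith
      simpa using hz (by simpa using h)
    rcases hb.eq_or_lt with rfl | hb'
    · obtain rfl : a = 1 := by linarith
      simpa using hy (by simpa using h)
    exact convex_convexHull ℝ _ (hy (by nlinarith)) (hz (by nlinarith)) ha hb hab
  exact key hx

/-- A common point of the two hulls must lie on the line `f = 0`, hence in the face of `s` spanned
by its vertices on that line, and these belong to `t`. All conformity checks inside one refined
triangle reduce to exhibiting such an `f`. -/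
theorem convexHull_inter_subset_of_separated {s t : Set Plane} {f : Plane → ℝ}
    (hf : ∀ (x y : Plane) (a b : ℝ), a + b = 1 → f (a • x + b • y) = a * f x + b * f y)
    (hs : ∀ y ∈ s, 0 ≤ f y) (ht : ∀ y ∈ t, f y ≤ 0) (hst : ∀ y ∈ s, f y = 0 → y ∈ t) :
    convexHull ℝ s ∩ convexHull ℝ t ⊆ convexHull ℝ (s ∩ t) := by
  rintro x ⟨hxs, hxt⟩
  have h1 := (mem_convexHull_face (f := fun y => - f y) (fun x y a b hab => by
    rw [hf x y a b hab]; ring) (fun y hy => by linarith [ht y hy]) hxt).1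
  refine convexHull_mono ?_ ((mem_convexHull_face hf hs hxs).2 (by linarith))
  exact fun y hy => ⟨hy.1, hst y hy.1 hy.2⟩

/-! ### The four pieces of a single triangle -/

section Triangle

variable {A B C : Plane} {p q r : ℝ}

theorem corner_inter_center (h : tdet A B C ≠ 0) (hp : p ∈ Ioo (0 : ℝ) 1)
    (hq : q ∈ Ioo (0 : ℝ) 1) (hr : r ∈ Ioo (0 : ℝ) 1) :
    convexHull ℝ ({A, node p A B, node r C A} : Set Plane)
      ∩ convexHull ℝ {node p A B, node q B C, node r C A}
      ⊆ convexHull ℝ (({A, node p A B, node r C A} : Set Plane)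
        ∩ {node p A B, node q B C, node r C A}) := by
  have hr1 : 0 < 1 - r := by linarith [hr.2]
  have hc : tdet A (node p A B) (node r C A) ≠ 0 := by
    rw [tdet_corner]; exact mul_ne_zero (mul_pos hp.1 hr1).ne' h
  refine convexHull_inter_subset_of_separated (f := bary A (node p A B) (node r C A))
    (fun x y a b hab => bary_affine _ _ _ hab) ?_ ?_ ?_
  · rintro y (rfl | rfl | rfl)
    · rw [bary_self hc]; exact zero_le_one
    · rw [bary_second]
    · rw [bary_third]
  · rintro y (rfl | rfl | rfl)
    · rw [bary_second]
    · rw [bary, tdet_center', tdet_corner, neg_div, mul_div_mul_right _ _ h, neg_nonpos]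
      exact div_nonneg (center_coeff_pos hp hq hr).le (mul_pos hp.1 hr1).le
    · rw [bary_third]
  · rintro y (rfl | rfl | rfl) hy
    · rw [bary_self hc] at hy; exact absurd hy one_ne_zero
    · simp
    · simp

theorem corner_inter_corner (h : tdet A B C ≠ 0) (hp : p ∈ Ioo (0 : ℝ) 1)
    (hq : q ∈ Ioo (0 : ℝ) 1) (hr : r ∈ Ioo (0 : ℝ) 1) :
    convexHull ℝ ({A, node p A B, node r C A} : Set Plane)
      ∩ convexHull ℝ {B, node q B C, node p A B}
      ⊆ convexHull ℝ (({A, node p A B, node r C A} : Set Plane)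
        ∩ {B, node q B C, node p A B}) := by
  have hB : tdet B C A ≠ 0 := by rwa [tdet_rotate]
  have hp1 : 0 < 1 - p := by linarith [hp.2]
  have hq1 : 0 < 1 - q := by linarith [hq.2]
  have hr0 := hr.1
  -- The separating line joins `C` to the new node on `AB`: the function vanishes at both, is
  -- positive at `A` and negative at `B`.
  refine convexHull_inter_subset_of_separated
    (f := fun x => p * bary A B C x - (1 - p) * bary B C A x)
    (fun x y a b hab => by simp only [bary_affine _ _ _ hab]; ring) ?_ ?_ ?_
  · rintro y (rfl | rfl | rfl) <;>
      simp only [bary_node, bary_self h, bary_self hB, bary_second, bary_third]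
    · linarith [hp.1]
    · linarith
    · have := mul_pos hp.1 hr0; linarith
  · rintro y (rfl | rfl | rfl) <;>
      simp only [bary_node, bary_self h, bary_self hB, bary_second, bary_third]
    · linarith
    · have := mul_pos hp1 hq1; linarith
    · linarith
  · rintro y (rfl | rfl | rfl) <;>
      simp only [bary_node, bary_self h, bary_self hB, bary_second, bary_third] <;> intro hy
    · linarith [hp.1]
    · simp
    · have := mul_pos hp.1 hr0; linarith

theorem mem_corner (h : tdet A B C ≠ 0) (hp : p ∈ Ioo (0 : ℝ) 1) (hr : r ∈ Ioo (0 : ℝ) 1)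
    {x : Plane} (hx : x ∈ convexHull ℝ ({A, B, C} : Set Plane))
    (h0 : 0 ≤ bary A (node p A B) (node r C A) x) :
    x ∈ convexHull ℝ ({A, node p A B, node r C A} : Set Plane) := by
  have hr1 : 0 < 1 - r := by linarith [hr.2]
  have hc : tdet A (node p A B) (node r C A) ≠ 0 := by
    rw [tdet_corner]; exact mul_ne_zero (mul_pos hp.1 hr1).ne' h
  rw [convexHull_triple h] at hx
  rw [convexHull_triple hc]
  have e1 : bary (node p A B) (node r C A) A x = bary B C A x / p := by
    rw [bary, bary, tdet_rotate A (node p A B) (node r C A), tdet_corner, tdet_rotate A B C,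
      show tdet x (node r C A) A = (1 - r) * tdet x C A by simp only [tdet, node_apply]; ring]
    have := hp.1
    field_simp
  have e2 : bary (node r C A) A (node p A B) x = bary C A B x / (1 - r) := by
    rw [bary, bary, ← tdet_rotate (node r C A), tdet_corner, ← tdet_rotate C A B,
      show tdet x A (node p A B) = p * tdet x A B by simp only [tdet, node_apply]; ring]
    have := hp.1
    field_simp
  exact ⟨h0, by rw [e1]; exact div_nonneg hx.2.1 hp.1.le, by rw [e2]; exact div_nonneg hx.2.2 hr1.le⟩

theorem bary_center (hp : p ∈ Ioo (0 : ℝ) 1) (hq : q ∈ Ioo (0 : ℝ) 1)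
    (hr : r ∈ Ioo (0 : ℝ) 1) {x : Plane} (h0 : bary A (node p A B) (node r C A) x ≤ 0) :
    0 ≤ bary (node q B C) (node r C A) (node p A B) x := by
  have hr1 : 0 < 1 - r := by linarith [hr.2]
  have hc := center_coeff_pos hp hq hr
  rw [bary, tdet_corner, mul_comm _ (tdet A B C), ← div_div] at h0
  have h1 := (div_le_iff₀ (mul_pos hp.1 hr1)).1 h0
  rw [bary, tdet_swap x (node p A B), tdet_rotate (node p A B) (node q B C), tdet_center,
    mul_comm _ (tdet A B C), ← div_div]
  refine div_nonneg ?_ hc.le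
  rw [neg_div]; linarith

/-- Three lines through pairs of new nodes cut off the corners. A point beyond one of them lies in
that corner; a point beyond none has nonnegative coordinates in the central triangle. -/
theorem mem_corner_or_center (h : tdet A B C ≠ 0) (hp : p ∈ Ioo (0 : ℝ) 1)
    (hq : q ∈ Ioo (0 : ℝ) 1) (hr : r ∈ Ioo (0 : ℝ) 1) {x : Plane}
    (hx : x ∈ convexHull ℝ ({A, B, C} : Set Plane)) :
    x ∈ convexHull ℝ ({A, node p A B, node r C A} : Set Plane) ∨
    x ∈ convexHull ℝ ({B, node q B C, node p A B} : Set Plane) ∨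
    x ∈ convexHull ℝ ({C, node r C A, node q B C} : Set Plane) ∨
    x ∈ convexHull ℝ ({node p A B, node q B C, node r C A} : Set Plane) := by
  have hB : tdet B C A ≠ 0 := by rwa [tdet_rotate]
  have hC : tdet C A B ≠ 0 := by rwa [← tdet_rotate C A B]
  rcases le_total 0 (bary A (node p A B) (node r C A) x) with h1 | h1
  · exact Or.inl (mem_corner h hp hr hx h1)
  rcases le_total 0 (bary B (node q B C) (node p A B) x) with h2 | h2
  · refine Or.inr (Or.inl (mem_corner hB hq hp ?_ h2))
    convert hx using 2; ext; simp; tauto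
  rcases le_total 0 (bary C (node r C A) (node q B C) x) with h3 | h3
  · refine Or.inr (Or.inr (Or.inl (mem_corner hC hr hq ?_ h3)))
    convert hx using 2; ext; simp; tauto
  refine Or.inr (Or.inr (Or.inr ?_))
  have hc : tdet (node p A B) (node q B C) (node r C A) ≠ 0 := by
    rw [tdet_center]; exact mul_ne_zero (center_coeff_pos hp hq hr).ne' h
  rw [convexHull_triple hc]
  exact ⟨bary_center hr hp hq h3, bary_center hp hq hr h1, bary_center hq hr hp h2⟩

end Triangle

/-- `t` is the vertex set of a nondegenerate triangle. -/
def IsTri (t : Finset Plane) : Prop := ∃ A B C : Plane, tdet A B C ≠ 0 ∧ t = {A, B, C}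

theorem IsTri.exists_of_mem {t : Finset Plane} (ht : IsTri t) {A : Plane} (hA : A ∈ t) :
    ∃ B C : Plane, tdet A B C ≠ 0 ∧ t = {A, B, C} := by
  obtain ⟨X, Y, Z, h, rfl⟩ := ht
  simp only [Finset.mem_insert, Finset.mem_singleton] at hA
  rcases hA with rfl | rfl | rfl
  · exact ⟨Y, Z, h, rfl⟩
  · exact ⟨Z, X, by rwa [tdet_rotate], by ext; simp; tauto⟩
  · exact ⟨X, Y, by rwa [← tdet_rotate A X Y], by ext; simp; tauto⟩

theorem IsTri.exists_of_mem_of_mem {t : Finset Plane} (ht : IsTri t) {A B : Plane} (hA : A ∈ t)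
    (hB : B ∈ t) (hAB : A ≠ B) : ∃ C : Plane, tdet A B C ≠ 0 ∧ t = {A, B, C} := by
  obtain ⟨Y, Z, h, rfl⟩ := ht.exists_of_mem hA
  simp only [Finset.mem_insert, Finset.mem_singleton] at hB
  rcases hB with rfl | rfl | rfl
  · exact absurd rfl hAB
  · exact ⟨Z, h, rfl⟩
  · exact ⟨Y, by rw [tdet_swap]; exact neg_ne_zero.2 h, by ext; simp; tauto⟩

theorem IsTri.card {t : Finset Plane} (ht : IsTri t) : t.card = 3 := by
  obtain ⟨A, B, C, h, rfl⟩ := ht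
  obtain ⟨h1, h2, h3⟩ := tdet_ne_zero_distinct h
  exact Finset.card_eq_three.2 ⟨A, B, C, h1, h2, h3, rfl⟩

/-- A conforming mesh of triangles covering `S`. -/
structure IsTriMesh (T : Set (Finset Plane)) (S : Set Plane) : Prop where
  finite : T.Finite
  isTri : ∀ t ∈ T, IsTri t
  conforming : ∀ s ∈ T, ∀ t ∈ T,
    convexHull ℝ (s : Set Plane) ∩ convexHull ℝ (t : Set Plane)
      ⊆ convexHull ℝ ((s : Set Plane) ∩ (t : Set Plane))
  cover : ⋃ t ∈ T, convexHull ℝ (t : Set Plane) = S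

/-- The division of `t` into four triangles by the new nodes `D A B`. -/
def refineTri (D : Plane → Plane → Plane) (t : Finset Plane) : Set (Finset Plane) :=
  {s | (∃ A ∈ t, s = t.image (D A)) ∨ s = t.offDiag.image (fun e => D e.1 e.2)}

/-- `D` places one node in the interior of each edge of `t`. -/
def IsEdgeSplit (D : Plane → Plane → Plane) (t : Finset Plane) : Prop :=
  ∀ A ∈ t, ∀ B ∈ t, D A A = A ∧ D A B = D B A ∧
    (A ≠ B → ∃ p ∈ Ioo (0 : ℝ) 1, D A B = node p A B)

theorem refineTri_triple {D : Plane → Plane → Plane} {A B C : Plane} (h : tdet A B C ≠ 0)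
    (hD : IsEdgeSplit D {A, B, C}) {s : Finset Plane} : s ∈ refineTri D {A, B, C} ↔
      s = {A, D A B, D C A} ∨ s = {B, D B C, D A B} ∨ s = {C, D C A, D B C} ∨
        s = {D A B, D B C, D C A} := by
  obtain ⟨h1, h2, h3⟩ := tdet_ne_zero_distinct h
  obtain ⟨aa, ab, -⟩ := hD A (by simp) B (by simp)
  obtain ⟨bb, bc, -⟩ := hD B (by simp) C (by simp)
  obtain ⟨cc, ca, -⟩ := hD C (by simp) A (by simp)
  have eA : ({A, B, C} : Finset Plane).image (D A) = {A, D A B, D C A} := by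
    rw [Finset.image_insert, Finset.image_insert, Finset.image_singleton, aa, ca]
  have eB : ({A, B, C} : Finset Plane).image (D B) = {B, D B C, D A B} := by
    rw [Finset.image_insert, Finset.image_insert, Finset.image_singleton, bb, ab]
    ext; simp; tauto
  have eC : ({A, B, C} : Finset Plane).image (D C) = {C, D C A, D B C} := by
    rw [Finset.image_insert, Finset.image_insert, Finset.image_singleton, cc, bc]
    ext; simp; tauto
  have eD : ({A, B, C} : Finset Plane).offDiag.image (fun e => D e.1 e.2)
      = {D A B, D B C, D C A} := by
    ext x
    simp only [Finset.mem_image, Finset.mem_offDiag, Finset.mem_insert, Finset.mem_singleton,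
      Prod.exists]
    constructor
    · rintro ⟨P, R, ⟨rfl | rfl | rfl, rfl | rfl | rfl, hne⟩, rfl⟩ <;> simp_all
    · rintro (rfl | rfl | rfl)
      · exact ⟨A, B, by simp [h1], rfl⟩
      · exact ⟨B, C, by simp [h3], rfl⟩
      · exact ⟨C, A, by simp [h2.symm], rfl⟩
  simp only [refineTri, mem_ofPred_eq, Finset.mem_insert, Finset.mem_singleton]
  rw [eD]
  constructor
  · rintro (⟨P, rfl | rfl | rfl, rfl⟩ | h)
    · exact Or.inl eA
    · exact Or.inr (Or.inl eB)
    · exact Or.inr (Or.inr (Or.inl eC))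
    · exact Or.inr (Or.inr (Or.inr h))
  · rintro (rfl | rfl | rfl | h)
    · exact Or.inl ⟨A, by simp, eA.symm⟩
    · exact Or.inl ⟨B, by simp, eB.symm⟩
    · exact Or.inl ⟨C, by simp, eC.symm⟩
    · exact Or.inr h

theorem IsEdgeSplit.exists_params {D : Plane → Plane → Plane} {A B C : Plane}
    (h : tdet A B C ≠ 0) (hD : IsEdgeSplit D {A, B, C}) :
    ∃ p ∈ Ioo (0 : ℝ) 1, ∃ q ∈ Ioo (0 : ℝ) 1, ∃ r ∈ Ioo (0 : ℝ) 1,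
      D A B = node p A B ∧ D B C = node q B C ∧ D C A = node r C A := by
  obtain ⟨h1, h2, h3⟩ := tdet_ne_zero_distinct h
  obtain ⟨p, hp, ep⟩ := (hD A (by simp) B (by simp)).2.2 h1
  obtain ⟨q, hq, eq⟩ := (hD B (by simp) C (by simp)).2.2 h3
  obtain ⟨r, hr, er⟩ := (hD C (by simp) A (by simp)).2.2 h2.symm
  exact ⟨p, hp, q, hq, r, hr, ep, eq, er⟩

theorem isTri_of_mem_refineTri {D : Plane → Plane → Plane} {t : Finset Plane} (ht : IsTri t)
    (hD : IsEdgeSplit D t) {s : Finset Plane} (hs : s ∈ refineTri D t) : IsTri s := by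
  obtain ⟨A, B, C, h, rfl⟩ := ht
  obtain ⟨p, hp, q, hq, r, hr, ep, eq, er⟩ := hD.exists_params h
  have hB : tdet B C A ≠ 0 := by rwa [tdet_rotate]
  have hC : tdet C A B ≠ 0 := by rwa [← tdet_rotate C A B]
  have hc := center_coeff_pos hp hq hr
  rw [refineTri_triple h hD, ep, eq, er] at hs
  have key : ∀ {p r : ℝ}, p ∈ Ioo (0 : ℝ) 1 → r ∈ Ioo (0 : ℝ) 1 → p * (1 - r) ≠ 0 :=
    fun hp hr => (mul_pos hp.1 (by linarith [hr.2])).ne'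
  rcases hs with rfl | rfl | rfl | rfl
  · exact ⟨_, _, _, by rw [tdet_corner]; exact mul_ne_zero (key hp hr) h, rfl⟩
  · exact ⟨_, _, _, by rw [tdet_corner]; exact mul_ne_zero (key hq hp) hB, rfl⟩
  · exact ⟨_, _, _, by rw [tdet_corner]; exact mul_ne_zero (key hr hq) hC, rfl⟩
  · exact ⟨_, _, _, by rw [tdet_center]; exact mul_ne_zero hc.ne' h, rfl⟩

theorem iUnion_refineTri {D : Plane → Plane → Plane} {t : Finset Plane} (ht : IsTri t)
    (hD : IsEdgeSplit D t) :
    ⋃ s ∈ refineTri D t, convexHull ℝ (s : Set Plane) = convexHull ℝ (t : Set Plane) := by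
  obtain ⟨A, B, C, h, rfl⟩ := ht
  obtain ⟨p, hp, q, hq, r, hr, ep, eq, er⟩ := hD.exists_params h
  apply Subset.antisymm
  · refine iUnion₂_subset fun s hs => convexHull_min ?_ (convex_convexHull ℝ _)
    rw [refineTri_triple h hD, ep, eq, er] at hs
    have hA : A ∈ convexHull ℝ (({A, B, C} : Finset Plane) : Set Plane) :=
      subset_convexHull ℝ _ (by simp)
    have hB : B ∈ convexHull ℝ (({A, B, C} : Finset Plane) : Set Plane) :=
      subset_convexHull ℝ _ (by simp)
    have hC : C ∈ convexHull ℝ (({A, B, C} : Finset Plane) : Set Plane) :=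
      subset_convexHull ℝ _ (by simp)
    have n1 := node_mem_convexHull hp hA hB
    have n2 := node_mem_convexHull hq hB hC
    have n3 := node_mem_convexHull hr hC hA
    rcases hs with rfl | rfl | rfl | rfl <;>
      simp only [Finset.coe_insert, Finset.coe_singleton] at * <;>
      rintro x (rfl | rfl | rfl) <;> assumption
  · intro x hx
    have := mem_corner_or_center h hp hq hr (by simpa using hx)
    simp only [mem_iUnion, refineTri_triple h hD, ep, eq, er, exists_prop]
    rcases this with h1 | h1 | h1 | h1
    · exact ⟨_, Or.inl rfl, by simpa using h1⟩
    · exact ⟨_, Or.inr (Or.inl rfl), by simpa using h1⟩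
    · exact ⟨_, Or.inr (Or.inr (Or.inl rfl)), by simpa using h1⟩
    · exact ⟨_, Or.inr (Or.inr (Or.inr rfl)), by simpa using h1⟩

theorem refineTri_conforming {D : Plane → Plane → Plane} {t : Finset Plane} (ht : IsTri t)
    (hD : IsEdgeSplit D t) {s s' : Finset Plane} (hs : s ∈ refineTri D t)
    (hs' : s' ∈ refineTri D t) :
    convexHull ℝ (s : Set Plane) ∩ convexHull ℝ (s' : Set Plane)
      ⊆ convexHull ℝ ((s : Set Plane) ∩ (s' : Set Plane)) := by
  obtain ⟨A, B, C, h, rfl⟩ := ht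
  obtain ⟨p, hp, q, hq, r, hr, ep, eq, er⟩ := hD.exists_params h
  have hB : tdet B C A ≠ 0 := by rwa [tdet_rotate]
  have hC : tdet C A B ≠ 0 := by rwa [← tdet_rotate C A B]
  rw [refineTri_triple h hD, ep, eq, er] at hs hs'
  have hcomm : ∀ s s' : Set Plane, convexHull ℝ s ∩ convexHull ℝ s' ⊆ convexHull ℝ (s ∩ s') →
      convexHull ℝ s' ∩ convexHull ℝ s ⊆ convexHull ℝ (s' ∩ s) := fun s s' h => by
    rwa [inter_comm (convexHull ℝ s'), inter_comm s']
  have r1 : ({node p A B, node q B C, node r C A} : Set Plane)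
    = {node q B C, node r C A, node p A B} := by ext; simp; tauto
  have r2 : ({node p A B, node q B C, node r C A} : Set Plane)
    = {node r C A, node p A B, node q B C} := by ext; simp; tauto
  have cA := corner_inter_center h hp hq hr
  have cB := corner_inter_center hB hq hr hp
  have cC := corner_inter_center hC hr hp hq
  rw [← r1] at cB
  rw [← r2] at cC
  have cAB := corner_inter_corner h hp hq hr
  have cBC := corner_inter_corner hB hq hr hp
  have cCA := corner_inter_corner hC hr hp hq
  rcases hs with rfl | rfl | rfl | rfl <;> rcases hs' with rfl | rfl | rfl | rfl <;>
    simp only [Finset.coe_insert, Finset.coe_singleton] <;>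
    first
      | (rw [inter_self, inter_self])
      | assumption
      | (apply hcomm _ _; assumption)

/-- The part of a refined triangle lying on an edge of the original one. -/
theorem mem_edge_of_mem_refineTri {D : Plane → Plane → Plane} {A B C : Plane}
    (h : tdet A B C ≠ 0) (hD : IsEdgeSplit D {A, B, C}) {s : Finset Plane}
    (hs : s ∈ refineTri D {A, B, C}) {x : Plane} (hx : x ∈ convexHull ℝ (s : Set Plane))
    (hxC : bary C A B x = 0) :
    (A ∈ s ∧ D A B ∈ s ∧ x ∈ convexHull ℝ {A, D A B}) ∨
    (B ∈ s ∧ D A B ∈ s ∧ x ∈ convexHull ℝ {B, D A B}) ∨ (D A B ∈ s ∧ x = D A B) := by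
  obtain ⟨p, hp, q, hq, r, hr, ep, eq, er⟩ := hD.exists_params h
  have hB : tdet B C A ≠ 0 := by rwa [tdet_rotate]
  have hC : tdet C A B ≠ 0 := by rwa [← tdet_rotate C A B]
  rw [refineTri_triple h hD, ep, eq, er] at hs
  rw [ep]
  have e1 : bary C A B (node p A B) = 0 := by rw [bary_node, bary_second, bary_third]; ring
  have e2 : bary C A B (node q B C) = q := by rw [bary_node, bary_third, bary_self hC]; ring
  have e3 : bary C A B (node r C A) = 1 - r := by rw [bary_node, bary_second, bary_self hC]; ring
  have q0 := hq.1
  have r0 : 0 < 1 - r := by linarith [hr.2]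
  -- The edge `AB` is the face on which `bary C A B` vanishes, so `x` lies in the hull of those
  -- vertices of the piece that are on the edge.
  have key : ∀ {u : Set Plane}, (∀ y ∈ u, 0 ≤ bary C A B y) → x ∈ convexHull ℝ u →
      x ∈ convexHull ℝ {y ∈ u | bary C A B y = 0} := fun hu hxu =>
    (mem_convexHull_face (fun x y a b hab => bary_affine C A B hab) hu hxu).2 hxC.le
  rcases hs with rfl | rfl | rfl | rfl <;>
    simp only [Finset.coe_insert, Finset.coe_singleton] at hx <;> have hx' := key ?_ hx
  · refine Or.inl ⟨by simp, by simp, convexHull_mono ?_ hx'⟩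
    rintro y ⟨rfl | rfl | rfl, hy⟩
    · simp
    · simp
    · linarith
  · rintro y (rfl | rfl | rfl)
    · rw [bary_second]
    · rw [e1]
    · rw [e3]; exact r0.le
  · refine Or.inr (Or.inl ⟨by simp, by simp, convexHull_mono ?_ hx'⟩)
    rintro y ⟨rfl | rfl | rfl, hy⟩
    · simp
    · linarith
    · simp
  · rintro y (rfl | rfl | rfl)
    · rw [bary_third]
    · rw [e2]; exact q0.le
    · rw [e1]
  · exfalso
    have : {y ∈ ({C, node r C A, node q B C} : Set Plane) | bary C A B y = 0} = ∅ := by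
      ext y
      simp only [mem_ofPred_eq, mem_empty_iff_false, iff_false]
      rintro ⟨rfl | rfl | rfl, hy⟩
      · rw [bary_self hC] at hy; exact one_ne_zero hy
      · linarith
      · linarith
    rw [this, convexHull_empty] at hx'
    exact hx'
  · rintro y (rfl | rfl | rfl)
    · rw [bary_self hC]; exact zero_le_one
    · rw [e3]; exact r0.le
    · rw [e2]; exact q0.le
  · refine Or.inr (Or.inr ⟨by simp, ?_⟩)
    rw [← mem_singleton_iff, ← convexHull_singleton (𝕜 := ℝ)]
    refine convexHull_mono ?_ hx'
    rintro y ⟨rfl | rfl | rfl, hy⟩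
    · simp
    · linarith
    · linarith
  · rintro y (rfl | rfl | rfl)
    · rw [e1]
    · rw [e2]; exact q0.le
    · rw [e3]; exact r0.le

theorem mem_of_mem_convexHull_refineTri {D : Plane → Plane → Plane} {A B C : Plane}
    (h : tdet A B C ≠ 0) (hD : IsEdgeSplit D {A, B, C}) {s : Finset Plane}
    (hs : s ∈ refineTri D {A, B, C}) (hx : A ∈ convexHull ℝ (s : Set Plane)) : A ∈ s := by
  obtain ⟨p, hp, q, hq, r, hr, ep, eq, er⟩ := hD.exists_params h
  have hne : A ≠ node p A B := fun e => by
    have := bary_node A B C p A B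
    rw [← e, bary_self h, bary_second] at this
    linarith [hp.1]
  have hBA : bary A B C (node p A B) < 1 := by
    rw [bary_node, bary_self h, bary_second]; linarith [hp.1]
  have hBC : bary A B C (node q B C) < 1 := by
    rw [bary_node, bary_third, bary_second]; linarith
  have hCA : bary A B C (node r C A) < 1 := by
    rw [bary_node, bary_third, bary_self h]; linarith [hr.2]
  by_contra hA
  have hlt : ∀ y ∈ s, bary A B C y < 1 := by
    intro y hy
    rw [refineTri_triple h hD, ep, eq, er] at hs
    rcases hs with rfl | rfl | rfl | rfl
    · simp at hA
    all_goals
      simp only [Finset.mem_insert, Finset.mem_singleton] at hy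
      rcases hy with rfl | rfl | rfl <;> first | assumption | simp [bary_second, bary_third]
  have hsub : convexHull ℝ (s : Set Plane) ⊆ {y | bary A B C y < 1} := by
    refine convexHull_min hlt fun y hy z hz a b ha hb hab => ?_
    simp only [mem_ofPred_eq, bary_affine _ _ _ hab] at hy hz ⊢
    rcases ha.eq_or_lt with rfl | ha'
    · obtain rfl : b = 1 := by linarith
      linarith
    · nlinarith
  have := hsub hx
  rw [mem_ofPred_eq, bary_self h] at this
  exact lt_irrefl _ this

theorem node_of_mem_halves {A B x : Plane} {p : ℝ} (hp : p ∈ Ioo (0 : ℝ) 1)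
    (hAB : A ≠ B)
    (hA : x ∈ convexHull ℝ ({A, node p A B} : Set Plane))
    (hB : x ∈ convexHull ℝ ({B, node p A B} : Set Plane)) : x = node p A B := by
  rw [convexHull_pair, segment_eq_image] at hA hB
  obtain ⟨a, ⟨ha0, ha1⟩, rfl⟩ := hA
  obtain ⟨b, ⟨hb0, hb1⟩, e⟩ := hB
  obtain ⟨i, hi⟩ : ∃ i, A i ≠ B i := by
    by_contra! hcon
    exact hAB (by ext i; exact hcon i)
  have e1 := congrArg (fun y : Plane => y i) e
  simp only [PiLp.add_apply, PiLp.smul_apply, smul_eq_mul, node_apply] at e1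
  have e2 : (A i - B i) * ((1 - a * p) - b * (1 - p)) = 0 := by linarith
  have e3 : (1 - a * p) - b * (1 - p) = 0 := by
    rcases mul_eq_zero.1 e2 with h | h
    · exact absurd (sub_eq_zero.1 h) hi
    · exact h
  have h1 := mul_le_mul_of_nonneg_right hb1 (by linarith [hp.2] : (0 : ℝ) ≤ 1 - p)
  obtain rfl : a = 1 := le_antisymm ha1 (by by_contra! h; nlinarith [hp.1])
  simp

/-- Pieces of different triangles meet inside the hull of the common vertices, which is an edge, a
vertex or empty. Along a common edge both subdivisions induce the same two halves, because the node
`D A B` depends only on the edge. -/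
theorem IsTriMesh.refine {T : Set (Finset Plane)} {S : Set Plane} (hT : IsTriMesh T S)
    {D : Plane → Plane → Plane} (hD : ∀ t ∈ T, IsEdgeSplit D t) :
    IsTriMesh (⋃ t ∈ T, refineTri D t) S where
  finite := by
    refine hT.finite.biUnion fun t ht => ?_
    obtain ⟨A, B, C, h, rfl⟩ := hT.isTri t ht
    refine Set.Finite.subset (Set.toFinite ({{A, D A B, D C A}, {B, D B C, D A B},
      {C, D C A, D B C}, {D A B, D B C, D C A}} : Set (Finset Plane))) fun s hs => ?_
    simpa using (refineTri_triple h (hD _ ht)).1 hs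
  isTri s hs := by
    simp only [mem_iUnion] at hs
    obtain ⟨t, ht, hs⟩ := hs
    exact isTri_of_mem_refineTri (hT.isTri t ht) (hD t ht) hs
  cover := by
    rw [← hT.cover]
    simp only [biUnion_iUnion]
    exact iUnion₂_congr fun t ht => iUnion_refineTri (hT.isTri t ht) (hD t ht)
  conforming s' hs' t' ht' := by
    simp only [mem_iUnion] at hs' ht'
    obtain ⟨s, hs, hs'⟩ := hs'
    obtain ⟨t, ht, ht'⟩ := ht'
    by_cases hst : s = t
    · subst hst
      exact refineTri_conforming (hT.isTri s hs) (hD s hs) hs' ht'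
    rintro x ⟨hx1, hx2⟩
    have hxs : x ∈ convexHull ℝ (s : Set Plane) := by
      rw [← iUnion_refineTri (hT.isTri s hs) (hD s hs)]
      exact mem_iUnion₂.2 ⟨s', hs', hx1⟩
    have hxt : x ∈ convexHull ℝ (t : Set Plane) := by
      rw [← iUnion_refineTri (hT.isTri t ht) (hD t ht)]
      exact mem_iUnion₂.2 ⟨t', ht', hx2⟩
    have hxst := hT.conforming s hs t ht ⟨hxs, hxt⟩
    -- Distinct triangles have equally many vertices, so some vertex `C` of `s` is not in `t`; the
    -- shared vertices are then among the other two.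
    obtain ⟨C, hCs, hCt⟩ : ∃ C ∈ s, C ∉ t := by
      by_contra! hcon
      exact hst (Finset.eq_of_subset_of_card_le hcon
        (by rw [(hT.isTri s hs).card, (hT.isTri t ht).card]))
    obtain ⟨A, B, h, rfl⟩ := (hT.isTri s hs).exists_of_mem hCs
    have hvertex : ∀ P, P ∈ ({C, A, B} : Finset Plane) → P ∈ t →
        (∀ y ∈ ({C, A, B} : Finset Plane), y ∈ t → y = P) →
        x ∈ convexHull ℝ ((s' : Set Plane) ∩ t') := by
      intro P hPs hPt hP
      have hxP : x = P := by
        rw [← mem_singleton_iff, ← convexHull_singleton (𝕜 := ℝ)]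
        refine convexHull_mono ?_ hxst
        rintro y ⟨hy1, hy2⟩
        exact hP y (by exact_mod_cast hy1) (by exact_mod_cast hy2)
      subst hxP
      refine subset_convexHull ℝ _ ⟨?_, ?_⟩
      · obtain ⟨Y, Z, h', e⟩ := (hT.isTri _ hs).exists_of_mem hPs
        rw [e] at hs'
        exact mem_of_mem_convexHull_refineTri h' (e ▸ hD _ hs) hs' hx1
      · obtain ⟨Y, Z, h', e⟩ := (hT.isTri _ ht).exists_of_mem hPt
        rw [e] at ht'
        exact mem_of_mem_convexHull_refineTri h' (e ▸ hD _ ht) ht' hx2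
    obtain ⟨n1, n2, n3⟩ := tdet_ne_zero_distinct h
    by_cases hA : A ∈ t
    · by_cases hB : B ∈ t
      · have hAs : A ∈ ({C, A, B} : Finset Plane) := by simp
        have hBs : B ∈ ({C, A, B} : Finset Plane) := by simp
        have hon : ∀ u ∈ T, ∀ u' ∈ refineTri D u, A ∈ u → B ∈ u →
            x ∈ convexHull ℝ (u' : Set Plane) →
            (A ∈ u' ∧ D A B ∈ u' ∧ x ∈ convexHull ℝ {A, D A B}) ∨
            (B ∈ u' ∧ D A B ∈ u' ∧ x ∈ convexHull ℝ {B, D A B}) ∨ (D A B ∈ u' ∧ x = D A B) := by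
          intro u hu u' hu' hAu hBu hxu
          obtain ⟨Z, h', rfl⟩ := (hT.isTri u hu).exists_of_mem_of_mem hAu hBu n3
          refine mem_edge_of_mem_refineTri h' (hD _ hu) hu' hxu ?_
          have hxAB : x ∈ convexHull ℝ ({A, B} : Set Plane) := by
            refine convexHull_mono ?_ hxst
            rintro y ⟨hy1, hy2⟩
            simp only [Finset.coe_insert, Finset.coe_singleton] at hy1
            rcases hy1 with rfl | rfl | rfl
            · exact absurd (by exact_mod_cast hy2) hCt
            · simp
            · simp
          have hsub : convexHull ℝ ({A, B} : Set Plane) ⊆ {y | bary Z A B y = 0} := by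
            refine convexHull_min ?_ fun y hy z hz a b ha hb hab => ?_
            · rintro y (rfl | rfl)
              · exact bary_second _ _ _
              · exact bary_third _ _ _
            · simp only [mem_ofPred_eq, bary_affine _ _ _ hab] at hy hz ⊢
              rw [hy, hz]; ring
          exact hsub hxAB
        obtain ⟨p, hp, ep⟩ := (hD _ hs A hAs B hBs).2.2 n3
        have hpair : ∀ P, P ∈ s' → P ∈ t' → D A B ∈ s' → D A B ∈ t' →
            x ∈ convexHull ℝ {P, D A B} → x ∈ convexHull ℝ ((s' : Set Plane) ∩ t') := by
          intro P h1 h2 h3 h4 hx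
          refine convexHull_mono ?_ hx
          rintro y (rfl | rfl)
          · exact ⟨h1, h2⟩
          · exact ⟨h3, h4⟩
        have hsing : D A B ∈ s' → D A B ∈ t' → x = D A B →
            x ∈ convexHull ℝ ((s' : Set Plane) ∩ t') := by
          rintro h1 h2 rfl
          exact subset_convexHull ℝ _ ⟨h1, h2⟩
        -- If both pieces contain the same half of the edge, they share its two endpoints; if they
        -- contain opposite halves, `x` is the node itself.
        rcases hon _ hs s' hs' hAs hBs hx1 with ⟨a1, a2, a3⟩ | ⟨a1, a2, a3⟩ | ⟨a1, a2⟩ <;>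
          rcases hon _ ht t' ht' hA hB hx2 with ⟨b1, b2, b3⟩ | ⟨b1, b2, b3⟩ | ⟨b1, b2⟩
        · exact hpair A a1 b1 a2 b2 a3
        · exact hsing a2 b2 (by rw [ep] at *; exact node_of_mem_halves hp n3 a3 b3)
        · exact hsing a2 b1 b2
        · exact hsing a2 b2 (by rw [ep] at *; exact node_of_mem_halves hp n3 b3 a3)
        · exact hpair B a1 b1 a2 b2 a3
        · exact hsing a2 b1 b2
        · exact hsing a1 b2 a2
        · exact hsing a1 b2 a2
        · exact hsing a1 b1 a2
      · refine hvertex A (by simp) hA fun y hy hyt => ?_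
        simp only [Finset.mem_insert, Finset.mem_singleton] at hy
        rcases hy with rfl | rfl | rfl
        · exact absurd hyt hCt
        · rfl
        · exact absurd hyt hB
    · by_cases hB : B ∈ t
      · refine hvertex B (by simp) hB fun y hy hyt => ?_
        simp only [Finset.mem_insert, Finset.mem_singleton] at hy
        rcases hy with rfl | rfl | rfl
        · exact absurd hyt hCt
        · exact absurd hyt hA
        · rfl
      · exfalso
        have : (({C, A, B} : Finset Plane) : Set Plane) ∩ t = ∅ := by
          ext y
          simp only [mem_inter_iff, Finset.mem_coe, Finset.mem_insert, Finset.mem_singleton,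
            mem_empty_iff_false, iff_false]
          rintro ⟨rfl | rfl | rfl, hy⟩ <;> contradiction
        rw [this, convexHull_empty] at hxst
        exact hxst

/-! ### Triangulations and the vertices of the domain -/

theorem tdet_ne_zero_of_affineIndependent {A B C : Plane} (hAB : A ≠ B) (hAC : A ≠ C) (hBC : B ≠ C)
    (h : AffineIndependent ℝ ((↑) : ({A, B, C} : Finset Plane) → Plane)) : tdet A B C ≠ 0 := by
  intro h0
  have hinj : Function.Injective (![⟨A, by simp⟩, ⟨B, by simp⟩, ⟨C, by simp⟩] :
      Fin 3 → ({A, B, C} : Finset Plane)) := by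
    intro i j hij
    have := congrArg Subtype.val hij
    fin_cases i <;> fin_cases j <;>
      first
        | rfl
        | exact (hAB this).elim
        | exact (hAB this.symm).elim
        | exact (hAC this).elim
        | exact (hAC this.symm).elim
        | exact (hBC this).elim
        | exact (hBC this.symm).elim
  have h1 := h.comp_embedding ⟨_, hinj⟩
  rw [affineIndependent_iff_not_collinear] at h1
  apply h1
  refine (collinear_iff_of_mem (p₀ := A) (mem_range.2 ⟨0, rfl⟩)).2 ⟨B - A, ?_⟩
  rintro _ ⟨j, rfl⟩
  fin_cases j
  · exact ⟨0, by simp⟩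
  · exact ⟨1, by simp⟩
  · obtain ⟨i, hi⟩ : ∃ i, B i - A i ≠ 0 := by
      by_contra! hcon
      exact hAB (by ext i; linarith [hcon i])
    refine ⟨(C i - A i) / (B i - A i), ?_⟩
    change C = _ + A
    ext l
    have h2 : (B l - A l) * (C i - A i) = (B i - A i) * (C l - A l) := by
      unfold tdet at h0
      fin_cases i <;> fin_cases l <;> simp <;> linarith
    simp only [PiLp.add_apply, PiLp.smul_apply, PiLp.sub_apply, smul_eq_mul]
    rw [div_mul_eq_mul_div, mul_comm (C i - A i), h2, mul_div_cancel_left₀ _ hi]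
    ring

theorem IsTriangulation.isTriMesh {T : Set (Finset Plane)} {S : Set Plane}
    (hT : IsTriangulation T S) : IsTriMesh T S where
  finite := hT.finite
  isTri t ht := by
    obtain ⟨A, B, C, h1, h2, h3, rfl⟩ := Finset.card_eq_three.1 (hT.card_eq t ht)
    exact ⟨A, B, C, tdet_ne_zero_of_affineIndependent h1 h2 h3 (hT.affineIndependent _ ht), rfl⟩
  conforming s hs t ht := (hT.conforming s hs t ht).subset
  cover := hT.cover

theorem IsTriMesh.isCompact {T : Set (Finset Plane)} {S : Set Plane} (hT : IsTriMesh T S)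
    {t : Finset Plane} (ht : t ∈ T) : IsCompact (convexHull ℝ (t : Set Plane)) := by
  obtain ⟨A, B, C, -, rfl⟩ := hT.isTri t ht
  simpa using isCompact_convexHull_triple A B C

theorem IsTriMesh.subset {T : Set (Finset Plane)} {S : Set Plane} (hT : IsTriMesh T S)
    {t : Finset Plane} (ht : t ∈ T) : convexHull ℝ (t : Set Plane) ⊆ S := by
  rw [← hT.cover]; exact subset_biUnion_of_mem (u := fun t : Finset Plane =>
    convexHull ℝ (t : Set Plane)) ht

theorem IsTriMesh.eventually_mem {T : Set (Finset Plane)} {S : Set Plane} (hT : IsTriMesh T S)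
    (x : Plane) : ∀ᶠ y in 𝓝 x, ∀ t ∈ T, y ∈ convexHull ℝ (t : Set Plane) →
      x ∈ convexHull ℝ (t : Set Plane) := by
  rw [Filter.eventually_all_finite hT.finite]
  intro t ht
  by_cases hx : x ∈ convexHull ℝ (t : Set Plane)
  · exact Eventually.of_forall fun _ _ => hx
  · filter_upwards [(hT.isCompact ht).isClosed.isOpen_compl.mem_nhds hx] with y hy hy'
    exact absurd hy' hy

/-- If the closure is locally a closed half-plane, then `interior (closure Ω) = Ω` makes `Ω` locally
the open half-plane, so the boundary is locally the line through `A` and `B`. -/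
theorem notMem_domainVertices_of_halfplane {Ω : Set Plane} (hreg : interior (closure Ω) = Ω)
    {A B C q : Plane} (h : tdet C A B ≠ 0) (hq : bary C A B q = 0)
    (hev : ∀ᶠ y in 𝓝 q, (y ∈ closure Ω ↔ 0 ≤ bary C A B y)) : q ∉ domainVertices Ω := by
  rintro ⟨-, hno⟩
  apply hno
  obtain ⟨ε, hε, hball⟩ := Metric.eventually_nhds_iff_ball.1 hev
  have hAB := (tdet_ne_zero_distinct h).2.2
  refine ⟨ε, hε, B - A, sub_ne_zero.2 hAB.symm, ?_⟩
  have hΩ : ∀ y ∈ Metric.ball q ε, (y ∈ Ω ↔ 0 < bary C A B y) := by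
    intro y hy
    rw [← hreg, mem_interior_iff_mem_nhds]
    constructor
    · intro hn
      refine lt_of_le_of_ne ((hball y hy).1 (subset_closure (by
        rw [← hreg]; exact mem_interior_iff_mem_nhds.2 hn))) fun h0 => ?_
      have ht : Tendsto (fun t : ℝ => y + t • (A - C)) (𝓝[>] 0) (𝓝 y) := by
        have : Tendsto (fun t : ℝ => y + t • (A - C)) (𝓝 0) (𝓝 (y + (0 : ℝ) • (A - C))) :=
          Continuous.tendsto (by fun_prop) 0
        simp only [zero_smul, add_zero] at this
        exact this.mono_left nhdsWithin_le_nhds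
      obtain ⟨t, ⟨h1, h2⟩, h3⟩ := (((ht.eventually hn).and
        (ht.eventually (Metric.isOpen_ball.mem_nhds hy))).and self_mem_nhdsWithin).exists
      have h3' : 0 < t := h3
      have h4 := (hball _ h2).1 h1
      have e : bary C A B (y + t • (A - C)) = bary C A B y - t := by
        have : y + t • (A - C) = (1 : ℝ) • y + t • A + (-t) • C := by module
        unfold bary
        field_simp
        simp only [tdet, PiLp.add_apply, PiLp.smul_apply, PiLp.sub_apply, smul_eq_mul]
        ring
      linarith
    · intro h0
      filter_upwards [Metric.isOpen_ball.mem_nhds hy,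
        (isOpen_lt continuous_const (continuous_bary C A B)).mem_nhds h0] with z hz hz'
      exact (hball z hz).2 (le_of_lt hz')
  have hopen : IsOpen Ω := by rw [← hreg]; exact isOpen_interior
  ext y
  simp only [mem_inter_iff, mem_range]
  refine and_congr_left fun hy => ?_
  rw [hopen.frontier_eq, Set.mem_sdiff, hball y hy, hΩ y hy]
  constructor
  · rintro ⟨h1, h2⟩
    have hy0 : bary C A B y = 0 := le_antisymm (not_lt.1 h2) h1
    have e1 := bary_combo h y
    have e2 := bary_combo h q
    have s1 := bary_sum h y
    have s2 := bary_sum h q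
    rw [hy0] at e1 s1
    rw [hq] at e2 s2
    refine ⟨bary B C A y - bary B C A q, ?_⟩
    rw [show bary A B C y = 1 - bary B C A y by linarith] at e1
    rw [show bary A B C q = 1 - bary B C A q by linarith] at e2
    set b := bary B C A y
    set b' := bary B C A q
    rw [e1, e2]
    module
  · rintro ⟨t, rfl⟩
    have : bary C A B (q + t • (B - A)) = 0 := by
      have h5 : bary C A B (q + t • (B - A)) = bary C A B q := by
        unfold bary
        congr 1
        simp only [tdet, PiLp.add_apply, PiLp.smul_apply, PiLp.sub_apply, smul_eq_mul]
        ring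
      rw [h5, hq]
    rw [this]; simp

theorem mem_of_mem_convexHull_of_bary_pos {A B C : Plane} (h : tdet A B C ≠ 0) {x : Plane}
    {s : Set Plane} (hs : s ⊆ {A, B, C}) (hx : x ∈ convexHull ℝ s) (h0 : 0 < bary A B C x) :
    A ∈ s := by
  by_contra hA
  have : convexHull ℝ s ⊆ {y | bary A B C y = 0} := by
    refine convexHull_min (fun y hy => ?_) fun y hy z hz a b ha hb hab => ?_
    · rcases hs hy with rfl | rfl | rfl
      · exact absurd hy hA
      · exact bary_second _ _ _
      · exact bary_third _ _ _
    · simp only [mem_ofPred_eq, bary_affine _ _ _ hab] at hy hz ⊢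
      rw [hy, hz]; ring
  exact h0.ne' (this hx)

/-- A vertex of the domain is not in the relative interior of an edge of the mesh. -/
theorem IsTriMesh.false_of_mem_edge {Ω : Set Plane} (hreg : interior (closure Ω) = Ω)
    {T : Set (Finset Plane)} (hT : IsTriMesh T (closure Ω)) {q : Plane}
    (hq : q ∈ domainVertices Ω) {A B C : Plane} (h : tdet A B C ≠ 0) (ht : {A, B, C} ∈ T)
    (hA : 0 < bary A B C q) (hB : 0 < bary B C A q) (hC : bary C A B q = 0) : False := by
  have hopen : IsOpen Ω := by rw [← hreg]; exact isOpen_interior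
  have hB' : tdet B C A ≠ 0 := by rwa [tdet_rotate]
  have hC' : tdet C A B ≠ 0 := by rwa [← tdet_rotate C A B]
  obtain ⟨hAB, -, -⟩ := tdet_ne_zero_distinct h
  have hqΩ : q ∉ Ω := by
    have := hq.1
    rw [hopen.frontier_eq] at this
    exact this.2
  have hqt : q ∈ convexHull ℝ (({A, B, C} : Finset Plane) : Set Plane) := by
    simp only [Finset.coe_insert, Finset.coe_singleton]
    rw [convexHull_triple h]
    exact ⟨hA.le, hB.le, hC.ge⟩
  -- By conformity `q` lies in the hull of the vertices common to both triangles; as `q` has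
  -- positive coordinates at `A` and `B`, both are common vertices.
  have hshare : ∀ s ∈ T, q ∈ convexHull ℝ (s : Set Plane) →
      ∃ C', tdet A B C' ≠ 0 ∧ s = {A, B, C'} := by
    intro s hs hqs
    have hmem := hT.conforming _ ht s hs ⟨hqt, hqs⟩
    refine (hT.isTri s hs).exists_of_mem_of_mem (A := A) (B := B) ?_ ?_ hAB
    · exact (mem_of_mem_convexHull_of_bary_pos h (fun y hy => by simpa using hy.1) hmem hA).2
    · refine (mem_of_mem_convexHull_of_bary_pos hB' (fun y hy => ?_) hmem hB).2
      have := hy.1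
      simp only [Finset.coe_insert, Finset.coe_singleton, mem_insert_iff,
        mem_singleton_iff] at this ⊢
      tauto
  have hratio : ∀ C' y, tdet A B C' ≠ 0 →
      bary C' A B y = bary C A B y * (tdet A B C / tdet A B C') := by
    intro C' y hC'
    unfold bary
    rw [← tdet_rotate C' A B, ← tdet_rotate C A B]
    field_simp
  have hloc : ∀ C', tdet A B C' ≠ 0 → ∀ᶠ y in 𝓝 q,
      (y ∈ convexHull ℝ (({A, B, C'} : Finset Plane) : Set Plane) ↔ 0 ≤ bary C' A B y) := by
    intro C' h'
    have h0 : bary C' A B q = 0 := by rw [hratio C' q h', hC, zero_mul]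
    have hcoord : bary A B C' q = bary A B C q ∧ bary B C' A q = bary B C A q := by
      have e1 := bary_combo h q
      rw [hC, zero_smul, add_zero] at e1
      have s1 := bary_sum h q
      rw [hC, add_zero] at s1
      have e2 : q = bary A B C q • A + bary B C A q • B + (0 : ℝ) • C' := by
        rw [zero_smul, add_zero]; exact e1
      constructor
      · conv_lhs => rw [e2]
        exact bary_of_combo h' (by rw [add_zero]; exact s1)
      · conv_lhs => rw [e2]
        exact bary_of_combo' h' (by rw [add_zero]; exact s1)
    filter_upwards [(isOpen_lt continuous_const (continuous_bary A B C')).mem_nhds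
        (by rw [mem_ofPred_eq, hcoord.1]; exact hA),
      (isOpen_lt continuous_const (continuous_bary B C' A)).mem_nhds
        (by rw [mem_ofPred_eq, hcoord.2]; exact hB)] with y hy1 hy2
    simp only [Finset.coe_insert, Finset.coe_singleton]
    rw [convexHull_triple h']
    exact ⟨fun h => h.2.2, fun h => ⟨le_of_lt hy1, le_of_lt hy2, h⟩⟩
  have hcov : ∀ y, y ∈ closure Ω ↔ ∃ s ∈ T, y ∈ convexHull ℝ (s : Set Plane) := by
    intro y; rw [← hT.cover]; simp
  -- With a triangle on the other side of `AB`, the two triangles cover a neighbourhood of `q`,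
  -- which then is interior. Without one, the closure is a half-plane near `q`. Either case
  -- contradicts that `q` is a vertex of the domain.
  by_cases hside : ∃ C', tdet A B C' ≠ 0 ∧ {A, B, C'} ∈ T ∧ tdet A B C / tdet A B C' < 0
  · obtain ⟨C', h', hs, hneg⟩ := hside
    apply hqΩ
    rw [← hreg, mem_interior_iff_mem_nhds]
    filter_upwards [hloc C h, hloc C' h'] with y h1 h2
    rw [hcov]
    rcases le_total 0 (bary C A B y) with h3 | h3
    · exact ⟨_, ht, h1.2 h3⟩
    · refine ⟨_, hs, h2.2 ?_⟩
      rw [hratio C' y h']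
      exact mul_nonneg_of_nonpos_of_nonpos h3 hneg.le
  · push Not at hside
    refine notMem_domainVertices_of_halfplane hreg hC' hC ?_ hq
    filter_upwards [hloc C h, hT.eventually_mem q] with y h1 h2
    rw [hcov]
    refine ⟨?_, fun h3 => ⟨_, ht, h1.2 h3⟩⟩
    rintro ⟨s, hs, hys⟩
    obtain ⟨C', h', rfl⟩ := hshare s hs (h2 s hs hys)
    have h3 := hside C' h' hs
    have h4 : 0 ≤ bary C' A B y := by
      simp only [Finset.coe_insert, Finset.coe_singleton] at hys
      rw [convexHull_triple h'] at hys
      exact hys.2.2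
    rw [hratio C' y h'] at h4
    have h5 : 0 < tdet A B C / tdet A B C' := lt_of_le_of_ne h3 (div_ne_zero h h').symm
    exact nonneg_of_mul_nonneg_left h4 h5

/-- A vertex of the domain which lies in a triangle of the mesh is one of its vertices. -/
theorem IsTriMesh.mem_of_mem_convexHull {Ω : Set Plane} (hreg : interior (closure Ω) = Ω)
    {T : Set (Finset Plane)} (hT : IsTriMesh T (closure Ω)) {q : Plane}
    (hq : q ∈ domainVertices Ω) {t : Finset Plane} (ht : t ∈ T)
    (hqt : q ∈ convexHull ℝ (t : Set Plane)) : q ∈ t := by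
  have hopen : IsOpen Ω := by rw [← hreg]; exact isOpen_interior
  obtain ⟨A, B, C, h, rfl⟩ := hT.isTri t ht
  have hB : tdet B C A ≠ 0 := by rwa [tdet_rotate]
  have hC : tdet C A B ≠ 0 := by rwa [← tdet_rotate C A B]
  have hsub := hT.subset ht
  simp only [Finset.coe_insert, Finset.coe_singleton] at hqt hsub
  have hcombo := bary_combo h q
  have hsum := bary_sum h q
  have hqt' := hqt
  rw [convexHull_triple h] at hqt'
  obtain ⟨h1, h2, h3⟩ := hqt'
  have rot : ({A, B, C} : Finset Plane) = {B, C, A} := by ext; simp; tauto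
  have rot' : ({A, B, C} : Finset Plane) = {C, A, B} := by ext; simp; tauto
  rcases h1.eq_or_lt with h1' | h1' <;> rcases h2.eq_or_lt with h2' | h2' <;>
    rcases h3.eq_or_lt with h3' | h3'
  · exfalso; linarith
  · have : q = C := by
      rw [← h1', ← h2'] at hcombo hsum
      rw [hcombo, show bary C A B q = 1 by linarith]; simp
    simp [this]
  · have : q = B := by
      rw [← h1', ← h3'] at hcombo hsum
      rw [hcombo, show bary B C A q = 1 by linarith]; simp
    simp [this]
  · exact (hT.false_of_mem_edge hreg hq hB (rot ▸ ht) h2' h3' h1'.symm).elim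
  · have : q = A := by
      rw [← h2', ← h3'] at hcombo hsum
      rw [hcombo, show bary A B C q = 1 by linarith]; simp
    simp [this]
  · exact (hT.false_of_mem_edge hreg hq hC (rot' ▸ ht) h3' h1' h2'.symm).elim
  · exact (hT.false_of_mem_edge hreg hq h ht h1' h2' h3'.symm).elim
  · exfalso
    have h4 := hq.1
    rw [hopen.frontier_eq] at h4
    refine h4.2 ?_
    rw [← hreg]
    exact interior_maximal ((openTri_subset h).trans hsub) (isOpen_openTri A B C) ⟨h1', h2', h3'⟩

/-! ### The weights -/

theorem exists_pos_le_of_isCompact {K : Set Plane} (hK : IsCompact K) {f : Plane → ℝ}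
    (hf : ContinuousOn f K) (hpos : ∀ x ∈ K, 0 < f x) : ∃ c > 0, ∀ x ∈ K, c ≤ f x := by
  rcases K.eq_empty_or_nonempty with rfl | hne
  · exact ⟨1, one_pos, by simp⟩
  · obtain ⟨x, hx, hmin⟩ := hK.exists_isMinOn hne hf
    exact ⟨f x, hpos x hx, fun y hy => hmin hy⟩

section Weights

variable {N : ℕ} {Q : Fin N → Plane} {b : Fin N → ℝ}

theorem rhoPow_nonneg (j : ℕ) (x : Plane) : 0 ≤ rhoPow Q b j x :=
  Finset.prod_nonneg fun _ _ => Real.rpow_nonneg dist_nonneg _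

theorem prod_rpow_dist_pos {s : Finset (Fin N)} {e : Fin N → ℝ} {x : Plane}
    (hx : ∀ i ∈ s, x ≠ Q i) : 0 < ∏ i ∈ s, dist x (Q i) ^ e i :=
  Finset.prod_pos fun i hi => Real.rpow_pos_of_pos (dist_pos.2 (hx i hi)) _

theorem continuousAt_prod_rpow_dist {s : Finset (Fin N)} {e : Fin N → ℝ} {x : Plane}
    (hx : ∀ i ∈ s, x ≠ Q i) : ContinuousAt (fun x => ∏ i ∈ s, dist x (Q i) ^ e i) x :=
  tendsto_finsetProd s fun i hi => ContinuousAt.rpow_const (by fun_prop)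
    (Or.inl (dist_pos.2 (hx i hi)).ne')

theorem rhoPow_pos {j : ℕ} {x : Plane} (hx : ∀ i, x ≠ Q i) : 0 < rhoPow Q b j x :=
  prod_rpow_dist_pos fun i _ => hx i

theorem continuousAt_rhoPow {j : ℕ} {x : Plane} (hx : ∀ i, x ≠ Q i) :
    ContinuousAt (rhoPow Q b j) x :=
  continuousAt_prod_rpow_dist fun i _ => hx i

theorem exists_rhoPow_ge {K : Set Plane} (hK : IsCompact K) (hKQ : ∀ i, Q i ∉ K) (j : ℕ) :
    ∃ c > 0, ∀ x ∈ K, c ≤ rhoPow Q b j x :=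
  exists_pos_le_of_isCompact hK
    (fun x hx => (continuousAt_rhoPow fun i h => hKQ i (by rw [← h]; exact hx)).continuousWithinAt)
    (fun x hx => rhoPow_pos fun i h => hKQ i (by rw [← h]; exact hx))

/-- Central projection of `x` from `A` onto the opposite edge. Since that edge is compact and avoids
`A`, the affine function `1 - bary A B C` is a substitute for the distance to `A`. -/
theorem exists_dist_eq_mul {A B C : Plane} (h : tdet A B C ≠ 0) {x : Plane}
    (hx : x ∈ convexHull ℝ ({A, B, C} : Set Plane)) (hξ : 0 < 1 - bary A B C x) :
    ∃ y ∈ convexHull ℝ ({B, C} : Set Plane), dist x A = (1 - bary A B C x) * dist y A := by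
  have hsum := bary_sum h x
  have hcombo := bary_combo h x
  rw [convexHull_triple h] at hx
  obtain ⟨-, hβ, hγ⟩ := hx
  generalize bary A B C x = α at *
  generalize bary B C A x = β at *
  generalize bary C A B x = γ at *
  refine ⟨(β / (1 - α)) • B + (γ / (1 - α)) • C, ?_, ?_⟩
  · exact convex_convexHull ℝ _ (subset_convexHull ℝ _ (by simp))
      (subset_convexHull ℝ _ (by simp)) (div_nonneg hβ hξ.le) (div_nonneg hγ hξ.le)
      (by rw [← add_div, div_eq_one_iff_eq hξ.ne']; linarith)
  · have : x - A = (1 - α) • ((β / (1 - α)) • B + (γ / (1 - α)) • C - A) := by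
      rw [smul_sub, smul_add, smul_smul, smul_smul, mul_div_cancel₀ _ hξ.ne',
        mul_div_cancel₀ _ hξ.ne', hcombo]
      module
    rw [dist_eq_norm, this, norm_smul, Real.norm_of_nonneg hξ.le, ← dist_eq_norm]

theorem exists_rpow_dist_ge {A B C : Plane} (h : tdet A B C ≠ 0) (e : ℝ) :
    ∃ c > 0, ∀ x ∈ convexHull ℝ ({A, B, C} : Set Plane), 0 < 1 - bary A B C x →
      c * (1 - bary A B C x) ^ e ≤ dist x A ^ e := by
  have hsub : convexHull ℝ ({B, C} : Set Plane) ⊆ {y | bary A B C y = 0} := by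
    refine convexHull_min ?_ fun y hy z hz a b ha hb hab => ?_
    · rintro y (rfl | rfl)
      · exact bary_second _ _ _
      · exact bary_third _ _ _
    · simp only [mem_ofPred_eq, bary_affine _ _ _ hab] at hy hz ⊢
      rw [hy, hz]; ring
  have hne : ∀ y ∈ convexHull ℝ ({B, C} : Set Plane), y ≠ A := by
    intro y hy hyA
    have h0 := hsub hy
    rw [mem_ofPred_eq, hyA, bary_self h] at h0
    exact one_ne_zero h0
  have hK : IsCompact (convexHull ℝ ({B, C} : Set Plane)) :=
    Set.Finite.isCompact_convexHull ℝ (Set.toFinite _)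
  have hcont : ContinuousOn (fun y => dist y A ^ e) (convexHull ℝ ({B, C} : Set Plane)) :=
    fun y hy => ContinuousAt.continuousWithinAt (ContinuousAt.rpow_const
      (continuous_id.dist continuous_const).continuousAt (Or.inl (dist_pos.2 (hne y hy)).ne'))
  obtain ⟨c, hc, hcb⟩ := exists_pos_le_of_isCompact hK hcont
    (fun y hy => Real.rpow_pos_of_pos (dist_pos.2 (hne y hy)) _)
  refine ⟨c, hc, fun x hx hξ => ?_⟩
  obtain ⟨y, hy, hxy⟩ := exists_dist_eq_mul h hx hξ
  rw [hxy, Real.mul_rpow hξ.le dist_nonneg, mul_comm c]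
  exact mul_le_mul_of_nonneg_left (hcb y hy) (Real.rpow_nonneg hξ.le _)

/-- No other `Q l` lies in the triangle, so the remaining factors of the weight are bounded below by
compactness, and the factor of `Q i` is a power of `1 - bary (Q i) B C`. -/
theorem exists_rhoPow_ge_corner {i : Fin N} {B C : Plane} (h : tdet (Q i) B C ≠ 0)
    (hQ : ∀ l, Q l ∈ convexHull ℝ ({Q i, B, C} : Set Plane) → l = i) (j : ℕ) :
    ∃ c > 0, ∀ x ∈ convexHull ℝ ({Q i, B, C} : Set Plane), 0 < 1 - bary (Q i) B C x →
      c * (1 - bary (Q i) B C x) ^ ((j : ℝ) - b i) ≤ rhoPow Q b j x := by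
  obtain ⟨c₁, hc₁, h₁⟩ := exists_pos_le_of_isCompact (isCompact_convexHull_triple (Q i) B C)
    (f := fun x => ∏ l ∈ Finset.univ.erase i, dist x (Q l) ^ ((j : ℝ) - b l))
    (fun x hx => (continuousAt_prod_rpow_dist fun l hl e =>
      (Finset.mem_erase.1 hl).1 (hQ l (by rw [← e]; exact hx))).continuousWithinAt)
    (fun x hx => prod_rpow_dist_pos fun l hl e =>
      (Finset.mem_erase.1 hl).1 (hQ l (by rw [← e]; exact hx)))
  obtain ⟨c₂, hc₂, h₂⟩ := exists_rpow_dist_ge h ((j : ℝ) - b i)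
  refine ⟨c₂ * c₁, mul_pos hc₂ hc₁, fun x hx hξ => ?_⟩
  unfold rhoPow
  rw [← Finset.mul_prod_erase _ _ (Finset.mem_univ i), mul_right_comm]
  exact mul_le_mul (h₂ x hx hξ) (h₁ x hx) hc₁.le (Real.rpow_nonneg dist_nonneg _)

end Weights

/-! ### Graded meshes -/

theorem node_self (p : ℝ) (A : Plane) : node p A A = A := by unfold node; module

theorem node_one (A B : Plane) : node 1 A B = B := by unfold node; module

theorem node_node (p s : ℝ) (A B : Plane) : node p A (node s A B) = node (p * s) A B := by
  unfold node; module

theorem dist_node_left {s : ℝ} (hs : 0 ≤ s) (A B : Plane) :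
    dist A (node s A B) = s * dist A B := by
  have : A - node s A B = s • (A - B) := by unfold node; module
  rw [dist_eq_norm, this, norm_smul, Real.norm_of_nonneg hs, ← dist_eq_norm]

theorem dist_node_node {s : ℝ} (hs : 0 ≤ s) (A B C : Plane) :
    dist (node s A B) (node s A C) = s * dist B C := by
  have : node s A B - node s A C = s • (B - C) := by unfold node; module
  rw [dist_eq_norm, this, norm_smul, Real.norm_of_nonneg hs, ← dist_eq_norm]

theorem tdet_node_node (s : ℝ) (A B C : Plane) :
    tdet A (node s A B) (node s A C) = s ^ 2 * tdet A B C := by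
  simp only [tdet, node_apply]; ring

theorem children_eq_refineTri {N : ℕ} (Q : Fin N → Plane) (κ : Fin N → ℝ) (t : Finset Plane) :
    children Q κ t = refineTri (newNode Q κ) t := rfl

section NewNode

variable {N : ℕ} {Q : Fin N → Plane} {κ : Fin N → ℝ}

theorem newNode_self (A : Plane) : newNode Q κ A A = A := by
  unfold newNode
  split_ifs <;> simp

theorem newNode_left (hQ : Function.Injective Q) (i : Fin N) (B : Plane) :
    newNode Q κ (Q i) B = node (κ i) (Q i) B := by
  have h : ∃ l, Q l = Q i := ⟨i, rfl⟩
  unfold newNode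
  rw [dif_pos h, hQ h.choose_spec]
  unfold node; module

theorem newNode_right (hQ : Function.Injective Q) {A : Plane} (hA : ∀ i, Q i ≠ A) (i : Fin N) :
    newNode Q κ A (Q i) = node (κ i) (Q i) A := by
  have h : ∃ l, Q l = Q i := ⟨i, rfl⟩
  unfold newNode
  rw [dif_neg (by simpa using hA), dif_pos h, hQ h.choose_spec]
  unfold node; module

theorem newNode_of_notMem {A B : Plane} (hA : ∀ i, Q i ≠ A) (hB : ∀ i, Q i ≠ B) :
    newNode Q κ A B = node (1 / 2) A B := by
  unfold newNode
  rw [dif_neg (by simpa using hA), dif_neg (by simpa using hB), midpoint_eq_smul_add]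
  unfold node; norm_num

/-- The rule for the new node is symmetric in the endpoints only when they are not two different
`Q`s; the condition of at most one `Q` per triangle excludes that case. -/
theorem isEdgeSplit_newNode (hQ : Function.Injective Q) (hκ : ∀ i, κ i ∈ Ioo (0 : ℝ) 1)
    {t : Finset Plane} (ht : ∀ i j, Q i ∈ t → Q j ∈ t → i = j) :
    IsEdgeSplit (newNode Q κ) t := by
  intro A hA B hB
  refine ⟨newNode_self A, ?_⟩
  by_cases hA' : ∃ i, Q i = A
  · obtain ⟨i, rfl⟩ := hA'
    rw [newNode_left hQ]
    by_cases hB' : ∃ j, Q j = B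
    · obtain ⟨j, rfl⟩ := hB'
      obtain rfl := ht i j hA hB
      rw [newNode_self, node_self]
      exact ⟨rfl, fun h => absurd rfl h⟩
    · rw [newNode_right hQ (by simpa using hB')]
      exact ⟨rfl, fun _ => ⟨_, hκ i, rfl⟩⟩
  · by_cases hB' : ∃ j, Q j = B
    · obtain ⟨j, rfl⟩ := hB'
      rw [newNode_right hQ (by simpa using hA'), newNode_left hQ]
      exact ⟨rfl, fun _ => ⟨1 - κ j, ⟨by linarith [(hκ j).2], by linarith [(hκ j).1]⟩,
        (node_symm _ _ _).symm⟩⟩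
    · have hA'' : ∀ i, Q i ≠ A := by simpa using hA'
      have hB'' : ∀ i, Q i ≠ B := by simpa using hB'
      rw [newNode_of_notMem hA'' hB'', newNode_of_notMem hB'' hA'']
      refine ⟨?_, fun _ => ⟨1 / 2, by norm_num, rfl⟩⟩
      rw [← node_symm]; norm_num

end NewNode

/-- `h^θ` for the mesh size `h = 2^{-n}`. -/
def meshScale (θ : ℝ) (n : ℕ) : ℝ := ((2 : ℝ) ^ (-(n : ℝ))) ^ θ

theorem meshScale_pos (θ : ℝ) (n : ℕ) : 0 < meshScale θ n :=
  Real.rpow_pos_of_pos (Real.rpow_pos_of_pos two_pos _) _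

theorem meshScale_zero (θ : ℝ) : meshScale θ 0 = 1 := by simp [meshScale]

theorem meshScale_succ (θ : ℝ) (n : ℕ) : meshScale θ (n + 1) = (2 : ℝ) ^ (-θ) * meshScale θ n := by
  unfold meshScale
  rw [← Real.rpow_mul two_pos.le, ← Real.rpow_mul two_pos.le, ← Real.rpow_add two_pos]
  congr 1; push_cast; ring

/-- The grading parameters `κ_{Q_i} = 2^{-θ/a_i}`. -/
abbrev grading {N : ℕ} (a : Fin N → ℝ) (θ : ℝ) : Fin N → ℝ := fun i => (2 : ℝ) ^ (-θ / a i)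

/-- A polygonal domain with a triangulation, and grading exponents for its vertices. -/
structure GradedSetup (Ω : Set Plane) {N : ℕ} (Q : Fin N → Plane) (T₀ : Set (Finset Plane))
    (a : Fin N → ℝ) (θ : ℝ) (p : ℕ) : Prop where
  domain : IsPolygonalDomain Ω
  injective : Function.Injective Q
  range_eq : range Q = domainVertices Ω
  mesh : IsTriMesh T₀ (closure Ω)
  one_vertex : ∀ t ∈ T₀, ∀ i j, Q i ∈ t → Q j ∈ t → i = j
  one_le : 1 ≤ p
  pos : ∀ i, 0 < a i
  le_exponent : ∀ i, a i ≤ θ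
  exponent_le : θ ≤ p

/-- A shape regular triangle whose diameter satisfies the grading condition. -/
def IsGradedTri {N : ℕ} (Q : Fin N → Plane) (b : Fin N → ℝ) (p : ℕ) (θ K : ℝ) (n : ℕ)
    (t : Finset Plane) : Prop :=
  ∃ (A B C : Plane) (d : ℝ≥0), t = {A, B, C} ∧ tdet A B C ≠ 0 ∧ dist A B ≤ d ∧ dist B C ≤ d ∧
    dist C A ≤ d ∧ (d : ℝ) ^ 2 ≤ K * |tdet A B C| ∧ (d : ℝ) ≤ K ∧
    (∀ i, Q i ∉ convexHull ℝ (t : Set Plane)) ∧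
    ∀ x ∈ convexHull ℝ (t : Set Plane), (d : ℝ) ^ p ≤ K * meshScale θ n * rhoPow Q b (p + 1) x

/-- The image of a triangle of `T₀` with a vertex `Q_i` under the homothety with centre `Q_i` and
ratio `κ_i^n`. -/
def IsCornerTri {N : ℕ} (Q : Fin N → Plane) (κ : Fin N → ℝ) (T₀ : Set (Finset Plane)) (n : ℕ)
    (t : Finset Plane) : Prop :=
  ∃ t₀ ∈ T₀, ∃ i, Q i ∈ t₀ ∧ t = t₀.image (node (κ i ^ n) (Q i))

theorem IsGradedTri.mono {N : ℕ} {Q : Fin N → Plane} {b : Fin N → ℝ} {p : ℕ} {θ K K' : ℝ} {n : ℕ}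
    {t : Finset Plane} (h : IsGradedTri Q b p θ K n t) (hK : K ≤ K') :
    IsGradedTri Q b p θ K' n t := by
  obtain ⟨A, B, C, d, h1, h2, h3, h4, h5, h6, h7, h8, h9⟩ := h
  refine ⟨A, B, C, d, h1, h2, h3, h4, h5, ?_, h7.trans hK, h8, fun x hx => (h9 x hx).trans ?_⟩
  · exact h6.trans (mul_le_mul_of_nonneg_right hK (abs_nonneg _))
  · exact mul_le_mul_of_nonneg_right (mul_le_mul_of_nonneg_right hK (meshScale_pos _ _).le)
      (rhoPow_nonneg _ _)

theorem exists_uniform_of_finite {α : Type*} {T : Set α} (hT : T.Finite) {P : α → ℝ → Prop}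
    (hmono : ∀ t K K', K ≤ K' → P t K → P t K') (h : ∀ t ∈ T, ∃ K, P t K) :
    ∃ K, ∀ t ∈ T, P t K := by
  choose! f hf using h
  obtain ⟨K, hK⟩ := (hT.image f).bddAbove
  exact ⟨K, fun t ht => hmono t _ _ (hK (mem_image_of_mem f ht)) (hf t ht)⟩

namespace GradedSetup

variable {Ω : Set Plane} {N : ℕ} {Q : Fin N → Plane} {T₀ : Set (Finset Plane)}
  {a : Fin N → ℝ} {θ : ℝ} {p : ℕ}

theorem vertex (S : GradedSetup Ω Q T₀ a θ p) (i : Fin N) : Q i ∈ domainVertices Ω := by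
  rw [← S.range_eq]; exact mem_range_self i

theorem exponent_pos (S : GradedSetup Ω Q T₀ a θ p) (i : Fin N) : 0 < θ :=
  (S.pos i).trans_le (S.le_exponent i)

theorem grading_mem (S : GradedSetup Ω Q T₀ a θ p) (i : Fin N) :
    grading a θ i ∈ Ioo (0 : ℝ) 1 :=
  ⟨Real.rpow_pos_of_pos two_pos _, Real.rpow_lt_one_of_one_lt_of_neg one_lt_two
    (div_neg_of_neg_of_pos (neg_lt_zero.2 (S.exponent_pos i)) (S.pos i))⟩

/-- The relation for which `κ_i` is chosen: at distance `κ_i^n` from `Q_i` the decay `r^(a_i)` of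
`v` has size `h^θ`. -/
theorem grading_pow_rpow (S : GradedSetup Ω Q T₀ a θ p) (i : Fin N) (n : ℕ) :
    (grading a θ i ^ n) ^ a i = meshScale θ n := by
  have := (S.pos i).ne'
  rw [meshScale, grading, ← Real.rpow_natCast, ← Real.rpow_mul two_pos.le,
    ← Real.rpow_mul two_pos.le, ← Real.rpow_mul two_pos.le]
  congr 1; field_simp

theorem mem_of_mem_convexHull (S : GradedSetup Ω Q T₀ a θ p) {t : Finset Plane} (ht : t ∈ T₀)
    {i : Fin N} (h : Q i ∈ convexHull ℝ (t : Set Plane)) : Q i ∈ t :=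
  S.mesh.mem_of_mem_convexHull S.domain.regular (S.vertex i) ht h

theorem exists_isGradedTri_zero (S : GradedSetup Ω Q T₀ a θ p) {t : Finset Plane} (ht : t ∈ T₀)
    (hQ : ∀ i, Q i ∉ t) (b : Fin N → ℝ) : ∃ K, IsGradedTri Q b p θ K 0 t := by
  have hQ' : ∀ i, Q i ∉ convexHull ℝ (t : Set Plane) := fun i h => hQ i (S.mem_of_mem_convexHull ht h)
  obtain ⟨c, hc, hcb⟩ := exists_rhoPow_ge (b := b) (S.mesh.isCompact ht) hQ' (p + 1)
  obtain ⟨A, B, C, h, rfl⟩ := S.mesh.isTri t ht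
  have hT := abs_pos.2 h
  set d : ℝ := max (dist A B) (max (dist B C) (dist C A)) with hd
  have hd0 : 0 ≤ d := dist_nonneg.trans (le_max_left _ _)
  refine ⟨max (d ^ 2 / |tdet A B C|) (max d (d ^ p / c)), A, B, C, ⟨d, hd0⟩, rfl, h,
    le_max_left _ _, (le_max_left _ _).trans (le_max_right _ _),
    (le_max_right _ _).trans (le_max_right _ _), ?_,
    (le_max_left _ _).trans (le_max_right _ _), hQ', fun x hx => ?_⟩
  · exact (div_le_iff₀ hT).1 (le_max_left _ _)
  · rw [meshScale_zero, mul_one]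
    calc d ^ p = d ^ p / c * c := (div_mul_cancel₀ _ hc.ne').symm
      _ ≤ _ := mul_le_mul ((le_max_right _ _).trans (le_max_right _ _)) (hcb x hx) hc.le
          ((div_nonneg (pow_nonneg hd0 _) hc.le).trans
            ((le_max_right _ _).trans (le_max_right _ _)))

/-- No vertex is a `Q i`, so all new nodes are midpoints: `d` is halved, the area is divided by
four, and `d^p` gains `2^(-p) ≤ 2^(-θ)` because `θ ≤ p`. The constant `K` is not enlarged, so it
survives any number of refinements. -/
theorem isGradedTri_succ (S : GradedSetup Ω Q T₀ a θ p) {b : Fin N → ℝ} {K : ℝ} {n : ℕ}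
    {t s : Finset Plane} (ht : IsGradedTri Q b p θ K n t)
    (hs : s ∈ children Q (grading a θ) t) : IsGradedTri Q b p θ K (n + 1) s := by
  obtain ⟨A, B, C, d, rfl, h, hAB, hBC, hCA, hσ, hdK, hQ, hρ⟩ := ht
  have hQt : ∀ i, Q i ∉ ({A, B, C} : Finset Plane) := fun i hi =>
    hQ i (subset_convexHull ℝ _ (by exact_mod_cast hi))
  have hsplit : IsEdgeSplit (newNode Q (grading a θ)) {A, B, C} :=
    isEdgeSplit_newNode S.injective S.grading_mem fun i j hi => absurd hi (hQt i)
  have hsub : convexHull ℝ (s : Set Plane)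
      ⊆ convexHull ℝ (({A, B, C} : Finset Plane) : Set Plane) := by
    rw [← iUnion_refineTri ⟨A, B, C, h, rfl⟩ hsplit]
    exact subset_biUnion_of_mem (u := fun s : Finset Plane => convexHull ℝ (s : Set Plane)) hs
  have hA : ∀ i, Q i ≠ A := fun i e => hQt i (by simp [e])
  have hB : ∀ i, Q i ≠ B := fun i e => hQt i (by simp [e])
  have hC : ∀ i, Q i ≠ C := fun i e => hQt i (by simp [e])
  have hd2 : ∀ x ∈ convexHull ℝ (s : Set Plane),
      ((d / 2 : ℝ≥0) : ℝ) ^ p ≤ K * meshScale θ (n + 1) * rhoPow Q b (p + 1) x := by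
    intro x hx
    have h1 := hρ x (hsub hx)
    have h2 : (2 : ℝ) ^ (-(p : ℝ)) ≤ (2 : ℝ) ^ (-θ) :=
      Real.rpow_le_rpow_of_exponent_le one_le_two (neg_le_neg S.exponent_le)
    rw [Real.rpow_neg two_pos.le, Real.rpow_natCast] at h2
    have h3 : 0 ≤ K * meshScale θ n * rhoPow Q b (p + 1) x := (pow_nonneg d.2 p).trans h1
    rw [meshScale_succ, NNReal.coe_div, NNReal.coe_ofNat, div_pow, div_eq_inv_mul]
    calc ((2 : ℝ) ^ p)⁻¹ * (d : ℝ) ^ p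
        ≤ (2 : ℝ) ^ (-θ) * (K * meshScale θ n * rhoPow Q b (p + 1) x) :=
          mul_le_mul h2 h1 (by positivity) (by positivity)
      _ = _ := by ring
  have hfin : ∀ X Y Z : Plane, s = {X, Y, Z} → tdet X Y Z = 1 / 4 * tdet A B C →
      dist X Y ≤ d / 2 → dist Y Z ≤ d / 2 → dist Z X ≤ d / 2 →
      IsGradedTri Q b p θ K (n + 1) s := by
    intro X Y Z hsX hdet h1 h2 h3
    refine ⟨X, Y, Z, d / 2, hsX, ?_, by simpa using h1, by simpa using h2, by simpa using h3, ?_,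
      ?_, fun i hi => hQ i (hsub hi), hd2⟩
    · rw [hdet]; exact mul_ne_zero (by norm_num) h
    · rw [hdet, abs_mul, NNReal.coe_div, NNReal.coe_ofNat, div_pow,
        abs_of_pos (by norm_num : (0 : ℝ) < 1 / 4)]
      linarith
    · rw [NNReal.coe_div, NNReal.coe_ofNat]
      have : (0 : ℝ) ≤ d := d.2
      linarith
  have hhalf : ∀ X Y Z : Plane, dist (node (1 / 2) X Y) (node (1 / 2) X Z) = dist Y Z / 2 := by
    intro X Y Z
    rw [dist_node_node (by norm_num)]; ring
  have hhalf' : ∀ X Y : Plane, dist X (node (1 / 2) X Y) = dist X Y / 2 := by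
    intro X Y
    rw [dist_node_left (by norm_num)]; ring
  have hsym : ∀ X Y : Plane, node (1 / 2) X Y = node (1 / 2) Y X := by
    intro X Y
    rw [← node_symm]; norm_num
  rw [children_eq_refineTri, refineTri_triple h hsplit, newNode_of_notMem hA hB,
    newNode_of_notMem hB hC, newNode_of_notMem hC hA] at hs
  have k1 : dist A B / 2 ≤ d / 2 := by linarith
  have k2 : dist B C / 2 ≤ d / 2 := by linarith
  have k3 : dist C A / 2 ≤ d / 2 := by linarith
  rcases hs with e | e | e | e
  · refine hfin _ _ _ e (by rw [tdet_corner]; norm_num) ?_ ?_ ?_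
    · rwa [hhalf']
    · rwa [hsym C A, hhalf]
    · rwa [dist_comm, hsym C A, hhalf', dist_comm A C]
  · refine hfin _ _ _ e (by rw [tdet_corner, tdet_rotate]; norm_num) ?_ ?_ ?_
    · rwa [hhalf']
    · rwa [hsym A B, hhalf]
    · rwa [dist_comm, hsym A B, hhalf', dist_comm B A]
  · refine hfin _ _ _ e (by rw [tdet_corner, ← tdet_rotate C A B]; norm_num) ?_ ?_ ?_
    · rwa [hhalf']
    · rwa [hsym B C, hhalf]
    · rwa [dist_comm, hsym B C, hhalf', dist_comm C B]
  · refine hfin _ _ _ e (by rw [tdet_center]; norm_num) ?_ ?_ ?_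
    · rwa [hsym A B, hhalf, dist_comm A C]
    · rwa [hsym B C, hhalf, dist_comm B A]
    · rwa [hsym C A, hhalf, dist_comm C B]

end GradedSetup

theorem one_sub_bary_node {A B C : Plane} (h : tdet A B C ≠ 0) (s : ℝ) (x : Plane) :
    1 - bary A B C (node s A x) = s * (1 - bary A B C x) := by
  rw [bary_node, bary_self h]; ring

theorem le_one_sub_bary_of_mem_convexHull {A B C : Plane} {s : Set Plane} {r : ℝ}
    (hs : ∀ y ∈ s, r ≤ 1 - bary A B C y) {x : Plane} (hx : x ∈ convexHull ℝ s) :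
    r ≤ 1 - bary A B C x := by
  have : convexHull ℝ s ⊆ {y | r ≤ 1 - bary A B C y} := by
    refine convexHull_min hs fun y hy z hz a b ha hb hab => ?_
    simp only [mem_ofPred_eq, bary_affine _ _ _ hab] at hy hz ⊢
    have h1 := mul_le_mul_of_nonneg_left hy ha
    have h2 := mul_le_mul_of_nonneg_left hz hb
    have h3 : r = a * r + b * r := by rw [← add_mul, hab, one_mul]
    have h4 : (1 : ℝ) = a + b := hab.symm
    nlinarith
  exact this hx

namespace GradedSetup

variable {Ω : Set Plane} {N : ℕ} {Q : Fin N → Plane} {T₀ : Set (Finset Plane)}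
  {a : Fin N → ℝ} {θ : ℝ} {p : ℕ}

theorem eq_of_mem_convexHull (S : GradedSetup Ω Q T₀ a θ p) {t : Finset Plane} (ht : t ∈ T₀)
    {i : Fin N} (hi : Q i ∈ t) {l : Fin N} (h : Q l ∈ convexHull ℝ (t : Set Plane)) : l = i :=
  S.one_vertex t ht l i (S.mem_of_mem_convexHull ht h) hi

theorem image_node_subset (S : GradedSetup Ω Q T₀ a θ p) {t : Finset Plane} {i : Fin N}
    (hi : Q i ∈ t) (n : ℕ) :
    convexHull ℝ ((t.image (node (grading a θ i ^ n) (Q i)) : Finset Plane) : Set Plane)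
      ⊆ convexHull ℝ (t : Set Plane) := by
  refine convexHull_min (fun y hy => ?_) (convex_convexHull ℝ _)
  simp only [Finset.coe_image, mem_image, Finset.mem_coe] at hy
  obtain ⟨x, hx, rfl⟩ := hy
  have h1 := pow_nonneg (S.grading_mem i).1.le n
  have h2 := pow_le_one₀ (n := n) (S.grading_mem i).1.le (S.grading_mem i).2.le
  exact convex_convexHull ℝ _ (subset_convexHull ℝ _ hi) (subset_convexHull ℝ _ hx)
    (by linarith) h1 (by ring)

theorem one_vertex_of_subset (S : GradedSetup Ω Q T₀ a θ p) {t₀ t : Finset Plane} (ht₀ : t₀ ∈ T₀)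
    (h : convexHull ℝ (t : Set Plane) ⊆ convexHull ℝ (t₀ : Set Plane)) :
    ∀ i j, Q i ∈ t → Q j ∈ t → i = j := fun i j hi hj =>
  S.one_vertex t₀ ht₀ i j
    (S.mem_of_mem_convexHull ht₀ (h (subset_convexHull ℝ _ (by exact_mod_cast hi))))
    (S.mem_of_mem_convexHull ht₀ (h (subset_convexHull ℝ _ (by exact_mod_cast hj))))

/-- The child at `Q i` is the next homothetic copy. The other three have size of order `κ^n` and
satisfy `1 - bary ≥ κ^(n+1)`, so `d^p` is of order `κ^(n a_i) κ^(n (p - a_i))`; the first factor is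
`h^θ` up to a constant, and the second is at most a constant times the weight since `a_i ≤ θ ≤ p`.
-/
theorem exists_corner_children (S : GradedSetup Ω Q T₀ a θ p) {t₀ : Finset Plane} (ht₀ : t₀ ∈ T₀)
    {i : Fin N} (hi : Q i ∈ t₀) : ∃ K, ∀ n, ∀ s ∈ children Q (grading a θ)
      (t₀.image (node (grading a θ i ^ n) (Q i))),
      s = t₀.image (node (grading a θ i ^ (n + 1)) (Q i)) ∨
        IsGradedTri Q (fun i => a i + 1) p θ K (n + 1) s := by
  obtain ⟨B, C, h, rfl⟩ := (S.mesh.isTri t₀ ht₀).exists_of_mem hi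
  have hQu : ∀ l, Q l ∈ convexHull ℝ ({Q i, B, C} : Set Plane) → l = i := fun l hl =>
    S.eq_of_mem_convexHull ht₀ hi (by simpa using hl)
  obtain ⟨c, hc, hcb⟩ := exists_rhoPow_ge_corner (b := fun i => a i + 1) h hQu (p + 1)
  set κ := grading a θ i with hκ
  have hκ0 : 0 < κ := (S.grading_mem i).1
  have hκ1 : κ < 1 := (S.grading_mem i).2
  set d₀ : ℝ := max (dist (Q i) B) (max (dist B C) (dist C (Q i))) with hd₀
  have hd₀0 : 0 ≤ d₀ := dist_nonneg.trans (le_max_left _ _)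
  have hT := abs_pos.2 h
  -- A lower bound for the area ratios of the three children away from `Q i`, which are `(1 - κ)/2`,
  -- `(1 - κ)/2` and, for the central one, `κ (1 - κ)`.
  set τ : ℝ := κ * (1 - κ) / 2 with hτ
  have hκ1' : 0 < 1 - κ := by linarith
  have hτ0 : 0 < τ := by positivity
  -- The three entries give shape regularity, boundedness of the diameter and the grading
  -- inequality; `κ^p` pays for the step from `κ^n` to `κ^(n+1)`.
  set K : ℝ := max (d₀ ^ 2 / (τ * |tdet (Q i) B C|)) (max d₀ (d₀ ^ p / (c * κ ^ p))) with hK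
  have hK0 : 0 ≤ K := hd₀0.trans ((le_max_left _ _).trans (le_max_right _ _))
  refine ⟨K, fun n s hs => ?_⟩
  set Bn := node (κ ^ n) (Q i) B with hBn
  set Cn := node (κ ^ n) (Q i) C with hCn
  have himg : ({Q i, B, C} : Finset Plane).image (node (κ ^ n) (Q i)) = {Q i, Bn, Cn} := by
    rw [Finset.image_insert, Finset.image_insert, Finset.image_singleton, node_self]
  have hsubn := S.image_node_subset hi n
  rw [← hκ] at hsubn
  rw [himg] at hs hsubn
  have hκn : 0 < κ ^ n := pow_pos hκ0 n
  have hn : tdet (Q i) Bn Cn ≠ 0 := by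
    rw [hBn, hCn, tdet_node_node]; exact mul_ne_zero (by positivity) h
  have hsplit : IsEdgeSplit (newNode Q (grading a θ)) {Q i, Bn, Cn} :=
    isEdgeSplit_newNode S.injective S.grading_mem (S.one_vertex_of_subset ht₀ hsubn)
  obtain ⟨n1, n2, n3⟩ := tdet_ne_zero_distinct hn
  have hBQ : ∀ l, Q l ≠ Bn := fun l e => by
    have := S.one_vertex_of_subset ht₀ hsubn l i (by rw [e]; simp) (by simp)
    rw [this] at e; exact n1 e
  have hCQ : ∀ l, Q l ≠ Cn := fun l e => by
    have := S.one_vertex_of_subset ht₀ hsubn l i (by rw [e]; simp) (by simp)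
    rw [this] at e; exact n2 e
  have hsub : convexHull ℝ (s : Set Plane)
      ⊆ convexHull ℝ (({Q i, Bn, Cn} : Finset Plane) : Set Plane) := by
    rw [← iUnion_refineTri ⟨_, _, _, hn, rfl⟩ hsplit]
    exact subset_biUnion_of_mem (u := fun s : Finset Plane => convexHull ℝ (s : Set Plane)) hs
  rw [children_eq_refineTri, refineTri_triple hn hsplit, newNode_left S.injective,
    newNode_of_notMem hBQ hCQ, newNode_right S.injective hCQ, ← node_symm _ (Q i) Cn, ← hκ] at hs
  have hξB : 1 - bary (Q i) B C Bn = κ ^ n := by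
    rw [hBn, one_sub_bary_node h, bary_second]; ring
  have hξC : 1 - bary (Q i) B C Cn = κ ^ n := by
    rw [hCn, one_sub_bary_node h, bary_third]; ring
  have hle : κ ^ (n + 1) ≤ κ ^ n := pow_le_pow_of_le_one hκ0.le hκ1.le (Nat.le_succ n)
  have hξD : κ ^ (n + 1) ≤ 1 - bary (Q i) B C (node κ (Q i) Bn) := by
    rw [one_sub_bary_node h, hξB, pow_succ']
  have hξD' : κ ^ (n + 1) ≤ 1 - bary (Q i) B C (node (1 - κ) Cn (Q i)) := by
    rw [node_symm, one_sub_bary_node h, hξC, pow_succ']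
  have hξM : κ ^ (n + 1) ≤ 1 - bary (Q i) B C (node (1 / 2) Bn Cn) := by
    rw [bary_node]; linarith
  have hdist : ∀ x ∈ convexHull ℝ (s : Set Plane), ∀ y ∈ convexHull ℝ (s : Set Plane),
      dist x y ≤ κ ^ n * d₀ := by
    intro x hx y hy
    refine dist_le_of_mem_convexHull (A := Q i) (B := Bn) (C := Cn) ?_ ?_ ?_
      (by simpa using hsub hx) (by simpa using hsub hy)
    · rw [hBn, dist_node_left hκn.le]
      exact mul_le_mul_of_nonneg_left (le_max_left _ _) hκn.le
    · rw [hBn, hCn, dist_node_node hκn.le]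
      exact mul_le_mul_of_nonneg_left ((le_max_left _ _).trans (le_max_right _ _)) hκn.le
    · rw [hCn, dist_comm, dist_node_left hκn.le, dist_comm]
      exact mul_le_mul_of_nonneg_left ((le_max_right _ _).trans (le_max_right _ _)) hκn.le
  have hfin : ∀ (X Y Z : Plane) (r : ℝ), s = {X, Y, Z} → τ ≤ r →
      tdet X Y Z = r * tdet (Q i) Bn Cn → κ ^ (n + 1) ≤ 1 - bary (Q i) B C X →
      κ ^ (n + 1) ≤ 1 - bary (Q i) B C Y → κ ^ (n + 1) ≤ 1 - bary (Q i) B C Z →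
      IsGradedTri Q (fun i => a i + 1) p θ K (n + 1) s := by
    intro X Y Z r hsX hr hdet hX hY hZ
    have hmX : X ∈ convexHull ℝ (s : Set Plane) := subset_convexHull ℝ _ (by simp [hsX])
    have hmY : Y ∈ convexHull ℝ (s : Set Plane) := subset_convexHull ℝ _ (by simp [hsX])
    have hmZ : Z ∈ convexHull ℝ (s : Set Plane) := subset_convexHull ℝ _ (by simp [hsX])
    have hr0 : 0 < r := hτ0.trans_le hr
    have hξ : ∀ x ∈ convexHull ℝ (s : Set Plane), κ ^ (n + 1) ≤ 1 - bary (Q i) B C x := by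
      intro x hx
      refine le_one_sub_bary_of_mem_convexHull ?_ hx
      rw [hsX]
      intro y hy
      simp only [Finset.coe_insert, Finset.coe_singleton] at hy
      rcases hy with rfl | rfl | rfl <;> assumption
    have hdet' : |tdet X Y Z| = (κ ^ n) ^ 2 * (r * |tdet (Q i) B C|) := by
      rw [hdet, hBn, hCn, tdet_node_node, abs_mul, abs_mul, abs_of_pos hr0,
        abs_of_pos (by positivity : 0 < (κ ^ n) ^ 2)]
      ring
    refine ⟨X, Y, Z, ⟨κ ^ n * d₀, by positivity⟩, hsX, ?_, hdist _ hmX _ hmY, hdist _ hmY _ hmZ,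
      hdist _ hmZ _ hmX, ?_, ?_, ?_, ?_⟩
    · rw [hdet]; exact mul_ne_zero hr0.ne' hn
    · rw [hdet']
      change (κ ^ n * d₀) ^ 2 ≤ _
      have h1 : d₀ ^ 2 ≤ K * (τ * |tdet (Q i) B C|) :=
        (div_le_iff₀ (by positivity)).1 (le_max_left _ _)
      have h2 : K * (τ * |tdet (Q i) B C|) ≤ K * (r * |tdet (Q i) B C|) := by gcongr
      calc (κ ^ n * d₀) ^ 2 = (κ ^ n) ^ 2 * d₀ ^ 2 := by ring
        _ ≤ (κ ^ n) ^ 2 * (K * (r * |tdet (Q i) B C|)) := by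
            exact mul_le_mul_of_nonneg_left (h1.trans h2) (by positivity)
        _ = _ := by ring
    · change κ ^ n * d₀ ≤ K
      calc κ ^ n * d₀ ≤ 1 * d₀ :=
            mul_le_mul_of_nonneg_right (pow_le_one₀ hκ0.le hκ1.le) hd₀0
        _ = d₀ := one_mul _
        _ ≤ K := (le_max_left _ _).trans (le_max_right _ _)
    · intro l hl
      obtain rfl : l = i := hQu l (by simpa using hsubn (hsub hl))
      have h1 := hξ _ hl
      rw [bary_self h, sub_self] at h1
      exact absurd h1 (not_le.2 (pow_pos hκ0 _))
    · intro x hx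
      change (κ ^ n * d₀) ^ p ≤ _
      have h1 := hξ x hx
      have hpos : 0 < κ ^ (n + 1) := pow_pos hκ0 _
      have h2 := hcb x (by simpa using hsubn (hsub hx)) (hpos.trans_le h1)
      have he : ((p + 1 : ℕ) : ℝ) - (a i + 1) = p - a i := by push_cast; ring
      simp only [he] at h2
      have hpa : 0 ≤ (p : ℝ) - a i := by
        linarith [S.le_exponent i, S.exponent_le]
      have h3 : c * (κ ^ (n + 1)) ^ ((p : ℝ) - a i)
          ≤ rhoPow Q (fun i => a i + 1) (p + 1) x :=
        (mul_le_mul_of_nonneg_left (Real.rpow_le_rpow hpos.le h1 hpa) hc.le).trans h2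
      have h4 : (κ ^ (n + 1)) ^ a i = meshScale θ (n + 1) := S.grading_pow_rpow i (n + 1)
      have h5 : meshScale θ (n + 1) * (κ ^ (n + 1)) ^ ((p : ℝ) - a i) = (κ ^ (n + 1)) ^ p := by
        rw [← h4, ← Real.rpow_add hpos, add_sub_cancel, Real.rpow_natCast]
      have h6 : d₀ ^ p ≤ K * (c * κ ^ p) :=
        (div_le_iff₀ (by positivity)).1 ((le_max_right _ _).trans (le_max_right _ _))
      calc (κ ^ n * d₀) ^ p = (κ ^ n) ^ p * d₀ ^ p := mul_pow _ _ _
        _ ≤ (κ ^ n) ^ p * (K * (c * κ ^ p)) := by gcongr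
        _ = K * c * (κ ^ (n + 1)) ^ p := by rw [pow_succ, mul_pow]; ring
        _ = K * meshScale θ (n + 1) * (c * (κ ^ (n + 1)) ^ ((p : ℝ) - a i)) := by
            rw [← h5]; ring
        _ ≤ _ := mul_le_mul_of_nonneg_left h3 (mul_nonneg hK0 (meshScale_pos _ _).le)
  rcases hs with e | e | e | e
  · left
    rw [e, Finset.image_insert, Finset.image_insert, Finset.image_singleton, node_self, node_symm,
      hBn, hCn, node_node, node_node, ← pow_succ']
  · right
    refine hfin _ _ _ (1 / 2 * (1 - κ)) e ?_ (by rw [tdet_corner, tdet_rotate]) (by rw [hξB]; exact hle) hξM hξD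
    rw [hτ]; nlinarith
  · right
    refine hfin _ _ _ ((1 - κ) * (1 / 2)) e ?_
      (by rw [tdet_corner, ← tdet_rotate Cn]; ring) (by rw [hξC]; exact hle) hξD' hξM
    rw [hτ]; nlinarith
  · right
    refine hfin _ _ _ _ e ?_ (tdet_center _ _ _ _ _ _) hξD hξM hξD'
    rw [hτ]; nlinarith

theorem exists_invariant (S : GradedSetup Ω Q T₀ a θ p) : ∃ K, 1 ≤ K ∧
    ∀ n, ∀ t ∈ gradedMesh Q (grading a θ) T₀ n,
      IsGradedTri Q (fun i => a i + 1) p θ K n t ∨ IsCornerTri Q (grading a θ) T₀ n t := by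
  obtain ⟨K₀, hK₀⟩ := exists_uniform_of_finite S.mesh.finite
    (P := fun t K => (∀ i, Q i ∉ t) → IsGradedTri Q (fun i => a i + 1) p θ K 0 t)
    (fun t K K' hK h hQ => (h hQ).mono hK) (fun t ht => by
      by_cases hQ : ∀ i, Q i ∉ t
      · obtain ⟨K, hK⟩ := S.exists_isGradedTri_zero ht hQ (fun i => a i + 1)
        exact ⟨K, fun _ => hK⟩
      · exact ⟨0, fun h => absurd h hQ⟩)
  obtain ⟨K₁, hK₁⟩ := exists_uniform_of_finite S.mesh.finite
    (P := fun t₀ K => ∀ i, Q i ∈ t₀ → ∀ n, ∀ s ∈ children Q (grading a θ)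
      (t₀.image (node (grading a θ i ^ n) (Q i))),
      s = t₀.image (node (grading a θ i ^ (n + 1)) (Q i)) ∨
        IsGradedTri Q (fun i => a i + 1) p θ K (n + 1) s)
    (fun t K K' hK h i hi n s hs => (h i hi n s hs).imp_right fun h => h.mono hK) (fun t ht => by
      by_cases hQ : ∃ i, Q i ∈ t
      · obtain ⟨i, hi⟩ := hQ
        obtain ⟨K, hK⟩ := S.exists_corner_children ht hi
        refine ⟨K, fun j hj => ?_⟩
        obtain rfl := S.one_vertex t ht i j hi hj
        exact hK
      · exact ⟨0, fun i hi => absurd ⟨i, hi⟩ hQ⟩)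
  refine ⟨max 1 (max K₀ K₁), le_max_left _ _, fun n => ?_⟩
  induction n with
  | zero =>
    intro t ht
    by_cases hQ : ∃ i, Q i ∈ t
    · obtain ⟨i, hi⟩ := hQ
      refine Or.inr ⟨t, ht, i, hi, ?_⟩
      simp only [pow_zero]
      ext x
      simp [node_one]
    · exact Or.inl ((hK₀ t ht (by simpa using hQ)).mono
        ((le_max_left _ _).trans (le_max_right _ _)))
  | succ n ih =>
    intro s hs
    simp only [gradedMesh, mem_iUnion] at hs
    obtain ⟨t, ht, hs⟩ := hs
    rcases ih t ht with h | ⟨t₀, ht₀, i, hi, rfl⟩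
    · exact Or.inl (S.isGradedTri_succ h hs)
    · rcases hK₁ t₀ ht₀ i hi n s hs with h | h
      · exact Or.inr ⟨t₀, ht₀, i, hi, h⟩
      · exact Or.inl (h.mono ((le_max_right _ _).trans (le_max_right _ _)))

/-- The invariant shows at every level that a triangle contains at most one `Q i`, which is what
makes the edge splitting well defined at the next refinement. -/
theorem isTriMesh (S : GradedSetup Ω Q T₀ a θ p) (n : ℕ) :
    IsTriMesh (gradedMesh Q (grading a θ) T₀ n) (closure Ω) := by
  obtain ⟨K, -, hK⟩ := S.exists_invariant
  induction n with
  | zero => exact S.mesh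
  | succ n ih =>
    refine ih.refine fun t ht => isEdgeSplit_newNode S.injective S.grading_mem ?_
    rcases hK n t ht with ⟨_, _, _, _, _, _, _, _, _, _, _, hQ, _⟩ | ⟨t₀, ht₀, i, hi, rfl⟩
    · exact fun i j hi => absurd (subset_convexHull ℝ _ (by exact_mod_cast hi)) (hQ i)
    · exact S.one_vertex_of_subset ht₀ (S.image_node_subset hi n)

end GradedSetup

/-! ### Weak derivatives of piecewise polynomial functions -/

/-- On the compact support of `φ` the function `w` is Lipschitz and extends to a Lipschitz function
on the plane, for which integration by parts holds. By Rademacher's theorem the extension is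
differentiable almost everywhere, with the derivative of `w` wherever `φ` is nonzero. -/
theorem integral_mul_partialDeriv_of_locallyLipschitzOn {Ω : Set Plane}
    {w : Plane → ℝ} (hw : LocallyLipschitzOn Ω w) (i : Fin 2) {φ : Plane → ℝ}
    (hφ : ContDiff ℝ ∞ φ) (hc : HasCompactSupport φ) (hs : tsupport φ ⊆ Ω) :
    ∫ x in Ω, w x * partialDeriv i φ x = - ∫ x in Ω, partialDeriv i w x * φ x := by
  obtain ⟨C, hC⟩ := (hw.mono hs).exists_lipschitzOnWith_of_compact hc
  obtain ⟨f, hf, hfw⟩ := hC.extend_real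
  obtain ⟨D, hD⟩ := (hφ.of_le (m := 1) (by simp)).lipschitzWith_of_hasCompactSupport
    hc one_ne_zero
  have key := hf.integral_lineDeriv_mul_eq (μ := volume) hD hc (EuclideanSpace.single i (1 : ℝ))
  have hφd : ∀ x, DifferentiableAt ℝ φ x := fun x => (hφ.differentiable (by simp)) x
  have e1 : ∫ x in Ω, w x * partialDeriv i φ x
      = ∫ x, -(lineDeriv ℝ φ x (-EuclideanSpace.single i (1 : ℝ)) * f x) := by
    rw [setIntegral_eq_integral_of_forall_compl_eq_zero]
    · refine integral_congr_ae (Eventually.of_forall fun x => ?_)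
      simp only [(hφd x).lineDeriv_eq_fderiv, map_neg]
      by_cases hx : x ∈ tsupport φ
      · rw [← hfw hx]; unfold partialDeriv; ring
      · rw [partialDeriv, fderiv_of_notMem_tsupport _ hx]; simp
    · intro x hx
      rw [partialDeriv, fderiv_of_notMem_tsupport _ fun h => hx (hs h)]; simp
  have e2 : ∫ x in Ω, partialDeriv i w x * φ x
      = ∫ x, lineDeriv ℝ f x (EuclideanSpace.single i (1 : ℝ)) * φ x := by
    rw [setIntegral_eq_integral_of_forall_compl_eq_zero]
    · refine integral_congr_ae ?_
      filter_upwards [hf.ae_differentiableAt (μ := volume)] with x hx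
      by_cases h0 : φ x = 0
      · simp [h0]
      · have hev : w =ᶠ[𝓝 x] f := by
          filter_upwards [hφ.continuous.isOpen_support.mem_nhds h0] with y hy
          exact hfw (subset_tsupport φ hy)
        simp only [partialDeriv, hx.lineDeriv_eq_fderiv, hev.fderiv_eq]
    · intro x hx
      rw [image_eq_zero_of_notMem_tsupport fun h => hx (hs h), mul_zero]
  rw [e1, e2, integral_neg, key]

theorem locallyIntegrableOn_partialDeriv {Ω : Set Plane} (hΩ : IsOpen Ω)
    {w : Plane → ℝ} (hw : LocallyLipschitzOn Ω w) (i : Fin 2) :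
    LocallyIntegrableOn (partialDeriv i w) Ω := by
  intro x hx
  obtain ⟨K, t, ht, hK⟩ := hw hx
  rw [hΩ.nhdsWithin_eq hx] at ht ⊢
  obtain ⟨ε, hε, hball⟩ := Metric.mem_nhds_iff.1 ht
  refine ⟨Metric.ball x ε, Metric.ball_mem_nhds x hε, ?_⟩
  refine Measure.integrableOn_of_bounded (M := K) (measure_ball_lt_top (μ := volume)).ne
    (measurable_fderiv_apply_const ℝ w _).aestronglyMeasurable ?_
  refine (ae_restrict_iff' measurableSet_ball).2 (Eventually.of_forall fun y hy => ?_)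
  have h1 := norm_fderiv_le_of_lipschitzOn (𝕜 := ℝ) (Metric.isOpen_ball.mem_nhds hy) (hK.mono hball)
  calc ‖partialDeriv i w y‖ ≤ ‖fderiv ℝ w y‖ * ‖EuclideanSpace.single i (1 : ℝ)‖ :=
        (fderiv ℝ w y).le_opNorm _
    _ ≤ K := by simpa using h1

theorem isWeakDeriv_partialDeriv_of_locallyLipschitzOn {Ω : Set Plane} (hΩ : IsOpen Ω)
    {w : Plane → ℝ} (hw : LocallyLipschitzOn Ω w) :
    IsWeakDeriv Ω (1, 0) w (partialDeriv 0 w) ∧ IsWeakDeriv Ω (0, 1) w (partialDeriv 1 w) := by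
  have hwi := hw.continuousOn.locallyIntegrableOn (μ := volume) hΩ.measurableSet
  refine ⟨⟨hwi, locallyIntegrableOn_partialDeriv hΩ hw 0, fun φ hφ hc hs => ?_⟩,
    ⟨hwi, locallyIntegrableOn_partialDeriv hΩ hw 1, fun φ hφ hc hs => ?_⟩⟩
  · simpa [multiDeriv] using integral_mul_partialDeriv_of_locallyLipschitzOn hw 0 hφ hc hs
  · simpa [multiDeriv] using integral_mul_partialDeriv_of_locallyLipschitzOn hw 1 hφ hc hs

/-- A continuous function on a convex set which is piecewise Lipschitz with respect to a finite
closed convex cover is Lipschitz. -/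
theorem lipschitzOnWith_of_finite_cover {ι : Type*} {T : Set ι} (hT : T.Finite)
    {F : ι → Set Plane} (hFc : ∀ t ∈ T, IsClosed (F t)) (hFconv : ∀ t ∈ T, Convex ℝ (F t))
    {f : ι → Plane → ℝ} (hf : ∀ t ∈ T, Differentiable ℝ (f t)) {M : ℝ≥0}
    (hM : ∀ t ∈ T, ∀ x ∈ F t, ‖fderiv ℝ (f t) x‖ ≤ M) {B : Set Plane} (hB : Convex ℝ B)
    (hcov : B ⊆ ⋃ t ∈ T, F t) {w : Plane → ℝ} (hw : ContinuousOn w B)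
    (hwf : ∀ t ∈ T, ∀ x ∈ F t, w x = f t x) : LipschitzOnWith M w B := by
  refine LipschitzOnWith.of_dist_le_mul fun x hx y hy => ?_
  set γ : ℝ → Plane := fun s => y + s • (x - y) with hγ
  have hγc : Continuous γ := by fun_prop
  have hγB : ∀ s ∈ Icc (0 : ℝ) 1, γ s ∈ B := fun s hs => by
    have : γ s = (1 - s) • y + s • x := by rw [hγ]; module
    rw [this]
    exact hB hy hx (by linarith [hs.2]) hs.1 (by ring)
  have hγd : ∀ s, HasDerivAt γ (x - y) s := fun s => by
    simpa [hγ] using ((hasDerivAt_id s).smul_const (x - y)).const_add y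
  have hright : ∀ s ∈ Ico (0 : ℝ) 1, ∃ D : ℝ, ‖D‖ ≤ M * dist x y ∧
      HasDerivWithinAt (w ∘ γ) D (Ici s) s := by
    intro s hs
    -- By finiteness some piece is met arbitrarily soon after `s`. Being closed and convex it
    -- contains a whole interval of the path starting at `s`, so `w ∘ γ` has a right derivative
    -- there, which suffices for the mean value inequality.
    obtain ⟨t, ht, hfr⟩ : ∃ t ∈ T, ∃ᶠ s' in 𝓝[>] s, γ s' ∈ F t := by
      by_contra! hcon
      have h1 : ∀ᶠ s' in 𝓝[>] s, ∀ t ∈ T, γ s' ∉ F t :=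
        (Filter.eventually_all_finite hT).2 hcon
      have h2 : ∀ᶠ s' in 𝓝[>] s, s' ∈ Ioo s 1 := Ioo_mem_nhdsGT hs.2
      obtain ⟨s', h3, h4⟩ := (h1.and h2).exists
      obtain ⟨t, ht, h5⟩ := mem_iUnion₂.1 (hcov (hγB s' ⟨hs.1.trans h4.1.le, h4.2.le⟩))
      exact h3 t ht h5
    have hmem : γ s ∈ F t := by
      have : γ s ∈ closure (F t) := mem_closure_of_frequently_of_tendsto hfr
        ((hγc.tendsto s).mono_left nhdsWithin_le_nhds)
      rwa [(hFc t ht).closure_eq] at this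
    obtain ⟨s₁, h1, h2⟩ := (hfr.and_eventually self_mem_nhdsWithin).exists
    have hlt : s < s₁ := h2
    refine ⟨fderiv ℝ (f t) (γ s) (x - y), ?_, ?_⟩
    · refine (ContinuousLinearMap.le_opNorm _ _).trans ?_
      rw [dist_eq_norm]
      exact mul_le_mul_of_nonneg_right (hM t ht _ hmem) (norm_nonneg _)
    have hd := ((hf t ht (γ s)).hasFDerivAt.comp_hasDerivAt s (hγd s)).hasDerivWithinAt (s := Ici s)
    have hin : ∀ s' ∈ Icc s s₁, γ s' ∈ F t := by
      intro s' hs'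
      have hpos : 0 < s₁ - s := by linarith
      have e : γ s' = (1 - (s' - s) / (s₁ - s)) • γ s + ((s' - s) / (s₁ - s)) • γ s₁ := by
        have h3 : s' = s + (s' - s) / (s₁ - s) * (s₁ - s) := by
          rw [div_mul_cancel₀ _ hpos.ne']; ring
        rw [hγ]
        generalize (s' - s) / (s₁ - s) = r at *
        subst h3
        module
      rw [e]
      refine hFconv t ht hmem h1 ?_ (div_nonneg (by linarith [hs'.1]) hpos.le) (by ring)
      rw [sub_nonneg, div_le_one hpos]; linarith [hs'.2]
    refine hd.congr_of_eventuallyEq ?_ (hwf t ht _ hmem)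
    filter_upwards [Icc_mem_nhdsGE hlt] with s' hs'
    exact hwf t ht _ (hin s' hs')
  choose! D hDb hDd using hright
  have hbound := norm_image_sub_le_of_norm_deriv_right_le_segment (f := w ∘ γ)
    (hw.comp hγc.continuousOn hγB) hDd hDb 1 (right_mem_Icc.2 zero_le_one)
  simpa [hγ, dist_eq_norm] using hbound

theorem locallyLipschitzOn_of_mesh {Ω : Set Plane} (hΩ : IsOpen Ω) {T : Set (Finset Plane)}
    (hT : IsTriMesh T (closure Ω)) {w : Plane → ℝ} (hw : ContinuousOn w Ω)
    {P : Finset Plane → MvPolynomial (Fin 2) ℝ}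
    (hP : ∀ t ∈ T, ∀ x ∈ convexHull ℝ (t : Set Plane), w x = polyFun (P t) x) :
    LocallyLipschitzOn Ω w := by
  obtain ⟨M, hM⟩ := exists_uniform_of_finite hT.finite
    (P := fun t M => ∀ x ∈ convexHull ℝ (t : Set Plane), ‖fderiv ℝ (polyFun (P t)) x‖ ≤ M)
    (fun t K K' hK h x hx => (h x hx).trans hK) (fun t ht => by
      obtain ⟨M, hM⟩ := (hT.isCompact ht).exists_bound_of_continuousOn
        (((contDiff_polyFun (P t)).continuous_fderiv (by simp)).continuousOn)
      exact ⟨M, hM⟩)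
  intro x hx
  obtain ⟨ε, hε, hball⟩ := Metric.isOpen_iff.1 hΩ x hx
  refine ⟨M.toNNReal, Metric.ball x ε, mem_nhdsWithin_of_mem_nhds (Metric.ball_mem_nhds x hε), ?_⟩
  refine lipschitzOnWith_of_finite_cover hT.finite (F := fun t => convexHull ℝ (t : Set Plane))
    (fun t ht => (hT.isCompact ht).isClosed) (fun t _ => convex_convexHull ℝ _)
    (f := fun t => polyFun (P t)) (fun t _ => (contDiff_polyFun (P t)).differentiable (by simp))
    (fun t ht x hx => (hM t ht x hx).trans (Real.le_coe_toNNReal M)) (convex_ball x ε) ?_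
    (hw.mono hball) hP
  rw [hT.cover]
  exact hball.trans subset_closure

/-! ### Weighted Sobolev jets -/

section Jets

variable {N : ℕ} {Q : Fin N → Plane} {b : Fin N → ℝ} {Ω U : Set Plane} {M : ℕ} {v : Plane → ℝ}
  {g : ℕ × ℕ → Plane → ℝ}

/-- The squared weighted seminorm of order `j`. -/
def wsq (Q : Fin N → Plane) (b : Fin N → ℝ) (U : Set Plane) (j : ℕ) (g : ℕ × ℕ → Plane → ℝ) :
    ℝ≥0∞ := fsq U j (fun ν x => rhoPow Q b j x * g ν x)

/-- The squared weighted norm of order `M`. -/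
def ksq (Q : Fin N → Plane) (b : Fin N → ℝ) (U : Set Plane) (M : ℕ) (g : ℕ × ℕ → Plane → ℝ) :
    ℝ≥0∞ := ∑ j ∈ Finset.range (M + 1), wsq Q b U j g

/-- The family `g` consists of the weak derivatives of `v ∈ K^M_b(Ω)`. -/
structure IsKondratievJet (Q : Fin N → Plane) (b : Fin N → ℝ) (Ω : Set Plane) (M : ℕ)
    (v : Plane → ℝ) (g : ℕ × ℕ → Plane → ℝ) : Prop where
  weak : ∀ ν, ν.1 + ν.2 ≤ M → IsWeakDeriv Ω ν v (g ν)
  fin : ksq Q b Ω M g ≠ ⊤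

theorem wsq_le_ksq {j : ℕ} (hj : j ≤ M) (hU : U ⊆ Ω) : wsq Q b U j g ≤ ksq Q b Ω M g :=
  (fsq_mono_set hU j _).trans (Finset.single_le_sum (f := fun j => wsq Q b Ω j g)
    (fun _ _ => zero_le) (Finset.mem_range.2 (by omega)))

theorem fsq_le_wsq {j : ℕ} (hU : IsOpen U) {c : ℝ} (hc : 0 < c)
    (h : ∀ x ∈ U, c ≤ rhoPow Q b j x) : fsq U j g ≤ ENNReal.ofReal (c⁻¹ ^ 2) * wsq Q b U j g := by
  unfold wsq fsq
  rw [Finset.mul_sum]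
  refine Finset.sum_le_sum fun ν _ => ?_
  rw [← enorm_sq_eq_ofReal, ← lsq_const_mul]
  refine setLIntegral_mono' hU.measurableSet fun x hx => ?_
  rw [enorm_sq_eq_ofReal, enorm_sq_eq_ofReal]
  refine ENNReal.ofReal_le_ofReal (sq_le_sq.2 ?_)
  change |g ν x| ≤ |c⁻¹ * (rhoPow Q b j x * g ν x)|
  rw [← mul_assoc, abs_mul]
  refine le_mul_of_one_le_left (abs_nonneg _) ?_
  refine le_trans ?_ (le_abs_self _)
  rw [inv_mul_eq_div, one_le_div hc]
  exact h x hx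

theorem IsKondratievJet.isSobolevJet (h : IsKondratievJet Q b Ω M v g) (hΩ : IsOpen Ω)
    (hU : IsOpen U) (hUΩ : U ⊆ Ω) {L : ℕ} (hL : L ≤ M)
    (hw : ∀ j ≤ L, ∃ c > 0, ∀ x ∈ U, c ≤ rhoPow Q b j x) : IsSobolevJet U L v g := by
  refine ⟨fun ν hν => (h.weak ν (hν.trans hL)).mono hΩ hUΩ, fun ν hν => ?_⟩
  obtain ⟨c, hc, hcw⟩ := hw _ hν
  refine ne_top_of_le_ne_top ?_ ((lsq_le_fsq U g ν).trans (fsq_le_wsq hU hc hcw))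
  exact ENNReal.mul_ne_top ENNReal.ofReal_ne_top
    (ne_top_of_le_ne_top h.fin (wsq_le_ksq (hν.trans hL) hUΩ))

theorem IsKondratievJet.isSobolevJet_of_isCompact (h : IsKondratievJet Q b Ω M v g)
    (hΩ : IsOpen Ω) (hU : IsOpen U) (hUΩ : U ⊆ Ω) {K : Set Plane} (hK : IsCompact K) (hUK : U ⊆ K)
    (hKQ : ∀ i, Q i ∉ K) : IsSobolevJet U M v g :=
  h.isSobolevJet hΩ hU hUΩ le_rfl fun j _ => by
    obtain ⟨c, hc, hcw⟩ := exists_rhoPow_ge (b := b) hK hKQ j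
    exact ⟨c, hc, fun x hx => hcw x (hUK hx)⟩

end Jets

/-! ### Polygonal domains away from the vertices -/

/-- Near a boundary point that is not a vertex, the boundary is a line through it. Each open half of
the disc is connected and avoids the boundary, so it lies inside or outside `Ω`; not both halves are
inside, since the domain equals the interior of its closure. -/
theorem IsPolygonalDomain.exists_convex_inter_ball {Ω : Set Plane} (hΩ : IsPolygonalDomain Ω)
    {x : Plane} (hx : x ∈ closure Ω) (hv : x ∉ domainVertices Ω) :
    ∃ ε > 0, Convex ℝ (Ω ∩ Metric.ball x ε) := by
  by_cases hxΩ : x ∈ Ω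
  · obtain ⟨ε, hε, hball⟩ := Metric.isOpen_iff.1 hΩ.isOpen x hxΩ
    exact ⟨ε, hε, by rw [inter_eq_right.2 hball]; exact convex_ball x ε⟩
  have hfr : x ∈ frontier Ω := by rw [hΩ.isOpen.frontier_eq]; exact ⟨hx, hxΩ⟩
  obtain ⟨ε, hε, u, hu, hline⟩ : ∃ ε > 0, ∃ u : Plane, u ≠ 0 ∧
      frontier Ω ∩ Metric.ball x ε = range (fun t : ℝ => x + t • u) ∩ Metric.ball x ε := by
    by_contra hcon
    exact hv ⟨hfr, hcon⟩
  refine ⟨ε, hε, ?_⟩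
  set l : Plane → ℝ := fun y => (y 0 - x 0) * u 1 - (y 1 - x 1) * u 0 with hl
  have hl0 : ∀ y ∈ Metric.ball x ε, (y ∈ frontier Ω ↔ l y = 0) := by
    intro y hy
    have h1 : y ∈ frontier Ω ↔ y ∈ range (fun t : ℝ => x + t • u) := by
      have := Set.ext_iff.1 hline y
      simpa [hy] using this
    rw [h1]
    constructor
    · rintro ⟨t, rfl⟩
      simp [hl]; ring
    · intro h0
      obtain ⟨i, hi⟩ : ∃ i, u i ≠ 0 := by
        by_contra! hcon
        exact hu (by ext i; simpa using hcon i)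
      refine ⟨(y i - x i) / u i, ?_⟩
      ext j
      simp only [hl] at h0
      simp only [PiLp.add_apply, PiLp.smul_apply, smul_eq_mul]
      have : (y i - x i) * u j = (y j - x j) * u i := by
        fin_cases i <;> fin_cases j <;> simp <;> linarith
      rw [div_mul_eq_mul_div, this, mul_div_cancel_right₀ _ hi]; ring
  have haff : ∀ (s : ℝ) (y z : Plane) (a b : ℝ), a + b = 1 →
      s * l (a • y + b • z) = a * (s * l y) + b * (s * l z) := by
    intro s y z a b hab
    obtain rfl : a = 1 - b := by linarith
    simp only [hl, PiLp.add_apply, PiLp.smul_apply, smul_eq_mul]; ring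
  have hconv : ∀ s : ℝ, Convex ℝ {y ∈ Metric.ball x ε | 0 < s * l y} := by
    intro s y hy z hz a b ha hb hab
    refine ⟨convex_ball x ε hy.1 hz.1 ha hb hab, ?_⟩
    have h1 := hy.2
    have h2 := hz.2
    simp only [haff _ _ _ _ _ hab]
    rcases ha.eq_or_lt with rfl | ha'
    · obtain rfl : b = 1 := by linarith
      linarith
    · positivity
  have hside : ∀ s : ℝ, {y ∈ Metric.ball x ε | 0 < s * l y} ⊆ Ω ∨
      ∀ y ∈ Metric.ball x ε, 0 < s * l y → y ∉ Ω := by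
    intro s
    by_contra! hcon
    obtain ⟨h1, y, hy, hys, hyΩ⟩ := hcon
    obtain ⟨z, hz, hzΩ⟩ := not_subset.1 h1
    have hdich : ∀ w ∈ {y ∈ Metric.ball x ε | 0 < s * l y}, w ∈ Ω ∪ (closure Ω)ᶜ := by
      intro w hw
      by_contra h
      rw [mem_union, not_or, mem_compl_iff, not_not] at h
      have h2 := hw.2
      rw [(hl0 w hw.1).1 (by rw [hΩ.isOpen.frontier_eq]; exact ⟨h.2, h.1⟩), mul_zero] at h2
      exact lt_irrefl _ h2
    obtain ⟨w, -, hw1, hw2⟩ := (hconv s).isPreconnected _ _ hΩ.isOpen isClosed_closure.isOpen_compl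
      hdich ⟨y, ⟨hy, hys⟩, hyΩ⟩ ⟨z, hz, (hdich z hz).resolve_left hzΩ⟩
    exact hw2 (subset_closure hw1)
  have hnot : ∀ y ∈ Ω, y ∈ Metric.ball x ε → l y ≠ 0 := by
    intro y hyΩ hy h0
    have := (hl0 y hy).2 h0
    rw [hΩ.isOpen.frontier_eq] at this
    exact this.2 hyΩ
  rcases hside 1 with h1 | h1 <;> rcases hside (-1) with h2 | h2
  · exfalso
    refine hxΩ ?_
    rw [← hΩ.regular, mem_interior_iff_mem_nhds]
    filter_upwards [Metric.ball_mem_nhds x hε] with y hy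
    rcases lt_trichotomy (l y) 0 with h3 | h3 | h3
    · exact subset_closure (h2 ⟨hy, by linarith⟩)
    · exact frontier_subset_closure ((hl0 y hy).2 h3)
    · exact subset_closure (h1 ⟨hy, by linarith⟩)
  · convert hconv 1 using 1
    ext y
    constructor
    · rintro ⟨hyΩ, hy⟩
      refine ⟨hy, ?_⟩
      have h3 := h2 y hy
      have h4 := hnot y hyΩ hy
      by_contra h5
      exact h3 (lt_of_le_of_ne (by linarith) (by intro h; apply h4; linarith)) hyΩ
    · exact fun hy => ⟨h1 hy, hy.1⟩
  · convert hconv (-1) using 1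
    ext y
    constructor
    · rintro ⟨hyΩ, hy⟩
      refine ⟨hy, ?_⟩
      have h3 := h1 y hy
      have h4 := hnot y hyΩ hy
      by_contra h5
      exact h3 (lt_of_le_of_ne (by linarith) (by intro h; apply h4; linarith)) hyΩ
    · exact fun hy => ⟨h2 hy, hy.1⟩
  · convert convex_empty (𝕜 := ℝ) (E := Plane) using 1
    ext y
    simp only [mem_inter_iff, mem_empty_iff_false, iff_false]
    rintro ⟨hyΩ, hy⟩
    rcases lt_trichotomy (l y) 0 with h3 | h3 | h3
    · exact h2 y hy (by linarith) hyΩ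
    · exact hnot y hyΩ hy h3
    · exact h1 y hy (by linarith) hyΩ

theorem EssCauchyAt.of_inter_ball {Ω : Set Plane} (hΩ : IsOpen Ω) {v : Plane → ℝ} {x : Plane}
    {ε : ℝ} (hε : 0 < ε) (h : EssCauchyAt (Ω ∩ Metric.ball x ε) v x) : EssCauchyAt Ω v x := by
  intro e he
  obtain ⟨c, δ, hδ, hc⟩ := h e he
  refine ⟨c, min δ ε, lt_min hδ hε, ?_⟩
  rw [ae_restrict_iff' (hΩ.inter Metric.isOpen_ball).measurableSet] at hc
  rw [ae_restrict_iff' hΩ.measurableSet]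
  filter_upwards [hc] with y hy hyΩ hyx
  exact hy ⟨hyΩ, hyx.trans_le (min_le_right _ _)⟩ (hyx.trans_le (min_le_left _ _))

/-- In a small disc away from the `Q i` the weights are bounded below, so `v` has an ordinary `H²`
jet on a convex set and is a uniform limit of smooth functions there. -/
theorem IsKondratievJet.essCauchyAt {N : ℕ} {Q : Fin N → Plane} {b : Fin N → ℝ} {Ω : Set Plane}
    {M : ℕ} {v : Plane → ℝ} {g : ℕ × ℕ → Plane → ℝ} (h : IsKondratievJet Q b Ω M v g) (hM : 2 ≤ M)
    (hΩ : IsPolygonalDomain Ω) (hQ : range Q = domainVertices Ω) {x : Plane} (hx : x ∈ closure Ω)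
    (hxQ : ∀ i, x ≠ Q i) : EssCauchyAt Ω v x := by
  obtain ⟨ε, hε, hconv⟩ := hΩ.exists_convex_inter_ball hx (by
    rw [← hQ]; rintro ⟨i, rfl⟩; exact hxQ i rfl)
  have hclosed : IsClosed (range Q) := (finite_range Q).isClosed
  obtain ⟨ε', hε', hball⟩ := Metric.nhds_basis_closedBall.mem_iff.1
    (hclosed.isOpen_compl.mem_nhds (show x ∈ (range Q)ᶜ by
      rintro ⟨i, rfl⟩; exact hxQ i rfl))
  have hr : 0 < min ε ε' := lt_min hε hε'
  refine EssCauchyAt.of_inter_ball hΩ.isOpen hr ?_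
  have hopen := hΩ.isOpen.inter (Metric.isOpen_ball (x := x) (ε := min ε ε'))
  have hjet : IsSobolevJet (Ω ∩ Metric.ball x (min ε ε')) M v g :=
    h.isSobolevJet_of_isCompact hΩ.isOpen hopen inter_subset_left
      (isCompact_closedBall x ε') (fun y hy => Metric.ball_subset_closedBall
        (Metric.ball_subset_ball (min_le_right _ _) hy.2)) fun i hi => hball hi (mem_range_self i)
  refine (hjet.mono_order hM).essCauchyAt ?_ hopen
    (Metric.isBounded_ball.subset inter_subset_right) ?_ x
  · have : Ω ∩ Metric.ball x (min ε ε')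
        = (Ω ∩ Metric.ball x ε) ∩ Metric.ball x (min ε ε') := by
      rw [inter_assoc, inter_eq_right.2 (Metric.ball_subset_ball (min_le_left ε ε'))]
    rw [this]
    exact hconv.inter (convex_ball _ _)
  · obtain ⟨y, hy, hyΩ⟩ := mem_closure_iff.1 hx _ Metric.isOpen_ball (Metric.mem_ball_self hr)
    exact ⟨y, hyΩ, hy⟩

/-! ### The supremum bound near a vertex -/

theorem le_ofReal_div_mul {c N : ℝ≥0∞} {x y : ℝ} (hx : 0 < x)
    (h : ENNReal.ofReal x * c ≤ ENNReal.ofReal y * N) : c ≤ ENNReal.ofReal (y / x) * N := by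
  have e : ENNReal.ofReal x⁻¹ * ENNReal.ofReal x = 1 := by
    rw [← ENNReal.ofReal_mul (inv_nonneg.2 hx.le), inv_mul_cancel₀ hx.ne', ENNReal.ofReal_one]
  calc c = ENNReal.ofReal x⁻¹ * (ENNReal.ofReal x * c) := by rw [← mul_assoc, e, one_mul]
    _ ≤ ENNReal.ofReal x⁻¹ * (ENNReal.ofReal y * N) := mul_le_mul_right h _
    _ = _ := by
        rw [← mul_assoc, ← ENNReal.ofReal_mul (inv_nonneg.2 hx.le), inv_mul_eq_div]

theorem isOpen_strip (A B C : Plane) (s r : ℝ) :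
    IsOpen {x ∈ openTri A B C | s < 1 - bary A B C x ∧ 1 - bary A B C x < r} :=
  (isOpen_openTri A B C).inter ((isOpen_lt continuous_const
    (continuous_const.sub (continuous_bary A B C))).inter
    (isOpen_lt (continuous_const.sub (continuous_bary A B C)) continuous_const))

theorem convex_strip (A B C : Plane) (s r : ℝ) :
    Convex ℝ {x ∈ openTri A B C | s < 1 - bary A B C x ∧ 1 - bary A B C x < r} := by
  have e : ∀ x y : Plane, ∀ α β : ℝ, α + β = 1 → 1 - bary A B C (α • x + β • y)
      = α * (1 - bary A B C x) + β * (1 - bary A B C y) := by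
    intro x y α β h
    rw [bary_affine _ _ _ h]; linear_combination -h
  intro x hx y hy α β hα hβ hab
  refine ⟨convex_openTri A B C hx.1 hy.1 hα hβ hab, ?_⟩
  rw [e x y α β hab]
  obtain ⟨-, hx1, hx2⟩ := hx
  obtain ⟨-, hy1, hy2⟩ := hy
  rcases hα.eq_or_lt with rfl | hα'
  · obtain rfl : β = 1 := by linarith
    constructor <;> linarith
  · obtain rfl : β = 1 - α := by linarith
    constructor <;> nlinarith

/-- The strip at scale `τ ≤ 1` contains the image of the strip at scale one under the homothety of
ratio `τ` centred at `A`. -/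
theorem exists_volume_strip {A B C : Plane} (h : tdet A B C ≠ 0) : ∃ v₁ > 0, ∀ τ : ℝ, 0 < τ →
    τ ≤ 1 → ENNReal.ofReal (τ ^ 2 * v₁) ≤
      volume {x ∈ openTri A B C | τ / 2 < 1 - bary A B C x ∧ 1 - bary A B C x < 2 * τ} := by
  set U := {x ∈ openTri A B C | 1 / 2 < 1 - bary A B C x ∧ 1 - bary A B C x < 2} with hU
  have hne : U.Nonempty := by
    refine ⟨(1 / 6 : ℝ) • A + (5 / 12 : ℝ) • B + (5 / 12 : ℝ) • C, ⟨?_, ?_, ?_⟩, ?_⟩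
    · rw [bary_of_combo h (by norm_num)]; norm_num
    · rw [bary_of_combo' h (by norm_num)]; norm_num
    · rw [bary_of_combo'' h (by norm_num)]; norm_num
    · rw [bary_of_combo h (by norm_num)]; norm_num
  have hpos : 0 < volume U := (isOpen_strip A B C _ _).measure_pos volume hne
  have hfin : volume U ≠ ⊤ := ((isBounded_openTri h).subset fun x hx => hx.1).measure_lt_top.ne
  refine ⟨(volume U).toReal, ENNReal.toReal_pos hpos.ne' hfin, fun τ hτ hτ1 => ?_⟩
  have hvol := Measure.addHaar_image_homothety (μ := (volume : Measure Plane)) A τ U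
  rw [finrank_euclideanSpace_fin, abs_of_pos (by positivity)] at hvol
  rw [ENNReal.ofReal_mul (by positivity), ENNReal.ofReal_toReal hfin, ← hvol]
  refine measure_mono ?_
  rintro _ ⟨y, ⟨⟨h1, h2, h3⟩, h4, h5⟩, rfl⟩
  have e : AffineMap.homothety A τ y = node τ A y := by
    rw [AffineMap.homothety_apply]; unfold node
    simp only [vsub_eq_sub, vadd_eq_add]; module
  rw [e]
  refine ⟨⟨?_, ?_, ?_⟩, ?_⟩
  · rw [bary_node, bary_self h]; nlinarith
  · rw [bary_node, bary_third]; positivity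
  · rw [bary_node, bary_second]; positivity
  · rw [one_sub_bary_node h]
    constructor <;> nlinarith

theorem dist_le_one_sub_bary {A B C : Plane} (h : tdet A B C ≠ 0) : ∃ d₀ > 0, ∀ x ∈ openTri A B C,
    dist x A ≤ d₀ * (1 - bary A B C x) := by
  obtain ⟨R, hR⟩ := (isCompact_convexHull_triple A B C).isBounded.subset_closedBall A
  refine ⟨max R 1, by positivity, fun x hx => ?_⟩
  have hξ : 0 < 1 - bary A B C x := by
    have := bary_sum h x
    linarith [hx.2.1, hx.2.2]
  obtain ⟨y, hy, hxy⟩ := exists_dist_eq_mul h (openTri_subset h hx) hξ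
  rw [hxy, mul_comm]
  refine mul_le_mul_of_nonneg_right (le_max_of_le_left ?_) hξ.le
  exact hR (convexHull_mono (by intro z; simp; tauto) hy)

theorem rpow_ge_of_mem_strip {τ ξ : ℝ} (hτ : 0 < τ) (h1 : τ / 2 < ξ) (h2 : ξ < 2 * τ) (e : ℝ) :
    (2 : ℝ) ^ (-|e|) * τ ^ e ≤ ξ ^ e := by
  have hξ : 0 < ξ := by linarith
  rcases le_total 0 e with he | he
  · rw [abs_of_nonneg he, Real.rpow_neg two_pos.le, ← Real.inv_rpow two_pos.le,
      ← Real.mul_rpow (by norm_num) hτ.le]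
    exact Real.rpow_le_rpow (by positivity) (by linarith) he
  · rw [abs_of_nonpos he, neg_neg, ← Real.mul_rpow two_pos.le hτ.le]
    exact Real.rpow_le_rpow_of_nonpos hξ h2.le he

/-- The factor `τ^(2j)` of the supremum bound and the weight of order `j` compensate: the power `τ²
τ^(2e)` is the same for every `j`. -/
theorem fsq_strip_le {N : ℕ} {Q : Fin N → Plane} {b : Fin N → ℝ} {Ω U : Set Plane} {M j : ℕ}
    (hj : j ≤ M) {g : ℕ × ℕ → Plane → ℝ} (hU : IsOpen U) (hUΩ : U ⊆ Ω) {c τ e D : ℝ}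
    (hc : 0 < c) (hτ : 0 < τ) (hw : ∀ x ∈ U, c * τ ^ ((j : ℝ) - (e + 1)) ≤ rhoPow Q b j x) :
    ENNReal.ofReal ((D * τ) ^ (2 * j)) * fsq U j g
      ≤ ENNReal.ofReal (D ^ (2 * j) * c⁻¹ ^ 2 * (τ ^ 2 * τ ^ (2 * e))) * ksq Q b Ω M g := by
  have h1 := (fsq_le_wsq (g := g) hU (mul_pos hc (Real.rpow_pos_of_pos hτ _)) hw).trans
    (mul_le_mul_right (wsq_le_ksq hj hUΩ) _)
  refine (mul_le_mul_right h1 _).trans (le_of_eq ?_)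
  rw [← mul_assoc, ← ENNReal.ofReal_mul ((even_two_mul j).pow_nonneg _)]
  congr 2
  have e1 : (c * τ ^ ((j : ℝ) - (e + 1)))⁻¹ ^ 2 = c⁻¹ ^ 2 * (τ ^ ((e + 1) - j)) ^ 2 := by
    rw [mul_inv, ← Real.rpow_neg hτ.le, neg_sub, mul_pow]
  have e2 : τ ^ (2 * j) * (τ ^ ((e + 1) - j)) ^ 2 = τ ^ 2 * τ ^ (2 * e) := by
    rw [← Real.rpow_natCast τ (2 * j), ← Real.rpow_natCast (τ ^ (e + 1 - j)) 2,
      ← Real.rpow_natCast τ 2, ← Real.rpow_mul hτ.le, ← Real.rpow_add hτ, ← Real.rpow_add hτ]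
    congr 1; push_cast; ring
  rw [e1, mul_pow]
  linear_combination (D ^ (2 * j) * c⁻¹ ^ 2) * e2

theorem multiDeriv_zero_fun (ν : ℕ × ℕ) : multiDeriv ν (fun _ => 0) = fun _ => 0 := by
  have h : ∀ i, partialDeriv i (fun _ => 0) = fun _ => 0 := fun i => by
    funext x; simp [partialDeriv]
  rw [multiDeriv, Function.iterate_fixed (h 1), Function.iterate_fixed (h 0)]

theorem IsSobolevJet.ae_le {U : Set Plane} {v : Plane → ℝ}
    {g : ℕ × ℕ → Plane → ℝ} (h : IsSobolevJet U 2 v g) (hU : Convex ℝ U) (hUo : IsOpen U)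
    (hUb : Bornology.IsBounded U) (hUn : U.Nonempty) {d : ℝ≥0}
    (hd : ∀ x ∈ U, ∀ y ∈ U, dist x y ≤ d) :
    ∀ᵐ x ∂volume.restrict U, volume U * ‖v x‖ₑ ^ 2 ≤
      12 * ∑ j ∈ Finset.range 3, ENNReal.ofReal ((d : ℝ) ^ (2 * j)) * fsq U j g := by
  filter_upwards [h.ae_sub_le hU hUo hUb hUn hd (f := fun _ => 0) contDiff_const] with x hx
  simp only [multiDeriv_zero_fun, sub_zero] at hx
  refine hx.trans (le_of_eq ?_)
  simp [Finset.sum_range_succ]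

theorem ae_le_of_strip {N : ℕ} {Q : Fin N → Plane} {b : Fin N → ℝ} {Ω U : Set Plane} {M : ℕ}
    (hM : 2 ≤ M) {v : Plane → ℝ} {g : ℕ × ℕ → Plane → ℝ} (hΩ : IsOpen Ω)
    (hj : IsKondratievJet Q b Ω M v g) (hU : IsOpen U) (hconv : Convex ℝ U)
    (hb : Bornology.IsBounded U) (hUΩ : U ⊆ Ω) {τ e D v₁ : ℝ} {c : ℕ → ℝ} (hc : ∀ j, 0 < c j)
    (hτ : 0 < τ) (hv₁ : 0 < v₁) (hvol : ENNReal.ofReal (τ ^ 2 * v₁) ≤ volume U) (hD : 0 ≤ D)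
    (hd : ∀ x ∈ U, ∀ y ∈ U, dist x y ≤ D * τ)
    (hw : ∀ j, ∀ x ∈ U, c j * τ ^ ((j : ℝ) - (e + 1)) ≤ rhoPow Q b j x) :
    ∀ᵐ x ∂volume.restrict U, ‖v x‖ₑ ^ 2 ≤ ENNReal.ofReal
      (12 * (∑ j ∈ Finset.range 3, D ^ (2 * j) * (c j)⁻¹ ^ 2) / v₁ * τ ^ (2 * e))
        * ksq Q b Ω M g := by
  have hne : U.Nonempty := by
    refine nonempty_of_measure_ne_zero (μ := volume) (ne_of_gt (lt_of_lt_of_le ?_ hvol))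
    exact ENNReal.ofReal_pos.2 (by positivity)
  have hjet : IsSobolevJet U 2 v g := hj.isSobolevJet hΩ hU hUΩ hM fun j _ =>
    ⟨_, mul_pos (hc j) (Real.rpow_pos_of_pos hτ _), hw j⟩
  filter_upwards [hjet.ae_le hconv hU hb hne (d := ⟨D * τ, by positivity⟩) hd] with x hx
  have h1 : ∑ j ∈ Finset.range 3, ENNReal.ofReal ((D * τ) ^ (2 * j)) * fsq U j g
      ≤ ENNReal.ofReal ((∑ j ∈ Finset.range 3, D ^ (2 * j) * (c j)⁻¹ ^ 2)
        * (τ ^ 2 * τ ^ (2 * e))) * ksq Q b Ω M g := by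
    rw [Finset.sum_mul, ENNReal.ofReal_sum_of_nonneg (fun j _ => by positivity), Finset.sum_mul]
    refine Finset.sum_le_sum fun j hj' => ?_
    have := Finset.mem_range.1 hj'
    exact fsq_strip_le (by omega) hU hUΩ (hc j) hτ (hw j)
  have h2 : ENNReal.ofReal (τ ^ 2 * v₁) * ‖v x‖ₑ ^ 2 ≤ ENNReal.ofReal
      (12 * ((∑ j ∈ Finset.range 3, D ^ (2 * j) * (c j)⁻¹ ^ 2) * (τ ^ 2 * τ ^ (2 * e))))
        * ksq Q b Ω M g := by
    refine (mul_le_mul_left hvol _).trans (hx.trans ?_)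
    rw [ENNReal.ofReal_mul (by norm_num), mul_assoc,
      show ENNReal.ofReal 12 = 12 by norm_num]
    exact mul_le_mul_right h1 _
  refine (le_ofReal_div_mul (by positivity) h2).trans (le_of_eq ?_)
  congr 2
  field_simp

/-- On the strip where `1 - bary` is comparable to `τ = 2^(-k)`, the scaled supremum bound has
right-hand side `τ² τ^(2 a_i) ‖v‖²`; division by the area, at least a constant times `τ²`, leaves
`τ^(2 a_i) ‖v‖²`. The strips overlap and cover the open triangle. -/
theorem exists_corner_sup {N : ℕ} {Q : Fin N → Plane} {a : Fin N → ℝ} {Ω : Set Plane}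
    (hΩ : IsOpen Ω) {i : Fin N} (ha : 0 < a i) {B C : Plane} (h : tdet (Q i) B C ≠ 0)
    (hQ : ∀ l, Q l ∈ convexHull ℝ ({Q i, B, C} : Set Plane) → l = i)
    (hsub : openTri (Q i) B C ⊆ Ω) : ∃ K : ℝ, 0 < K ∧
    ∀ (M : ℕ) (v : Plane → ℝ) (g : ℕ × ℕ → Plane → ℝ), 2 ≤ M →
      IsKondratievJet Q (fun i => a i + 1) Ω M v g →
      ∀ᵐ x ∂volume.restrict (openTri (Q i) B C), ‖v x‖ₑ ^ 2 ≤
        ENNReal.ofReal (K * (1 - bary (Q i) B C x) ^ (2 * a i))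
          * ksq Q (fun i => a i + 1) Ω M g := by
  obtain ⟨v₁, hv₁, hvol⟩ := exists_volume_strip h
  obtain ⟨d₀, hd₀, hdist⟩ := dist_le_one_sub_bary h
  choose c hc hcw using fun j : ℕ => exists_rhoPow_ge_corner (b := fun i => a i + 1) h hQ j
  set c' : ℕ → ℝ := fun j => c j * (2 : ℝ) ^ (-|(j : ℝ) - (a i + 1)|) with hc'
  have hc'0 : ∀ j, 0 < c' j := fun j => mul_pos (hc j) (Real.rpow_pos_of_pos two_pos _)
  -- Two points of a strip are each within `2 τ d₀` of `Q i`.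
  set D := 4 * d₀ with hD
  set K₀ : ℝ := ∑ j ∈ Finset.range 3, D ^ (2 * j) * (c' j)⁻¹ ^ 2 with hK₀
  have hK₀0 : 0 < K₀ := Finset.sum_pos (fun j _ => by
    have := hc'0 j
    positivity) (by simp)
  refine ⟨12 * K₀ / v₁ * (2 : ℝ) ^ (2 * a i), by positivity, fun M v g hM hj => ?_⟩
  set Nk := ksq Q (fun i => a i + 1) Ω M g with hNk
  set U : ℕ → Set Plane := fun k => {x ∈ openTri (Q i) B C | (1 / 2 : ℝ) ^ k / 2
    < 1 - bary (Q i) B C x ∧ 1 - bary (Q i) B C x < 2 * (1 / 2 : ℝ) ^ k} with hU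
  have hstrip : ∀ k, ∀ᵐ x ∂volume.restrict (U k), ‖v x‖ₑ ^ 2 ≤
      ENNReal.ofReal (12 * K₀ / v₁ * ((1 / 2 : ℝ) ^ k) ^ (2 * a i)) * Nk := by
    intro k
    have hτ : (0 : ℝ) < (1 / 2) ^ k := by positivity
    have hτ1 : (1 / 2 : ℝ) ^ k ≤ 1 := pow_le_one₀ (by norm_num) (by norm_num)
    have hvk := hvol _ hτ hτ1
    refine ae_le_of_strip hM hΩ hj (isOpen_strip _ _ _ _ _) (convex_strip _ _ _ _ _)
      ((isBounded_openTri h).subset fun x hx => hx.1) (fun x hx => hsub hx.1) hc'0 hτ hv₁ hvk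
      (by positivity) ?_ ?_
    · intro x hx y hy
      have h1 := hdist x hx.1
      have h2 := hdist y hy.1
      have h3 := mul_le_mul_of_nonneg_left hx.2.2.le hd₀.le
      have h4 := mul_le_mul_of_nonneg_left hy.2.2.le hd₀.le
      have h5 := dist_triangle_right x y (Q i)
      rw [hD]; linarith
    · intro j x hx
      refine le_trans ?_ (hcw j x (openTri_subset h hx.1) (lt_trans (by positivity) hx.2.1))
      rw [hc', mul_assoc]
      exact mul_le_mul_of_nonneg_left (rpow_ge_of_mem_strip hτ hx.2.1 hx.2.2 _) (hc j).le
  have hall : ∀ᵐ x ∂volume, ∀ k, x ∈ U k → ‖v x‖ₑ ^ 2 ≤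
      ENNReal.ofReal (12 * K₀ / v₁ * ((1 / 2 : ℝ) ^ k) ^ (2 * a i)) * Nk :=
    ae_all_iff.2 fun k => (ae_restrict_iff' (isOpen_strip _ _ _ _ _).measurableSet).1 (hstrip k)
  rw [ae_restrict_iff' (isOpen_openTri _ _ _).measurableSet]
  filter_upwards [hall] with x hx hxt
  have hsum := bary_sum h x
  have hξ : 0 < 1 - bary (Q i) B C x := by linarith [hxt.2.1, hxt.2.2]
  have hξ1 : 1 - bary (Q i) B C x ≤ 1 := by linarith [hxt.1]
  obtain ⟨k, hk1, hk2⟩ := exists_nat_pow_near_of_lt_one hξ hξ1 (y := (1 / 2 : ℝ)) (by norm_num)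
    (by norm_num)
  have hτ : (0 : ℝ) < (1 / 2) ^ k := by positivity
  rw [pow_succ] at hk1
  refine (hx k ⟨hxt, by linarith, by linarith⟩).trans ?_
  refine mul_le_mul_left (ENNReal.ofReal_le_ofReal ?_) _
  rw [mul_assoc (12 * K₀ / v₁), ← Real.mul_rpow two_pos.le hξ.le]
  refine mul_le_mul_of_nonneg_left (Real.rpow_le_rpow hτ.le (by linarith) (by positivity))
    (by positivity)

/-! ### The continuous representative -/

/-- An open convex set is the interior of its closure. In particular `openTri` does not depend on
the order of the vertices. -/
theorem openTri_eq_interior {A B C : Plane} (h : tdet A B C ≠ 0) :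
    openTri A B C = interior (convexHull ℝ ({A, B, C} : Set Plane)) := by
  have h1 := (convex_openTri A B C).interior_closure_eq_interior_of_nonempty_interior
    (by rw [(isOpen_openTri A B C).interior_eq]; exact openTri_nonempty h)
  rw [closure_openTri h, (isOpen_openTri A B C).interior_eq] at h1
  exact h1.symm

theorem IsTriMesh.openTri_subset {Ω : Set Plane} (hreg : interior (closure Ω) = Ω)
    {T : Set (Finset Plane)} (hT : IsTriMesh T (closure Ω)) {A B C : Plane}
    (h : tdet A B C ≠ 0) (ht : {A, B, C} ∈ T) : openTri A B C ⊆ Ω := by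
  rw [← hreg]
  refine interior_maximal ((GradedFEM.openTri_subset h).trans ?_) (isOpen_openTri A B C)
  simpa using hT.subset ht

theorem IsTriMesh.ae_of_forall {Ω : Set Plane} (hΩ : MeasurableSet Ω) {T : Set (Finset Plane)}
    (hT : IsTriMesh T (closure Ω)) {q : Plane → Prop}
    (h : ∀ A B C : Plane, tdet A B C ≠ 0 → {A, B, C} ∈ T →
      ∀ᵐ x ∂volume.restrict (openTri A B C), q x) : ∀ᵐ x ∂volume.restrict Ω, q x := by
  have h1 : ∀ t ∈ T, ∀ᵐ x ∂(volume : Measure Plane), x ∈ convexHull ℝ (t : Set Plane) → q x := by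
    intro t ht
    obtain ⟨A, B, C, hABC, rfl⟩ := hT.isTri t ht
    have h2 := (ae_restrict_iff' (isOpen_openTri A B C).measurableSet).1 (h A B C hABC ht)
    filter_upwards [h2, (convexHull_ae_eq_openTri hABC).mem_iff] with x hx hx' hmem
    exact hx (hx'.1 (by simpa using hmem))
  rw [ae_restrict_iff' hΩ]
  filter_upwards [(ae_ball_iff hT.finite.countable).2 h1] with x hx hxΩ
  have : x ∈ ⋃ t ∈ T, convexHull ℝ (t : Set Plane) := by rw [hT.cover]; exact subset_closure hxΩ
  obtain ⟨t, ht, hxt⟩ := mem_iUnion₂.1 this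
  exact hx t ht hxt

namespace GradedSetup

variable {Ω : Set Plane} {N : ℕ} {Q : Fin N → Plane} {T₀ : Set (Finset Plane)}
  {a : Fin N → ℝ} {θ : ℝ} {p : ℕ}

/-- The essential limit at `Q i` is `0`: on each initial triangle at `Q i` the bound of
`exists_corner_sup` is continuous and vanishes at `Q i` because `a i > 0`, and the other triangles
stay away from `Q i`. -/
theorem essCauchyAt_vertex (S : GradedSetup Ω Q T₀ a θ p) {M : ℕ} (hM : 2 ≤ M) {v : Plane → ℝ}
    {g : ℕ × ℕ → Plane → ℝ} (hj : IsKondratievJet Q (fun i => a i + 1) Ω M v g) (i : Fin N) :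
    EssCauchyAt Ω v (Q i) := by
  intro ε hε
  have key : ∀ t ∈ T₀, ∃ V ∈ 𝓝 (Q i), ∀ A B C : Plane, tdet A B C ≠ 0 → t = {A, B, C} →
      ∀ᵐ x ∂volume.restrict (openTri A B C), x ∈ V → |v x - 0| ≤ ε := by
    intro t ht
    by_cases hi : Q i ∈ t
    · obtain ⟨B, C, h, e⟩ := (S.mesh.isTri t ht).exists_of_mem hi
      subst e
      obtain ⟨K, hK, hsup⟩ := exists_corner_sup S.domain.isOpen (S.pos i) h
        (fun l hl => S.eq_of_mem_convexHull ht hi (by simpa using hl))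
        (S.mesh.openTri_subset S.domain.regular h ht)
      set Nk := ksq Q (fun i => a i + 1) Ω M g with hNk
      set F : Plane → ℝ := fun x => K * (1 - bary (Q i) B C x) ^ (2 * a i) * Nk.toReal with hF
      have hFc : Continuous F := by
        have h1 : Continuous fun x => (1 - bary (Q i) B C x) ^ (2 * a i) :=
          (continuous_const.sub (continuous_bary _ _ _)).rpow_const
            fun x => Or.inr (by have := S.pos i; positivity)
        exact (continuous_const.mul h1).mul continuous_const
      have hF0 : F (Q i) < ε ^ 2 := by
        have := S.pos i
        simp only [hF, bary_self h, sub_self]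
        rw [Real.zero_rpow (by positivity)]
        simp only [mul_zero, zero_mul]
        positivity
      refine ⟨{x | F x < ε ^ 2}, (isOpen_lt hFc continuous_const).mem_nhds hF0, ?_⟩
      intro A' B' C' h' e
      have hopen : openTri A' B' C' = openTri (Q i) B C := by
        have e' : ({Q i, B, C} : Set Plane) = {A', B', C'} := by
          have := congrArg (fun s : Finset Plane => (s : Set Plane)) e
          simpa using this
        rw [openTri_eq_interior h', openTri_eq_interior h, e']
      rw [hopen, ae_restrict_iff' (isOpen_openTri _ _ _).measurableSet]
      have h2 := (ae_restrict_iff' (isOpen_openTri _ _ _).measurableSet).1 (hsup M v g hM hj)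
      filter_upwards [h2] with x hx hxt hxV
      have hξ : 0 ≤ 1 - bary (Q i) B C x := by
        have := bary_sum h x
        linarith [hxt.2.1, hxt.2.2]
      have h3 := hx hxt
      rw [← ENNReal.ofReal_toReal hj.fin, ← ENNReal.ofReal_mul (by positivity),
        enorm_sq_eq_ofReal, ENNReal.ofReal_le_ofReal_iff (by positivity)] at h3
      rw [sub_zero]
      exact abs_le_of_sq_le_sq (h3.trans (le_of_lt hxV)) hε.le
    · have hn : Q i ∉ convexHull ℝ (t : Set Plane) := fun h => hi (S.mem_of_mem_convexHull ht h)
      refine ⟨_, (S.mesh.isCompact ht).isClosed.isOpen_compl.mem_nhds hn, ?_⟩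
      rintro A B C h rfl
      rw [ae_restrict_iff' (isOpen_openTri _ _ _).measurableSet]
      exact Eventually.of_forall fun x hx hxV =>
        absurd (by simpa using GradedFEM.openTri_subset h hx) hxV
  choose! V hV hVv using key
  obtain ⟨δ, hδ, hball⟩ := Metric.mem_nhds_iff.1 ((Filter.biInter_mem S.mesh.finite).2 hV)
  refine ⟨0, δ, hδ, S.mesh.ae_of_forall S.domain.isOpen.measurableSet fun A B C h ht => ?_⟩
  filter_upwards [hVv _ ht A B C h rfl] with x hx hxδ
  exact hx (mem_iInter₂.1 (hball hxδ) _ ht)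

theorem exists_isContinuousRep (S : GradedSetup Ω Q T₀ a θ p) {M : ℕ} (hM : 2 ≤ M) {v : Plane → ℝ}
    {g : ℕ × ℕ → Plane → ℝ} (hj : IsKondratievJet Q (fun i => a i + 1) Ω M v g) :
    ∃ vc, IsContinuousRep Ω v vc := by
  refine exists_continuousOn_of_essCauchyAt S.domain.isOpen subset_closure subset_rfl
    fun x hx => ?_
  by_cases hxQ : ∃ i, x = Q i
  · obtain ⟨i, rfl⟩ := hxQ
    exact S.essCauchyAt_vertex hM hj i
  · exact hj.essCauchyAt hM S.domain S.range_eq hx (by simpa using hxQ)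

end GradedSetup

/-! ### Local interpolation estimates -/

/-- The squared `H¹(U)` distance of the jet `g` to the polynomial `P`. -/
def errSq (U : Set Plane) (g : ℕ × ℕ → Plane → ℝ) (P : MvPolynomial (Fin 2) ℝ) : ℝ≥0∞ :=
  lsq U (fun x => g (0, 0) x - polyFun P x) +
    (lsq U (fun x => g (0, 1) x - partialDeriv 1 (polyFun P) x) +
      lsq U (fun x => g (1, 0) x - partialDeriv 0 (polyFun P) x))

theorem coe_pow_eq_ofReal (d : ℝ≥0) (n : ℕ) : (d : ℝ≥0∞) ^ n = ENNReal.ofReal ((d : ℝ) ^ n) := by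
  rw [ENNReal.ofReal_pow d.coe_nonneg, ENNReal.ofReal_coe_nnreal]

theorem lagrangeNodes_subset {k : ℕ} (hk : 1 ≤ k) {A B C : Plane} (h : tdet A B C ≠ 0) :
    lagrangeNodes k {A, B, C} ⊆ convexHull ℝ ({A, B, C} : Set Plane) := by
  intro x hx
  obtain ⟨μ, hμ, rfl⟩ := (mem_lagrangeNodes_triple hk h).1 hx
  rw [mem_multiIndices] at hμ
  have hk0 : (0 : ℝ) < k := by positivity
  have hs : ((k : ℝ) - μ.1 - μ.2) / k + (μ.1 : ℝ) / k + (μ.2 : ℝ) / k = 1 := by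
    field_simp; ring
  rw [convexHull_triple h, mem_ofPred_eq, bary_of_combo h hs, bary_of_combo' h hs,
    bary_of_combo'' h hs]
  have : ((μ.1 : ℝ) + μ.2) ≤ k := by exact_mod_cast hμ
  exact ⟨div_nonneg (by linarith) hk0.le, by positivity, by positivity⟩

theorem lsq_sub_le (U : Set Plane) {f : Plane → ℝ} (hf : Continuous f) (w : Plane → ℝ) :
    lsq U (fun x => w x - f x) ≤ 2 * (lsq U f + lsq U w) := by
  have := lsq_add_le U (f := fun x => - f x) (g := w) hf.neg.aestronglyMeasurable
  rw [lsq_neg] at this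
  simpa only [neg_add_eq_sub] using this

theorem lsq_le_mul_volume {U : Set Plane} {f : Plane → ℝ} {B : ℝ≥0∞}
    (h : ∀ᵐ x ∂volume.restrict U, ‖f x‖ₑ ^ 2 ≤ B) : lsq U f ≤ B * volume U := by
  calc lsq U f ≤ ∫⁻ _ in U, B := lintegral_mono_ae h
    _ = B * volume U := by rw [lintegral_const, Measure.restrict_apply_univ]

theorem continuous_polyFun (P : MvPolynomial (Fin 2) ℝ) : Continuous (polyFun P) :=
  (contDiff_polyFun P).continuous

theorem continuous_partialDeriv_polyFun (i : Fin 2) (P : MvPolynomial (Fin 2) ℝ) :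
    Continuous (partialDeriv i (polyFun P)) :=
  ((contDiff_polyFun P).partialDeriv i).continuous

/-- A crude bound for the error on a small set on which the function and its interpolant are
bounded. -/
theorem errSq_le_of_bounds {U : Set Plane} (hU : MeasurableSet U) {d S : ℝ≥0} (hd : d ≠ 0)
    {V G E : ℝ≥0∞} (hvol : volume U ≤ (d : ℝ≥0∞) ^ 2 * V) {v : Plane → ℝ}
    {g : ℕ × ℕ → Plane → ℝ} (hgv : g (0, 0) =ᵐ[volume.restrict U] v)
    (hv : ∀ᵐ x ∂volume.restrict U, ‖v x‖ₑ ^ 2 ≤ E) {P : MvPolynomial (Fin 2) ℝ}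
    (hP : ∀ x ∈ U, ‖polyFun P x‖ₑ ^ 2 ≤ S * E ∧
      ∀ i, (d : ℝ≥0∞) ^ 2 * ‖partialDeriv i (polyFun P) x‖ₑ ^ 2 ≤ S * E)
    (hG : fsq U 1 g ≤ G) :
    errSq U g P ≤ 2 * (1 + S) * (d : ℝ≥0∞) ^ 2 * V * E + 4 * S * V * E + 2 * G := by
  have hd2 : (d : ℝ≥0∞) ^ 2 ≠ 0 := by simpa using hd
  have hd2' : (d : ℝ≥0∞) ^ 2 ≠ ⊤ := by simp
  have hdd : ((d : ℝ≥0∞) ^ 2)⁻¹ * (d : ℝ≥0∞) ^ 2 = 1 := ENNReal.inv_mul_cancel hd2 hd2'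
  have h0 : lsq U (g (0, 0)) ≤ E * ((d : ℝ≥0∞) ^ 2 * V) := by
    rw [lsq_congr hgv]
    exact (lsq_le_mul_volume hv).trans (mul_le_mul_right hvol _)
  have h1 : lsq U (polyFun P) ≤ S * E * ((d : ℝ≥0∞) ^ 2 * V) :=
    (lsq_le_mul_volume ((ae_restrict_iff' hU).2 (Eventually.of_forall fun x hx =>
      (hP x hx).1))).trans (mul_le_mul_right hvol _)
  have h2 : ∀ i, lsq U (partialDeriv i (polyFun P)) ≤ S * E * V := by
    intro i
    have : lsq U (partialDeriv i (polyFun P)) ≤ (((d : ℝ≥0∞) ^ 2)⁻¹ * (S * E)) * volume U := by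
      refine lsq_le_mul_volume ((ae_restrict_iff' hU).2 (Eventually.of_forall fun x hx => ?_))
      calc ‖partialDeriv i (polyFun P) x‖ₑ ^ 2
          = ((d : ℝ≥0∞) ^ 2)⁻¹ * ((d : ℝ≥0∞) ^ 2 * ‖partialDeriv i (polyFun P) x‖ₑ ^ 2) := by
            rw [← mul_assoc, hdd, one_mul]
        _ ≤ _ := mul_le_mul_right ((hP x hx).2 i) _
    refine this.trans ((mul_le_mul_right hvol _).trans (le_of_eq ?_))
    calc ((d : ℝ≥0∞) ^ 2)⁻¹ * (S * E) * ((d : ℝ≥0∞) ^ 2 * V)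
        = (((d : ℝ≥0∞) ^ 2)⁻¹ * (d : ℝ≥0∞) ^ 2) * (S * E * V) := by ring
      _ = S * E * V := by rw [hdd, one_mul]
  rw [fsq_one] at hG
  have k0 := (lsq_sub_le U (continuous_polyFun P) (g (0, 0))).trans
    (mul_le_mul_right (add_le_add h1 h0) 2)
  have k1 := (lsq_sub_le U (continuous_partialDeriv_polyFun 1 P) (g (0, 1))).trans
    (mul_le_mul_right (add_le_add (h2 1) le_rfl) 2)
  have k2 := (lsq_sub_le U (continuous_partialDeriv_polyFun 0 P) (g (1, 0))).trans
    (mul_le_mul_right (add_le_add (h2 0) le_rfl) 2)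
  unfold errSq
  refine (add_le_add k0 (add_le_add k1 k2)).trans ?_
  calc _ = 2 * (1 + S) * (d : ℝ≥0∞) ^ 2 * V * E + 4 * S * V * E
        + 2 * (lsq U (g (0, 1)) + lsq U (g (1, 0))) := by ring
    _ ≤ _ := by gcongr

namespace GradedSetup

variable {Ω : Set Plane} {N : ℕ} {Q : Fin N → Plane} {T₀ : Set (Finset Plane)}
  {a : Fin N → ℝ} {θ : ℝ} {p : ℕ}

/-- `interpolation_error` at order `p + 1` leaves `d^(2p)` in front of the squared seminorm for the
gradient, and the grading inequality replaces it by `h^(2θ)` times the squared weight of order `p +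
1`. -/
theorem exists_errSq_le_graded (S : GradedSetup Ω Q T₀ a θ p) {k : ℕ} (hk : p ≤ k) (K : ℝ) :
    ∃ L : ℝ≥0∞, L ≠ ⊤ ∧ ∀ (v vc : Plane → ℝ) (g : ℕ × ℕ → Plane → ℝ),
      IsKondratievJet Q (fun i => a i + 1) Ω (p + 1) v g → IsContinuousRep Ω v vc →
      ∀ n, ∀ t ∈ gradedMesh Q (grading a θ) T₀ n, IsGradedTri Q (fun i => a i + 1) p θ K n t →
      ∀ P : MvPolynomial (Fin 2) ℝ, P.totalDegree ≤ k →
        (∀ x ∈ lagrangeNodes k t, polyFun P x = vc x) →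
        errSq (interior (convexHull ℝ (t : Set Plane))) g P ≤
          L * (ENNReal.ofReal (meshScale θ n ^ 2) * wsq Q (fun i => a i + 1)
            (interior (convexHull ℝ (t : Set Plane))) (p + 1) g) := by
  obtain ⟨C, hC⟩ := interpolation_error (p + 1) (by have := S.one_le; omega)
  obtain ⟨R, hR⟩ := isStableNodes_triangle (S.one_le.trans hk) K.toNNReal
  refine ⟨C * (1 + R) * (ENNReal.ofReal (K ^ 2) + 2) * ENNReal.ofReal (K ^ 2),
    by finiteness, ?_⟩
  intro v vc g hj hvc n t ht htg P hP hPt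
  obtain ⟨A, B, D, d, rfl, h, hAB, hBD, hDA, hσ, hdK, hQ, hρ⟩ := htg
  simp only [Finset.coe_insert, Finset.coe_singleton] at *
  rw [← openTri_eq_interior h]
  set U := openTri A B D with hU
  have hUo : IsOpen U := isOpen_openTri A B D
  have hUΩ : U ⊆ Ω := (S.isTriMesh n).openTri_subset S.domain.regular h ht
  have hUt : U ⊆ convexHull ℝ ({A, B, D} : Set Plane) := openTri_subset h
  have hclU : closure U = convexHull ℝ ({A, B, D} : Set Plane) := closure_openTri h
  have hd : d ≠ 0 := by
    rintro rfl
    exact (tdet_ne_zero_distinct h).1 (dist_le_zero.1 (by simpa using hAB))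
  have hd0 : (0 : ℝ) < d := by exact_mod_cast pos_iff_ne_zero.2 hd
  have hK : 0 < K := hd0.trans_le hdK
  have hnodes : lagrangeNodes k ({A, B, D} : Finset Plane) ⊆ closure U := by
    rw [hclU]; exact lagrangeNodes_subset (S.one_le.trans hk) h
  have hst := hR (d := d) h hAB hBD hDA (by rw [Real.coe_toNNReal _ hK.le]; exact hσ)
  have hjet : IsSobolevJet U (p + 1) v g := hj.isSobolevJet_of_isCompact S.domain.isOpen hUo hUΩ
    (isCompact_convexHull_triple A B D) hUt hQ
  have hvcU : ContinuousOn vc (closure U) := hvc.1.mono (closure_mono hUΩ)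
  have hvU : vc =ᵐ[volume.restrict U] v := ae_restrict_of_ae_restrict_of_subset hUΩ hvc.2
  obtain ⟨e0, e1, e2⟩ := hC U (convex_openTri A B D) hUo (isBounded_openTri h) (openTri_nonempty h)
    d (fun x hx y hy => dist_le_of_mem_convexHull hAB hBD hDA (hUt hx) (hUt hy))
    _ R k hnodes (by simpa using hk) (fun P hP B hB hX x hx => hst P hP B hB hX x (hUt hx))
    v vc g hjet hvcU hvU P hP hPt
  set F := fsq U (p + 1) g with hF
  set H := ENNReal.ofReal (meshScale θ n ^ 2) * wsq Q (fun i => a i + 1) U (p + 1) g with hH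
  have hFH : (d : ℝ≥0∞) ^ (2 * p) * F ≤ ENNReal.ofReal (K ^ 2) * H := by
    have h1 := fsq_le_wsq (Q := Q) (b := fun i => a i + 1) (g := g) (j := p + 1) hUo
      (div_pos (pow_pos hd0 p) (mul_pos hK (meshScale_pos θ n))) (fun x hx => by
        rw [div_le_iff₀ (mul_pos hK (meshScale_pos θ n)), mul_comm (rhoPow _ _ _ _)]
        exact hρ x (hUt hx))
    refine (mul_le_mul_right h1 _).trans (le_of_eq ?_)
    rw [coe_pow_eq_ofReal, ← mul_assoc, ← ENNReal.ofReal_mul (by positivity), hH, ← mul_assoc,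
      ← ENNReal.ofReal_mul (by positivity)]
    congr 2
    rw [inv_div]
    field_simp
    ring
  have hd2 : (d : ℝ≥0∞) ^ 2 ≠ 0 := by simpa using hd
  have hd2' : (d : ℝ≥0∞) ^ 2 ≠ ⊤ := by simp
  have hdK2 : (d : ℝ≥0∞) ^ 2 ≤ ENNReal.ofReal (K ^ 2) := by
    rw [coe_pow_eq_ofReal]
    exact ENNReal.ofReal_le_ofReal (pow_le_pow_left₀ hd0.le hdK 2)
  -- The surplus `d²` is cancelled in the two derivative terms and bounded by `K²` in the `L²` term.
  have hpow : ∀ X : ℝ≥0∞, X * (d : ℝ≥0∞) ^ (2 * (p + 1)) * F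
      = (d : ℝ≥0∞) ^ 2 * (X * ((d : ℝ≥0∞) ^ (2 * p) * F)) := fun X => by
    rw [mul_add, mul_one, pow_add]; ring
  rw [hpow] at e0 e1 e2
  have e1' := (ENNReal.mul_le_mul_iff_right hd2 hd2').1 e1
  have e2' := (ENNReal.mul_le_mul_iff_right hd2 hd2').1 e2
  unfold errSq
  calc _ ≤ ENNReal.ofReal (K ^ 2) * (C * (1 + R) * ((d : ℝ≥0∞) ^ (2 * p) * F))
        + (C * (1 + R) * ((d : ℝ≥0∞) ^ (2 * p) * F) + C * (1 + R) * ((d : ℝ≥0∞) ^ (2 * p) * F)) :=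
        add_le_add (e0.trans (mul_le_mul_left hdK2 _)) (add_le_add e2' e1')
    _ = C * (1 + R) * (ENNReal.ofReal (K ^ 2) + 2) * ((d : ℝ≥0∞) ^ (2 * p) * F) := by ring
    _ ≤ C * (1 + R) * (ENNReal.ofReal (K ^ 2) + 2) * (ENNReal.ofReal (K ^ 2) * H) :=
        mul_le_mul_right hFH _
    _ = _ := by ring

end GradedSetup

namespace GradedSetup

variable {Ω : Set Plane} {N : ℕ} {Q : Fin N → Plane} {T₀ : Set (Finset Plane)}
  {a : Fin N → ℝ} {θ : ℝ} {p : ℕ}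

/-- The weights do not give `H²` up to `Q i`, so no cancellation between `v` and the interpolant is
used. Both are bounded by `E`, of order `s^(2 a_i) = h^(2θ)`; the inverse estimate costs `d⁻²` for
the gradient of the interpolant, which the area pays. Since `r^(-a_i) ≥ c s^(-a_i)` here, the
weighted norm controls the gradient of `v` with the same factor. -/
theorem exists_errSq_le_corner_aux (S : GradedSetup Ω Q T₀ a θ p) {k : ℕ} (hk : 1 ≤ k) {M : ℕ}
    (hM : 2 ≤ M) {t₀ : Finset Plane} (ht₀ : t₀ ∈ T₀) {i : Fin N} (hi : Q i ∈ t₀) :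
    ∃ L : ℝ≥0∞, L ≠ ⊤ ∧ ∀ (v vc : Plane → ℝ) (g : ℕ × ℕ → Plane → ℝ),
      IsKondratievJet Q (fun i => a i + 1) Ω M v g → IsContinuousRep Ω v vc →
      ∀ n, ∀ P : MvPolynomial (Fin 2) ℝ, P.totalDegree ≤ k →
        (∀ x ∈ lagrangeNodes k (t₀.image (node (grading a θ i ^ n) (Q i))),
          polyFun P x = vc x) →
        errSq (interior (convexHull ℝ
          ((t₀.image (node (grading a θ i ^ n) (Q i)) : Finset Plane) : Set Plane))) g P ≤
          L * (ENNReal.ofReal (meshScale θ n ^ 2) * ksq Q (fun i => a i + 1) Ω M g) := by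
  obtain ⟨B, C, h, rfl⟩ := (S.mesh.isTri t₀ ht₀).exists_of_mem hi
  have hQu : ∀ l, Q l ∈ convexHull ℝ ({Q i, B, C} : Set Plane) → l = i := fun l hl =>
    S.eq_of_mem_convexHull ht₀ hi (by simpa using hl)
  have hsub := S.mesh.openTri_subset S.domain.regular h ht₀
  have ha := S.pos i
  obtain ⟨K₁, hK₁, hsup⟩ := exists_corner_sup S.domain.isOpen ha h hQu hsub
  obtain ⟨c, hc, hcw⟩ := exists_rhoPow_ge_corner (b := fun i => a i + 1) h hQu 1
  set d₀ : ℝ≥0 := max (nndist (Q i) B) (max (nndist B C) (nndist C (Q i))) with hd₀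
  have hd₀0 : d₀ ≠ 0 := fun h0 => by
    have : nndist (Q i) B ≤ 0 := h0 ▸ le_max_left _ _
    exact (tdet_ne_zero_distinct h).1 (nndist_eq_zero.1 (le_antisymm this bot_le))
  have hT := abs_pos.2 h
  obtain ⟨R, hR⟩ := isStableNodes_triangle hk ((d₀ : ℝ) ^ 2 / |tdet (Q i) B C|).toNNReal
  set V : ℝ≥0∞ := volume (Metric.ball (0 : Plane) 1) with hV
  have hVt : V ≠ ⊤ := measure_ball_lt_top.ne
  refine ⟨2 * (1 + R) * (d₀ : ℝ≥0∞) ^ 2 * V * ENNReal.ofReal K₁ + 4 * R * V * ENNReal.ofReal K₁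
    + 2 * ENNReal.ofReal (c⁻¹ ^ 2), by finiteness, ?_⟩
  intro v vc g hj hvc n P hP hPt
  have hsubn := S.image_node_subset hi n
  have hms : (grading a θ i ^ n) ^ a i = meshScale θ n := S.grading_pow_rpow i n
  have hs0 : 0 < grading a θ i ^ n := pow_pos (S.grading_mem i).1 n
  have hs1 : grading a θ i ^ n ≤ 1 := pow_le_one₀ (S.grading_mem i).1.le (S.grading_mem i).2.le
  generalize grading a θ i ^ n = s at *
  have hms2 : s ^ (2 * a i) = meshScale θ n ^ 2 := by
    rw [mul_comm, Real.rpow_mul hs0.le, hms, Real.rpow_two]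
  set Bn := node s (Q i) B with hBn
  set Cn := node s (Q i) C with hCn
  have himg : ({Q i, B, C} : Finset Plane).image (node s (Q i)) = {Q i, Bn, Cn} := by
    rw [Finset.image_insert, Finset.image_insert, Finset.image_singleton, node_self]
  rw [himg] at hPt hsubn ⊢
  simp only [Finset.coe_insert, Finset.coe_singleton] at hsubn ⊢
  have hn : tdet (Q i) Bn Cn ≠ 0 := by
    rw [hBn, hCn, tdet_node_node]; exact mul_ne_zero (by positivity) h
  set Nk := ksq Q (fun i => a i + 1) Ω M g with hNk
  have hUsub : openTri (Q i) Bn Cn ⊆ openTri (Q i) B C := by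
    rw [openTri_eq_interior hn, openTri_eq_interior h]; exact interior_mono hsubn
  rw [← openTri_eq_interior hn]
  set U := openTri (Q i) Bn Cn with hU
  have hUo : IsOpen U := isOpen_openTri _ _ _
  have hUt : U ⊆ convexHull ℝ ({Q i, Bn, Cn} : Set Plane) := openTri_subset hn
  have hclU : closure U = convexHull ℝ ({Q i, Bn, Cn} : Set Plane) := closure_openTri hn
  have hUΩ : U ⊆ Ω := hUsub.trans hsub
  have hξ : ∀ x ∈ U, 0 < 1 - bary (Q i) B C x ∧ 1 - bary (Q i) B C x ≤ s := by
    intro x hx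
    constructor
    · have h1 := hUsub hx
      have := bary_sum h x
      linarith [h1.2.1, h1.2.2]
    · have := (mem_convexHull_face (f := fun y => bary (Q i) B C y - (1 - s))
        (fun x y α β hab => by
          simp only [bary_affine _ _ _ hab]; linear_combination (1 - s) * hab)
        (s := {Q i, Bn, Cn}) (fun y hy => ?_) (hUt hx)).1
      · linarith
      · rcases hy with rfl | rfl | rfl
        · rw [bary_self h]; linarith
        · rw [hBn, bary_node, bary_self h, bary_second]; linarith
        · rw [hCn, bary_node, bary_self h, bary_third]; linarith
  set E : ℝ≥0∞ := ENNReal.ofReal (K₁ * s ^ (2 * a i)) * Nk with hE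
  have hEt : E ≠ ⊤ := ENNReal.mul_ne_top ENNReal.ofReal_ne_top hj.fin
  have hvE : ∀ᵐ x ∂volume.restrict U, ‖v x‖ₑ ^ 2 ≤ E := by
    filter_upwards [ae_restrict_of_ae_restrict_of_subset hUsub (hsup M v g hM hj),
      ae_restrict_mem hUo.measurableSet] with x hx hxU
    refine hx.trans (mul_le_mul_left (ENNReal.ofReal_le_ofReal ?_) _)
    exact mul_le_mul_of_nonneg_left (Real.rpow_le_rpow (hξ x hxU).1.le (hξ x hxU).2
      (by positivity)) hK₁.le
  have hvU : vc =ᵐ[volume.restrict U] v := ae_restrict_of_ae_restrict_of_subset hUΩ hvc.2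
  have hvcE := enorm_sq_le_of_ae hUo (hvc.1.mono (closure_mono hUΩ))
    (by filter_upwards [hvE, hvU] with x h1 h2; rwa [h2])
  set d : ℝ≥0 := ⟨s, hs0.le⟩ * d₀ with hd
  have hdr : (d : ℝ) = s * d₀ := rfl
  have hd0 : d ≠ 0 := mul_ne_zero (fun e => hs0.ne' (congrArg NNReal.toReal e)) hd₀0
  have hdd₀ : d ≤ d₀ := mul_le_of_le_one_left bot_le hs1
  have m1 : dist (Q i) B ≤ d₀ := by
    rw [← coe_nndist]; exact_mod_cast (le_max_left _ _ : nndist (Q i) B ≤ d₀)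
  have m2 : dist B C ≤ d₀ := by
    rw [← coe_nndist]
    exact_mod_cast ((le_max_left _ _).trans (le_max_right _ _) : nndist B C ≤ d₀)
  have m3 : dist C (Q i) ≤ d₀ := by
    rw [← coe_nndist]
    exact_mod_cast ((le_max_right _ _).trans (le_max_right _ _) : nndist C (Q i) ≤ d₀)
  have k1 : dist (Q i) Bn ≤ d := by
    rw [hBn, dist_node_left hs0.le, hdr]
    exact mul_le_mul_of_nonneg_left m1 hs0.le
  have k2 : dist Bn Cn ≤ d := by
    rw [hBn, hCn, dist_node_node hs0.le, hdr]
    exact mul_le_mul_of_nonneg_left m2 hs0.le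
  have k3 : dist Cn (Q i) ≤ d := by
    rw [hCn, dist_comm, dist_node_left hs0.le, hdr, dist_comm]
    exact mul_le_mul_of_nonneg_left m3 hs0.le
  have hst := hR (d := d) hn k1 k2 k3 (by
    rw [Real.coe_toNNReal _ (by positivity), hBn, hCn, tdet_node_node, abs_mul,
      abs_of_pos (by positivity : 0 < s ^ 2), hdr]
    refine le_of_eq ?_
    field_simp)
  have hPE := hst P hP E hEt (fun x hx => by
    rw [hPt x hx]
    exact hvcE x (by rw [hclU]; exact lagrangeNodes_subset hk hn hx))
  have hvol : volume U ≤ (d : ℝ≥0∞) ^ 2 * V := by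
    have hball : U ⊆ Metric.closedBall (Q i) d := fun x hx =>
      dist_le_of_mem_convexHull k1 k2 k3 (hUt hx) (subset_convexHull ℝ _ (by simp))
    refine (measure_mono hball).trans (le_of_eq ?_)
    rw [Measure.addHaar_closedBall _ _ d.coe_nonneg, finrank_euclideanSpace_fin,
      coe_pow_eq_ofReal]
  have hG : fsq U 1 g ≤ ENNReal.ofReal (c⁻¹ ^ 2) * (ENNReal.ofReal (meshScale θ n ^ 2) * Nk) := by
    have hcs : 0 < c * s ^ (-a i) := mul_pos hc (Real.rpow_pos_of_pos hs0 _)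
    have h1 := fsq_le_wsq (Q := Q) (b := fun i => a i + 1) (g := g) (j := 1) hUo hcs
      (fun x hx => by
        refine le_trans ?_ (hcw x (openTri_subset h (hUsub hx)) (hξ x hx).1)
        have e : ((1 : ℕ) : ℝ) - (a i + 1) = - a i := by push_cast; ring
        rw [e]
        exact mul_le_mul_of_nonneg_left (Real.rpow_le_rpow_of_nonpos (hξ x hx).1 (hξ x hx).2
          (by linarith)) hc.le)
    refine (h1.trans (mul_le_mul_right (wsq_le_ksq (by omega : 1 ≤ M) hUΩ) _)).trans (le_of_eq ?_)
    rw [← mul_assoc, ← ENNReal.ofReal_mul (by positivity), mul_inv, ← Real.rpow_neg hs0.le,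
      neg_neg, mul_pow, hms]
  have hgv : g (0, 0) =ᵐ[volume.restrict U] v :=
    (((hj.weak (0, 0) (Nat.zero_le _)).ae_eq S.domain.isOpen
      (isWeakDeriv_zero (hj.weak (0, 0) (Nat.zero_le _)).locallyIntegrable)).filter_mono
      (ae_mono (Measure.restrict_mono hUΩ le_rfl)))
  refine (errSq_le_of_bounds hUo.measurableSet hd0 hvol hgv hvE
    (fun x hx => hPE x (hUt hx)) hG).trans ?_
  have hE' : E = ENNReal.ofReal K₁ * (ENNReal.ofReal (meshScale θ n ^ 2) * Nk) := by
    rw [hE, hms2, ENNReal.ofReal_mul hK₁.le, mul_assoc]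
  rw [hE']
  generalize ENNReal.ofReal (meshScale θ n ^ 2) * Nk = X
  calc _ ≤ 2 * (1 + R) * (d₀ : ℝ≥0∞) ^ 2 * V * (ENNReal.ofReal K₁ * X)
        + 4 * R * V * (ENNReal.ofReal K₁ * X) + 2 * (ENNReal.ofReal (c⁻¹ ^ 2) * X) := by
        gcongr
    _ = _ := by ring

theorem exists_errSq_le_corner (S : GradedSetup Ω Q T₀ a θ p) {k : ℕ} (hk : 1 ≤ k) {M : ℕ}
    (hM : 2 ≤ M) : ∃ L : ℝ≥0∞, L ≠ ⊤ ∧ ∀ (v vc : Plane → ℝ) (g : ℕ × ℕ → Plane → ℝ),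
      IsKondratievJet Q (fun i => a i + 1) Ω M v g → IsContinuousRep Ω v vc →
      ∀ n, ∀ t, IsCornerTri Q (grading a θ) T₀ n t →
      ∀ P : MvPolynomial (Fin 2) ℝ, P.totalDegree ≤ k →
        (∀ x ∈ lagrangeNodes k t, polyFun P x = vc x) →
        errSq (interior (convexHull ℝ (t : Set Plane))) g P ≤
          L * (ENNReal.ofReal (meshScale θ n ^ 2) * ksq Q (fun i => a i + 1) Ω M g) := by
  have h1 : ∀ q : Finset Plane × Fin N, q.1 ∈ T₀ → Q q.2 ∈ q.1 → _ := fun q hq hi =>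
    S.exists_errSq_le_corner_aux hk hM hq hi
  choose! L hL hLb using h1
  set F := (S.mesh.finite.toFinset ×ˢ (Finset.univ : Finset (Fin N))).filter
    (fun q => Q q.2 ∈ q.1) with hF
  have hmemF : ∀ {q}, q ∈ F ↔ q.1 ∈ T₀ ∧ Q q.2 ∈ q.1 := by
    intro q; simp [hF]
  refine ⟨∑ q ∈ F, L q, ENNReal.sum_ne_top.2 fun q hq =>
    hL q (hmemF.1 hq).1 (hmemF.1 hq).2, ?_⟩
  rintro v vc g hj hvc n _ ⟨t₀, ht₀, i, hi, rfl⟩ P hP hPt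
  refine (hLb (t₀, i) ht₀ hi v vc g hj hvc n P hP hPt).trans (mul_le_mul_left ?_ _)
  exact Finset.single_le_sum (f := L) (fun _ _ => zero_le)
    (hmemF.2 ⟨ht₀, hi⟩ : ((t₀, i) : Finset Plane × Fin N) ∈ F)

end GradedSetup

/-! ### Summation over the mesh -/

/-- An interior point has positive barycentric coordinates, so by conformity every vertex of one
triangle would be a vertex of the other. -/
theorem IsTriMesh.pairwiseDisjoint_interior {T : Set (Finset Plane)} {S : Set Plane}
    (hT : IsTriMesh T S) : T.PairwiseDisjoint fun t => interior (convexHull ℝ (t : Set Plane)) := by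
  intro s hs t ht hst
  refine Set.disjoint_left.2 fun x hxs hxt => ?_
  obtain ⟨C, hCs, hCt⟩ : ∃ C ∈ s, C ∉ t := by
    by_contra! hsub
    exact hst (Finset.eq_of_subset_of_card_le hsub
      (by rw [(hT.isTri s hs).card, (hT.isTri t ht).card]))
  obtain ⟨A, B, h, rfl⟩ := (hT.isTri s hs).exists_of_mem hCs
  have hx := hT.conforming _ hs _ ht ⟨interior_subset hxs, interior_subset hxt⟩
  have hxo : x ∈ openTri C A B := by rw [openTri_eq_interior h]; simpa using hxs
  exact hCt (mem_of_mem_convexHull_of_bary_pos h (fun y hy => by simpa using hy.1) hx hxo.1).2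

theorem IsTriMesh.interior_subset {Ω : Set Plane} (hreg : interior (closure Ω) = Ω)
    {T : Set (Finset Plane)} (hT : IsTriMesh T (closure Ω)) {t : Finset Plane} (ht : t ∈ T) :
    interior (convexHull ℝ (t : Set Plane)) ⊆ Ω := by
  conv_rhs => rw [← hreg]
  exact interior_mono (hT.subset ht)

theorem IsTri.convexHull_ae_eq_interior {t : Finset Plane} (ht : IsTri t) :
    (convexHull ℝ (t : Set Plane) : Set Plane) =ᵐ[volume]
      interior (convexHull ℝ (t : Set Plane)) := by
  obtain ⟨A, B, C, h, rfl⟩ := ht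
  rw [Finset.coe_insert, Finset.coe_insert, Finset.coe_singleton, ← openTri_eq_interior h]
  exact convexHull_ae_eq_openTri h

theorem IsTriMesh.lsq_le_sum {Ω : Set Plane} {T : Set (Finset Plane)}
    (hT : IsTriMesh T (closure Ω)) (f : Plane → ℝ) :
    lsq Ω f ≤ ∑ t ∈ hT.finite.toFinset, lsq (interior (convexHull ℝ (t : Set Plane))) f := by
  have h1 : Ω ⊆ ⋃ t ∈ hT.finite.toFinset, convexHull ℝ (t : Set Plane) := by
    have h := hT.cover
    simp only [Set.Finite.mem_toFinset]
    rw [h]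
    exact subset_closure
  refine (lsq_mono_set h1 f).trans ?_
  have h2 : ∀ F : Finset (Finset Plane), (∀ t ∈ F, IsTri t) →
      lsq (⋃ t ∈ F, convexHull ℝ (t : Set Plane)) f ≤
        ∑ t ∈ F, lsq (interior (convexHull ℝ (t : Set Plane))) f := by
    intro F
    induction F using Finset.induction_on with
    | empty => intro _; simp [lsq]
    | insert t F ht ih =>
      intro hF
      rw [Finset.set_biUnion_insert, Finset.sum_insert ht]
      refine (lintegral_union_le _ _ _).trans (add_le_add (le_of_eq ?_)
        (ih fun s hs => hF s (Finset.mem_insert_of_mem hs)))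
      exact setLIntegral_congr (hF t (Finset.mem_insert_self _ _)).convexHull_ae_eq_interior
  exact h2 _ fun t ht => hT.isTri t (hT.finite.mem_toFinset.1 ht)

theorem IsTriMesh.sum_lsq_le {Ω : Set Plane} (hreg : interior (closure Ω) = Ω)
    {T : Set (Finset Plane)} (hT : IsTriMesh T (closure Ω)) (f : Plane → ℝ) :
    ∑ t ∈ hT.finite.toFinset, lsq (interior (convexHull ℝ (t : Set Plane))) f ≤ lsq Ω f := by
  unfold lsq
  rw [← lintegral_biUnion_finset
    (by rw [Set.Finite.coe_toFinset]; exact hT.pairwiseDisjoint_interior)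
    (fun _ _ => isOpen_interior.measurableSet)]
  exact lintegral_mono_set (Set.iUnion₂_subset fun t ht =>
    hT.interior_subset hreg (hT.finite.mem_toFinset.1 ht))

theorem IsTriMesh.sum_wsq_le {Ω : Set Plane} (hreg : interior (closure Ω) = Ω)
    {T : Set (Finset Plane)} (hT : IsTriMesh T (closure Ω)) {N : ℕ} (Q : Fin N → Plane)
    (b : Fin N → ℝ) (j : ℕ) (g : ℕ × ℕ → Plane → ℝ) :
    ∑ t ∈ hT.finite.toFinset, wsq Q b (interior (convexHull ℝ (t : Set Plane))) j g ≤
      wsq Q b Ω j g := by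
  unfold wsq fsq
  rw [Finset.sum_comm]
  exact Finset.sum_le_sum fun ν _ => hT.sum_lsq_le hreg _

/-- The bound does not depend on `n`; therefore the corner estimate may use the norm over all of `Ω`
on each corner triangle. -/
theorem card_isCornerTri_le {N : ℕ} {Q : Fin N → Plane} {κ : Fin N → ℝ} {T₀ : Set (Finset Plane)}
    (hT₀ : T₀.Finite) (n : ℕ) (F : Finset (Finset Plane)) (hF : ∀ t ∈ F, IsCornerTri Q κ T₀ n t) :
    F.card ≤ (hT₀.toFinset ×ˢ (Finset.univ : Finset (Fin N))).card := by
  refine (Finset.card_le_card (t := (hT₀.toFinset ×ˢ (Finset.univ : Finset (Fin N))).image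
    fun q => q.1.image (node (κ q.2 ^ n) (Q q.2))) fun t ht => ?_).trans Finset.card_image_le
  obtain ⟨t₀, ht₀, i, -, rfl⟩ := hF t ht
  exact Finset.mem_image.2 ⟨(t₀, i), by simpa using ht₀, rfl⟩

/-- The squared norm in `H¹(U)` of the difference of the function with derivatives `g` and `w`. -/
def errFun (U : Set Plane) (g : ℕ × ℕ → Plane → ℝ) (w : Plane → ℝ) : ℝ≥0∞ :=
  lsq U (fun x => g (0, 0) x - w x) +
    (lsq U (fun x => g (0, 1) x - partialDeriv 1 w x) +
      lsq U (fun x => g (1, 0) x - partialDeriv 0 w x))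

theorem errFun_eq_errSq {U : Set Plane} (hU : IsOpen U) (g : ℕ × ℕ → Plane → ℝ) {w : Plane → ℝ}
    {P : MvPolynomial (Fin 2) ℝ} (h : ∀ x ∈ U, w x = polyFun P x) :
    errFun U g w = errSq U g P := by
  have hd : ∀ i, ∀ x ∈ U, partialDeriv i w x = partialDeriv i (polyFun P) x := by
    intro i x hx
    have : w =ᶠ[𝓝 x] polyFun P := by
      filter_upwards [hU.mem_nhds hx] with y hy using h y hy
    unfold partialDeriv
    rw [this.fderiv_eq]
  unfold errFun errSq lsq
  congr 1
  · exact setLIntegral_congr_fun hU.measurableSet fun x hx => by simp only [h x hx]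
  congr 1
  · exact setLIntegral_congr_fun hU.measurableSet fun x hx => by simp only [hd 1 x hx]
  · exact setLIntegral_congr_fun hU.measurableSet fun x hx => by simp only [hd 0 x hx]

namespace GradedSetup

variable {Ω : Set Plane} {N : ℕ} {Q : Fin N → Plane} {T₀ : Set (Finset Plane)} {a : Fin N → ℝ}
  {θ : ℝ} {p : ℕ}

/-- On graded triangles the local weighted seminorms sum to at most the global one by disjointness;
on corner triangles their bounded number replaces localisation. -/
theorem exists_errFun_le (S : GradedSetup Ω Q T₀ a θ p) {k : ℕ} (hk : p ≤ k) :
    ∃ L : ℝ≥0∞, L ≠ ⊤ ∧ ∀ (v vc : Plane → ℝ) (g : ℕ × ℕ → Plane → ℝ),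
      IsKondratievJet Q (fun i => a i + 1) Ω (p + 1) v g → IsContinuousRep Ω v vc →
      ∀ n, ∀ w, IsNodalInterpolant Ω (gradedMesh Q (grading a θ) T₀ n) k vc w →
        errFun Ω g w ≤ L * (ENNReal.ofReal (meshScale θ n ^ 2) *
          ksq Q (fun i => a i + 1) Ω (p + 1) g) := by
  obtain ⟨K, -, hK⟩ := S.exists_invariant
  obtain ⟨L₁, hL₁, h₁⟩ := S.exists_errSq_le_graded hk K
  obtain ⟨L₂, hL₂, h₂⟩ := S.exists_errSq_le_corner (S.one_le.trans hk)
    (M := p + 1) (by have := S.one_le; omega)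
  set R := (S.mesh.finite.toFinset ×ˢ (Finset.univ : Finset (Fin N))).card with hR
  refine ⟨L₁ + R * L₂, by finiteness, fun v vc g hj hvc n w hw => ?_⟩
  have hT := S.isTriMesh n
  set F := hT.finite.toFinset with hF
  set I : Finset Plane → Set Plane := fun t => interior (convexHull ℝ (t : Set Plane)) with hI
  set s := ENNReal.ofReal (meshScale θ n ^ 2) with hs
  set Nk := ksq Q (fun i => a i + 1) Ω (p + 1) g with hNk
  have hloc : ∀ t ∈ F, errFun (I t) g w ≤
      L₁ * (s * wsq Q (fun i => a i + 1) (I t) (p + 1) g) +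
        if IsCornerTri Q (grading a θ) T₀ n t then L₂ * (s * Nk) else 0 := by
    intro t ht
    have htT := hT.finite.mem_toFinset.1 ht
    obtain ⟨P, hP, hPw⟩ := hw.1.2 t htT
    have hPt : ∀ x ∈ lagrangeNodes k t, polyFun P x = vc x := by
      intro x hx
      rw [← hw.2 t htT x hx, hPw x ?_]; · rfl
      obtain ⟨A, B, C, h, rfl⟩ := hT.isTri t htT
      simpa using lagrangeNodes_subset (S.one_le.trans hk) h hx
    rw [errFun_eq_errSq isOpen_interior g (P := P) fun x hx => hPw x (_root_.interior_subset hx)]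
    by_cases hc : IsCornerTri Q (grading a θ) T₀ n t
    · rw [if_pos hc]
      exact (h₂ v vc g hj hvc n t hc P hP hPt).trans le_add_self
    · rw [if_neg hc, add_zero]
      exact h₁ v vc g hj hvc n t htT ((hK n t htT).resolve_right hc) P hP hPt
  calc errFun Ω g w ≤ ∑ t ∈ F, errFun (I t) g w := by
        unfold errFun
        rw [Finset.sum_add_distrib, Finset.sum_add_distrib]
        exact add_le_add (hT.lsq_le_sum _) (add_le_add (hT.lsq_le_sum _) (hT.lsq_le_sum _))
    _ ≤ _ := Finset.sum_le_sum hloc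
    _ = L₁ * (s * ∑ t ∈ F, wsq Q (fun i => a i + 1) (I t) (p + 1) g) +
          (F.filter fun t => IsCornerTri Q (grading a θ) T₀ n t).card * (L₂ * (s * Nk)) := by
        rw [Finset.sum_add_distrib, ← Finset.sum_filter, Finset.sum_const, nsmul_eq_mul,
          ← Finset.mul_sum, ← Finset.mul_sum]
    _ ≤ L₁ * (s * Nk) + R * (L₂ * (s * Nk)) := by
        gcongr
        · exact (hT.sum_wsq_le S.domain.regular _ _ _ _).trans (wsq_le_ksq le_rfl subset_rfl)
        · exact_mod_cast card_isCornerTri_le S.mesh.finite n _ fun t ht =>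
            (Finset.mem_filter.1 ht).2
    _ = _ := by ring

end GradedSetup

/-! ### Existence of the nodal interpolant -/

theorem exists_polynomial_comp_node (P : MvPolynomial (Fin 2) ℝ) (A B : Plane) :
    ∃ r : Polynomial ℝ, r.natDegree ≤ P.totalDegree ∧
      ∀ s : ℝ, r.eval s = polyFun P (node s A B) := by
  refine ⟨MvPolynomial.aeval
    (fun i => Polynomial.C (B i - A i) * Polynomial.X + Polynomial.C (A i)) P, ?_, fun s => ?_⟩
  · have := MvPolynomial.aeval_natDegree_le (n := 1) P le_rfl
      (fun i => Polynomial.C (B i - A i) * Polynomial.X + Polynomial.C (A i))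
      (fun i => Polynomial.natDegree_linear_le)
    simpa using this
  · rw [← Polynomial.coe_evalRingHom, MvPolynomial.aeval_def, MvPolynomial.hom_eval₂]
    unfold polyFun MvPolynomial.eval MvPolynomial.eval₂Hom
    simp only [RingHom.coe_mk, MonoidHom.coe_mk, OneHom.coe_mk]
    congr 1
    · ext x; simp
    · funext i
      simp [node]
      ring

theorem node_mem_lagrangeNodes {k : ℕ} (hk : 1 ≤ k) {A B C : Plane} (h : tdet A B C ≠ 0) {i : ℕ}
    (hi : i ≤ k) : node ((i : ℝ) / k) A B ∈ lagrangeNodes k {A, B, C} := by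
  refine (mem_lagrangeNodes_triple hk h).2 ⟨(i, 0), mem_multiIndices.2 (by simpa using hi), ?_⟩
  have : (k : ℝ) ≠ 0 := by positivity
  have e : ((k : ℝ) - i) / k = 1 - i / k := by field_simp
  simp [node, e]

theorem polyFun_eq_on_segment {k : ℕ} (hk : 1 ≤ k) {P R : MvPolynomial (Fin 2) ℝ}
    (hP : P.totalDegree ≤ k) (hR : R.totalDegree ≤ k) {A B : Plane}
    (h : ∀ i ≤ k, polyFun P (node ((i : ℝ) / k) A B) = polyFun R (node ((i : ℝ) / k) A B)) {x : Plane}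
    (hx : x ∈ segment ℝ A B) : polyFun P x = polyFun R x := by
  obtain ⟨p, hp, hpe⟩ := exists_polynomial_comp_node P A B
  obtain ⟨r, hr, hre⟩ := exists_polynomial_comp_node R A B
  have hk0 : (k : ℝ) ≠ 0 := by positivity
  have hdeg : ∀ q : Polynomial ℝ, q.natDegree ≤ k → q.degree < (Finset.range (k + 1)).card := by
    intro q hq
    rw [Finset.card_range]
    exact lt_of_le_of_lt Polynomial.degree_le_natDegree (by exact_mod_cast Nat.lt_succ_of_le hq)
  have hpr : p = r := by
    refine Polynomial.eq_of_degrees_lt_of_eval_index_eq (v := fun i : ℕ => (i : ℝ) / k)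
      (Finset.range (k + 1)) (fun i _ j _ hij => ?_) (hdeg p (hp.trans hP)) (hdeg r (hr.trans hR))
      fun i hi => ?_
    · have : (i : ℝ) / k = j / k := hij
      field_simp at this
      exact_mod_cast this
    · rw [hpe, hre]
      exact h i (Nat.lt_succ_iff.1 (Finset.mem_range.1 hi))
  obtain ⟨a, b, ha, hb, hab, rfl⟩ := hx
  have e : a • A + b • B = node b A B := by rw [node, ← hab]; simp
  rw [e, ← hpe, ← hre, hpr]

/-- Two distinct triangles share at most an edge. It carries `k + 1` Lagrange nodes belonging to
both, and these determine a polynomial of degree at most `k` along the edge; a single shared vertex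
is itself a node. -/
theorem polyFun_eq_of_mem_convexHull_inter {k : ℕ} (hk : 1 ≤ k) {s t : Finset Plane} (hs : IsTri s)
    (ht : IsTri t) (hst : s ≠ t) {P R : MvPolynomial (Fin 2) ℝ} (hP : P.totalDegree ≤ k)
    (hR : R.totalDegree ≤ k) {f : Plane → ℝ} (hPf : ∀ x ∈ lagrangeNodes k s, polyFun P x = f x)
    (hRf : ∀ x ∈ lagrangeNodes k t, polyFun R x = f x) {x : Plane}
    (hx : x ∈ convexHull ℝ ((s : Set Plane) ∩ t)) : polyFun P x = polyFun R x := by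
  obtain ⟨A, hAs, hAt⟩ := convexHull_nonempty_iff.1 ⟨x, hx⟩
  have hnodes : ∀ B, B ∈ s → B ∈ t → A ≠ B → ∀ i ≤ k,
      polyFun P (node ((i : ℝ) / k) A B) = polyFun R (node ((i : ℝ) / k) A B) := by
    intro B hBs hBt hAB i hi
    obtain ⟨C, h, rfl⟩ := hs.exists_of_mem_of_mem hAs hBs hAB
    obtain ⟨D, h', rfl⟩ := ht.exists_of_mem_of_mem hAt hBt hAB
    rw [hPf _ (node_mem_lagrangeNodes hk h hi), hRf _ (node_mem_lagrangeNodes hk h' hi)]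
  by_cases hB : ∃ B, B ∈ s ∧ B ∈ t ∧ A ≠ B
  · obtain ⟨B, hBs, hBt, hAB⟩ := hB
    refine polyFun_eq_on_segment hk hP hR (hnodes B hBs hBt hAB) ?_
    rw [← convexHull_pair]
    refine convexHull_mono (fun y hy => ?_) hx
    obtain ⟨C, h, rfl⟩ := hs.exists_of_mem_of_mem hAs hBs hAB
    have hy1 : y ∈ ({A, B, C} : Finset Plane) := hy.1
    simp only [Finset.mem_insert, Finset.mem_singleton] at hy1
    rcases hy1 with rfl | rfl | rfl
    · simp
    · simp
    · refine absurd (Finset.eq_of_subset_of_card_le (fun z hz => ?_)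
        (by rw [hs.card, ht.card])) hst
      simp only [Finset.mem_insert, Finset.mem_singleton] at hz
      rcases hz with rfl | rfl | rfl
      exacts [hAt, hBt, hy.2]
  · have hsub : ((s : Set Plane) ∩ t) ⊆ {A} := by
      intro y hy
      by_contra hne
      exact hB ⟨y, hy.1, hy.2, fun e => hne e.symm⟩
    have hxA : x = A := by simpa using convexHull_mono hsub hx
    subst hxA
    obtain ⟨B, C, h, rfl⟩ := hs.exists_of_mem hAs
    obtain ⟨D, E, h', rfl⟩ := ht.exists_of_mem hAt
    have h1 := hPf _ (node_mem_lagrangeNodes hk h (Nat.zero_le k))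
    have h2 := hRf _ (node_mem_lagrangeNodes hk h' (Nat.zero_le k))
    simp only [node, Nat.cast_zero, zero_div, sub_zero, one_smul, zero_smul, add_zero] at h1 h2
    rw [h1, h2]

/-- The local interpolants agree on overlaps, so the choice of a triangle containing `x` is
immaterial. Continuity follows from gluing over a finite closed cover. -/
theorem IsTriMesh.exists_isNodalInterpolant {Ω : Set Plane} {T : Set (Finset Plane)}
    (hT : IsTriMesh T (closure Ω)) {k : ℕ} (hk : 1 ≤ k) (f : Plane → ℝ) :
    ∃ w, IsNodalInterpolant Ω T k f w := by
  have h1 : ∀ t ∈ T, ∃ P : MvPolynomial (Fin 2) ℝ, P.totalDegree ≤ k ∧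
      ∀ x ∈ lagrangeNodes k t, polyFun P x = f x := by
    intro t ht
    obtain ⟨A, B, C, h, rfl⟩ := hT.isTri t ht
    exact exists_interpolating_poly hk h f
  choose! P hP hPf using h1
  set w : Plane → ℝ := fun x =>
    if h : ∃ t ∈ T, x ∈ convexHull ℝ (t : Set Plane) then polyFun (P h.choose) x else 0 with hw
  have hwP : ∀ t ∈ T, ∀ x ∈ convexHull ℝ (t : Set Plane), w x = polyFun (P t) x := by
    intro t ht x hx
    have h : ∃ t ∈ T, x ∈ convexHull ℝ (t : Set Plane) := ⟨t, ht, hx⟩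
    have hwx : w x = polyFun (P h.choose) x := dif_pos h
    rw [hwx]
    obtain ⟨hs, hxs⟩ := h.choose_spec
    rcases eq_or_ne h.choose t with e | e
    · rw [e]
    · exact polyFun_eq_of_mem_convexHull_inter hk (hT.isTri _ hs) (hT.isTri t ht) e (hP _ hs)
        (hP t ht) (hPf _ hs) (hPf t ht) (hT.conforming _ hs _ ht ⟨hxs, hx⟩)
  refine ⟨w, ⟨?_, fun t ht => ⟨P t, hP t ht, hwP t ht⟩⟩, fun t ht x hx => ?_⟩
  · have := hT.finite.to_subtype
    rw [← hT.cover, Set.biUnion_eq_iUnion]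
    refine (locallyFinite_of_finite _).continuousOn_iUnion
      (fun t => (hT.isCompact t.2).isClosed) fun t => ?_
    exact (continuous_polyFun (P t)).continuousOn.congr (hwP t t.2)
  · rw [hwP t ht x ?_, hPf t ht x hx]
    obtain ⟨A, B, C, h, rfl⟩ := hT.isTri t ht
    simpa using lagrangeNodes_subset hk h hx

/-! ### Norms and jets -/

theorem isWeakDeriv_weakDeriv {Ω : Set Plane} {ν : ℕ × ℕ} {v : Plane → ℝ}
    (h : ∃ g, IsWeakDeriv Ω ν v g) : IsWeakDeriv Ω ν v (weakDeriv Ω ν v) := by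
  rw [weakDeriv, dif_pos h]
  exact h.choose_spec

theorem IsWeakDeriv.sub {Ω : Set Plane} {ν : ℕ × ℕ} {v w g h : Plane → ℝ}
    (hv : IsWeakDeriv Ω ν v g) (hw : IsWeakDeriv Ω ν w h) :
    IsWeakDeriv Ω ν (fun x => v x - w x) (fun x => g x - h x) := by
  refine ⟨hv.locallyIntegrable.sub hw.locallyIntegrable,
    hv.locallyIntegrable_deriv.sub hw.locallyIntegrable_deriv, fun φ hφ hc hs => ?_⟩
  have hs' := (tsupport_multiDeriv_subset φ ν).trans hs
  have hφ' := (hφ.multiDeriv ν).continuous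
  have hc' : HasCompactSupport (multiDeriv ν φ) :=
    hc.of_isClosed_subset (isClosed_tsupport _) (tsupport_multiDeriv_subset φ ν)
  simp only [sub_mul]
  rw [integral_sub (integrable_mul_of_locallyIntegrableOn hv.locallyIntegrable hφ' hc' hs')
      (integrable_mul_of_locallyIntegrableOn hw.locallyIntegrable hφ' hc' hs'),
    integral_sub
      (integrable_mul_of_locallyIntegrableOn hv.locallyIntegrable_deriv hφ.continuous hc hs)
      (integrable_mul_of_locallyIntegrableOn hw.locallyIntegrable_deriv hφ.continuous hc hs),
    hv.integral_eq φ hφ hc hs, hw.integral_eq φ hφ hc hs, mul_sub]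

theorem ofReal_integral_sq_abs {Ω : Set Plane} {f : Plane → ℝ}
    (hf : MemLp f 2 (volume.restrict Ω)) :
    ENNReal.ofReal (∫ x in Ω, |f x| ^ 2) = lsq Ω f := by
  have hi : Integrable (fun x => |f x| ^ 2) (volume.restrict Ω) := by
    simpa using hf.integrable_sq
  rw [ofReal_integral_eq_lintegral_ofReal hi (ae_of_all _ fun x => by positivity)]
  exact lintegral_congr fun x => by rw [enorm_sq_eq_ofReal, sq_abs]

theorem MemWeighted.ofReal_weightedNorm_sq {w : ℕ → Plane → ℝ} {m : ℕ} {Ω : Set Plane}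
    {v : Plane → ℝ} (h : MemWeighted w m Ω v) :
    ENNReal.ofReal (weightedNorm w m Ω v ^ 2) =
      ∑ ν ∈ multiIndices m, lsq Ω (fun x => w (ν.1 + ν.2) x * weakDeriv Ω ν v x) := by
  have h0 : ∀ ν ∈ multiIndices m,
      0 ≤ ∫ x in Ω, |w (ν.1 + ν.2) x * weakDeriv Ω ν v x| ^ 2 := fun ν _ =>
    integral_nonneg fun x => by positivity
  rw [weightedNorm, Real.sq_sqrt (Finset.sum_nonneg h0), ENNReal.ofReal_sum_of_nonneg h0]
  exact Finset.sum_congr rfl fun ν hν => ofReal_integral_sq_abs (h ν hν).2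

theorem ksq_eq_sum {N : ℕ} (Q : Fin N → Plane) (b : Fin N → ℝ) (U : Set Plane) (M : ℕ)
    (g : ℕ × ℕ → Plane → ℝ) : ksq Q b U M g =
      ∑ ν ∈ multiIndices M, lsq U (fun x => rhoPow Q b (ν.1 + ν.2) x * g ν x) := by
  have hmaps : ∀ ν ∈ multiIndices M, ν.1 + ν.2 ∈ Finset.range (M + 1) := fun ν hν =>
    Finset.mem_range.2 (Nat.lt_succ_iff.2 (mem_multiIndices.1 hν))
  rw [← Finset.sum_fiberwise_of_maps_to hmaps]
  refine Finset.sum_congr rfl fun j hj => ?_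
  have hfil : (multiIndices M).filter (fun ν => ν.1 + ν.2 = j) = Finset.HasAntidiagonal.antidiagonal j := by
    ext ν
    rw [Finset.mem_filter, mem_multiIndices, Finset.HasAntidiagonal.mem_antidiagonal]
    have := Finset.mem_range.1 hj
    omega
  rw [hfil, wsq, fsq]
  refine Finset.sum_congr rfl fun ν hν => ?_
  have e : ν.1 + ν.2 = j := Finset.HasAntidiagonal.mem_antidiagonal.1 hν
  rw [e]

theorem ksq_mono {N : ℕ} {Q : Fin N → Plane} {b : Fin N → ℝ} {U : Set Plane} {M L : ℕ}
    (h : M ≤ L) (g : ℕ × ℕ → Plane → ℝ) : ksq Q b U M g ≤ ksq Q b U L g :=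
  Finset.sum_le_sum_of_subset (Finset.range_mono (by omega))

theorem MemK.ofReal_normK_sq {N : ℕ} {Q : Fin N → Plane} {b : Fin N → ℝ} {M : ℕ} {Ω : Set Plane}
    {v : Plane → ℝ} (h : MemK Q b M Ω v) :
    ENNReal.ofReal (normK Q b M Ω v ^ 2) = ksq Q b Ω M (fun ν => weakDeriv Ω ν v) := by
  rw [ksq_eq_sum]
  exact MemWeighted.ofReal_weightedNorm_sq h

theorem MemK.isKondratievJet {N : ℕ} {Q : Fin N → Plane} {b : Fin N → ℝ} {M L : ℕ} (hL : L ≤ M)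
    {Ω : Set Plane} {v : Plane → ℝ} (h : MemK Q b M Ω v) :
    IsKondratievJet Q b Ω L v (fun ν => weakDeriv Ω ν v) where
  weak ν hν := isWeakDeriv_weakDeriv (h ν (mem_multiIndices.2 (hν.trans hL))).1
  fin := ne_top_of_le_ne_top (by rw [← h.ofReal_normK_sq]; exact ENNReal.ofReal_ne_top)
    (ksq_mono hL _)

theorem multiIndices_one : multiIndices 1 = {(0, 0), (0, 1), (1, 0)} := by decide

theorem MemFE.locallyLipschitzOn {Ω : Set Plane} (hΩ : IsOpen Ω) {T : Set (Finset Plane)}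
    (hT : IsTriMesh T (closure Ω)) {k : ℕ} {w : Plane → ℝ} (hw : MemFE Ω T k w) :
    LocallyLipschitzOn Ω w := by
  choose! P _ hP using hw.2
  exact locallyLipschitzOn_of_mesh hΩ hT (hw.1.mono subset_closure) hP

/-- Weak derivatives are unique almost everywhere, so the chosen `weakDeriv` of `v - w` may be
replaced by `g` minus the classical derivatives of `w`. -/
theorem memH_one_sub_and_normH_sq {Ω : Set Plane} (hΩ : IsOpen Ω) {v w : Plane → ℝ}
    {g : ℕ × ℕ → Plane → ℝ} (hg : ∀ ν, ν.1 + ν.2 ≤ 1 → IsWeakDeriv Ω ν v (g ν))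
    (hw : LocallyLipschitzOn Ω w) (hfin : errFun Ω g w ≠ ⊤) :
    MemH 1 Ω (fun x => v x - w x) ∧
      ENNReal.ofReal (normH 1 Ω (fun x => v x - w x) ^ 2) = errFun Ω g w := by
  obtain ⟨hw1, hw2⟩ := isWeakDeriv_partialDeriv_of_locallyLipschitzOn hΩ hw
  have d0 := (hg (0, 0) (by simp)).sub (isWeakDeriv_zero hw1.locallyIntegrable)
  have d1 := (hg (1, 0) (by simp)).sub hw1
  have d2 := (hg (0, 1) (by simp)).sub hw2
  have hsq : ∀ {ν h}, IsWeakDeriv Ω ν (fun x => v x - w x) h →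
      lsq Ω (fun x => 1 * weakDeriv Ω ν (fun x => v x - w x) x) = lsq Ω h := fun hd =>
    lsq_congr (by simpa using (isWeakDeriv_weakDeriv ⟨_, hd⟩).ae_eq hΩ hd)
  have hmem : ∀ {ν h}, IsWeakDeriv Ω ν (fun x => v x - w x) h → lsq Ω h ≠ ⊤ →
      (∃ h, IsWeakDeriv Ω ν (fun x => v x - w x) h) ∧
      MemLp (fun x => 1 * weakDeriv Ω ν (fun x => v x - w x) x) 2 (volume.restrict Ω) := by
    intro ν h hd hf
    refine ⟨⟨h, hd⟩, (memLp_two_iff_lsq ?_).2 (by rwa [hsq hd])⟩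
    simpa using (isWeakDeriv_weakDeriv ⟨_, hd⟩).aestronglyMeasurable_deriv
  have hM : MemH 1 Ω (fun x => v x - w x) := by
    unfold errFun at hfin
    rw [ENNReal.add_ne_top, ENNReal.add_ne_top] at hfin
    intro ν hν
    rw [multiIndices_one] at hν
    simp only [Finset.mem_insert, Finset.mem_singleton] at hν
    rcases hν with rfl | rfl | rfl
    exacts [hmem d0 hfin.1, hmem d2 hfin.2.1, hmem d1 hfin.2.2]
  refine ⟨hM, ?_⟩
  rw [normH, MemWeighted.ofReal_weightedNorm_sq hM, multiIndices_one,
    Finset.sum_insert (by simp), Finset.sum_insert (by simp), Finset.sum_singleton,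
    hsq d0, hsq d1, hsq d2]
  rfl

theorem le_sqrt_mul_of_ofReal_sq_le {x s y : ℝ} (hs : 0 ≤ s) (hy : 0 ≤ y) {L : ℝ≥0∞} (hL : L ≠ ⊤)
    (h : ENNReal.ofReal (x ^ 2) ≤ L * (ENNReal.ofReal (s ^ 2) * ENNReal.ofReal (y ^ 2))) :
    x ≤ (Real.sqrt L.toReal + 1) * s * y := by
  rw [← ENNReal.ofReal_toReal hL, ← ENNReal.ofReal_mul (by positivity),
    ← ENNReal.ofReal_mul (by positivity), ENNReal.ofReal_le_ofReal_iff (by positivity)] at h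
  have h1 : x ^ 2 ≤ (Real.sqrt L.toReal * s * y) ^ 2 := by
    rw [mul_pow, mul_pow, Real.sq_sqrt ENNReal.toReal_nonneg]; linarith
  have h2 := (le_abs_self x).trans (abs_le_of_sq_le_sq h1 (by positivity))
  refine h2.trans ?_
  gcongr
  linarith

end GradedFEM

end

/-! ### The error estimate -/

open GradedFEM in
theorem mainTheorem3
    (Ω : Set Plane) (hΩ : IsPolygonalDomain Ω)
    (N : ℕ) (Q : Fin N → Plane) (hQ_inj : Function.Injective Q)
    (hQ : Set.range Q = domainVertices Ω)
    (T₀ : Set (Finset Plane)) (hT₀ : IsTriangulation T₀ (closure Ω))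
    (hT₀Q : ∀ t ∈ T₀, ∀ i j : Fin N, Q i ∈ t → Q j ∈ t → i = j)
    (k m : ℕ) (hk : 1 ≤ k) (hm : 1 ≤ m)
    (a : Fin N → ℝ) (θ : ℝ)
    (ha : ∀ i, 0 < a i) (haθ : ∀ i, a i ≤ θ) (hθ : θ ≤ ((min k m : ℕ) : ℝ)) :
    ∃ C : ℝ, 0 < C ∧
      ∀ v : Plane → ℝ, MemK Q (fun i => a i + 1) (m + 1) Ω v →
        (∃ vc, IsContinuousRep Ω v vc) ∧
        ∀ vc, IsContinuousRep Ω v vc → ∀ n : ℕ,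
          (∃ vI, IsNodalInterpolant Ω
            (gradedMesh Q (fun i => (2 : ℝ) ^ (-θ / a i)) T₀ n) k vc vI) ∧
          ∀ vI, IsNodalInterpolant Ω
              (gradedMesh Q (fun i => (2 : ℝ) ^ (-θ / a i)) T₀ n) k vc vI →
            MemH 1 Ω (fun x => v x - vI x) ∧
            normH 1 Ω (fun x => v x - vI x)
              ≤ C * ((2 : ℝ) ^ (-(n : ℝ))) ^ θ * normK Q (fun i => a i + 1) (m + 1) Ω v := by
  -- The order `min k m` serves two purposes: it is at most `k`, so the elements reproduce
  -- polynomials of that degree, and at most `m`, so `v` has the derivatives required.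
  have S : GradedSetup Ω Q T₀ a θ (min k m) :=
    ⟨hΩ, hQ_inj, hQ, hT₀.isTriMesh, hT₀Q, le_min hk hm, ha, haθ, hθ⟩
  obtain ⟨L, hL, herr⟩ := S.exists_errFun_le (min_le_left k m)
  -- The summand `1` only ensures positivity in case `L = 0`.
  refine ⟨Real.sqrt L.toReal + 1, by positivity, fun v hv => ?_⟩
  have hj : IsKondratievJet Q (fun i => a i + 1) Ω (min k m + 1) v (fun ν => weakDeriv Ω ν v) :=
    MemK.isKondratievJet (Nat.add_le_add_right (min_le_right k m) 1) hv
  refine ⟨S.exists_isContinuousRep (Nat.succ_le_succ S.one_le) hj, fun vc hvc n =>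
    ⟨(S.isTriMesh n).exists_isNodalInterpolant hk vc, fun w hw => ?_⟩⟩
  have he := herr v vc _ hj hvc n w hw
  obtain ⟨h1, h2⟩ := memH_one_sub_and_normH_sq hΩ.isOpen
    (fun ν hν => hj.weak ν (hν.trans (Nat.le_add_left 1 _)))
    (hw.1.locallyLipschitzOn hΩ.isOpen (S.isTriMesh n))
    (ne_top_of_le_ne_top (ENNReal.mul_ne_top hL
      (ENNReal.mul_ne_top ENNReal.ofReal_ne_top hj.fin)) he)
  have hy : 0 ≤ normK Q (fun i => a i + 1) (m + 1) Ω v := Real.sqrt_nonneg _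
  refine ⟨h1, le_sqrt_mul_of_ofReal_sq_le (meshScale_pos θ n).le hy hL ?_⟩
  rw [h2, MemK.ofReal_normK_sq hv]
  exact he.trans (mul_le_mul_right (mul_le_mul_right
    (ksq_mono (Nat.add_le_add_right (min_le_right k m) 1) _) _) _)
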